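/- **Setting.** Let $A$ (treatment), $Z$ (mediator), $C$ (pre-treatment covariates) be random variables with countably many values and $Y$ a real outcome with $EY^2<\infty$. There are potential mediators $Z(a)$ and potential outcomes $Y(a)$, $Y(a,z)$ with, almost surely, $Y(a)=Y(a,z)$ if $Z(a)=z$; $Y=Y(a)$ and $Z=Z(a)$ if $A=a$; $Y=Y(a,z)$ if $A=a$, $Z=z$. Fix treatment values $a^*,a$ and let $\theta=EY(a^*)-EY(a)$. Write $\mathbb P$ for expectation over a new observation $X$, random functions built from the data being held fixed, and $\|f\|^2=\mathbb P f^2$. The data are i.i.d.: $X_1,\dots,X_n$ and a separate sample of size $k_n=O(n)$ ($k_n=0$ is allowed), with $n\to\infty$. Nuisance estimators $\hat\eta$ are measurable functions of all the data. *Two-door assumption (TD).* For all $a,a',z$: $Y(a,z)=Y(a',z)$ a.s., $Z(a)\perp A\mid C$, $Y(a,z)\perp Z(a')\mid A,C$. *Front-door assumption (FD).* For all $a,a',z$: $Y(a,z)=Y(a',z)$ a.s., $Z(a)\perp A$, $Y(a,z)\perp Z(a')\mid A$. With $\eta=(E(Y|A,Z,C),p(Z|A,C),p(A|C))$ and $X=(C,A,Z,Y)$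 put $$\varphi_{td}(X,\eta,\theta)=(Y-E(Y|A,Z,C))\tfrac{p(Z|a^*,C)-p(Z|a,C)}{p(Z|A,C)}+\Big(\sum_{\bar a}E(Y|\bar a,Z,C)p(\bar a|C)-\sum_{\bar a,z}E(Y|\bar a,z,C)p(z|A,C)p(\bar a|C)\Big)\tfrac{I(A=a^*)-I(A=a)}{p(A|C)}+\sum_zE(Y|A,z,C)(p(z|a^*,C)-p(z|a,C))-\theta .$$ With $\eta=(E(Y|A,Z),p(Z|A),p(A))$ and $X=(A,Z,Y)$ put $$\varphi_{fd}(X,\eta,\theta)=(Y-E(Y|A,Z))\tfrac{p(Z|a^*)-p(Z|a)}{p(Z|A)}+\tfrac{I(A=a^*)}{p(A)}\Big(\sum_{\bar a}E(Y|\bar a,Z)p(\bar a)-EY(a^*)\Big)-\tfrac{I(A=a)}{p(A)}\Big(\sum_{\bar a}E(Y|\bar a,Z)p(\bar a)-EY(a)\Big)+\sum_zE(Y|A,z)(p(z|a^*)-p(z|a))-\theta ,$$ where in the plug-in version $\varphi_{fd}(X,\hat\eta,\theta)$ the quantity $EY(a')$, $a'\in\{a^*,a\}$, is replaced by $\sum_{\bar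 a,z}\hat E(Y|\bar a,z)\hat p(z|a')\hat p(\bar a)$. In both cases let $m(X,\eta)=\varphi(X,\eta,\theta)+\theta$ (for $\varphi_{fd}$, with the plug-in version), and let $\eta_0$ be the true nuisance. *Regularity assumption.* (a) $\|m(\cdot,\hat\eta)-m(\cdot,\eta_0)\|^2=o_p(1)$; (b) either $\hat\eta$ is a function of the separate sample only (sample splitting), or there is a $P$-Donsker class, $P$ being the law of $X$, to which $m(\cdot,\hat\eta)$ belongs with probability tending to one. *Definitions.* $\hat\theta$ is asymptotically linear with influence function $\varphi$ if $E\varphi(X)=0$, $E\varphi(X)^2<\infty$ and $\sqrt n(\hat\theta-\theta)=n^{-1/2}\sum_{i\le n}\varphi(X_i)+o_p(1)$. It is regular in a model (a set of observed-data laws with their values of $\theta$) if $\sqrt n(\hat\theta-\theta(\alpha_n))$ converges in distribution to one and the same limit law whenever the data are i.i.d. from the law with parameter $\alpha_n$ in a finite-dimensional submodel that passes through the true law at $\alpha=0$ and is dominated and differentiable in quadratic mean there, and $\sqrt n\|\alpha_n\|$ is bounded. **Theorem.** (1) Assume TD, that every value of $(A,Z,C)$ has positive probability, the regularity assumption, and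 that there are constants $\epsilon_j>0$ such that: almost surely $p(Z|A,C)>\epsilon_2$ and $p(A|C)>\epsilon_5$; and, each with probability tending to one over the data, for almost every new $(C,A,Z)$ and for $\breve a\in\{a^*,a\}$: $|\hat E(Y|A,Z,C)|<\epsilon_1$, $\hat p(Z|A,C)>\epsilon_3$, $|\hat p(Z|\breve a,C)|<\epsilon_4$, $\hat p(\breve a|C)>\epsilon_6$, $|\hat p(A|C)|<\epsilon_7$, $|\hat p(\breve a|C)|<\epsilon_8$. Suppose that for every $\breve a\in\{a^*,a\}$ the following products are all $o_p(n^{-1/2})$: - $\|\hat E(Y|A,Z,C)-E(Y|A,Z,C)\|\cdot\|\hat p(Z|A,C)-p(Z|A,C)\|$, - $\|\hat E(Y|A,Z,C)-E(Y|A,Z,C)\|\cdot\|\hat p(Z|\breve a,C)-p(Z|\breve a,C)\|$, - $\|\hat p(Z|\breve a,C)-p(Z|\breve a,C)\|\cdot\|\hat p(\breve a|C)-p(\breve a|C)\|$, - $\|\hat p(Z|\breve a,C)-p(Z|\breve a,C)\|\cdot\|\hat p(A|C)-p(A|C)\|$. Then the solution $\hat\theta_{td}$ of $\frac1n\sum_{i\le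 n}\varphi_{td}(X_i,\hat\eta,\hat\theta_{td})=0$ is asymptotically linear for $\theta$ with influence function $\varphi_{td}(\cdot,\eta_0,\theta)$. For all $\epsilon>0$ and $B$ it is regular in the model of all laws of $(C,A,Z,Y)$ that arise under TD with positivity, $p(Z|A,C)>\epsilon$ and $p(A|C)>\epsilon$ a.s., and $EY^2\le B$. (2) Assume FD, that every value of $(A,Z)$ has positive probability, the regularity assumption, and that there are constants $\epsilon_j>0$ such that: almost surely $p(Z|A)>\epsilon_2$ and $p(A)>\epsilon_5$; and, each with probability tending to one over the data, for almost every new $(A,Z)$ and for $\breve a\in\{a^*,a\}$: $|\hat E(Y|A,Z)|<\epsilon_1$, $\hat p(Z|A)>\epsilon_3$, $|\hat p(Z|\breve a)|<\epsilon_4$, $\hat p(\breve a)>\epsilon_6$, $|\hat p(A)|<\epsilon_7$, $|\hat p(\breve a)|<\epsilon_8$. Suppose that for every $\breve a\in\{a^*,a\}$ the following products are all $o_p(n^{-1/2})$: - $\|\hat E(Y|A,Z)-E(Y|A,Z)\|\cdot\|\hat p(Z|A)-p(Z|A)\|$, - $\|\hat E(Y|A,Z)-E(Y|A,Z)\|\cdot\|\hat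 p(Z|\breve a)-p(Z|\breve a)\|$, - $\|\hat p(Z|\breve a)-p(Z|\breve a)\|\cdot\|\hat p(\breve a)-p(\breve a)\|$, - $\|\hat p(Z|\breve a)-p(Z|\breve a)\|\cdot\|\hat p(A)-p(A)\|$. Then the solution $\hat\theta_{fd}$ of $\frac1n\sum_{i\le n}\varphi_{fd}(X_i,\hat\eta,\hat\theta_{fd})=0$ is asymptotically linear for $\theta$ with influence function $\varphi_{fd}(\cdot,\eta_0,\theta)$. For all $\epsilon>0$ and $B$ it is regular in the model of all laws of $(A,Z,Y)$ that arise under FD with positivity, $p(Z|A)>\epsilon$ and $p(A)>\epsilon$ a.s., and $EY^2\le B$. -/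

import Mathlib

open MeasureTheory ProbabilityTheory Filter Topology
open scoped ENNReal BoundedContinuousFunction

universe u

noncomputable section

section Sampling

/-- The data: an estimation sample of size `n` and a separate sample of size `k`. With `k = 0` this
is just a sample of size `n`. -/
abbrev Sample (𝒳 : Type*) (n k : ℕ) : Type _ := (Fin n → 𝒳) × (Fin k → 𝒳)

/-- The law of the data when all observations are i.i.d. with law `P`. -/
def sampleLaw {𝒳 : Type*} [MeasurableSpace 𝒳] (P : Measure 𝒳) (n k : ℕ) :
    Measure (Sample 𝒳 n k) :=
  (Measure.pi fun _ : Fin n => P).prod (Measure.pi fun _ : Fin k => P)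

/-- `X n → 0` in probability, i.e. `X n = o_p(1)`, for nonnegative variables. -/
def TendstoZeroInProb {S : ℕ → Type*} [∀ n, MeasurableSpace (S n)] (μ : ∀ n, Measure (S n))
    (X : ∀ n, S n → ℝ≥0∞) : Prop :=
  ∀ ε : ℝ≥0∞, 0 < ε → Tendsto (fun n => μ n {s | ε ≤ X n s}) atTop (𝓝 0)

/-- With probability tending to one, `s` satisfies `p n s`. -/
def WithProbTendingToOne {S : ℕ → Type*} [∀ n, MeasurableSpace (S n)] (μ : ∀ n, Measure (S n))
    (p : ∀ n, S n → Prop) : Prop :=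
  Tendsto (fun n => μ n {s | ¬ p n s}) atTop (𝓝 0)

/-- The random function `f n s` is bounded in absolute value by one constant, `P`-almost surely,
with probability tending to one. -/
def BoundedAboveWPTO {𝒳 : Type*} [MeasurableSpace 𝒳] (P : Measure 𝒳) (k : ℕ → ℕ)
    (f : ∀ n, Sample 𝒳 n (k n) → 𝒳 → ℝ) : Prop :=
  ∃ ε : ℝ, WithProbTendingToOne (fun n => sampleLaw P n (k n))
    fun n s => ∀ᵐ x ∂P, |f n s x| < ε

/-- The random function `f n s` is bounded below by one positive constant, `P`-almost surely,
with probability tending to one. -/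
def BoundedBelowWPTO {𝒳 : Type*} [MeasurableSpace 𝒳] (P : Measure 𝒳) (k : ℕ → ℕ)
    (f : ∀ n, Sample 𝒳 n (k n) → 𝒳 → ℝ) : Prop :=
  ∃ ε : ℝ, 0 < ε ∧ WithProbTendingToOne (fun n => sampleLaw P n (k n))
    fun n s => ∀ᵐ x ∂P, ε < f n s x

/-- `‖f n s‖ * ‖g n s‖ = o_p(n^{-1/2})`, where `‖·‖` is the norm of `L²(P)`, the random functions
`f n s`, `g n s` being treated as fixed. -/
def ProductRate {𝒳 : Type*} [MeasurableSpace 𝒳] (P : Measure 𝒳) (k : ℕ → ℕ)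
    (f g : ∀ n, Sample 𝒳 n (k n) → 𝒳 → ℝ) : Prop :=
  TendstoZeroInProb (fun n => sampleLaw P n (k n))
    fun n s => ENNReal.ofReal (√n) * (eLpNorm (f n s) 2 P * eLpNorm (g n s) 2 P)

end Sampling

section Donsker

/-- Outer expectation of a bounded function. -/
def outerExpectation {S : Type*} [MeasurableSpace S] (μ : Measure S) (T : S → ℝ) : ℝ :=
  sInf {r | ∃ U : S → ℝ, Measurable U ∧ Integrable U μ ∧ (∀ s, T s ≤ U s) ∧ r = ∫ s, U s ∂μ}

/-- The space `ℓ^∞(F)` of bounded real functions on `F`, with the supremum norm. -/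
abbrev EllInfty {𝒳 : Type*} (F : Set (𝒳 → ℝ)) : Type _ := lp (fun _ : F => ℝ) ∞

instance ellInftyMeasurableSpace {𝒳 : Type*} (F : Set (𝒳 → ℝ)) : MeasurableSpace (EllInfty F) :=
  borel _

instance ellInftyBorelSpace {𝒳 : Type*} (F : Set (𝒳 → ℝ)) : BorelSpace (EllInfty F) := ⟨rfl⟩

/-- The element `f ↦ f x - P f` of `ℓ^∞(F)`. -/
def centeredEval {𝒳 : Type*} [MeasurableSpace 𝒳] {P : Measure 𝒳} {F : Set (𝒳 → ℝ)}
    (hF : ∀ x, BddAbove (Set.range fun f : F => ‖f.1 x - ∫ y, f.1 y ∂P‖)) (x : 𝒳) : EllInfty F :=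
  ⟨fun f => f.1 x - ∫ y, f.1 y ∂P, memℓp_infty (hF x)⟩

/-- The empirical process `f ↦ n^{-1/2} ∑ᵢ (f (xᵢ) - P f)`. -/
def empiricalProcess {𝒳 : Type*} [MeasurableSpace 𝒳] {P : Measure 𝒳} {F : Set (𝒳 → ℝ)}
    (hF : ∀ x, BddAbove (Set.range fun f : F => ‖f.1 x - ∫ y, f.1 y ∂P‖)) (n : ℕ)
    (x : Fin n → 𝒳) : EllInfty F :=
  (√n)⁻¹ • ∑ i, centeredEval hF (x i)

/-- `F` is a `P`-Donsker class: the empirical process indexed by `F` converges weakly (in the sense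
of outer expectations) in `ℓ^∞(F)` to a tight Borel probability measure. -/
def IsDonsker {𝒳 : Type*} [MeasurableSpace 𝒳] (P : Measure 𝒳) (F : Set (𝒳 → ℝ)) : Prop :=
  (∀ f ∈ F, Measurable f ∧ MemLp f 2 P) ∧
  ∃ hF : ∀ x, BddAbove (Set.range fun f : F => ‖f.1 x - ∫ y, f.1 y ∂P‖),
  ∃ γ : Measure (EllInfty F), IsProbabilityMeasure γ ∧ IsTightMeasureSet {γ} ∧
    ∀ H : EllInfty F →ᵇ ℝ,
      Tendsto (fun n : ℕ =>
          outerExpectation (Measure.pi fun _ : Fin n => P) fun x => H (empiricalProcess hF n x))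
        atTop (𝓝 (∫ z, H z ∂γ))

end Donsker

section RegularAsymptoticLinearity

/-- A (smooth) parametric submodel, with parameter `α` in a neighbourhood of `0` in `ℝ^d`, of a
semiparametric model `𝓜`, a set of pairs (law of an observation, value of the target parameter).
The true law is at `α = 0`, and the submodel is dominated and differentiable in quadratic mean
there, with score `ℓ`. -/
structure IsRegularSubmodel {𝒳 : Type*} [MeasurableSpace 𝒳] (𝓜 : Set (Measure 𝒳 × ℝ))
    (P : Measure 𝒳) (θ : ℝ) (d : ℕ) (Pα : EuclideanSpace ℝ (Fin d) → Measure 𝒳)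
    (θα : EuclideanSpace ℝ (Fin d) → ℝ) : Prop where
  law_zero : Pα 0 = P
  param_zero : θα 0 = θ
  mem_model : ∀ᶠ α in 𝓝 0, (Pα α, θα α) ∈ 𝓜
  quadratic_mean : ∃ ν : Measure 𝒳, SigmaFinite ν ∧ (∀ᶠ α in 𝓝 0, Pα α ≪ ν) ∧
    ∃ ℓ : 𝒳 → EuclideanSpace ℝ (Fin d), MemLp ℓ 2 P ∧
      (fun α => ∫ x, (√((Pα α).rnDeriv ν x).toReal - √((Pα 0).rnDeriv ν x).toReal
          - 1 / 2 * inner ℝ α (ℓ x) * √((Pα 0).rnDeriv ν x).toReal) ^ 2 ∂ν)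
        =o[𝓝 0] fun α => ‖α‖ ^ 2

/-- The estimator `est` of `θ` is regular in the model `𝓜` at `P`: under every local data generating
process in a parametric submodel (data of size `n` drawn i.i.d. from the parameter value `α n`,
where `√n ‖α n‖` is bounded), `√n (est - θ(α n))` converges in distribution to one and the same
limit law. -/
def IsRegularEstimator {𝒳 : Type*} [MeasurableSpace 𝒳] (𝓜 : Set (Measure 𝒳 × ℝ))
    (P : Measure 𝒳) (θ : ℝ) (k : ℕ → ℕ) (est : ∀ n, Sample 𝒳 n (k n) → ℝ) : Prop :=
  ∃ L : Measure ℝ, IsProbabilityMeasure L ∧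
    ∀ (d : ℕ) (Pα : EuclideanSpace ℝ (Fin d) → Measure 𝒳)
      (θα : EuclideanSpace ℝ (Fin d) → ℝ), IsRegularSubmodel 𝓜 P θ d Pα θα →
    ∀ α : ℕ → EuclideanSpace ℝ (Fin d), (∃ B : ℝ, ∀ n : ℕ, √n * ‖α n‖ ≤ B) →
    ∀ H : ℝ →ᵇ ℝ,
      Tendsto (fun n : ℕ =>
          ∫ s, H (√n * (est n s - θα (α n))) ∂(sampleLaw (Pα (α n)) n (k n)))
        atTop (𝓝 (∫ y, H y ∂L))

/-- `est` is asymptotically linear with influence function `φ`: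
`√n (est - θ) = n^{-1/2} ∑ᵢ φ (Xᵢ) + o_p(1)`, with `E φ = 0` and `E φ² < ∞`. -/
structure IsAsymptoticallyLinear {𝒳 : Type*} [MeasurableSpace 𝒳] (P : Measure 𝒳) (θ : ℝ)
    (k : ℕ → ℕ) (est : ∀ n, Sample 𝒳 n (k n) → ℝ) (φ : 𝒳 → ℝ) : Prop where
  memLp : MemLp φ 2 P
  mean_zero : ∫ x, φ x ∂P = 0
  expansion : TendstoZeroInProb (fun n => sampleLaw P n (k n))
    fun n s => ‖√n * (est n s - θ) - (√n)⁻¹ * ∑ i, φ (s.1 i)‖ₑ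

/-- The regularity assumption on the plug-in nuisance estimator `ηhat`, for the estimating function
`m` and the true nuisance `η₀`:
(a) `‖m(·, ηhat) - m(·, η₀)‖ = o_p(1)`;
(b) sample splitting (`ηhat` is a function of the separate sample only) or `m(·, ηhat)` belongs to a
Donsker class. -/
def PlugInRegularity {𝒳 H : Type*} [MeasurableSpace 𝒳] (P : Measure 𝒳) (k : ℕ → ℕ)
    (m : 𝒳 → H → ℝ) (η₀ : H) (ηhat : ∀ n, Sample 𝒳 n (k n) → H) : Prop :=
  TendstoZeroInProb (fun n => sampleLaw P n (k n))
      (fun n s => eLpNorm (fun x => m x (ηhat n s) - m x η₀) 2 P ^ 2) ∧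
  ((∀ n s s', s.2 = s'.2 → ηhat n s = ηhat n s') ∨
    ∃ F : Set (𝒳 → ℝ), IsDonsker P F ∧
      WithProbTendingToOne (fun n => sampleLaw P n (k n)) fun n s => (fun x => m x (ηhat n s)) ∈ F)

end RegularAsymptoticLinearity

section Causal

/-- A potential outcome model with treatment `A`, mediator `Z`, outcome `Y` and pre-treatment
covariates `C`: potential mediators `Z(a)`, potential outcomes `Y(a)` and `Y(a, z)`, with the
composition `Y(a) = Y(a, Z(a))` and the consistency assumption. -/
structure CausalModel (𝒜 𝒵 𝒞 : Type u) [MeasurableSpace 𝒜] [MeasurableSpace 𝒵]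
    [MeasurableSpace 𝒞] where
  Ω : Type u
  [measurableSpace : MeasurableSpace Ω]
  Q : Measure Ω
  [isProbabilityMeasure : IsProbabilityMeasure Q]
  A : Ω → 𝒜
  C : Ω → 𝒞
  Z : Ω → 𝒵
  Y : Ω → ℝ
  Zpot : 𝒜 → Ω → 𝒵
  Ypot : 𝒜 → Ω → ℝ
  Ypot₂ : 𝒜 → 𝒵 → Ω → ℝ
  measurable_A : Measurable A
  measurable_C : Measurable C
  measurable_Z : Measurable Z
  measurable_Y : Measurable Y
  measurable_Zpot : ∀ a, Measurable (Zpot a)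
  measurable_Ypot : ∀ a, Measurable (Ypot a)
  measurable_Ypot₂ : ∀ a z, Measurable (Ypot₂ a z)
  composition : ∀ a z, ∀ᵐ ω ∂Q, Zpot a ω = z → Ypot a ω = Ypot₂ a z ω
  consistency_Y : ∀ a, ∀ᵐ ω ∂Q, A ω = a → Y ω = Ypot a ω
  consistency_Z : ∀ a, ∀ᵐ ω ∂Q, A ω = a → Z ω = Zpot a ω
  consistency_Y₂ : ∀ a z, ∀ᵐ ω ∂Q, A ω = a → Z ω = z → Y ω = Ypot₂ a z ω

attribute [instance] CausalModel.measurableSpace CausalModel.isProbabilityMeasure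

variable {𝒜 𝒵 𝒞 : Type u} [MeasurableSpace 𝒜] [MeasurableSpace 𝒵] [MeasurableSpace 𝒞]

/-- `E Y(a)`. -/
def CausalModel.meanY (M : CausalModel 𝒜 𝒵 𝒞) (a : 𝒜) : ℝ := ∫ ω, M.Ypot a ω ∂M.Q

/-- The average causal effect `θ = E Y(a*) - E Y(a)`. -/
def CausalModel.ace (M : CausalModel 𝒜 𝒵 𝒞) (aStar a : 𝒜) : ℝ := M.meanY aStar - M.meanY a

/-- The two-door assumption. As `A` and `C` are discrete, conditioning on them is conditioning on
the events `C = c` and `A = a, C = c`. -/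
structure CausalModel.TwoDoor (M : CausalModel 𝒜 𝒵 𝒞) : Prop where
  td1 : ∀ a a' z, M.Ypot₂ a z =ᵐ[M.Q] M.Ypot₂ a' z
  td2 : ∀ a c, IndepFun (M.Zpot a) M.A (cond M.Q {ω | M.C ω = c})
  td3 : ∀ a a' z b c, IndepFun (M.Ypot₂ a z) (M.Zpot a') (cond M.Q {ω | M.A ω = b ∧ M.C ω = c})

/-- The front-door assumption. -/
structure CausalModel.FrontDoor (M : CausalModel 𝒜 𝒵 𝒞) : Prop where
  fd1 : ∀ a a' z, M.Ypot₂ a z =ᵐ[M.Q] M.Ypot₂ a' z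
  fd2 : ∀ a, IndepFun (M.Zpot a) M.A M.Q
  fd3 : ∀ a a' z b, IndepFun (M.Ypot₂ a z) (M.Zpot a') (cond M.Q {ω | M.A ω = b})

end Causal

section TwoDoor

/-- An observation `X = (C, A, Z, Y)`. -/
abbrev ObsTD (𝒜 𝒵 𝒞 : Type u) : Type u := 𝒞 × 𝒜 × 𝒵 × ℝ

variable {𝒜 𝒵 𝒞 : Type u}

/-- The covariate `C` of an observation. -/
def ObsTD.C (x : ObsTD 𝒜 𝒵 𝒞) : 𝒞 := x.1
/-- The treatment `A` of an observation. -/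
def ObsTD.A (x : ObsTD 𝒜 𝒵 𝒞) : 𝒜 := x.2.1
/-- The mediator `Z` of an observation. -/
def ObsTD.Z (x : ObsTD 𝒜 𝒵 𝒞) : 𝒵 := x.2.2.1
/-- The outcome `Y` of an observation. -/
def ObsTD.Y (x : ObsTD 𝒜 𝒵 𝒞) : ℝ := x.2.2.2

/-- Values of the nuisance functions `E(Y|a,z,c)`, `p(z|a,c)`, `p(a|c)`. -/
structure NuisanceTD (𝒜 𝒵 𝒞 : Type u) where
  outcome : 𝒜 → 𝒵 → 𝒞 → ℝ
  mediator : 𝒵 → 𝒜 → 𝒞 → ℝ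
  propensity : 𝒜 → 𝒞 → ℝ

/-- The function `m_td(x, η)`, so that `φ_td(x, η, θ) = m_td(x, η) - θ`. -/
def mTD (aStar a : 𝒜) (x : ObsTD 𝒜 𝒵 𝒞) (η : NuisanceTD 𝒜 𝒵 𝒞) : ℝ :=
  (x.Y - η.outcome x.A x.Z x.C) *
      ((η.mediator x.Z aStar x.C - η.mediator x.Z a x.C) / η.mediator x.Z x.A x.C)
  + ((∑' b, η.outcome b x.Z x.C * η.propensity b x.C)
      - ∑' b, ∑' z, η.outcome b z x.C * η.mediator z x.A x.C * η.propensity b x.C) *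
      ((Set.indicator {aStar} (fun _ => (1 : ℝ)) x.A - Set.indicator {a} (fun _ => (1 : ℝ)) x.A)
        / η.propensity x.A x.C)
  + ∑' z, η.outcome x.A z x.C * (η.mediator z aStar x.C - η.mediator z a x.C)

/-- The influence function `φ_td(x, η, θ)`. -/
def phiTD (aStar a : 𝒜) (x : ObsTD 𝒜 𝒵 𝒞) (η : NuisanceTD 𝒜 𝒵 𝒞) (θ : ℝ) : ℝ :=
  mTD aStar a x η - θ

variable [MeasurableSpace 𝒜] [MeasurableSpace 𝒵] [MeasurableSpace 𝒞]

/-- The true nuisance functions of the law `P` of `(C, A, Z, Y)`. -/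
def trueNuisanceTD (P : Measure (ObsTD 𝒜 𝒵 𝒞)) : NuisanceTD 𝒜 𝒵 𝒞 where
  outcome a z c := ∫ x, x.Y ∂(cond P {x | x.A = a ∧ x.Z = z ∧ x.C = c})
  mediator z a c := (cond P {x | x.A = a ∧ x.C = c}).real {x | x.Z = z}
  propensity a c := (cond P {x | x.C = c}).real {x | x.A = a}

/-- The law of the observation `(C, A, Z, Y)`. -/
def CausalModel.obsLawTD (M : CausalModel 𝒜 𝒵 𝒞) : Measure (ObsTD 𝒜 𝒵 𝒞) :=
  M.Q.map fun ω => (M.C ω, M.A ω, M.Z ω, M.Y ω)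

/-- Positivity: all values of `(A, Z, C)` have positive probability. -/
def CausalModel.PositiveTD (M : CausalModel 𝒜 𝒵 𝒞) : Prop :=
  ∀ a z c, 0 < M.Q {ω | M.A ω = a ∧ M.Z ω = z ∧ M.C ω = c}

/-- The semiparametric model for the law of `(C, A, Z, Y)` given by the two-door assumption,
positivity, the bounds `p(Z|A,C) > ε`, `p(A|C) > ε` and `E Y² ≤ B`, together with the target
parameter `E Y(a*) - E Y(a)`. -/
def modelTD (aStar a : 𝒜) (ε B : ℝ) : Set (Measure (ObsTD 𝒜 𝒵 𝒞) × ℝ) :=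
  {q | ∃ M : CausalModel 𝒜 𝒵 𝒞, M.TwoDoor ∧ M.PositiveTD ∧
    (∀ᵐ x ∂M.obsLawTD, ε < (trueNuisanceTD M.obsLawTD).mediator x.Z x.A x.C) ∧
    (∀ᵐ x ∂M.obsLawTD, ε < (trueNuisanceTD M.obsLawTD).propensity x.A x.C) ∧
    MemLp M.Y 2 M.Q ∧ ∫ ω, M.Y ω ^ 2 ∂M.Q ≤ B ∧
    q = (M.obsLawTD, M.ace aStar a)}

/-- The nuisance estimators are measurable functions of the data. -/
def MeasurableNuisanceTD {k : ℕ → ℕ}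
    (ηhat : ∀ n, Sample (ObsTD 𝒜 𝒵 𝒞) n (k n) → NuisanceTD 𝒜 𝒵 𝒞) : Prop :=
  (∀ n a z c, Measurable fun s => (ηhat n s).outcome a z c) ∧
  (∀ n z a c, Measurable fun s => (ηhat n s).mediator z a c) ∧
  (∀ n a c, Measurable fun s => (ηhat n s).propensity a c)

/-- The boundedness assumption for the two-door estimator. -/
structure BoundednessTD (aStar a : 𝒜) (P : Measure (ObsTD 𝒜 𝒵 𝒞)) (k : ℕ → ℕ)
    (ηhat : ∀ n, Sample (ObsTD 𝒜 𝒵 𝒞) n (k n) → NuisanceTD 𝒜 𝒵 𝒞) : Prop where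
  outcome_hat : BoundedAboveWPTO P k fun n s x => (ηhat n s).outcome x.A x.Z x.C
  mediator : ∃ ε : ℝ, 0 < ε ∧ ∀ᵐ x ∂P, ε < (trueNuisanceTD P).mediator x.Z x.A x.C
  mediator_hat_below : BoundedBelowWPTO P k fun n s x => (ηhat n s).mediator x.Z x.A x.C
  mediator_hat_above : ∀ b ∈ ({aStar, a} : Set 𝒜),
    BoundedAboveWPTO P k fun n s x => (ηhat n s).mediator x.Z b x.C
  propensity : ∃ ε : ℝ, 0 < ε ∧ ∀ᵐ x ∂P, ε < (trueNuisanceTD P).propensity x.A x.C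
  propensity_hat_below : ∀ b ∈ ({aStar, a} : Set 𝒜),
    BoundedBelowWPTO P k fun n s x => (ηhat n s).propensity b x.C
  propensity_hat_above : BoundedAboveWPTO P k fun n s x => (ηhat n s).propensity x.A x.C
  propensity_hat_above' : ∀ b ∈ ({aStar, a} : Set 𝒜),
    BoundedAboveWPTO P k fun n s x => (ηhat n s).propensity b x.C

/-- The product rate conditions for the two-door estimator. -/
structure RatesTD (aStar a : 𝒜) (P : Measure (ObsTD 𝒜 𝒵 𝒞)) (k : ℕ → ℕ)
    (ηhat : ∀ n, Sample (ObsTD 𝒜 𝒵 𝒞) n (k n) → NuisanceTD 𝒜 𝒵 𝒞) : Prop where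
  outcome_mediator : ProductRate P k
    (fun n s x => (ηhat n s).outcome x.A x.Z x.C - (trueNuisanceTD P).outcome x.A x.Z x.C)
    (fun n s x => (ηhat n s).mediator x.Z x.A x.C - (trueNuisanceTD P).mediator x.Z x.A x.C)
  outcome_mediator' : ∀ b ∈ ({aStar, a} : Set 𝒜), ProductRate P k
    (fun n s x => (ηhat n s).outcome x.A x.Z x.C - (trueNuisanceTD P).outcome x.A x.Z x.C)
    (fun n s x => (ηhat n s).mediator x.Z b x.C - (trueNuisanceTD P).mediator x.Z b x.C)
  mediator_propensity : ∀ b ∈ ({aStar, a} : Set 𝒜), ProductRate P k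
    (fun n s x => (ηhat n s).mediator x.Z b x.C - (trueNuisanceTD P).mediator x.Z b x.C)
    (fun n s x => (ηhat n s).propensity b x.C - (trueNuisanceTD P).propensity b x.C)
  mediator_propensity' : ∀ b ∈ ({aStar, a} : Set 𝒜), ProductRate P k
    (fun n s x => (ηhat n s).mediator x.Z b x.C - (trueNuisanceTD P).mediator x.Z b x.C)
    (fun n s x => (ηhat n s).propensity x.A x.C - (trueNuisanceTD P).propensity x.A x.C)

end TwoDoor

section FrontDoor

/-- An observation `X = (A, Z, Y)`; the covariates are not used. -/
abbrev ObsFD (𝒜 𝒵 : Type u) : Type u := 𝒜 × 𝒵 × ℝ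

variable {𝒜 𝒵 𝒞 : Type u}

/-- The treatment `A` of an observation. -/
def ObsFD.A (x : ObsFD 𝒜 𝒵) : 𝒜 := x.1
/-- The mediator `Z` of an observation. -/
def ObsFD.Z (x : ObsFD 𝒜 𝒵) : 𝒵 := x.2.1
/-- The outcome `Y` of an observation. -/
def ObsFD.Y (x : ObsFD 𝒜 𝒵) : ℝ := x.2.2

/-- Values of the nuisance functions `E(Y|a,z)`, `p(z|a)`, `p(a)`. -/
structure NuisanceFD (𝒜 𝒵 : Type u) where
  outcome : 𝒜 → 𝒵 → ℝ
  mediator : 𝒵 → 𝒜 → ℝ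
  treatment : 𝒜 → ℝ

/-- The front-door expression `∑_{b,z} E(Y|b,z) p(z|a') p(b)` for `E Y(a')`, as a function of the
nuisance functions. -/
def frontDoorMean (η : NuisanceFD 𝒜 𝒵) (a' : 𝒜) : ℝ :=
  ∑' b, ∑' z, η.outcome b z * η.mediator z a' * η.treatment b

/-- The influence function `φ_fd(x, η, θ)`, where `μStar` and `μ` stand for `E Y(a*)` and
`E Y(a)`. -/
def phiFD (aStar a : 𝒜) (x : ObsFD 𝒜 𝒵) (η : NuisanceFD 𝒜 𝒵) (μStar μ θ : ℝ) : ℝ :=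
  (x.Y - η.outcome x.A x.Z) *
      ((η.mediator x.Z aStar - η.mediator x.Z a) / η.mediator x.Z x.A)
  + Set.indicator {aStar} (fun _ => (1 : ℝ)) x.A / η.treatment x.A *
      ((∑' b, η.outcome b x.Z * η.treatment b) - μStar)
  - Set.indicator {a} (fun _ => (1 : ℝ)) x.A / η.treatment x.A *
      ((∑' b, η.outcome b x.Z * η.treatment b) - μ)
  + (∑' z, η.outcome x.A z * (η.mediator z aStar - η.mediator z a)) - θ

/-- The plug-in version of `φ_fd`, in which `E Y(a*)` and `E Y(a)` are the front-door expressions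
in `η`. -/
def phiFDPlugIn (aStar a : 𝒜) (x : ObsFD 𝒜 𝒵) (η : NuisanceFD 𝒜 𝒵) (θ : ℝ) : ℝ :=
  phiFD aStar a x η (frontDoorMean η aStar) (frontDoorMean η a) θ

/-- The function `m_fd(x, η)`, so that the plug-in `φ_fd(x, η, θ)` is `m_fd(x, η) - θ`. -/
def mFD (aStar a : 𝒜) (x : ObsFD 𝒜 𝒵) (η : NuisanceFD 𝒜 𝒵) : ℝ :=
  phiFDPlugIn aStar a x η 0

variable [MeasurableSpace 𝒜] [MeasurableSpace 𝒵] [MeasurableSpace 𝒞]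

/-- The true nuisance functions of the law `P` of `(A, Z, Y)`. -/
def trueNuisanceFD (P : Measure (ObsFD 𝒜 𝒵)) : NuisanceFD 𝒜 𝒵 where
  outcome a z := ∫ x, x.Y ∂(cond P {x | x.A = a ∧ x.Z = z})
  mediator z a := (cond P {x | x.A = a}).real {x | x.Z = z}
  treatment a := P.real {x | x.A = a}

/-- The law of the observation `(A, Z, Y)`. -/
def CausalModel.obsLawFD (M : CausalModel 𝒜 𝒵 𝒞) : Measure (ObsFD 𝒜 𝒵) :=
  M.Q.map fun ω => (M.A ω, M.Z ω, M.Y ω)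

/-- Positivity: all values of `(A, Z)` have positive probability. -/
def CausalModel.PositiveFD (M : CausalModel 𝒜 𝒵 𝒞) : Prop :=
  ∀ a z, 0 < M.Q {ω | M.A ω = a ∧ M.Z ω = z}

/-- The semiparametric model for the law of `(A, Z, Y)` given by the front-door assumption,
positivity, the bounds `p(Z|A) > ε`, `p(A) > ε` and `E Y² ≤ B`, together with the target
parameter `E Y(a*) - E Y(a)`. -/
def modelFD (𝒞 : Type u) [MeasurableSpace 𝒞] (aStar a : 𝒜) (ε B : ℝ) :
    Set (Measure (ObsFD 𝒜 𝒵) × ℝ) :=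
  {q | ∃ M : CausalModel 𝒜 𝒵 𝒞, M.FrontDoor ∧ M.PositiveFD ∧
    (∀ᵐ x ∂M.obsLawFD, ε < (trueNuisanceFD M.obsLawFD).mediator x.Z x.A) ∧
    (∀ᵐ x ∂M.obsLawFD, ε < (trueNuisanceFD M.obsLawFD).treatment x.A) ∧
    MemLp M.Y 2 M.Q ∧ ∫ ω, M.Y ω ^ 2 ∂M.Q ≤ B ∧
    q = (M.obsLawFD, M.ace aStar a)}

/-- The nuisance estimators are measurable functions of the data. -/
def MeasurableNuisanceFD {k : ℕ → ℕ}
    (ηhat : ∀ n, Sample (ObsFD 𝒜 𝒵) n (k n) → NuisanceFD 𝒜 𝒵) : Prop :=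
  (∀ n a z, Measurable fun s => (ηhat n s).outcome a z) ∧
  (∀ n z a, Measurable fun s => (ηhat n s).mediator z a) ∧
  (∀ n a, Measurable fun s => (ηhat n s).treatment a)

/-- The boundedness assumption for the front-door estimator. -/
structure BoundednessFD (aStar a : 𝒜) (P : Measure (ObsFD 𝒜 𝒵)) (k : ℕ → ℕ)
    (ηhat : ∀ n, Sample (ObsFD 𝒜 𝒵) n (k n) → NuisanceFD 𝒜 𝒵) : Prop where
  outcome_hat : BoundedAboveWPTO P k fun n s x => (ηhat n s).outcome x.A x.Z
  mediator : ∃ ε : ℝ, 0 < ε ∧ ∀ᵐ x ∂P, ε < (trueNuisanceFD P).mediator x.Z x.A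
  mediator_hat_below : BoundedBelowWPTO P k fun n s x => (ηhat n s).mediator x.Z x.A
  mediator_hat_above : ∀ b ∈ ({aStar, a} : Set 𝒜),
    BoundedAboveWPTO P k fun n s x => (ηhat n s).mediator x.Z b
  treatment : ∃ ε : ℝ, 0 < ε ∧ ∀ᵐ x ∂P, ε < (trueNuisanceFD P).treatment x.A
  treatment_hat_below : ∀ b ∈ ({aStar, a} : Set 𝒜),
    BoundedBelowWPTO P k fun n s _ => (ηhat n s).treatment b
  treatment_hat_above : BoundedAboveWPTO P k fun n s x => (ηhat n s).treatment x.A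
  treatment_hat_above' : ∀ b ∈ ({aStar, a} : Set 𝒜),
    BoundedAboveWPTO P k fun n s _ => (ηhat n s).treatment b

/-- The product rate conditions for the front-door estimator. -/
structure RatesFD (aStar a : 𝒜) (P : Measure (ObsFD 𝒜 𝒵)) (k : ℕ → ℕ)
    (ηhat : ∀ n, Sample (ObsFD 𝒜 𝒵) n (k n) → NuisanceFD 𝒜 𝒵) : Prop where
  outcome_mediator : ProductRate P k
    (fun n s x => (ηhat n s).outcome x.A x.Z - (trueNuisanceFD P).outcome x.A x.Z)
    (fun n s x => (ηhat n s).mediator x.Z x.A - (trueNuisanceFD P).mediator x.Z x.A)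
  outcome_mediator' : ∀ b ∈ ({aStar, a} : Set 𝒜), ProductRate P k
    (fun n s x => (ηhat n s).outcome x.A x.Z - (trueNuisanceFD P).outcome x.A x.Z)
    (fun n s x => (ηhat n s).mediator x.Z b - (trueNuisanceFD P).mediator x.Z b)
  mediator_treatment : ∀ b ∈ ({aStar, a} : Set 𝒜), ProductRate P k
    (fun n s x => (ηhat n s).mediator x.Z b - (trueNuisanceFD P).mediator x.Z b)
    (fun n s _ => (ηhat n s).treatment b - (trueNuisanceFD P).treatment b)
  mediator_treatment' : ∀ b ∈ ({aStar, a} : Set 𝒜), ProductRate P k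
    (fun n s x => (ηhat n s).mediator x.Z b - (trueNuisanceFD P).mediator x.Z b)
    (fun n s x => (ηhat n s).treatment x.A - (trueNuisanceFD P).treatment x.A)

end FrontDoor

end

/-! The front-door problem is the two-door problem with a one-point covariate: with that covariate
`phiFDPlugIn` is `mTD` minus θ (`phiFDPlugIn_eq`). The analysis is therefore done once, for an
observation space with a map `X` into two-door observations, which is either the identity or
`ObsFD.toTD`.

Identification. Given `A = b` and `C = c`, the variable `Z(a')` has law `p(·|a',c)` and is
independent of `Y(a',z) = Y(b,z)`. Hence the law of `Y(a')` is the law of `Y` reweighted by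
`p(Z|a',C) / p(Z|A,C)` (`CausalModel.TwoDoor.map_Ypot_eq`), and θ is the mean of `Y w₀` with `w₀ =
(p(Z|a*,C) - p(Z|a,C)) / p(Z|A,C)`.

Bias. For any bounded nuisance value with regression `Q` and weight `w`, `m - Y w₀ = (Y - Q)(w - w₀)
+ (rest - Q w₀)`. In the first term `Y` may be replaced by the true regression, which leaves an
outcome error times mediator errors. The second term, averaged over `(A, Z)` given `C`, collapses by
the algebraic identity `sum_rest` to mediator errors times treatment errors. So
`enorm_integral_mTD_sub_le` bounds the bias by a constant times a sum of the products that are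
assumed to be `o_p(n^{-1/2})`.

Asymptotic linearity. The error of the linear expansion is the empirical process at `m(·, ηhat) -
m(·, η₀)` plus `√n` times the bias. The former is negligible by Chebyshev's inequality given the
separate sample, or by asymptotic equicontinuity over the Donsker class
(`PlugInRegularity.empirical_sub_tendsto`).

Regularity. The bias formula, used under a perturbed law with the nuisance held at a truncation of
its unperturbed value, shows that θ is differentiable along every submodel with gradient the
influence function (`QMD.isLittleO_twoDoor`); the conditional probabilities move by `O(‖α‖)` in `L²`
because they are Lipschitz for the Hellinger distance. Under the local laws, contiguity
(`QMD.contiguity`) keeps negligible terms negligible, a bounded truncation of the influence function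
obeys a central limit theorem for row-wise i.i.d. arrays, and the shift of its mean cancels `√n (θ(α
n) - θ)` up to a small error. The limit is the same centred Gaussian for every submodel
(`tendsto_integral_cexp_of_pathwise`).

Two devices recur. Lower bounds on the conditional probabilities force `A` and `Z` to be
finite-valued, so the inner sums are finite and a norm taken at the observed `(A, Z)` controls all
`(b, z)`. The true regression may be unbounded in `C`; it is truncated, and this causes no bias
because the mediator and treatment probabilities stay exact. -/

lemma abs_sub_apply_le_dist {𝒳 : Type*} {F : Set (𝒳 → ℝ)} (z w : EllInfty F) (f : F) :
    |z f - w f| ≤ dist z w := by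
  have := lp.norm_apply_le_norm (p := ∞) ENNReal.top_ne_zero (z - w) f
  rwa [dist_eq_norm, ← Real.norm_eq_abs]

/-! ### Empirical processes and asymptotic equicontinuity of Donsker classes. -/

section EmpiricalProcess

variable {𝒳 : Type*} [MeasurableSpace 𝒳] {P : Measure 𝒳}

/-- The empirical process `n^{-1/2} ∑ᵢ (f (xᵢ) - P f)` at one function `f`. -/
noncomputable def empirical (P : Measure 𝒳) (n : ℕ) (f : 𝒳 → ℝ) (x : Fin n → 𝒳) : ℝ :=
  (√n)⁻¹ * ∑ i, (f (x i) - ∫ y, f y ∂P)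

lemma memLp_empirical [IsProbabilityMeasure P] {f : 𝒳 → ℝ} (hf : MemLp f 2 P) (n : ℕ) :
    MemLp (empirical P n f) 2 (Measure.pi fun _ : Fin n => P) := by
  have h : ∀ i : Fin n, MemLp (fun x : Fin n → 𝒳 => f (x i) - ∫ y, f y ∂P) 2
      (Measure.pi fun _ : Fin n => P) := fun i =>
    (hf.sub (memLp_const (∫ y, f y ∂P))).comp_measurePreserving
      (measurePreserving_eval (fun _ : Fin n => P) i)
  exact (memLp_finsetSum Finset.univ fun i _ => h i).const_mul _

/-- The centred summands are independent, so for positive `n` the second moment is `Var[f; P]`,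
which is at most the raw second moment. -/
lemma integral_sq_empirical_le [IsProbabilityMeasure P] {f : 𝒳 → ℝ} (hf : MemLp f 2 P) (n : ℕ) :
    ∫ x, empirical P n f x ^ 2 ∂(Measure.pi fun _ : Fin n => P) ≤ ∫ x, f x ^ 2 ∂P := by
  have hg : MemLp (fun x => f x - ∫ y, f y ∂P) 2 P := hf.sub (memLp_const _)
  have hvar : Var[∑ i : Fin n, fun x : Fin n → 𝒳 => f (x i) - ∫ y, f y ∂P;
      Measure.pi fun _ : Fin n => P] = n * Var[f; P] := by
    rw [variance_sum_pi (μ := fun _ : Fin n => P) (X := fun _ x => f x - ∫ y, f y ∂P)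
      fun _ => hg]
    simp [variance_sub_const hf.aestronglyMeasurable]
  have hmean : ∫ x, (∑ i : Fin n, fun x : Fin n → 𝒳 => f (x i) - ∫ y, f y ∂P) x
      ∂(Measure.pi fun _ : Fin n => P) = 0 := by
    simp only [Finset.sum_apply]
    rw [integral_finsetSum]
    · refine Finset.sum_eq_zero fun i _ => ?_
      have := integral_comp_eval (μ := fun _ : Fin n => P) (i := i)
        (f := fun x => f x - ∫ y, f y ∂P) hg.aestronglyMeasurable
      rw [this, integral_sub (hf.integrable one_le_two) (integrable_const _)]
      simp
    · intro i _
      exact integrable_comp_eval (μ := fun _ : Fin n => P) (hg.integrable one_le_two)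
  rw [variance_of_integral_eq_zero _ hmean] at hvar
  -- For `n = 0` the sum is empty and the left side vanishes; otherwise the square of `(√n)⁻¹`
  -- cancels the factor `n` of the variance.
  · rcases n.eq_zero_or_pos with rfl | hn
    · simpa [empirical] using integral_nonneg fun x => sq_nonneg (f x)
    have h1 : ∀ x : Fin n → 𝒳, empirical P n f x ^ 2 =
        (n : ℝ)⁻¹ * ((∑ i : Fin n, fun x : Fin n → 𝒳 => f (x i) - ∫ y, f y ∂P) x) ^ 2 := by
      intro x
      simp only [empirical, Finset.sum_apply, mul_pow, inv_pow]
      rw [Real.sq_sqrt (Nat.cast_nonneg n)]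
    simp_rw [h1]
    rw [integral_const_mul, hvar]
    have hn' : (n : ℝ) ≠ 0 := by positivity
    rw [← mul_assoc, inv_mul_cancel₀ hn', one_mul]
    exact variance_le_expectation_sq hf.aestronglyMeasurable
  · have := memLp_finsetSum' Finset.univ fun (i : Fin n) _ =>
      hg.comp_measurePreserving (measurePreserving_eval (fun _ : Fin n => P) i)
    exact this.aestronglyMeasurable.aemeasurable

/-- Chebyshev's inequality, with a bound free of `n`. -/
lemma measure_empirical_ge_le [IsProbabilityMeasure P] {f : 𝒳 → ℝ} (hf : MemLp f 2 P) (n : ℕ)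
    {ε : ℝ} (hε : 0 < ε) :
    (Measure.pi fun _ : Fin n => P) {x | ε ≤ |empirical P n f x|} ≤
      ENNReal.ofReal ((∫ x, f x ^ 2 ∂P) / ε ^ 2) := by
  have h := mul_meas_ge_le_integral_of_nonneg (μ := Measure.pi fun _ : Fin n => P)
    (f := fun x => empirical P n f x ^ 2) (Eventually.of_forall fun x => sq_nonneg _)
    (memLp_empirical hf n).integrable_sq (ε ^ 2)
  have hs : {x : Fin n → 𝒳 | ε ≤ |empirical P n f x|} = {x | ε ^ 2 ≤ empirical P n f x ^ 2} := by
    ext x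
    simp only [Set.mem_ofPred_eq]
    rw [sq_le_sq, abs_of_pos hε]
  rw [hs, ← ofReal_measureReal]
  refine ENNReal.ofReal_le_ofReal ?_
  rw [le_div_iff₀ (by positivity), mul_comm]
  exact h.trans (integral_sq_empirical_le hf n)

lemma outerExpectation_le_integral {S : Type*} [MeasurableSpace S] {μ : Measure S}
    [IsProbabilityMeasure μ] {T : S → ℝ} (hT : Measurable T) (h0 : ∀ s, 0 ≤ T s)
    (h1 : ∀ s, T s ≤ 1) : outerExpectation μ T ≤ ∫ s, T s ∂μ := by
  refine csInf_le ⟨0, ?_⟩ ⟨T, hT, ?_, fun _ => le_rfl, rfl⟩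
  · rintro r ⟨U, -, -, hU, rfl⟩
    exact integral_nonneg fun s => (h0 s).trans (hU s)
  · exact Integrable.of_bound hT.aestronglyMeasurable 1
      (Eventually.of_forall fun s => by rw [Real.norm_of_nonneg (h0 s)]; exact h1 s)

/-- Markov's inequality for a measurable majorant of `T` whose integral is below `c`. Neither `T`
nor the event need be measurable, so convergence of outer expectations is turned into a bound on an
outer probability. -/
lemma measure_le_of_outerExpectation_lt {S : Type*} [MeasurableSpace S] {μ : Measure S}
    [IsProbabilityMeasure μ] {T : S → ℝ} (h0 : ∀ s, 0 ≤ T s) (h1 : ∀ s, T s ≤ 1) {c : ℝ}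
    (hc : outerExpectation μ T < c) : μ {s | 1 ≤ T s} ≤ ENNReal.ofReal c := by
  have hne : {r | ∃ U : S → ℝ, Measurable U ∧ Integrable U μ ∧ (∀ s, T s ≤ U s) ∧
      r = ∫ s, U s ∂μ}.Nonempty :=
    ⟨_, fun _ => (1 : ℝ), measurable_const, integrable_const _, h1, rfl⟩
  obtain ⟨r, ⟨U, hUm, hUi, hU, rfl⟩, hr⟩ := exists_lt_of_csInf_lt hne hc
  calc μ {s | 1 ≤ T s} ≤ μ {s | 1 ≤ U s} := measure_mono fun s hs => le_trans hs (hU s)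
    _ = ENNReal.ofReal (μ.real {s | 1 ≤ U s}) := (ofReal_measureReal).symm
    _ ≤ ENNReal.ofReal c := by
      refine ENNReal.ofReal_le_ofReal ?_
      have := mul_meas_ge_le_integral_of_nonneg
        (Eventually.of_forall fun s => (h0 s).trans (hU s)) hUi 1
      rw [one_mul] at this
      exact this.trans hr.le

lemma empiricalProcess_apply {F : Set (𝒳 → ℝ)}
    (hF : ∀ x, BddAbove (Set.range fun f : F => ‖f.1 x - ∫ y, f.1 y ∂P‖)) (n : ℕ)
    (x : Fin n → 𝒳) (f : F) : empiricalProcess hF n x f = empirical P n f.1 x := by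
  rw [empiricalProcess, lp.coeFn_smul, lp.coeFn_sum, Pi.smul_apply, Finset.sum_apply, smul_eq_mul]
  rfl

lemma measurable_empirical {f : 𝒳 → ℝ} (hf : Measurable f) (n : ℕ) :
    Measurable (empirical P n f) := by
  unfold empirical
  fun_prop

/-- Weak convergence of the empirical process bounds the increments of its limit. -/
lemma limit_increment_le [IsProbabilityMeasure P] {F : Set (𝒳 → ℝ)}
    (hF2 : ∀ f ∈ F, Measurable f ∧ MemLp f 2 P)
    (hF : ∀ x, BddAbove (Set.range fun f : F => ‖f.1 x - ∫ y, f.1 y ∂P‖))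
    {γ : Measure (EllInfty F)} [IsProbabilityMeasure γ]
    (hconv : ∀ H : EllInfty F →ᵇ ℝ, Tendsto (fun n : ℕ =>
      outerExpectation (Measure.pi fun _ : Fin n => P) fun x => H (empiricalProcess hF n x))
        atTop (𝓝 (∫ z, H z ∂γ))) (f g : F) {η : ℝ} (hη : 0 < η) :
    γ {z | η ≤ |z f - z g|} ≤ ENNReal.ofReal ((∫ x, (f.1 x - g.1 x) ^ 2 ∂P) / η ^ 2) := by
  have hev : ∀ f : F, Continuous fun z : EllInfty F => z f := fun f =>
    LipschitzWith.continuous (K := 1) (LipschitzWith.of_dist_le_mul fun z w => by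
      simpa [Real.dist_eq] using abs_sub_apply_le_dist z w f)
  -- A bounded continuous test function that equals `1` on the event in question. Its expectation
  -- along the empirical process is at most the second moment of the increment over `η ^ 2` for
  -- every `n`, and the bound survives the limit.
  have hc : Continuous fun z : EllInfty F => min 1 (((z f - z g) / η) ^ 2) :=
    continuous_const.min ((((hev f).sub (hev g)).div_const _).pow 2)
  have h0 : ∀ z : EllInfty F, 0 ≤ min 1 (((z f - z g) / η) ^ 2) := fun z =>
    le_min zero_le_one (sq_nonneg _)
  let H : EllInfty F →ᵇ ℝ := BoundedContinuousFunction.ofNormedAddCommGroup _ hc 1 fun z => by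
    rw [Real.norm_of_nonneg (h0 z)]; exact min_le_left _ _
  have hH : ∀ z, H z = min 1 (((z f - z g) / η) ^ 2) := fun z => rfl
  have hfg : MemLp (fun x => f.1 x - g.1 x) 2 P := (hF2 f f.2).2.sub (hF2 g g.2).2
  have hlim : ∫ z, H z ∂γ ≤ (∫ x, (f.1 x - g.1 x) ^ 2 ∂P) / η ^ 2 := by
    refine le_of_tendsto (hconv H) (Eventually.of_forall fun n => ?_)
    have hsub : ∀ x : Fin n → 𝒳, empirical P n f.1 x - empirical P n g.1 x =
        empirical P n (fun y => f.1 y - g.1 y) x := by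
      intro x
      simp only [empirical]
      rw [integral_sub ((hF2 f f.2).2.integrable one_le_two)
        ((hF2 g g.2).2.integrable one_le_two), ← mul_sub, ← Finset.sum_sub_distrib]
      congr 1
      exact Finset.sum_congr rfl fun i _ => by ring
    have hm : ∀ x : Fin n → 𝒳, H (empiricalProcess hF n x) =
        min 1 ((empirical P n (fun y => f.1 y - g.1 y) x / η) ^ 2) := by
      intro x
      rw [hH, empiricalProcess_apply, empiricalProcess_apply, hsub]
    have hmeas : Measurable fun x : Fin n → 𝒳 =>
        min 1 ((empirical P n (fun y => f.1 y - g.1 y) x / η) ^ 2) := by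
      have := measurable_empirical (P := P) ((hF2 f f.2).1.sub (hF2 g g.2).1) n
      exact measurable_const.min ((this.div_const _).pow_const 2)
    simp_rw [hm]
    refine (outerExpectation_le_integral hmeas (fun x => le_min zero_le_one (sq_nonneg _))
      fun x => min_le_left _ _).trans ?_
    calc ∫ x, min 1 ((empirical P n (fun y => f.1 y - g.1 y) x / η) ^ 2)
          ∂(Measure.pi fun _ : Fin n => P)
        ≤ ∫ x, empirical P n (fun y => f.1 y - g.1 y) x ^ 2 / η ^ 2
          ∂(Measure.pi fun _ : Fin n => P) := by
          refine integral_mono_of_nonneg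
            (Eventually.of_forall fun x => le_min zero_le_one (sq_nonneg _))
            ((memLp_empirical hfg n).integrable_sq.div_const _)
            (Eventually.of_forall fun x => ?_)
          simpa only [div_pow] using min_le_right _ _
      _ ≤ _ := by
          rw [integral_div]
          exact div_le_div_of_nonneg_right (integral_sq_empirical_le hfg n) (by positivity)
  have hset : {z : EllInfty F | η ≤ |z f - z g|} ⊆ {z | 1 ≤ H z} := by
    intro z hz
    simp only [Set.mem_ofPred_eq] at hz ⊢
    rw [hH, le_min_iff]
    refine ⟨le_rfl, ?_⟩
    rw [one_le_sq_iff_one_le_abs, abs_div, abs_of_pos hη, le_div_iff₀ hη, one_mul]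
    exact hz
  refine (measure_mono hset).trans ?_
  rw [← ofReal_measureReal]
  refine ENNReal.ofReal_le_ofReal (le_trans ?_ hlim)
  have := mul_meas_ge_le_integral_of_nonneg (μ := γ) (f := H) (Eventually.of_forall fun z => h0 z)
    (H.integrable γ) 1
  rwa [one_mul] at this

/-- The empirical process indexed by a Donsker class is asymptotically equicontinuous. -/
theorem IsDonsker.asymptotic_equicontinuity [IsProbabilityMeasure P] {F : Set (𝒳 → ℝ)}
    (h : IsDonsker P F) {ε : ℝ} (hε : 0 < ε) :
    ∃ δ > 0, ∀ᶠ n : ℕ in atTop, ∃ E : Set (Fin n → 𝒳),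
      (Measure.pi fun _ : Fin n => P) E ≤ ENNReal.ofReal ε ∧
      ∀ x ∉ E, ∀ f ∈ F, ∀ g ∈ F, ∫ y, (f y - g y) ^ 2 ∂P ≤ δ →
        |empirical P n f x - empirical P n g x| ≤ ε := by
  obtain ⟨hF2, hF, γ, hγ, htight, hconv⟩ := h
  -- `ε' < 1` makes the good set `U` nonempty; `ε' < ε` leaves room for the strict inequality that
  -- passes from the limit to large `n`.
  set ε' : ℝ := min ε 1 / 2 with hε'
  have hε'pos : 0 < ε' := by positivity
  have hε'1 : ε' < 1 := by have := min_le_right ε 1; rw [hε']; linarith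
  have hε'ε : ε' < ε := by have := min_le_left ε 1; rw [hε']; linarith
  -- At the end the empirical process is within `3 * η` of a point `z` with `|z f - z g| < η`, so
  -- its increment is below `7 * η < ε`.
  set η : ℝ := ε / 8 with hη'
  have hη : 0 < η := by positivity
  obtain ⟨K, hK, hKγ⟩ := isTightMeasureSet_iff_exists_isCompact_measure_compl_le.1 htight
    (ENNReal.ofReal ε') (ENNReal.ofReal_pos.2 hε'pos)
  obtain ⟨t, -, htfin, hKt⟩ := hK.finite_cover_balls hη
  -- Balls of zero mass are discarded, so that the finitely many remaining masses have a positive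
  -- lower bound with which `δ` can be compared.
  set t' : Set (EllInfty F) := {z ∈ t | γ (Metric.ball z η) ≠ 0} with ht'
  have ht'fin : t'.Finite := htfin.subset fun z hz => hz.1
  set U : Set (EllInfty F) := ⋃ z ∈ t', Metric.ball z η with hU
  have hUopen : IsOpen U := isOpen_biUnion fun _ _ => Metric.isOpen_ball
  have hUγ : γ Uᶜ ≤ ENNReal.ofReal ε' := by
    have hnull : γ (⋃ z ∈ {z ∈ t | γ (Metric.ball z η) = 0}, Metric.ball z η) = 0 :=
      (measure_biUnion_null_iff (htfin.subset fun z hz => hz.1).countable).2 fun z hz => hz.2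
    have hsub : Uᶜ ⊆ Kᶜ ∪ ⋃ z ∈ {z ∈ t | γ (Metric.ball z η) = 0}, Metric.ball z η := by
      intro z hz
      by_cases hzK : z ∈ K
      · right
        obtain ⟨w, hwt, hzw⟩ := Set.mem_iUnion₂.1 (hKt hzK)
        refine Set.mem_iUnion₂.2 ⟨w, ⟨hwt, ?_⟩, hzw⟩
        by_contra hne
        exact hz (Set.mem_iUnion₂.2 ⟨w, ⟨hwt, hne⟩, hzw⟩)
      · exact Or.inl hzK
    calc γ Uᶜ ≤ γ Kᶜ + γ (⋃ z ∈ {z ∈ t | γ (Metric.ball z η) = 0}, Metric.ball z η) :=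
          (measure_mono hsub).trans (measure_union_le _ _)
      _ ≤ ENNReal.ofReal ε' := by rw [hnull, add_zero]; exact hKγ γ rfl
  have hUne : U.Nonempty := by
    by_contra hne
    rw [Set.not_nonempty_iff_eq_empty] at hne
    rw [hne, Set.compl_empty, measure_univ] at hUγ
    rw [ENNReal.one_le_ofReal] at hUγ
    linarith
  -- For such `δ` the exceptional set of `limit_increment_le` cannot fill a retained ball. So for
  -- each close pair `f`, `g` every retained ball contains a point with small increment. The point
  -- may depend on the pair, hence no supremum over pairs under `γ` has to be controlled.
  have hδ : ∀ᶠ δ : ℝ in 𝓝[>] 0, ∀ z ∈ t', ENNReal.ofReal (δ / η ^ 2) < γ (Metric.ball z η) := by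
    rw [eventually_all_finite ht'fin]
    intro z hz
    have hcont : Tendsto (fun δ : ℝ => ENNReal.ofReal (δ / η ^ 2)) (𝓝[>] 0) (𝓝 0) := by
      have : Continuous fun δ : ℝ => ENNReal.ofReal (δ / η ^ 2) :=
        ENNReal.continuous_ofReal.comp (continuous_id.div_const _)
      have h0 := this.tendsto 0
      simp only [zero_div, ENNReal.ofReal_zero] at h0
      exact h0.mono_left nhdsWithin_le_nhds
    exact hcont.eventually (gt_mem_nhds (pos_iff_ne_zero.2 hz.2))
  obtain ⟨δ, hδt, hδpos⟩ := (hδ.and self_mem_nhdsWithin).exists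
  refine ⟨δ, hδpos, ?_⟩
  have hc : Continuous fun z : EllInfty F => min 1 (Metric.infDist z U / η) :=
    continuous_const.min ((Metric.continuous_infDist_pt U).div_const _)
  have h0 : ∀ z : EllInfty F, 0 ≤ min 1 (Metric.infDist z U / η) := fun z =>
    le_min zero_le_one (div_nonneg Metric.infDist_nonneg hη.le)
  let H : EllInfty F →ᵇ ℝ := BoundedContinuousFunction.ofNormedAddCommGroup _ hc 1 fun z => by
    rw [Real.norm_of_nonneg (h0 z)]; exact min_le_left _ _
  have hH : ∀ z, H z = min 1 (Metric.infDist z U / η) := fun z => rfl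
  have hint : ∫ z, H z ∂γ ≤ ε' := by
    calc ∫ z, H z ∂γ ≤ ∫ z, Uᶜ.indicator (fun _ => (1 : ℝ)) z ∂γ := by
          refine integral_mono (H.integrable γ)
            ((integrable_const _).indicator hUopen.measurableSet.compl) fun z => ?_
          by_cases hz : z ∈ U
          · simp [hH, Metric.infDist_zero_of_mem hz, hz]
          · simp [hH, hz]
      _ = γ.real Uᶜ := by
          rw [integral_indicator_const _ hUopen.measurableSet.compl, smul_eq_mul, mul_one]
      _ ≤ ε' := ENNReal.toReal_le_of_le_ofReal hε'pos.le hUγ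
  filter_upwards [(hconv H).eventually (gt_mem_nhds (hint.trans_lt hε'ε))] with n hn
  refine ⟨_, measure_le_of_outerExpectation_lt (fun x => h0 _) (fun x => min_le_left _ _) hn, ?_⟩
  intro x hx f hf g hg hfg
  simp only [Set.mem_ofPred_eq, not_le] at hx
  set G := empiricalProcess hF n x with hG
  have hGU : Metric.infDist G U < η := by
    have : Metric.infDist G U / η < 1 := by
      by_contra hcon
      exact absurd hx (not_lt.2 (le_min le_rfl (not_lt.1 hcon)))
    rwa [div_lt_one hη] at this
  obtain ⟨u, huU, hGu⟩ := (Metric.infDist_lt_iff hUne).1 hGU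
  obtain ⟨w, hwt, huw⟩ := Set.mem_iUnion₂.1 huU
  obtain ⟨z, hzball, hz⟩ : ∃ z ∈ Metric.ball w η, |z ⟨f, hf⟩ - z ⟨g, hg⟩| < η := by
    by_contra hcon
    push Not at hcon
    have h1 : γ (Metric.ball w η) ≤ ENNReal.ofReal (δ / η ^ 2) :=
      ((measure_mono hcon).trans (limit_increment_le hF2 hF hconv ⟨f, hf⟩ ⟨g, hg⟩ hη)).trans
        (ENNReal.ofReal_le_ofReal (div_le_div_of_nonneg_right hfg (by positivity)))
    exact absurd (hδt w hwt) (not_lt.2 h1)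
  have hdist : dist G z < 3 * η := by
    have h1 := dist_triangle4 G u w z
    have h2 : dist u w < η := huw
    have h3 : dist w z < η := by rw [dist_comm]; exact hzball
    linarith
  have h1 := abs_sub_apply_le_dist G z ⟨f, hf⟩
  have h2 := abs_sub_apply_le_dist G z ⟨g, hg⟩
  have e1 : G ⟨f, hf⟩ = empirical P n f x := empiricalProcess_apply hF n x ⟨f, hf⟩
  have e2 : G ⟨g, hg⟩ = empirical P n g x := empiricalProcess_apply hF n x ⟨g, hg⟩
  rw [← e1, ← e2]
  rw [abs_le] at h1 h2 ⊢
  rw [abs_lt] at hz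
  constructor <;> linarith [h1.1, h1.2, h2.1, h2.2, hz.1, hz.2]

end EmpiricalProcess

/-! ### Calculus of convergence to zero in (outer) probability. -/

section StochasticOrder

variable {S : ℕ → Type*} [∀ n, MeasurableSpace (S n)] {μ : ∀ n, Measure (S n)}

lemma TendstoZeroInProb.of_le_add {X Y Z : ∀ n, S n → ℝ≥0∞} (hY : TendstoZeroInProb μ Y)
    (hZ : TendstoZeroInProb μ Z) (h : ∀ᶠ n in atTop, ∀ s, X n s ≤ Y n s + Z n s) :
    TendstoZeroInProb μ X := by
  intro ε hε
  have hε2 : 0 < ε / 2 := ENNReal.half_pos hε.ne'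
  have hsum := (hY _ hε2).add (hZ _ hε2)
  rw [add_zero] at hsum
  refine tendsto_of_tendsto_of_tendsto_of_le_of_le' tendsto_const_nhds hsum
    (Eventually.of_forall fun _ => zero_le) ?_
  filter_upwards [h] with n hn
  refine (measure_mono fun s hs => ?_).trans (measure_union_le _ _)
  by_contra hcon
  simp only [Set.mem_union, Set.mem_ofPred_eq, not_or, not_le] at hcon hs
  have := (hs.trans (hn s)).trans_lt (ENNReal.add_lt_add hcon.1 hcon.2)
  rw [ENNReal.add_halves] at this
  exact lt_irrefl _ this

lemma TendstoZeroInProb.add {Y Z : ∀ n, S n → ℝ≥0∞} (hY : TendstoZeroInProb μ Y)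
    (hZ : TendstoZeroInProb μ Z) : TendstoZeroInProb μ fun n s => Y n s + Z n s :=
  hY.of_le_add hZ (Eventually.of_forall fun _ _ => le_rfl)

lemma TendstoZeroInProb.const_mul {Y : ∀ n, S n → ℝ≥0∞} (hY : TendstoZeroInProb μ Y)
    {c : ℝ≥0∞} (hc : c ≠ ∞) : TendstoZeroInProb μ fun n s => c * Y n s := by
  intro ε hε
  rcases eq_or_ne c 0 with rfl | hc0
  · have : ∀ n, {s : S n | ε ≤ 0 * Y n s} = ∅ := fun n => by
      ext s; simp [hε.ne']
    simp only [this, measure_empty, tendsto_const_nhds_iff]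
  · refine (hY (ε / c) (ENNReal.div_pos hε.ne' hc)).congr fun n => ?_
    congr 1
    ext s
    simp only [Set.mem_ofPred_eq]
    rw [ENNReal.div_le_iff hc0 hc, mul_comm]

lemma TendstoZeroInProb.of_wpto {X Y : ∀ n, S n → ℝ≥0∞} {p : ∀ n, S n → Prop}
    (hp : WithProbTendingToOne μ p) (hY : TendstoZeroInProb μ Y)
    (h : ∀ᶠ n in atTop, ∀ s, p n s → X n s ≤ Y n s) : TendstoZeroInProb μ X := by
  intro ε hε
  have hsum := (hY ε hε).add hp
  rw [add_zero] at hsum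
  refine tendsto_of_tendsto_of_tendsto_of_le_of_le' tendsto_const_nhds hsum
    (Eventually.of_forall fun _ => zero_le) ?_
  filter_upwards [h] with n hn
  refine (measure_mono fun s hs => ?_).trans (measure_union_le _ _)
  by_cases hps : p n s
  · exact Or.inl (le_trans hs (hn s hps))
  · exact Or.inr hps

lemma WithProbTendingToOne.and {p q : ∀ n, S n → Prop} (hp : WithProbTendingToOne μ p)
    (hq : WithProbTendingToOne μ q) : WithProbTendingToOne μ fun n s => p n s ∧ q n s := by
  have hsum := Tendsto.add hp hq
  rw [add_zero] at hsum
  refine tendsto_of_tendsto_of_tendsto_of_le_of_le tendsto_const_nhds hsum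
    (fun _ => zero_le) fun n => ?_
  refine (measure_mono fun s hs => ?_).trans (measure_union_le _ _)
  exact not_and_or.1 hs

lemma WithProbTendingToOne.mono {p q : ∀ n, S n → Prop} (hp : WithProbTendingToOne μ p)
    (h : ∀ n s, p n s → q n s) : WithProbTendingToOne μ q :=
  tendsto_of_tendsto_of_tendsto_of_le_of_le tendsto_const_nhds hp
    (fun _ => zero_le) fun n => measure_mono fun s hs hps => hs (h n s hps)

lemma tendstoZeroInProb_of_forall_real {X : ∀ n, S n → ℝ≥0∞}
    (h : ∀ ε > (0 : ℝ), ∀ τ > (0 : ℝ), ∀ᶠ n in atTop,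
      μ n {s | ENNReal.ofReal ε ≤ X n s} ≤ ENNReal.ofReal τ) : TendstoZeroInProb μ X := by
  intro ε hε
  rw [ENNReal.tendsto_nhds_zero]
  intro τ hτ
  obtain ⟨ε', hε'0, hε'⟩ := ENNReal.lt_iff_exists_nnreal_btwn.1 hε
  obtain ⟨τ', hτ'0, hτ'⟩ := ENNReal.lt_iff_exists_nnreal_btwn.1 hτ
  filter_upwards [h ε' (by exact_mod_cast hε'0) τ' (by exact_mod_cast hτ'0)] with n hn
  rw [ENNReal.ofReal_coe_nnreal, ENNReal.ofReal_coe_nnreal] at hn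
  exact (measure_mono fun s hs => hε'.le.trans hs).trans (hn.trans hτ'.le)

lemma TendstoZeroInProb.eventually_le {X : ∀ n, S n → ℝ≥0∞} (h : TendstoZeroInProb μ X)
    {ε τ : ℝ} (hε : 0 < ε) (hτ : 0 < τ) :
    ∀ᶠ n in atTop, μ n {s | ENNReal.ofReal ε ≤ X n s} ≤ ENNReal.ofReal τ :=
  ENNReal.tendsto_nhds_zero.1 (h _ (ENNReal.ofReal_pos.2 hε)) _ (ENNReal.ofReal_pos.2 hτ)

end StochasticOrder

/-! ### Second moments, and functions built from an independent sample. -/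

section SecondMoment

variable {𝒳 : Type*} [MeasurableSpace 𝒳] {P : Measure 𝒳}

lemma eLpNorm_two_sq (f : 𝒳 → ℝ) : eLpNorm f 2 P ^ 2 = ∫⁻ x, ‖f x‖ₑ ^ 2 ∂P := by
  have := eLpNorm_nnreal_pow_eq_lintegral (μ := P) (f := f) (p := 2) two_ne_zero
  simpa using this

lemma ofReal_integral_sq {f : 𝒳 → ℝ} (hf : MemLp f 2 P) :
    ENNReal.ofReal (∫ x, f x ^ 2 ∂P) = eLpNorm f 2 P ^ 2 := by
  rw [eLpNorm_two_sq, ofReal_integral_eq_lintegral_ofReal hf.integrable_sq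
    (Eventually.of_forall fun x => sq_nonneg _)]
  refine lintegral_congr fun x => ?_
  rw [← sq_abs, ENNReal.ofReal_pow (abs_nonneg _), Real.enorm_eq_ofReal_abs]

lemma memLp_two_of_eLpNorm_sq_lt {f : 𝒳 → ℝ} (hf : AEStronglyMeasurable f P) {δ : ℝ≥0∞}
    (h : eLpNorm f 2 P ^ 2 < δ) : MemLp f 2 P :=
  ⟨hf, by
    by_contra hcon
    rw [not_lt, top_le_iff] at hcon
    rw [hcon] at h
    simp at h⟩

lemma empirical_sub {f g : 𝒳 → ℝ} (hf : Integrable f P) (hg : Integrable g P) (n : ℕ)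
    (x : Fin n → 𝒳) :
    empirical P n (fun y => f y - g y) x = empirical P n f x - empirical P n g x := by
  simp only [empirical]
  rw [integral_sub hf hg, ← mul_sub, ← Finset.sum_sub_distrib]
  congr 1
  exact Finset.sum_congr rfl fun i _ => by ring

/-- The product formula for rectangles needs no measurability, so exceptional sets that are small
only in outer measure are covered. -/
lemma sampleLaw_preimage_fst_le [IsProbabilityMeasure P] {n k : ℕ} (E : Set (Fin n → 𝒳)) :
    sampleLaw P n k {s | s.1 ∈ E} ≤ (Measure.pi fun _ : Fin n => P) E := by
  have : {s : Sample 𝒳 n k | s.1 ∈ E} = E ×ˢ Set.univ := by ext s; simp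
  rw [this, sampleLaw, Measure.prod_prod, measure_univ, mul_one]

/-- A random function built from an independent sample that is small in `L²` has a small
empirical process. -/
lemma sampleLaw_empirical_ge_le [IsProbabilityMeasure P] {n k : ℕ} {g : (Fin k → 𝒳) → 𝒳 → ℝ}
    (hg : Measurable fun p : 𝒳 × (Fin k → 𝒳) => g p.2 p.1) {ε δ : ℝ} (hε : 0 < ε) :
    sampleLaw P n k {s | eLpNorm (g s.2) 2 P ^ 2 < ENNReal.ofReal δ ∧
      ε ≤ |empirical P n (g s.2) s.1|} ≤ ENNReal.ofReal (δ / ε ^ 2) := by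
  have hg' : Measurable fun p : (Fin k → 𝒳) × 𝒳 => g p.1 p.2 := hg.comp measurable_swap
  have hgs : ∀ s, Measurable (g s) := fun s => hg'.comp measurable_prodMk_left
  have hB : MeasurableSet {s : Sample 𝒳 n k | eLpNorm (g s.2) 2 P ^ 2 < ENNReal.ofReal δ ∧
      ε ≤ |empirical P n (g s.2) s.1|} := by
    have h1 : Measurable fun s : Sample 𝒳 n k => eLpNorm (g s.2) 2 P ^ 2 := by
      simp_rw [eLpNorm_two_sq]
      have : Measurable fun s₂ : Fin k → 𝒳 => ∫⁻ x, ‖g s₂ x‖ₑ ^ 2 ∂P :=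
        Measurable.lintegral_prod_right' (f := fun p : (Fin k → 𝒳) × 𝒳 => ‖g p.1 p.2‖ₑ ^ 2)
          (hg'.enorm.pow_const 2)
      exact this.comp measurable_snd
    have h2 : Measurable fun s : Sample 𝒳 n k => empirical P n (g s.2) s.1 := by
      have hint : Measurable fun s₂ : Fin k → 𝒳 => ∫ x, g s₂ x ∂P :=
        (StronglyMeasurable.integral_prod_right (ν := P) hg'.stronglyMeasurable).measurable
      unfold empirical
      refine (Finset.measurable_sum _ fun i _ => ?_).const_mul _
      refine Measurable.sub ?_ (hint.comp measurable_snd)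
      have hi : Measurable fun s : Sample 𝒳 n k => (s.1 i, s.2) :=
        ((measurable_pi_apply i).comp measurable_fst).prodMk measurable_snd
      exact hg.comp hi
    exact (measurableSet_lt h1 measurable_const).inter
      (measurableSet_le measurable_const (continuous_abs.measurable.comp h2))
  -- Given the separate sample the function is fixed, so Chebyshev's inequality applies to each
  -- section; sections where the `L²` norm is not small are empty.
  rw [sampleLaw, Measure.prod_apply_symm hB]
  calc _ ≤ ∫⁻ _ : Fin k → 𝒳, ENNReal.ofReal (δ / ε ^ 2) ∂(Measure.pi fun _ : Fin k => P) := by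
        refine lintegral_mono fun s₂ => ?_
        by_cases hs : eLpNorm (g s₂) 2 P ^ 2 < ENNReal.ofReal δ
        · have hmem := memLp_two_of_eLpNorm_sq_lt (hgs s₂).aestronglyMeasurable hs
          refine (measure_mono fun s₁ h => ?_).trans
            ((measure_empirical_ge_le hmem n hε).trans (ENNReal.ofReal_le_ofReal ?_))
          · exact h.2
          · refine div_le_div_of_nonneg_right ?_ (by positivity)
            rw [← ofReal_integral_sq hmem] at hs
            exact ((ENNReal.ofReal_lt_ofReal_iff_of_nonneg
              (integral_nonneg fun x => sq_nonneg _)).1 hs).le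
        · have : (fun s₁ : Fin n → 𝒳 => (s₁, s₂)) ⁻¹' {s : Sample 𝒳 n k |
              eLpNorm (g s.2) 2 P ^ 2 < ENNReal.ofReal δ ∧ ε ≤ |empirical P n (g s.2) s.1|} = ∅ := by
            ext s₁
            simp [hs]
          rw [this, measure_empty]
          exact zero_le
    _ = ENNReal.ofReal (δ / ε ^ 2) := by simp

end SecondMoment

/-! ### Asymptotic linearity of plug-in estimators. -/

section AsymptoticLinearity

variable {𝒳 : Type*} [MeasurableSpace 𝒳] {P : Measure 𝒳}

/-- Under the regularity assumption, the empirical process at the plug-in estimating function is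
asymptotically equivalent to the one at the true nuisance. -/
lemma PlugInRegularity.empirical_sub_tendsto [IsProbabilityMeasure P] {H : Type*} {k : ℕ → ℕ}
    {m : 𝒳 → H → ℝ} {η₀ : H} {ηhat : ∀ n, Sample 𝒳 n (k n) → H}
    (hreg : PlugInRegularity P k m η₀ ηhat)
    (hm : ∀ n, Measurable fun p : 𝒳 × Sample 𝒳 n (k n) => m p.1 (ηhat n p.2))
    (hm₀ : Measurable fun x => m x η₀) (hm₀2 : MemLp (fun x => m x η₀) 2 P) :
    TendstoZeroInProb (fun n => sampleLaw P n (k n)) fun n s =>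
      ‖empirical P n (fun x => m x (ηhat n s)) s.1 - empirical P n (fun x => m x η₀) s.1‖ₑ := by
  have hms : ∀ n s, Measurable fun x => m x (ηhat n s) := fun n s =>
    (hm n).comp measurable_prodMk_right
  have hdiff : ∀ n s, ∀ δ : ℝ≥0∞, eLpNorm (fun x => m x (ηhat n s) - m x η₀) 2 P ^ 2 < δ →
      MemLp (fun x => m x (ηhat n s)) 2 P := by
    intro n s δ h
    have := (memLp_two_of_eLpNorm_sq_lt ((hms n s).sub hm₀).aestronglyMeasurable h).add hm₀2
    refine this.ae_eq (Eventually.of_forall fun x => ?_)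
    simp
  refine tendstoZeroInProb_of_forall_real fun ε hε τ hτ => ?_
  obtain ⟨ha, hb | ⟨F, hF, hFm⟩⟩ := hreg
  · have hτ2 : 0 < τ / 2 := by positivity
    -- Makes the Chebyshev bound `δ / ε ^ 2` equal to `τ / 2`.
    set δ := ε ^ 2 * (τ / 2) with hδ
    have hδpos : 0 < δ := by positivity
    filter_upwards [ha.eventually_le hδpos hτ2] with n hn
    rcases isEmpty_or_nonempty (Fin n → 𝒳) with hemp | ⟨⟨s₀⟩⟩
    · have : {s : Sample 𝒳 n (k n) | ENNReal.ofReal ε ≤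
          ‖empirical P n (fun x => m x (ηhat n s)) s.1 - empirical P n (fun x => m x η₀) s.1‖ₑ} = ∅ :=
        Set.eq_empty_of_forall_notMem fun s => (hemp.false s.1).elim
      rw [this, measure_empty]
      exact zero_le
    -- Under sample splitting the estimation sample can be frozen at an arbitrary `s₀`, which
    -- exhibits the estimating function as a measurable function of the separate sample alone.
    let g : (Fin (k n) → 𝒳) → 𝒳 → ℝ := fun s₂ x => m x (ηhat n (s₀, s₂)) - m x η₀
    have hgs : ∀ s : Sample 𝒳 n (k n), g s.2 = fun x => m x (ηhat n s) - m x η₀ := by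
      intro s
      simp only [g, hb n (s₀, s.2) s rfl]
    have hg : Measurable fun p : 𝒳 × (Fin (k n) → 𝒳) => g p.2 p.1 :=
      ((hm n).comp (measurable_fst.prodMk (measurable_const.prodMk measurable_snd))).sub
        (hm₀.comp measurable_fst)
    have hBle := sampleLaw_empirical_ge_le (P := P) (n := n) (δ := δ) hg hε
    have : δ / ε ^ 2 = τ / 2 := by rw [hδ]; field_simp
    rw [this] at hBle
    calc _ ≤ sampleLaw P n (k n) ({s | ENNReal.ofReal δ ≤
            eLpNorm (fun x => m x (ηhat n s) - m x η₀) 2 P ^ 2} ∪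
          {s | eLpNorm (g s.2) 2 P ^ 2 < ENNReal.ofReal δ ∧ ε ≤ |empirical P n (g s.2) s.1|}) := by
          refine measure_mono fun s hs => ?_
          by_cases hsd : ENNReal.ofReal δ ≤ eLpNorm (fun x => m x (ηhat n s) - m x η₀) 2 P ^ 2
          · exact Or.inl hsd
          · right
            rw [not_le] at hsd
            refine ⟨by rw [hgs s]; exact hsd, ?_⟩
            rw [hgs s, empirical_sub ((hdiff n s _ hsd).integrable one_le_two)
              (hm₀2.integrable one_le_two)]
            simp only [Set.mem_ofPred_eq] at hs
            rw [Real.enorm_eq_ofReal_abs] at hs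
            exact (ENNReal.ofReal_le_ofReal_iff (abs_nonneg _)).1 hs
      _ ≤ ENNReal.ofReal (τ / 2) + ENNReal.ofReal (τ / 2) :=
          (measure_union_le _ _).trans (add_le_add hn hBle)
      _ = ENNReal.ofReal τ := by
          rw [← ENNReal.ofReal_add hτ2.le hτ2.le, add_halves]
  · have hτ4 : 0 < τ / 4 := by positivity
    set ε' := min (ε / 2) (τ / 4) with hε'
    have hε'pos : 0 < ε' := by positivity
    obtain ⟨δ, hδpos, hδ⟩ := hF.asymptotic_equicontinuity hε'pos
    -- Equicontinuity compares members of `F` only, and `m(·, η₀)` need not be one. A fixed `f ∈ F`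
    -- near it serves as intermediary: `δ / 4` makes `m(·, ηhat)` and `f` close enough, by `(x - y)²
    -- ≤ 2x² + 2y²`, and the other entry is the Chebyshev budget for `f - m(·, η₀)`.
    set δ' := min (δ / 4) ((ε / 2) ^ 2 * (τ / 4)) with hδ'
    have hδ'pos : 0 < δ' := by positivity
    by_cases hf₀ : ∃ f ∈ F, eLpNorm (fun x => f x - m x η₀) 2 P ^ 2 < ENNReal.ofReal δ'
    · obtain ⟨f, hfF, hf⟩ := hf₀
      have hf2 := (hF.1 f hfF).2
      have hfm : MemLp (fun x => f x - m x η₀) 2 P := hf2.sub hm₀2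
      have hfint : ∫ x, (f x - m x η₀) ^ 2 ∂P < δ' := by
        rw [← ofReal_integral_sq hfm] at hf
        exact (ENNReal.ofReal_lt_ofReal_iff_of_nonneg (integral_nonneg fun x => sq_nonneg _)).1 hf
      filter_upwards [hδ, ha.eventually_le hδ'pos hτ4,
        ENNReal.tendsto_nhds_zero.1 hFm _ (ENNReal.ofReal_pos.2 hτ4)] with n ⟨E, hE, hEx⟩ hn hFn
      have h1 : sampleLaw P n (k n) {s | s.1 ∈ E} ≤ ENNReal.ofReal (τ / 4) :=
        (sampleLaw_preimage_fst_le E).trans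
          (hE.trans (ENNReal.ofReal_le_ofReal (min_le_right _ _)))
      have h2 : sampleLaw P n (k n) {s | s.1 ∈ {x | ε / 2 ≤
          |empirical P n (fun y => f y - m y η₀) x|}} ≤ ENNReal.ofReal (τ / 4) := by
        refine (sampleLaw_preimage_fst_le _).trans ((measure_empirical_ge_le hfm n
          (half_pos hε)).trans (ENNReal.ofReal_le_ofReal ?_))
        rw [div_le_iff₀ (by positivity), mul_comm]
        exact hfint.le.trans (min_le_right _ _)
      calc _ ≤ sampleLaw P n (k n) (({s | ENNReal.ofReal δ' ≤
              eLpNorm (fun x => m x (ηhat n s) - m x η₀) 2 P ^ 2} ∪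
            {s | ¬ (fun x => m x (ηhat n s)) ∈ F}) ∪ ({s | s.1 ∈ E} ∪
            {s | s.1 ∈ {x | ε / 2 ≤ |empirical P n (fun y => f y - m y η₀) x|}})) := by
            refine measure_mono fun s hs => ?_
            by_contra hcon
            simp only [Set.mem_union, Set.mem_ofPred_eq, not_or, not_le, not_not] at hcon hs
            obtain ⟨⟨c1, c2⟩, c3, c4⟩ := hcon
            have hmem := hdiff n s _ c1
            have hmem' : MemLp (fun x => m x (ηhat n s) - m x η₀) 2 P := hmem.sub hm₀2
            have c1' : ∫ x, (m x (ηhat n s) - m x η₀) ^ 2 ∂P < δ' := by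
              rw [← ofReal_integral_sq hmem'] at c1
              exact (ENNReal.ofReal_lt_ofReal_iff_of_nonneg
                (integral_nonneg fun x => sq_nonneg _)).1 c1
            have hd : ∫ y, (m y (ηhat n s) - f y) ^ 2 ∂P ≤ δ := by
              calc ∫ y, (m y (ηhat n s) - f y) ^ 2 ∂P
                  ≤ ∫ y, (2 * (m y (ηhat n s) - m y η₀) ^ 2 + 2 * (f y - m y η₀) ^ 2) ∂P := by
                    refine integral_mono (hmem.sub hf2).integrable_sq
                      ((hmem'.integrable_sq.const_mul 2).add (hfm.integrable_sq.const_mul 2))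
                      fun y => ?_
                    beta_reduce
                    nlinarith [sq_nonneg ((m y (ηhat n s) - m y η₀) + (f y - m y η₀))]
                _ = 2 * ∫ y, (m y (ηhat n s) - m y η₀) ^ 2 ∂P
                    + 2 * ∫ y, (f y - m y η₀) ^ 2 ∂P := by
                    rw [integral_add (hmem'.integrable_sq.const_mul 2)
                      (hfm.integrable_sq.const_mul 2), integral_const_mul, integral_const_mul]
                _ ≤ δ := by
                    have := min_le_left (δ / 4) ((ε / 2) ^ 2 * (τ / 4))
                    rw [← hδ'] at this
                    linarith
            have e1 := hEx s.1 c3 _ c2 f hfF hd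
            rw [empirical_sub (hf2.integrable one_le_two) (hm₀2.integrable one_le_two)] at c4
            have e2 : ε' ≤ ε / 2 := min_le_left _ _
            rw [Real.enorm_eq_ofReal_abs, ENNReal.ofReal_le_ofReal_iff (abs_nonneg _)] at hs
            have := abs_sub_le (empirical P n (fun x => m x (ηhat n s)) s.1) (empirical P n f s.1)
              (empirical P n (fun x => m x η₀) s.1)
            linarith
        _ ≤ (ENNReal.ofReal (τ / 4) + ENNReal.ofReal (τ / 4)) +
            (ENNReal.ofReal (τ / 4) + ENNReal.ofReal (τ / 4)) := by
            refine (measure_union_le _ _).trans (add_le_add ?_ ?_)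
            · exact (measure_union_le _ _).trans (add_le_add hn hFn)
            · exact (measure_union_le _ _).trans (add_le_add h1 h2)
        _ = ENNReal.ofReal τ := by
            rw [← ENNReal.ofReal_add hτ4.le hτ4.le, ← ENNReal.ofReal_add (by positivity)
              (by positivity)]
            congr 1
            ring
    -- Without such an `f`, membership in `F` and closeness to `m(·, η₀)` exclude each other, so the
    -- failures of these two properties cover the whole sample space, which then has small measure.
    · push Not at hf₀
      filter_upwards [ha.eventually_le hδ'pos hτ4,
        ENNReal.tendsto_nhds_zero.1 hFm _ (ENNReal.ofReal_pos.2 hτ4)] with n hn hFn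
      calc _ ≤ sampleLaw P n (k n) ({s | ENNReal.ofReal δ' ≤
              eLpNorm (fun x => m x (ηhat n s) - m x η₀) 2 P ^ 2} ∪
            {s | ¬ (fun x => m x (ηhat n s)) ∈ F}) := by
            refine measure_mono fun s _ => ?_
            by_cases hs : (fun x => m x (ηhat n s)) ∈ F
            · exact Or.inl (hf₀ _ hs)
            · exact Or.inr hs
        _ ≤ ENNReal.ofReal (τ / 4) + ENNReal.ofReal (τ / 4) :=
            (measure_union_le _ _).trans (add_le_add hn hFn)
        _ ≤ ENNReal.ofReal τ := by
            rw [← ENNReal.ofReal_add hτ4.le hτ4.le]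
            exact ENNReal.ofReal_le_ofReal (by linarith)

/-- A plug-in estimator with negligible bias is asymptotically linear. -/
theorem isAsymptoticallyLinear_of_plugIn [IsProbabilityMeasure P] {H : Type*} {k : ℕ → ℕ}
    {m : 𝒳 → H → ℝ} {η₀ : H} {ηhat : ∀ n, Sample 𝒳 n (k n) → H} {θ : ℝ}
    {est : ∀ n, Sample 𝒳 n (k n) → ℝ}
    (hreg : PlugInRegularity P k m η₀ ηhat)
    (hm : ∀ n, Measurable fun p : 𝒳 × Sample 𝒳 n (k n) => m p.1 (ηhat n p.2))
    (hm₀ : Measurable fun x => m x η₀) (hm₀2 : MemLp (fun x => m x η₀) 2 P)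
    (hmean : ∫ x, m x η₀ ∂P = θ)
    (hbias : TendstoZeroInProb (fun n => sampleLaw P n (k n)) fun n s =>
      ENNReal.ofReal (√n) * ‖∫ x, m x (ηhat n s) ∂P - θ‖ₑ)
    (hest : ∀ n (s : Sample 𝒳 n (k n)), 0 < n →
      est n s = (1 / (n : ℝ)) * ∑ i, m (s.1 i) (ηhat n s)) :
    IsAsymptoticallyLinear P θ k est (fun x => m x η₀ - θ) where
  memLp := hm₀2.sub (memLp_const θ)
  mean_zero := by
    rw [integral_sub (hm₀2.integrable one_le_two) (integrable_const _), hmean]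
    simp
  expansion := by
    refine (hreg.empirical_sub_tendsto hm hm₀ hm₀2).of_le_add hbias ?_
    filter_upwards [eventually_gt_atTop 0] with n hn s
    have hsq : √(n : ℝ) * √n = n := Real.mul_self_sqrt (Nat.cast_nonneg n)
    have hne : √(n : ℝ) ≠ 0 := (Real.sqrt_pos.2 (Nat.cast_pos.2 hn)).ne'
    -- The increment of the empirical process plus `√n` times the bias.
    have hkey : √(n : ℝ) * (est n s - θ) - (√(n : ℝ))⁻¹ * ∑ i, (m (s.1 i) η₀ - θ) =
        (empirical P n (fun x => m x (ηhat n s)) s.1 - empirical P n (fun x => m x η₀) s.1) +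
          √n * (∫ x, m x (ηhat n s) ∂P - θ) := by
      rw [hest n s hn]
      simp only [empirical, Finset.sum_sub_distrib, Finset.sum_const, Finset.card_univ,
        Fintype.card_fin, nsmul_eq_mul, hmean]
      field_simp
      rw [Real.sq_sqrt (Nat.cast_nonneg n)]
      ring
    rw [hkey]
    refine (enorm_add_le _ _).trans (add_le_add le_rfl ?_)
    rw [enorm_mul, Real.enorm_eq_ofReal (Real.sqrt_nonneg _)]

end AsymptoticLinearity

/-! ### Cauchy–Schwarz bounds and truncation in `L²`. -/

section CauchySchwarz

variable {𝒳 : Type*} [MeasurableSpace 𝒳] {ν : Measure 𝒳}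

lemma abs_integral_mul_le_sqrt {f g : 𝒳 → ℝ} (hf : MemLp f 2 ν) (hg : MemLp g 2 ν) :
    |∫ x, f x * g x ∂ν| ≤ √(∫ x, f x ^ 2 ∂ν) * √(∫ x, g x ^ 2 ∂ν) := by
  have h := integral_mul_norm_le_Lp_mul_Lq (μ := ν) (f := f) (g := g) (p := 2) (q := 2)
    (by constructor <;> norm_num) (by simpa using hf) (by simpa using hg)
  simp only [Real.rpow_ofNat, Real.norm_eq_abs, sq_abs] at h
  rw [← Real.sqrt_eq_rpow, ← Real.sqrt_eq_rpow] at h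
  refine (abs_integral_le_integral_abs).trans ?_
  simpa only [abs_mul] using h

lemma abs_integral_mul_le_of_sq_le {f g : 𝒳 → ℝ} (hf : MemLp f 2 ν) (hg : MemLp g 2 ν)
    {a b : ℝ} (ha : 0 ≤ a) (hb : 0 ≤ b) (hfa : ∫ x, f x ^ 2 ∂ν ≤ a ^ 2)
    (hgb : ∫ x, g x ^ 2 ∂ν ≤ b ^ 2) : |∫ x, f x * g x ∂ν| ≤ a * b :=
  (abs_integral_mul_le_sqrt hf hg).trans
    (mul_le_mul ((Real.sqrt_le_left ha).2 hfa) ((Real.sqrt_le_left hb).2 hgb)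
      (Real.sqrt_nonneg _) ha)

/-- A square-integrable function has small squared integral beyond a truncation level. -/
lemma exists_tail_sq_le {f : 𝒳 → ℝ} (hfm : Measurable f) (hf : MemLp f 2 ν) {ε : ℝ} (hε : 0 < ε) :
    ∃ K > 0, ∫ x, ({y | K < |f y|}.indicator f x) ^ 2 ∂ν ≤ ε ^ 2 := by
  have hlim : Tendsto (fun n : ℕ => ∫ x, ({y | (n : ℝ) < |f y|}.indicator f x) ^ 2 ∂ν) atTop
      (𝓝 (∫ x, (0 : ℝ) ∂ν)) := by
    refine tendsto_integral_of_dominated_convergence (fun x => f x ^ 2) (fun n => ?_)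
      hf.integrable_sq (fun n => Eventually.of_forall fun x => ?_)
      (Eventually.of_forall fun x => ?_)
    · exact ((hfm.indicator (measurableSet_lt measurable_const
        (continuous_abs.measurable.comp hfm))).pow_const 2).aestronglyMeasurable
    · by_cases hx : (n : ℝ) < |f x|
      · simp [Set.indicator, hx]
      · simp [Set.indicator, hx, sq_nonneg]
    · obtain ⟨N, hN⟩ := exists_nat_ge |f x|
      refine tendsto_const_nhds.congr' ?_
      filter_upwards [eventually_ge_atTop N] with n hn
      have : ¬ (n : ℝ) < |f x| := not_lt.2 (hN.trans (by exact_mod_cast hn))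
      simp [Set.indicator, this]
  rw [integral_zero] at hlim
  obtain ⟨n, hn, hn0⟩ := ((hlim.eventually (gt_mem_nhds (sq_pos_of_pos hε))).and
    (eventually_gt_atTop 0)).exists
  exact ⟨n, by exact_mod_cast hn0, hn.le⟩

end CauchySchwarz

/-! ### Square roots of densities as elements of `L²`. -/

section RootDensity

variable {𝒳 : Type*} [MeasurableSpace 𝒳]

/-- The square root of the density of `μ` with respect to `ν`. -/
noncomputable def rootDensity (μ ν : Measure 𝒳) (x : 𝒳) : ℝ := √(μ.rnDeriv ν x).toReal

variable {μ ν : Measure 𝒳}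

lemma measurable_rootDensity : Measurable (rootDensity μ ν) :=
  (Measure.measurable_rnDeriv μ ν).ennreal_toReal.sqrt

lemma rootDensity_nonneg (x : 𝒳) : 0 ≤ rootDensity μ ν x := Real.sqrt_nonneg _

lemma rootDensity_sq (x : 𝒳) : rootDensity μ ν x ^ 2 = (μ.rnDeriv ν x).toReal :=
  Real.sq_sqrt ENNReal.toReal_nonneg

variable [IsFiniteMeasure μ] [SigmaFinite ν]

lemma integral_mul_rootDensity_sq (h : μ ≪ ν) (f : 𝒳 → ℝ) :
    ∫ x, f x * rootDensity μ ν x ^ 2 ∂ν = ∫ x, f x ∂μ := by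
  rw [← integral_rnDeriv_smul h]
  refine integral_congr_ae (Eventually.of_forall fun x => ?_)
  simp only [rootDensity_sq, smul_eq_mul, mul_comm]

lemma integrable_mul_rootDensity_sq (h : μ ≪ ν) {f : 𝒳 → ℝ} (hf : Integrable f μ) :
    Integrable (fun x => f x * rootDensity μ ν x ^ 2) ν := by
  refine ((integrable_rnDeriv_smul_iff h).2 hf).congr (Eventually.of_forall fun x => ?_)
  simp only [rootDensity_sq, smul_eq_mul, mul_comm]

lemma memLp_mul_rootDensity (h : μ ≪ ν) {f : 𝒳 → ℝ} (hfm : Measurable f) (hf : MemLp f 2 μ) :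
    MemLp (fun x => f x * rootDensity μ ν x) 2 ν := by
  have hm : AEStronglyMeasurable (fun x => f x * rootDensity μ ν x) ν :=
    (hfm.mul measurable_rootDensity).aestronglyMeasurable
  rw [memLp_two_iff_integrable_sq hm]
  simpa only [mul_pow] using integrable_mul_rootDensity_sq h hf.integrable_sq

lemma memLp_rootDensity (h : μ ≪ ν) : MemLp (rootDensity μ ν) 2 ν := by
  simpa using memLp_mul_rootDensity h measurable_const (memLp_const (1 : ℝ))

lemma integral_sq_mul_rootDensity (h : μ ≪ ν) (f : 𝒳 → ℝ) :
    ∫ x, (f x * rootDensity μ ν x) ^ 2 ∂ν = ∫ x, f x ^ 2 ∂μ := by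
  simpa only [mul_pow] using integral_mul_rootDensity_sq h fun x => f x ^ 2

lemma lintegral_mul_rootDensity_sq (h : μ ≪ ν) {f : 𝒳 → ℝ≥0∞} (hf : Measurable f) :
    ∫⁻ x, f x * ENNReal.ofReal (rootDensity μ ν x ^ 2) ∂ν = ∫⁻ x, f x ∂μ := by
  rw [← lintegral_rnDeriv_mul h hf.aemeasurable]
  refine lintegral_congr_ae ?_
  filter_upwards [Measure.rnDeriv_lt_top μ ν] with x hx
  rw [rootDensity_sq, ENNReal.ofReal_toReal hx.ne, mul_comm]

end RootDensity

/-! ### Submodels differentiable in quadratic mean. -/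

section QuadraticMean

variable {𝒳 : Type*} [MeasurableSpace 𝒳]

/-- A dominated family of probability measures through `P`, differentiable in quadratic mean at
`0` with measurable score `ℓ`. -/
structure QMD (P : Measure 𝒳) {d : ℕ} (Pα : EuclideanSpace ℝ (Fin d) → Measure 𝒳)
    (ν : Measure 𝒳) (ℓ : 𝒳 → EuclideanSpace ℝ (Fin d)) : Prop where
  sigmaFinite : SigmaFinite ν
  law_zero : Pα 0 = P
  isProbabilityMeasure : ∀ᶠ α in 𝓝 0, IsProbabilityMeasure (Pα α)
  ac : ∀ᶠ α in 𝓝 0, Pα α ≪ ν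
  measurable_score : Measurable ℓ
  memLp_score : MemLp ℓ 2 P
  remainder : (fun α => ∫ x, (rootDensity (Pα α) ν x - rootDensity P ν x
      - 1 / 2 * inner ℝ α (ℓ x) * rootDensity P ν x) ^ 2 ∂ν) =o[𝓝 0] fun α => ‖α‖ ^ 2

/-- The given score is only almost everywhere measurable under `P`, so it is replaced by a
measurable version. The two can differ, outside a `ν`-null set, only where the density of `P`
vanishes, and there the score is multiplied by a zero root density, so the remainder does not
change. -/
lemma IsRegularSubmodel.exists_qmd {𝓜 : Set (Measure 𝒳 × ℝ)} {P : Measure 𝒳} {θ : ℝ} {d : ℕ}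
    {Pα : EuclideanSpace ℝ (Fin d) → Measure 𝒳} {θα : EuclideanSpace ℝ (Fin d) → ℝ}
    (h : IsRegularSubmodel 𝓜 P θ d Pα θα) (h𝓜 : ∀ q ∈ 𝓜, IsProbabilityMeasure q.1) :
    ∃ ν ℓ, QMD P Pα ν ℓ := by
  obtain ⟨ν, hν, hac, ℓ, hℓ, hrem⟩ := h.quadratic_mean
  have hℓm := hℓ.aestronglyMeasurable
  have hprob : ∀ᶠ α in 𝓝 0, IsProbabilityMeasure (Pα α) := by
    filter_upwards [h.mem_model] with α hα using h𝓜 _ hα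
  have hP : IsProbabilityMeasure P := h.law_zero ▸ hprob.self_of_nhds
  have hPν : P ≪ ν := h.law_zero ▸ hac.self_of_nhds
  have hae : ∀ᵐ x ∂ν, P.rnDeriv ν x ≠ 0 → ℓ x = hℓm.mk ℓ x := by
    rw [← ae_withDensity_iff (Measure.measurable_rnDeriv P ν), Measure.withDensity_rnDeriv_eq P ν hPν]
    exact hℓm.ae_eq_mk
  refine ⟨ν, hℓm.mk ℓ, hν, h.law_zero, hprob, hac, hℓm.stronglyMeasurable_mk.measurable,
    (memLp_congr_ae hℓm.ae_eq_mk).1 hℓ, hrem.congr (fun α => ?_) fun _ => rfl⟩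
  rw [h.law_zero]
  refine integral_congr_ae ?_
  filter_upwards [hae] with x hx
  by_cases h0 : P.rnDeriv ν x = 0
  · simp [rootDensity, h0]
  · rw [hx h0]
    rfl

variable {P : Measure 𝒳} {d : ℕ} {Pα : EuclideanSpace ℝ (Fin d) → Measure 𝒳} {ν : Measure 𝒳}
  {ℓ : 𝒳 → EuclideanSpace ℝ (Fin d)}

/-- The remainder in the expansion of the root density. -/
noncomputable def qmdRemainder (P : Measure 𝒳) (Pα : EuclideanSpace ℝ (Fin d) → Measure 𝒳) (ν : Measure 𝒳)
    (ℓ : 𝒳 → EuclideanSpace ℝ (Fin d)) (α : EuclideanSpace ℝ (Fin d)) (x : 𝒳) : ℝ :=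
  rootDensity (Pα α) ν x - rootDensity P ν x - 1 / 2 * inner ℝ α (ℓ x) * rootDensity P ν x

namespace QMD

lemma isProbabilityMeasure_zero (h : QMD P Pα ν ℓ) : IsProbabilityMeasure P :=
  h.law_zero ▸ h.isProbabilityMeasure.self_of_nhds

lemma ac_zero (h : QMD P Pα ν ℓ) : P ≪ ν := h.law_zero ▸ h.ac.self_of_nhds

lemma eventually_remainder_le (h : QMD P Pα ν ℓ) {ε : ℝ} (hε : 0 < ε) :
    ∀ᶠ α in 𝓝 0, ∫ x, qmdRemainder P Pα ν ℓ α x ^ 2 ∂ν ≤ (ε * ‖α‖) ^ 2 := by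
  filter_upwards [h.remainder.def (sq_pos_of_pos hε)] with α hα
  rw [Real.norm_of_nonneg (integral_nonneg fun x => sq_nonneg _),
    Real.norm_of_nonneg (by positivity), ← mul_pow] at hα
  exact hα

lemma measurable_inner_score (h : QMD P Pα ν ℓ) (α : EuclideanSpace ℝ (Fin d)) :
    Measurable fun x => inner ℝ α (ℓ x) :=
  measurable_const.inner h.measurable_score

lemma memLp_inner_score (h : QMD P Pα ν ℓ) (α : EuclideanSpace ℝ (Fin d)) :
    MemLp (fun x => inner ℝ α (ℓ x)) 2 P :=
  h.memLp_score.const_inner α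

lemma memLp_norm_score (h : QMD P Pα ν ℓ) : MemLp (fun x => ‖ℓ x‖) 2 P := h.memLp_score.norm

lemma memLp_remainder (h : QMD P Pα ν ℓ) {α : EuclideanSpace ℝ (Fin d)}
    (hprob : IsProbabilityMeasure (Pα α)) (hac : Pα α ≪ ν) :
    MemLp (qmdRemainder P Pα ν ℓ α) 2 ν := by
  have := h.sigmaFinite
  have := h.isProbabilityMeasure_zero
  refine ((memLp_rootDensity hac).sub (memLp_rootDensity h.ac_zero)).sub ?_
  have := (memLp_mul_rootDensity h.ac_zero (h.measurable_inner_score α)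
    (h.memLp_inner_score α)).const_mul (1 / 2)
  simpa only [mul_assoc] using this

/-- Squared integral of the score beyond a truncation level. -/
lemma exists_score_tail_le (h : QMD P Pα ν ℓ) {ε : ℝ} (hε : 0 < ε) :
    ∃ K > 0, ∫ x, ({y | K < ‖ℓ y‖}.indicator (fun y => ‖ℓ y‖) x) ^ 2 ∂P ≤ ε ^ 2 := by
  simpa only [abs_norm] using exists_tail_sq_le h.measurable_score.norm h.memLp_norm_score hε

/-- The Hellinger distance along a differentiable submodel is of order `‖α‖`. -/
lemma exists_hellinger_le (h : QMD P Pα ν ℓ) :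
    ∃ C > 0, ∀ᶠ α in 𝓝 0,
      ∫ x, (rootDensity (Pα α) ν x - rootDensity P ν x) ^ 2 ∂ν ≤ (C * ‖α‖) ^ 2 := by
  have := h.sigmaFinite
  have := h.isProbabilityMeasure_zero
  set T := ∫ x, ‖ℓ x‖ ^ 2 ∂P with hT
  have hT0 : 0 ≤ T := integral_nonneg fun x => sq_nonneg _
  -- The increment of the root density is `½ ⟨α, ℓ⟩ u₀` plus the remainder. Its square is at most
  -- twice the sum of the squares: at most `T ‖α‖²` from the score, after a wasteful rounding, and
  -- `2 ‖α‖²` from the remainder bound with `ε = 1`.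
  refine ⟨√(T + 2), Real.sqrt_pos.2 (by linarith), ?_⟩
  filter_upwards [h.eventually_remainder_le one_pos, h.isProbabilityMeasure, h.ac]
    with α hr hprob hac
  have hrm := h.memLp_remainder hprob hac
  have hs := memLp_mul_rootDensity h.ac_zero h.measurable_score.norm h.memLp_norm_score
  calc ∫ x, (rootDensity (Pα α) ν x - rootDensity P ν x) ^ 2 ∂ν
      ≤ ∫ x, (‖α‖ ^ 2 * (‖ℓ x‖ * rootDensity P ν x) ^ 2
          + 2 * qmdRemainder P Pα ν ℓ α x ^ 2) ∂ν := by
        refine integral_mono ((memLp_rootDensity hac).sub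
          (memLp_rootDensity h.ac_zero)).integrable_sq
          ((hs.integrable_sq.const_mul _).add (hrm.integrable_sq.const_mul _)) fun x => ?_
        beta_reduce
        have e : rootDensity (Pα α) ν x - rootDensity P ν x = 1 / 2 * inner ℝ α (ℓ x) *
          rootDensity P ν x + qmdRemainder P Pα ν ℓ α x := by simp only [qmdRemainder]; ring
        have hi : (inner ℝ α (ℓ x)) ^ 2 ≤ (‖α‖ * ‖ℓ x‖) ^ 2 := by
          rw [sq_le_sq, abs_of_nonneg (by positivity : 0 ≤ ‖α‖ * ‖ℓ x‖)]
          exact abs_real_inner_le_norm _ _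
        have hi2 := mul_le_mul_of_nonneg_right hi (sq_nonneg (rootDensity P ν x))
        rw [e]
        nlinarith [sq_nonneg (1 / 2 * inner ℝ α (ℓ x) * rootDensity P ν x
          - qmdRemainder P Pα ν ℓ α x), sq_nonneg (inner ℝ α (ℓ x) * rootDensity P ν x)]
    _ = ‖α‖ ^ 2 * T + 2 * ∫ x, qmdRemainder P Pα ν ℓ α x ^ 2 ∂ν := by
        rw [integral_add (hs.integrable_sq.const_mul _) (hrm.integrable_sq.const_mul _),
          integral_const_mul, integral_const_mul, integral_sq_mul_rootDensity h.ac_zero]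
    _ ≤ (√(T + 2) * ‖α‖) ^ 2 := by
        rw [mul_pow, Real.sq_sqrt (by linarith)]
        rw [one_mul] at hr
        linarith

/-- Differentiability of expectations along the submodel, uniformly over functions bounded in
`L²`. -/
theorem expectation_expansion (h : QMD P Pα ν ℓ) {ε : ℝ} (hε : 0 < ε) :
    ∀ᶠ α in 𝓝 0, ∀ (f : 𝒳 → ℝ) (B : ℝ), 0 ≤ B → Measurable f → MemLp f 2 (Pα α) → MemLp f 2 P →
      ∫ x, f x ^ 2 ∂(Pα α) ≤ B ^ 2 → ∫ x, f x ^ 2 ∂P ≤ B ^ 2 →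
      |∫ x, f x ∂(Pα α) - ∫ x, f x ∂P - ∫ x, f x * inner ℝ α (ℓ x) ∂P| ≤ ε * B * ‖α‖ := by
  have := h.sigmaFinite
  have := h.isProbabilityMeasure_zero
  obtain ⟨K, hK, hKt⟩ := h.exists_score_tail_le (ε := ε / 4) (by positivity)
  obtain ⟨C, hC, hH⟩ := h.exists_hellinger_le
  have hsmall : ∀ᶠ α : EuclideanSpace ℝ (Fin d) in 𝓝 0, K * (C * ‖α‖) ≤ ε / 4 := by
    have : Tendsto (fun α : EuclideanSpace ℝ (Fin d) => K * (C * ‖α‖)) (𝓝 0) (𝓝 0) := by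
      have := ((continuous_norm (E := EuclideanSpace ℝ (Fin d))).const_mul C).const_mul K
      simpa using this.tendsto 0
    exact (this.eventually (gt_mem_nhds (by positivity))).mono fun α hα => hα.le
  filter_upwards [hH, hsmall, h.eventually_remainder_le (ε := ε / 8) (by positivity),
    h.isProbabilityMeasure, h.ac] with α hHα hα hr hprob hac f B hB hfm hfα hf hfαB hfB
  set u := rootDensity (Pα α) ν with hu
  set u₀ := rootDensity P ν with hu₀
  set r := qmdRemainder P Pα ν ℓ α with hr'
  have hrm : MemLp r 2 ν := h.memLp_remainder hprob hac
  have hfu : MemLp (fun x => f x * u x) 2 ν := memLp_mul_rootDensity hac hfm hfα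
  have hfu₀ : MemLp (fun x => f x * u₀ x) 2 ν := memLp_mul_rootDensity h.ac_zero hfm hf
  have hfuB : ∫ x, (f x * u x) ^ 2 ∂ν ≤ B ^ 2 := by
    rw [hu, integral_sq_mul_rootDensity hac]; exact hfαB
  have hfu₀B : ∫ x, (f x * u₀ x) ^ 2 ∂ν ≤ B ^ 2 := by
    rw [hu₀, integral_sq_mul_rootDensity h.ac_zero]; exact hfB
  have hd : MemLp (fun x => u x - u₀ x) 2 ν :=
    (memLp_rootDensity hac).sub (memLp_rootDensity h.ac_zero)
  have hfd : MemLp (fun x => f x * (u x - u₀ x)) 2 ν := by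
    refine (hfu.sub hfu₀).ae_eq (Eventually.of_forall fun x => ?_)
    simp only [Pi.sub_apply, mul_sub]
  set A : Set 𝒳 := {y | K < ‖ℓ y‖} with hA
  have hAm : MeasurableSet A := measurableSet_lt measurable_const h.measurable_score.norm
  set s : 𝒳 → ℝ := fun x => inner ℝ α (ℓ x) with hs
  have hsm : Measurable s := h.measurable_inner_score α
  have hsA : MemLp (fun x => A.indicator s x * u₀ x) 2 ν :=
    memLp_mul_rootDensity h.ac_zero (hsm.indicator hAm) ((h.memLp_inner_score α).indicator hAm)
  have hsAbd : ∀ x, |Aᶜ.indicator s x| ≤ ‖α‖ * K := by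
    intro x
    by_cases hx : x ∈ A
    · simp only [Set.indicator, Set.mem_compl_iff, hx, not_true, if_false, abs_zero]
      positivity
    · simp only [Set.indicator, Set.mem_compl_iff, hx, not_false_iff, if_true]
      exact (abs_real_inner_le_norm _ _).trans
        (mul_le_mul_of_nonneg_left (not_lt.1 hx) (norm_nonneg _))
  have hsAc : MemLp (fun x => Aᶜ.indicator s x * (u x - u₀ x)) 2 ν := by
    refine (hd.const_mul (‖α‖ * K)).mono
      (((hsm.indicator hAm.compl).aestronglyMeasurable).mul hd.aestronglyMeasurable)
      (Eventually.of_forall fun x => ?_)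
    rw [norm_mul, norm_mul, Real.norm_eq_abs (Aᶜ.indicator s x)]
    exact mul_le_mul_of_nonneg_right ((hsAbd x).trans (Real.le_norm_self _)) (norm_nonneg _)
  have i1 : Integrable (fun x => (f x * u x) * r x) ν := hfu.integrable_mul hrm
  have i2 : Integrable (fun x => (f x * u₀ x) * r x) ν := hfu₀.integrable_mul hrm
  have i3 : Integrable (fun x => (f x * (u x - u₀ x)) * (A.indicator s x * u₀ x)) ν :=
    hfd.integrable_mul hsA
  have i4 : Integrable (fun x => (f x * u₀ x) * (Aᶜ.indicator s x * (u x - u₀ x))) ν :=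
    hfu₀.integrable_mul hsAc
  have i5 : Integrable (fun x => (f x * u x) * r x + (f x * u₀ x) * r x) ν := i1.add i2
  have i6 : Integrable (fun x => 1 / 2 * ((f x * (u x - u₀ x)) * (A.indicator s x * u₀ x) +
      (f x * u₀ x) * (Aᶜ.indicator s x * (u x - u₀ x)))) ν := (i3.add i4).const_mul _
  -- From `u² - u₀² = (u + u₀)(u - u₀)` and `u - u₀ = ½ s u₀ + r`, the error is `∫ f (u + u₀) r + ½
  -- ∫ f (u - u₀) s u₀`. In the last integral the score is cut at level `K`: its tail is small in
  -- `L²(P)`, and its bounded part is paired with `u - u₀`, itself of order `‖α‖`. Only second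
  -- moments of `f` enter, whence the uniformity in `f`.
  have hdecomp : ∫ x, f x ∂(Pα α) - ∫ x, f x ∂P - ∫ x, f x * s x ∂P =
      (∫ x, (f x * u x) * r x ∂ν + ∫ x, (f x * u₀ x) * r x ∂ν) +
      1 / 2 * (∫ x, (f x * (u x - u₀ x)) * (A.indicator s x * u₀ x) ∂ν +
        ∫ x, (f x * u₀ x) * (Aᶜ.indicator s x * (u x - u₀ x)) ∂ν) := by
    rw [← integral_mul_rootDensity_sq hac, ← integral_mul_rootDensity_sq h.ac_zero f,
      ← integral_mul_rootDensity_sq h.ac_zero fun x => f x * s x,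
      ← integral_sub (integrable_mul_rootDensity_sq hac (hfα.integrable one_le_two))
        (integrable_mul_rootDensity_sq h.ac_zero (hf.integrable one_le_two)), ← integral_sub,
      ← integral_add i1 i2, ← integral_add i3 i4, ← integral_const_mul,
      ← integral_add i5 i6]
    · refine integral_congr_ae (Eventually.of_forall fun x => ?_)
      simp only [← hu, ← hu₀]
      have hi : s x = A.indicator s x + Aᶜ.indicator s x := by
        rw [← Pi.add_apply, Set.indicator_self_add_compl]
      have hrx : r x = u x - u₀ x - 1 / 2 * s x * u₀ x := rfl
      rw [hrx]
      linear_combination (1 / 2 * f x * u₀ x * (u x - u₀ x)) * hi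
    · exact (integrable_mul_rootDensity_sq hac (hfα.integrable one_le_two)).sub
        (integrable_mul_rootDensity_sq h.ac_zero (hf.integrable one_le_two))
    · exact integrable_mul_rootDensity_sq h.ac_zero (hf.integrable_mul (h.memLp_inner_score α))
  have hα0 := norm_nonneg α
  have b1 := abs_integral_mul_le_of_sq_le hfu hrm hB (by positivity) hfuB hr
  have b2 := abs_integral_mul_le_of_sq_le hfu₀ hrm hB (by positivity) hfu₀B hr
  have b3 : |∫ x, (f x * (u x - u₀ x)) * (A.indicator s x * u₀ x) ∂ν| ≤
      (2 * B) * (‖α‖ * (ε / 4)) := by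
    refine abs_integral_mul_le_of_sq_le hfd hsA (by positivity) (by positivity) ?_ ?_
    · calc ∫ x, (f x * (u x - u₀ x)) ^ 2 ∂ν
          ≤ ∫ x, (2 * (f x * u x) ^ 2 + 2 * (f x * u₀ x) ^ 2) ∂ν := by
            refine integral_mono hfd.integrable_sq ((hfu.integrable_sq.const_mul 2).add
              (hfu₀.integrable_sq.const_mul 2)) fun x => ?_
            beta_reduce
            nlinarith [sq_nonneg (f x * u x + f x * u₀ x)]
        _ = 2 * ∫ x, (f x * u x) ^ 2 ∂ν + 2 * ∫ x, (f x * u₀ x) ^ 2 ∂ν := by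
            rw [integral_add (hfu.integrable_sq.const_mul 2) (hfu₀.integrable_sq.const_mul 2),
              integral_const_mul, integral_const_mul]
        _ ≤ (2 * B) ^ 2 := by nlinarith
    · rw [hu₀, integral_sq_mul_rootDensity h.ac_zero, mul_pow]
      have hint : Integrable (fun x => (A.indicator (fun y => ‖ℓ y‖) x) ^ 2) P :=
        (h.memLp_norm_score.indicator hAm).integrable_sq
      calc ∫ x, A.indicator s x ^ 2 ∂P
          ≤ ∫ x, ‖α‖ ^ 2 * (A.indicator (fun y => ‖ℓ y‖) x) ^ 2 ∂P := by
            refine integral_mono ((h.memLp_inner_score α).indicator hAm).integrable_sq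
              (hint.const_mul _) fun x => ?_
            beta_reduce
            rw [← mul_pow, sq_le_sq]
            by_cases hx : x ∈ A
            · simp only [Set.indicator_of_mem hx]
              rw [abs_of_nonneg (by positivity : 0 ≤ ‖α‖ * ‖ℓ x‖)]
              exact abs_real_inner_le_norm _ _
            · simp [Set.indicator_of_notMem hx]
        _ ≤ ‖α‖ ^ 2 * (ε / 4) ^ 2 := by
            rw [integral_const_mul]
            exact mul_le_mul_of_nonneg_left hKt (sq_nonneg _)
  have b4 : |∫ x, (f x * u₀ x) * (Aᶜ.indicator s x * (u x - u₀ x)) ∂ν| ≤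
      B * ((‖α‖ * K) * (C * ‖α‖)) := by
    refine abs_integral_mul_le_of_sq_le hfu₀ hsAc hB (by positivity) hfu₀B ?_
    calc ∫ x, (Aᶜ.indicator s x * (u x - u₀ x)) ^ 2 ∂ν
        ≤ ∫ x, (‖α‖ * K) ^ 2 * (u x - u₀ x) ^ 2 ∂ν := by
          refine integral_mono hsAc.integrable_sq (hd.integrable_sq.const_mul _) fun x => ?_
          beta_reduce
          rw [mul_pow]
          refine mul_le_mul_of_nonneg_right ?_ (sq_nonneg _)
          rw [sq_le_sq, abs_of_nonneg (by positivity : 0 ≤ ‖α‖ * K)]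
          exact hsAbd x
      _ ≤ ((‖α‖ * K) * (C * ‖α‖)) ^ 2 := by
          rw [integral_const_mul, mul_pow _ (C * ‖α‖)]
          exact mul_le_mul_of_nonneg_left hHα (sq_nonneg _)
  have b4' : B * ((‖α‖ * K) * (C * ‖α‖)) ≤ B * (‖α‖ * (ε / 4)) := by
    rw [mul_assoc ‖α‖ K]
    exact mul_le_mul_of_nonneg_left (mul_le_mul_of_nonneg_left hα hα0) hB
  rw [hdecomp]
  have hpos : 0 ≤ ε * B * ‖α‖ := by positivity
  rw [abs_le] at b1 b2 b3 b4 ⊢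
  constructor <;> nlinarith [b1.1, b1.2, b2.1, b2.2, b3.1, b3.2, b4.1, b4.2, b4', hpos]

/-- The mass of the set where the likelihood ratio exceeds `4` is `o(‖α‖²)`. -/
lemma eventually_measure_large_ratio_le (h : QMD P Pα ν ℓ) {ε : ℝ} (hε : 0 < ε) :
    ∀ᶠ α in 𝓝 0, (Pα α).real {x | 2 * rootDensity P ν x < rootDensity (Pα α) ν x} ≤
      ε * ‖α‖ ^ 2 := by
  have := h.sigmaFinite
  have := h.isProbabilityMeasure_zero
  obtain ⟨K, hK, hKt⟩ := h.exists_score_tail_le (ε := √(ε / 8)) (by positivity)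
  rw [Real.sq_sqrt (by positivity)] at hKt
  obtain ⟨C, hC, hH⟩ := h.exists_hellinger_le
  have hsmall : ∀ᶠ α : EuclideanSpace ℝ (Fin d) in 𝓝 0, K ^ 2 * (C * ‖α‖) ^ 2 ≤ ε / 8 := by
    have : Tendsto (fun α : EuclideanSpace ℝ (Fin d) => K ^ 2 * (C * ‖α‖) ^ 2) (𝓝 0) (𝓝 0) := by
      have := (((continuous_norm (E := EuclideanSpace ℝ (Fin d))).const_mul C).pow 2).const_mul
        (K ^ 2)
      simpa using this.tendsto 0
    exact (this.eventually (gt_mem_nhds (by positivity))).mono fun α hα => hα.le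
  filter_upwards [hH, hsmall, h.eventually_remainder_le (ε := √(ε / 16)) (by positivity),
    h.isProbabilityMeasure, h.ac] with α hHα hα hr hprob hac
  rw [mul_pow, Real.sq_sqrt (by positivity)] at hr
  set u := rootDensity (Pα α) ν with hu
  set u₀ := rootDensity P ν with hu₀
  set r := qmdRemainder P Pα ν ℓ α with hr'
  have hrm : MemLp r 2 ν := h.memLp_remainder hprob hac
  have hd : MemLp (fun x => u x - u₀ x) 2 ν :=
    (memLp_rootDensity hac).sub (memLp_rootDensity h.ac_zero)
  set S : Set 𝒳 := {x | 2 * u₀ x < u x} with hS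
  have hSm : MeasurableSet S :=
    measurableSet_lt (measurable_rootDensity.const_mul 2) measurable_rootDensity
  set A : Set 𝒳 := {y | K < ‖ℓ y‖} with hA
  have hAm : MeasurableSet A := measurableSet_lt measurable_const h.measurable_score.norm
  have hAint : Integrable (fun x => (A.indicator (fun y => ‖ℓ y‖) x * u₀ x) ^ 2) ν :=
    (memLp_mul_rootDensity h.ac_zero (h.measurable_score.norm.indicator hAm)
      (h.memLp_norm_score.indicator hAm)).integrable_sq
  have hdint : Integrable (fun x => K ^ 2 * (u x - u₀ x) ^ 2) ν := hd.integrable_sq.const_mul _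
  have hAdint : Integrable (fun x => 2 * ‖α‖ ^ 2 *
      ((A.indicator (fun y => ‖ℓ y‖) x * u₀ x) ^ 2 + K ^ 2 * (u x - u₀ x) ^ 2)) ν :=
    (hAint.add hdint).const_mul _
  have hPS : (Pα α).real S = ∫ x, S.indicator 1 x * u x ^ 2 ∂ν := by
    rw [hu, integral_mul_rootDensity_sq hac, integral_indicator_one hSm]
  -- On `S` one has `u₀ < u - u₀` and `u ≤ 2 (u - u₀)`, so `u² ≤ 2 (⟨α, ℓ⟩ u₀)² + 8 r²`. Where `‖ℓ‖
  -- ≤ K`, the factor `‖ℓ‖ u₀` is at most `K (u - u₀)`; elsewhere the tail of the score is used.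
  -- Every piece integrates to `o(‖α‖²)`.
  have hmul : ∀ x, S.indicator 1 x * u x ^ 2 ≤
      2 * ‖α‖ ^ 2 * ((A.indicator (fun y => ‖ℓ y‖) x * u₀ x) ^ 2 + K ^ 2 * (u x - u₀ x) ^ 2)
        + 8 * r x ^ 2 := by
    intro x
    by_cases hx : x ∈ S
    · rw [Set.indicator_of_mem hx, Pi.one_apply, one_mul]
      have hx' : 2 * u₀ x < u x := hx
      have h0 : 0 ≤ u₀ x := rootDensity_nonneg x
      have hrx : u x - u₀ x = 1 / 2 * inner ℝ α (ℓ x) * u₀ x + r x := by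
        simp only [hr', qmdRemainder, ← hu, ← hu₀]; ring
      have hi : (inner ℝ α (ℓ x) * u₀ x) ^ 2 ≤ ‖α‖ ^ 2 * (‖ℓ x‖ * u₀ x) ^ 2 := by
        have hi₀ : (inner ℝ α (ℓ x)) ^ 2 ≤ (‖α‖ * ‖ℓ x‖) ^ 2 := by
          rw [sq_le_sq, abs_of_nonneg (by positivity : 0 ≤ ‖α‖ * ‖ℓ x‖)]
          exact abs_real_inner_le_norm _ _
        have := mul_le_mul_of_nonneg_right hi₀ (sq_nonneg (u₀ x))
        linarith
      have hl : (‖ℓ x‖ * u₀ x) ^ 2 ≤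
          (A.indicator (fun y => ‖ℓ y‖) x * u₀ x) ^ 2 + K ^ 2 * (u x - u₀ x) ^ 2 := by
        by_cases hxA : x ∈ A
        · rw [Set.indicator_of_mem hxA]
          exact le_add_of_nonneg_right (by positivity)
        · rw [Set.indicator_of_notMem hxA, ← mul_pow]
          have hxK : ‖ℓ x‖ ≤ K := not_lt.1 hxA
          have hle : ‖ℓ x‖ * u₀ x ≤ K * (u x - u₀ x) :=
            mul_le_mul hxK (by linarith) h0 hK.le
          have := pow_le_pow_left₀ (mul_nonneg (norm_nonneg _) h0) hle 2
          simpa using this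
      have hu2 : u x ^ 2 ≤ 4 * (u x - u₀ x) ^ 2 := by nlinarith
      have h2 : (u x - u₀ x) ^ 2 ≤ 1 / 2 * (inner ℝ α (ℓ x) * u₀ x) ^ 2 + 2 * r x ^ 2 := by
        rw [hrx]
        nlinarith [sq_nonneg (1 / 2 * (inner ℝ α (ℓ x) * u₀ x) - r x)]
      have h3 := mul_le_mul_of_nonneg_left hl (sq_nonneg ‖α‖)
      linarith
    · rw [Set.indicator_of_notMem hx, zero_mul]
      positivity
  rw [hPS]
  calc ∫ x, S.indicator 1 x * u x ^ 2 ∂ν ≤ ∫ x, (2 * ‖α‖ ^ 2 *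
        ((A.indicator (fun y => ‖ℓ y‖) x * u₀ x) ^ 2 + K ^ 2 * (u x - u₀ x) ^ 2)
        + 8 * r x ^ 2) ∂ν := by
        refine integral_mono (integrable_mul_rootDensity_sq hac
          ((integrable_const (1 : ℝ)).indicator hSm)) ?_ hmul
        exact hAdint.add (hrm.integrable_sq.const_mul _)
    _ = 2 * ‖α‖ ^ 2 * (∫ x, (A.indicator (fun y => ‖ℓ y‖) x) ^ 2 ∂P +
          K ^ 2 * ∫ x, (u x - u₀ x) ^ 2 ∂ν) + 8 * ∫ x, r x ^ 2 ∂ν := by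
        rw [integral_add hAdint (hrm.integrable_sq.const_mul _), integral_const_mul,
          integral_const_mul, integral_add hAint hdint, integral_const_mul, hu₀,
          integral_sq_mul_rootDensity h.ac_zero]
    _ ≤ ε * ‖α‖ ^ 2 := by
        have h1 := mul_le_mul_of_nonneg_left hHα (sq_nonneg K)
        have h2 := mul_le_mul_of_nonneg_left
          (add_le_add hKt (h1.trans hα)) (by positivity : 0 ≤ 2 * ‖α‖ ^ 2)
        linarith

end QMD

end QuadraticMean

/-! ### Contiguity through truncated likelihood ratios. -/

section Contiguity

/-- `μ` has, up to a mass `δ`, a density with respect to `P` whose second moment is at most `K`. -/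
def NearlyDominated {X : Type*} [MeasurableSpace X] (P μ : Measure X) (δ K : ℝ≥0∞) : Prop :=
  ∃ g : X → ℝ≥0∞, Measurable g ∧ ∫⁻ x, g x ^ 2 ∂P ≤ K ∧
    ∀ h : X → ℝ≥0∞, Measurable h → (∀ x, h x ≤ 1) → ∫⁻ x, h x ∂μ ≤ δ + ∫⁻ x, h x * g x ∂P

namespace NearlyDominated

variable {X X' : Type*} [MeasurableSpace X] [MeasurableSpace X']

/-- This is why the notion suits i.i.d. samples: the discarded masses add and the second moments
multiply. The inner integral is capped at `1` because the outer bound is available only for test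
functions with values at most `1`. -/
lemma prod {P μ : Measure X} {P' μ' : Measure X'} [IsProbabilityMeasure P] [IsProbabilityMeasure μ]
    [IsProbabilityMeasure P'] [IsProbabilityMeasure μ'] {δ K δ' K' : ℝ≥0∞}
    (h : NearlyDominated P μ δ K) (h' : NearlyDominated P' μ' δ' K') :
    NearlyDominated (P.prod P') (μ.prod μ') (δ + δ') (K * K') := by
  obtain ⟨g, hg, hgK, hgd⟩ := h
  obtain ⟨g', hg', hgK', hgd'⟩ := h'
  refine ⟨fun p => g p.1 * g' p.2, (hg.comp measurable_fst).mul (hg'.comp measurable_snd), ?_, ?_⟩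
  · simp_rw [mul_pow]
    rw [lintegral_prod_mul (hg.pow_const 2).aemeasurable (hg'.pow_const 2).aemeasurable]
    exact mul_le_mul' hgK hgK'
  · intro f hf hf1
    have hI : Measurable fun x => ∫⁻ y, f (x, y) * g' y ∂P' :=
      Measurable.lintegral_prod_right' (f := fun p : X × X' => f p * g' p.2)
        (hf.mul (hg'.comp measurable_snd))
    have hmin : Measurable fun x => min 1 (∫⁻ y, f (x, y) * g' y ∂P') := measurable_const.min hI
    rw [lintegral_prod _ hf.aemeasurable]
    calc ∫⁻ x, ∫⁻ y, f (x, y) ∂μ' ∂μ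
        ≤ ∫⁻ x, (min 1 (∫⁻ y, f (x, y) * g' y ∂P') + δ') ∂μ := by
          refine lintegral_mono fun x => ?_
          have h1 : ∫⁻ y, f (x, y) ∂μ' ≤ δ' + ∫⁻ y, f (x, y) * g' y ∂P' :=
            hgd' _ (hf.comp measurable_prodMk_left) fun y => hf1 _
          have h2 : ∫⁻ y, f (x, y) ∂μ' ≤ 1 := by
            calc ∫⁻ y, f (x, y) ∂μ' ≤ ∫⁻ _, 1 ∂μ' := lintegral_mono fun y => hf1 _
              _ = 1 := by simp
          rcases le_total 1 (∫⁻ y, f (x, y) * g' y ∂P') with hle | hle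
          · rw [min_eq_left hle]
            exact h2.trans le_self_add
          · rw [min_eq_right hle, add_comm]
            exact h1
      _ = ∫⁻ x, min 1 (∫⁻ y, f (x, y) * g' y ∂P') ∂μ + δ' := by
          rw [lintegral_add_right _ measurable_const]
          simp
      _ ≤ (δ + ∫⁻ x, min 1 (∫⁻ y, f (x, y) * g' y ∂P') * g x ∂P) + δ' :=
          add_le_add (hgd _ hmin fun x => min_le_left _ _) le_rfl
      _ ≤ (δ + ∫⁻ x, (∫⁻ y, f (x, y) * g' y ∂P') * g x ∂P) + δ' := by
          gcongr
          exact min_le_right _ _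
      _ = δ + δ' + ∫⁻ p, f p * (g p.1 * g' p.2) ∂(P.prod P') := by
          have hm : Measurable fun p : X × X' => f p * (g p.1 * g' p.2) :=
            hf.mul ((hg.comp measurable_fst).mul (hg'.comp measurable_snd))
          rw [lintegral_prod _ hm.aemeasurable, add_right_comm]
          congr 1
          refine lintegral_congr fun x => ?_
          rw [← lintegral_mul_const]
          · exact lintegral_congr fun y => by ring
          · exact (hf.comp measurable_prodMk_left).mul hg'

lemma of_measurePreserving {P μ : Measure X} {P' μ' : Measure X'} {δ K : ℝ≥0∞} (e : X' ≃ᵐ X)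
    (hP : MeasurePreserving e P' P) (hμ : MeasurePreserving e μ' μ)
    (h : NearlyDominated P μ δ K) : NearlyDominated P' μ' δ K := by
  obtain ⟨g, hg, hgK, hgd⟩ := h
  refine ⟨g ∘ e, hg.comp e.measurable, ?_, fun f hf hf1 => ?_⟩
  · rw [← hP.lintegral_comp (hg.pow_const 2)] at hgK
    exact hgK
  · have := hgd (f ∘ e.symm) (hf.comp e.symm.measurable) fun x => hf1 _
    have hfg : Measurable fun x => (f ∘ e.symm) x * g x := (hf.comp e.symm.measurable).mul hg
    rw [← hμ.lintegral_comp (hf.comp e.symm.measurable), ← hP.lintegral_comp hfg] at this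
    simpa using this

lemma pi {𝒳 : Type*} [MeasurableSpace 𝒳] {P μ : Measure 𝒳} [IsProbabilityMeasure P]
    [IsProbabilityMeasure μ] {δ K : ℝ≥0∞} (h : NearlyDominated P μ δ K) (n : ℕ) :
    NearlyDominated (Measure.pi fun _ : Fin n => P) (Measure.pi fun _ : Fin n => μ)
      (n * δ) (K ^ n) := by
  induction n with
  | zero =>
    refine ⟨fun _ => 1, measurable_const, by simp, fun f _ _ => ?_⟩
    have : (Measure.pi fun _ : Fin 0 => μ) = Measure.pi fun _ : Fin 0 => P := by
      rw [Measure.pi_of_empty, Measure.pi_of_empty]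
    simp [this]
  | succ n ih =>
    have := of_measurePreserving (MeasurableEquiv.piFinSuccAbove (fun _ : Fin (n + 1) => 𝒳) 0)
      (measurePreserving_piFinSuccAbove (fun _ : Fin (n + 1) => P) 0)
      (measurePreserving_piFinSuccAbove (fun _ : Fin (n + 1) => μ) 0) (h.prod ih)
    have e1 : δ + n * δ = ((n + 1 : ℕ) : ℝ≥0∞) * δ := by push_cast; ring
    have e2 : K * K ^ n = K ^ (n + 1) := by ring
    rwa [e1, e2] at this

lemma sampleLaw {𝒳 : Type*} [MeasurableSpace 𝒳] {P μ : Measure 𝒳} [IsProbabilityMeasure P]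
    [IsProbabilityMeasure μ] {δ K : ℝ≥0∞} (h : NearlyDominated P μ δ K) (n k : ℕ) :
    NearlyDominated (sampleLaw P n k) (sampleLaw μ n k) ((n + k : ℕ) * δ) (K ^ (n + k)) := by
  have := (h.pi n).prod (h.pi k)
  rwa [← add_mul, ← pow_add, ← Nat.cast_add] at this

/-- Cauchy–Schwarz against the indicator of a measurable hull of `E`, so `E` need not be measurable.
-/
lemma measure_le {P μ : Measure X} {δ K : ℝ≥0∞} (h : NearlyDominated P μ δ K) (E : Set X) :
    μ E ≤ δ + K ^ (1 / 2 : ℝ) * P E ^ (1 / 2 : ℝ) := by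
  obtain ⟨g, hg, hgK, hgd⟩ := h
  set F := toMeasurable P E with hF
  have hFm : MeasurableSet F := measurableSet_toMeasurable P E
  have h1 := hgd (F.indicator 1) (measurable_one.indicator hFm) fun x =>
    Set.indicator_le_self' (f := (1 : X → ℝ≥0∞)) (fun _ _ => zero_le) x
  rw [lintegral_indicator_one hFm] at h1
  refine (measure_mono (subset_toMeasurable P E)).trans (h1.trans (add_le_add le_rfl ?_))
  have h2 := ENNReal.lintegral_mul_le_Lp_mul_Lq P (p := 2) (q := 2) (by constructor <;> norm_num)
    (measurable_one.indicator hFm).aemeasurable hg.aemeasurable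
    (f := F.indicator (1 : X → ℝ≥0∞)) (g := g)
  refine h2.trans ?_
  rw [mul_comm]
  refine mul_le_mul' (ENNReal.rpow_le_rpow (by simpa using hgK) (by norm_num))
    (ENNReal.rpow_le_rpow ?_ (by norm_num))
  have : ∀ x, (F.indicator (1 : X → ℝ≥0∞) x) ^ (2 : ℝ) = F.indicator 1 x := by
    intro x
    by_cases hx : x ∈ F <;> simp [hx]
  simp_rw [this]
  rw [lintegral_indicator_one hFm, measure_toMeasurable]

end NearlyDominated

variable {𝒳 : Type*} [MeasurableSpace 𝒳]

/-- The mass of the set where the root density more than doubles is discarded; off it `(u / u₀)²`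
serves as the density. Its second moment is the integral of `u⁴ / u₀²`, and `u⁴ / u₀² - 2u² + u₀² =
(u - u₀)² (u + u₀)² / u₀²` is at most `9 (u - u₀)²` because `u ≤ 2 u₀`. Since `u²` and `u₀²`
integrate to one, this produces the constant `1 + 9 ∫ (u - u₀)²`. -/
lemma nearlyDominated_of_rootDensity {P μ ν : Measure 𝒳} [IsProbabilityMeasure P]
    [IsProbabilityMeasure μ] [SigmaFinite ν] (hP : P ≪ ν) (hμ : μ ≪ ν) :
    NearlyDominated P μ (μ {x | 2 * rootDensity P ν x < rootDensity μ ν x})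
      (ENNReal.ofReal (1 + 9 * ∫ x, (rootDensity μ ν x - rootDensity P ν x) ^ 2 ∂ν)) := by
  set u := rootDensity μ ν with hu
  set u₀ := rootDensity P ν with hu₀
  set S : Set 𝒳 := {x | 2 * u₀ x < u x} with hS
  have hum : Measurable u := measurable_rootDensity
  have hu₀m : Measurable u₀ := measurable_rootDensity
  have hSm : MeasurableSet S := measurableSet_lt (hu₀m.const_mul 2) hum
  have hu2 : Integrable (fun x => u x ^ 2) ν := (memLp_rootDensity hμ).integrable_sq
  have hu₀2 : Integrable (fun x => u₀ x ^ 2) ν := (memLp_rootDensity hP).integrable_sq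
  have hd2 : Integrable (fun x => (u x - u₀ x) ^ 2) ν :=
    ((memLp_rootDensity hμ).sub (memLp_rootDensity hP)).integrable_sq
  set g : 𝒳 → ℝ≥0∞ := Sᶜ.indicator fun x => ENNReal.ofReal ((u x / u₀ x) ^ 2) with hg
  have hgm : Measurable g := (((hum.div hu₀m).pow_const 2).ennreal_ofReal).indicator hSm.compl
  have hgu : ∀ x ∉ S, g x * ENNReal.ofReal (u₀ x ^ 2) = ENNReal.ofReal (u x ^ 2) := by
    intro x hx
    rw [hg, Set.indicator_of_mem hx, ← ENNReal.ofReal_mul (sq_nonneg _)]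
    congr 1
    by_cases h0 : u₀ x = 0
    · have hx' : u x ≤ 2 * u₀ x := not_lt.1 hx
      have : u x = 0 := le_antisymm (by rw [h0] at hx'; linarith) (rootDensity_nonneg x)
      simp [h0, this]
    · field_simp
  refine ⟨g, hgm, ?_, fun f hf hf1 => ?_⟩
  · rw [← lintegral_mul_rootDensity_sq hP (hgm.pow_const 2)]
    have hone : ∫ x, u x ^ 2 ∂ν = 1 := by
      have := integral_mul_rootDensity_sq hμ fun _ => (1 : ℝ)
      simpa using this
    have hone₀ : ∫ x, u₀ x ^ 2 ∂ν = 1 := by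
      have := integral_mul_rootDensity_sq hP fun _ => (1 : ℝ)
      simpa using this
    -- Nonnegativity is needed on the whole space, the discarded set included, to exchange the
    -- Bochner and the lower Lebesgue integral.
    have hpt : ∀ x, 0 ≤ 9 * (u x - u₀ x) ^ 2 + 2 * u x ^ 2 - u₀ x ^ 2 := by
      intro x
      nlinarith [sq_nonneg (u x - 2 * u₀ x), sq_nonneg (u x), sq_nonneg (10 * u x - 9 * u₀ x),
        sq_nonneg (u₀ x), sq_nonneg (11 * u x - 9 * u₀ x)]
    have hint1 : Integrable (fun x => 9 * (u x - u₀ x) ^ 2) ν := hd2.const_mul 9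
    have hint2 : Integrable (fun x => 2 * u x ^ 2) ν := hu2.const_mul 2
    have hint12 : Integrable (fun x => 9 * (u x - u₀ x) ^ 2 + 2 * u x ^ 2) ν := hint1.add hint2
    have hint : Integrable (fun x => 9 * (u x - u₀ x) ^ 2 + 2 * u x ^ 2 - u₀ x ^ 2) ν :=
      hint12.sub hu₀2
    have hval : ∫ x, (9 * (u x - u₀ x) ^ 2 + 2 * u x ^ 2 - u₀ x ^ 2) ∂ν =
        1 + 9 * ∫ x, (u x - u₀ x) ^ 2 ∂ν := by
      rw [integral_sub hint12 hu₀2, integral_add hint1 hint2, integral_const_mul,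
        integral_const_mul, hone, hone₀]
      ring
    rw [← hval, ofReal_integral_eq_lintegral_ofReal hint (Eventually.of_forall hpt)]
    refine lintegral_mono fun x => ?_
    by_cases hx : x ∈ S
    · have : g x = 0 := Set.indicator_of_notMem (by simpa using hx) _
      simp [this]
    · rw [sq, mul_assoc, ← hu₀, hgu x hx, hg, Set.indicator_of_mem hx,
        ← ENNReal.ofReal_mul (sq_nonneg _)]
      refine ENNReal.ofReal_le_ofReal ?_
      have hx' : u x ≤ 2 * u₀ x := not_lt.1 hx
      have h0 : 0 ≤ u x := rootDensity_nonneg x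
      have h0' : 0 ≤ u₀ x := rootDensity_nonneg x
      rcases h0'.eq_or_lt with h00 | h00
      · rw [← h00]
        have : u x = 0 := le_antisymm (by linarith) h0
        simp [this]
      · rw [div_pow, div_mul_eq_mul_div, div_le_iff₀ (by positivity)]
        have h3 : (u x + u₀ x) ^ 2 ≤ (3 * u₀ x) ^ 2 := by
          refine pow_le_pow_left₀ (by linarith) (by linarith) 2
        nlinarith [mul_le_mul_of_nonneg_left h3 (sq_nonneg (u x - u₀ x))]
  · have h1 : ∫⁻ x, f x ∂μ = ∫⁻ x in S, f x ∂μ + ∫⁻ x in Sᶜ, f x ∂μ :=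
      (lintegral_add_compl f hSm).symm
    rw [h1]
    refine add_le_add ?_ ?_
    · calc ∫⁻ x in S, f x ∂μ ≤ ∫⁻ _ in S, 1 ∂μ := lintegral_mono fun x => hf1 x
        _ = μ S := by simp
    · have hfg : Measurable fun x => f x * g x := hf.mul hgm
      rw [← lintegral_indicator hSm.compl,
        ← lintegral_mul_rootDensity_sq hμ (hf.indicator hSm.compl),
        ← lintegral_mul_rootDensity_sq hP hfg]
      refine lintegral_mono fun x => ?_
      by_cases hx : x ∈ S
      · simp [hx]
      · rw [Set.indicator_of_mem (by exact hx : x ∈ Sᶜ), ← hu, ← hu₀, ← hgu x hx, mul_assoc]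

/-- Contiguity, in quantitative form, of the local data generating processes. -/
theorem QMD.contiguity {P : Measure 𝒳} {d : ℕ} {Pα : EuclideanSpace ℝ (Fin d) → Measure 𝒳}
    {ν : Measure 𝒳} {ℓ : 𝒳 → EuclideanSpace ℝ (Fin d)} (h : QMD P Pα ν ℓ)
    {α : ℕ → EuclideanSpace ℝ (Fin d)} {B : ℝ} (hα : ∀ n : ℕ, √n * ‖α n‖ ≤ B) {k : ℕ → ℕ}
    (hk : (fun n => (k n : ℝ)) =O[atTop] fun n => (n : ℝ)) :
    ∃ C > (0 : ℝ), ∀ τ > (0 : ℝ), ∀ᶠ n in atTop, ∀ E : Set (Sample 𝒳 n (k n)), ∀ p ≥ (0 : ℝ),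
      sampleLaw P n (k n) E ≤ ENNReal.ofReal p →
      sampleLaw (Pα (α n)) n (k n) E ≤ ENNReal.ofReal (τ + C * √p) := by
  have := h.sigmaFinite
  have := h.isProbabilityMeasure_zero
  have hα0 : Tendsto α atTop (𝓝 0) := by
    rw [tendsto_zero_iff_norm_tendsto_zero]
    have hlim : Tendsto (fun n : ℕ => B / √(n : ℝ)) atTop (𝓝 0) :=
      tendsto_const_nhds.div_atTop (Real.tendsto_sqrt_atTop.comp tendsto_natCast_atTop_atTop)
    refine squeeze_zero' (Eventually.of_forall fun n => norm_nonneg _) ?_ hlim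
    filter_upwards [eventually_gt_atTop 0] with n hn
    rw [le_div_iff₀ (Real.sqrt_pos.2 (Nat.cast_pos.2 hn)), mul_comm]
    exact hα n
  have hB : 0 ≤ B := le_trans (by positivity) (hα 0)
  obtain ⟨C₀, hC₀, hH⟩ := h.exists_hellinger_le
  obtain ⟨c, hc, hkc⟩ := hk.exists_pos
  rw [Asymptotics.isBigOWith_iff] at hkc
  have hnα : ∀ n : ℕ, n * ‖α n‖ ^ 2 ≤ B ^ 2 := by
    intro n
    have := pow_le_pow_left₀ (by positivity) (hα n) 2
    rwa [mul_pow, Real.sq_sqrt (Nat.cast_nonneg n)] at this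
  -- There are `n + k n ≤ (1 + c) n` observations; this is where `k n = O(n)` enters. As `n ‖α n‖² ≤
  -- B²`, the second moment of the product density is at most `(1 + 9 C₀² ‖α n‖²) ^ (n + k n) ≤ exp
  -- D`, while the total discarded mass is `(n + k n) · o(‖α n‖²)`, eventually below `τ`.
  set D : ℝ := (1 + c) * (9 * C₀ ^ 2 * B ^ 2) with hD
  refine ⟨√(Real.exp D), by positivity, fun τ hτ => ?_⟩
  set ε : ℝ := τ / ((1 + c) * (B ^ 2 + 1)) with hε
  have hεpos : 0 < ε := by positivity
  filter_upwards [hkc, hα0.eventually hH, hα0.eventually h.ac,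
    hα0.eventually h.isProbabilityMeasure,
    hα0.eventually (h.eventually_measure_large_ratio_le hεpos)] with n hkn hHn hacn hpn hLn
  intro E p hp hE
  have hkn' : (k n : ℝ) ≤ c * n := by simpa using hkn
  have hdom := ((nearlyDominated_of_rootDensity h.ac_zero hacn).sampleLaw n (k n)).measure_le E
  refine hdom.trans ?_
  rw [ENNReal.ofReal_add hτ.le (by positivity)]
  have hnk : ((n + k n : ℕ) : ℝ) ≤ (1 + c) * n := by push_cast; linarith
  refine add_le_add ?_ ?_
  · rw [← ofReal_measureReal, ← ENNReal.ofReal_natCast, ← ENNReal.ofReal_mul (Nat.cast_nonneg _)]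
    refine ENNReal.ofReal_le_ofReal ?_
    calc ((n + k n : ℕ) : ℝ) * _ ≤ ((1 + c) * n) * (ε * ‖α n‖ ^ 2) :=
          mul_le_mul hnk hLn measureReal_nonneg (by positivity)
      _ = (1 + c) * ε * (n * ‖α n‖ ^ 2) := by ring
      _ ≤ (1 + c) * ε * (B ^ 2 + 1) :=
          mul_le_mul_of_nonneg_left ((hnα n).trans (by linarith)) (by positivity)
      _ = τ := by rw [hε]; field_simp
  · rw [ENNReal.ofReal_mul (Real.sqrt_nonneg _), Real.sqrt_eq_rpow, Real.sqrt_eq_rpow,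
      ← ENNReal.ofReal_rpow_of_nonneg (Real.exp_nonneg _) (by norm_num),
      ← ENNReal.ofReal_rpow_of_nonneg hp (by norm_num)]
    refine mul_le_mul' (ENNReal.rpow_le_rpow ?_ (by norm_num))
      (ENNReal.rpow_le_rpow hE (by norm_num))
    have hI : 0 ≤ ∫ x, (rootDensity (Pα (α n)) ν x - rootDensity P ν x) ^ 2 ∂ν :=
      integral_nonneg fun x => sq_nonneg _
    rw [← ENNReal.ofReal_pow (by positivity)]
    refine ENNReal.ofReal_le_ofReal ?_
    calc _ ≤ (Real.exp (9 * (C₀ * ‖α n‖) ^ 2)) ^ (n + k n) := by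
          refine pow_le_pow_left₀ (by positivity) ?_ _
          rw [add_comm]
          exact (add_le_add (mul_le_mul_of_nonneg_left hHn (by norm_num)) le_rfl).trans
            (Real.add_one_le_exp _)
      _ = Real.exp ((n + k n : ℕ) * (9 * (C₀ * ‖α n‖) ^ 2)) := by rw [← Real.exp_nat_mul]
      _ ≤ Real.exp D := by
          refine Real.exp_le_exp.2 ?_
          calc ((n + k n : ℕ) : ℝ) * (9 * (C₀ * ‖α n‖) ^ 2)
              ≤ ((1 + c) * n) * (9 * (C₀ * ‖α n‖) ^ 2) :=
                mul_le_mul_of_nonneg_right hnk (by positivity)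
            _ = (1 + c) * (9 * C₀ ^ 2) * (n * ‖α n‖ ^ 2) := by ring
            _ ≤ (1 + c) * (9 * C₀ ^ 2) * B ^ 2 :=
                mul_le_mul_of_nonneg_left (hnα n) (by positivity)
            _ = D := by rw [hD]; ring

end Contiguity

/-! ### Central limit theorem for row-wise i.i.d. arrays. -/

section TriangularCLT

variable {𝒳 : Type*} [MeasurableSpace 𝒳]

lemma norm_cexp_mul_I_sub_quadratic_le (x : ℝ) :
    ‖Complex.exp (x * Complex.I) - (1 + x * Complex.I - x ^ 2 / 2)‖ ≤ |x| ^ 3 * Real.exp |x| := by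
  have h := Complex.norm_exp_sub_sum_le_norm_mul_exp (x * Complex.I) 3
  have hs : ∑ m ∈ Finset.range 3, ((x : ℂ) * Complex.I) ^ m / (m.factorial : ℂ) =
      1 + x * Complex.I - x ^ 2 / 2 := by
    simp [Finset.sum_range_succ, mul_pow]
    ring
  rw [hs] at h
  simpa using h

lemma integral_cexp_empirical {μ : Measure 𝒳} [IsProbabilityMeasure μ] (n : ℕ) (φ : 𝒳 → ℝ)
    (t : ℝ) :
    ∫ x, Complex.exp (((t * empirical μ n φ x : ℝ) : ℂ) * Complex.I)
        ∂(Measure.pi fun _ : Fin n => μ) =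
      (∫ x, Complex.exp (((t * (√n)⁻¹ * (φ x - ∫ y, φ y ∂μ) : ℝ) : ℂ) * Complex.I) ∂μ) ^ n := by
  have h := integral_fintype_prod_eq_pow (ι := Fin n) (μ := μ) (𝕜 := ℂ) fun x =>
    Complex.exp (((t * (√n)⁻¹ * (φ x - ∫ y, φ y ∂μ) : ℝ) : ℂ) * Complex.I)
  rw [Fintype.card_fin] at h
  rw [← h]
  refine integral_congr_ae (Eventually.of_forall fun x => ?_)
  beta_reduce
  rw [← Complex.exp_sum]
  congr 1
  rw [← Finset.sum_mul, empirical, ← mul_assoc, Finset.mul_sum]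
  push_cast
  rfl

/-- Central limit theorem for row-wise i.i.d. arrays of the form `φ (Xᵢ)`, `φ` bounded. -/
lemma tendsto_integral_cexp_empirical {μ : ℕ → Measure 𝒳}
    (hμ : ∀ᶠ n in atTop, IsProbabilityMeasure (μ n)) {φ : 𝒳 → ℝ} (hφ : Measurable φ) {K : ℝ}
    (hK : ∀ x, |φ x| ≤ K) {v : ℝ}
    (hv : Tendsto (fun n => ∫ x, (φ x - ∫ y, φ y ∂μ n) ^ 2 ∂μ n) atTop (𝓝 v)) (t : ℝ) :
    Tendsto (fun n : ℕ => ∫ x, Complex.exp (((t * empirical (μ n) n φ x : ℝ) : ℂ) * Complex.I)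
      ∂(Measure.pi fun _ : Fin n => μ n)) atTop (𝓝 (Complex.exp ((-(t ^ 2 * v / 2) : ℝ)))) := by
  set f : ℕ → 𝒳 → ℝ := fun n x => t * (√n)⁻¹ * (φ x - ∫ y, φ y ∂μ n) with hf
  set g : ℕ → ℂ := fun n => ∫ x, Complex.exp ((f n x : ℂ) * Complex.I) ∂μ n - 1 with hg
  -- The characteristic function of one summand is expanded to second order. As `φ` is bounded, the
  -- cubic error is at most `(M / √n)³ exp M` per observation, uniformly over the row laws, so no
  -- Lindeberg condition has to be checked.
  have hlim : Tendsto (fun n : ℕ => (n : ℂ) * g n) atTop (𝓝 ((-(t ^ 2 * v / 2) : ℝ) : ℂ)) := by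
    set M : ℝ := |t| * (2 * K) with hM
    have hmain : Tendsto (fun n : ℕ => ((-(t ^ 2 * (∫ x, (φ x - ∫ y, φ y ∂μ n) ^ 2 ∂μ n) / 2) : ℝ)
        : ℂ)) atTop (𝓝 ((-(t ^ 2 * v / 2) : ℝ) : ℂ)) :=
      (Complex.continuous_ofReal.tendsto _).comp (((hv.const_mul _).div_const _).neg)
    have herr : Tendsto (fun n : ℕ => M ^ 3 * Real.exp M / √(n : ℝ)) atTop (𝓝 0) :=
      tendsto_const_nhds.div_atTop (Real.tendsto_sqrt_atTop.comp tendsto_natCast_atTop_atTop)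
    refine hmain.congr_dist (squeeze_zero' (Eventually.of_forall fun n => dist_nonneg) ?_ herr)
    filter_upwards [hμ, eventually_gt_atTop 0] with n hn hn0
    have hK0 : 0 ≤ K := by
      obtain ⟨x⟩ : Nonempty 𝒳 := nonempty_of_isProbabilityMeasure (μ n)
      exact (abs_nonneg _).trans (hK x)
    have hn1 : (1 : ℝ) ≤ n := by exact_mod_cast hn0
    have hsq : 0 < √(n : ℝ) := Real.sqrt_pos.2 (by linarith)
    have hsq1 : 1 ≤ √(n : ℝ) := Real.one_le_sqrt.2 hn1
    have hφi : Integrable φ (μ n) := Integrable.of_bound hφ.aestronglyMeasurable K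
      (Eventually.of_forall hK)
    have hcb : |∫ y, φ y ∂μ n| ≤ K := by
      have := norm_integral_le_of_norm_le_const (μ := μ n) (f := φ) (Eventually.of_forall hK)
      simpa using this
    have hyb : ∀ x, |φ x - ∫ y, φ y ∂μ n| ≤ 2 * K := fun x =>
      (abs_sub _ _).trans (by linarith [hK x])
    have hfm : Measurable (f n) := (hφ.sub_const _).const_mul _
    have hfb : ∀ x, |f n x| ≤ M / √n := by
      intro x
      rw [hf, hM]
      simp only [abs_mul, abs_inv, abs_of_pos hsq]
      rw [div_eq_mul_inv, mul_right_comm]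
      exact mul_le_mul_of_nonneg_right (mul_le_mul_of_nonneg_left (hyb x) (abs_nonneg _))
        (inv_nonneg.2 hsq.le)
    have hM0 : 0 ≤ M := by positivity
    have hfb' : ∀ x, |f n x| ≤ M := fun x => (hfb x).trans (div_le_self hM0 hsq1)
    have hfi : Integrable (f n) (μ n) := Integrable.of_bound hfm.aestronglyMeasurable M
      (Eventually.of_forall hfb')
    have hf2i : Integrable (fun x => f n x ^ 2) (μ n) :=
      Integrable.of_bound (hfm.pow_const 2).aestronglyMeasurable (M ^ 2)
        (Eventually.of_forall fun x => by
          rw [norm_pow]; exact pow_le_pow_left₀ (norm_nonneg _) (hfb' x) 2)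
    have hei : Integrable (fun x => Complex.exp ((f n x : ℂ) * Complex.I)) (μ n) :=
      Integrable.of_bound (by fun_prop) 1
        (Eventually.of_forall fun x => (Complex.norm_exp_ofReal_mul_I _).le)
    have hfc : Integrable (fun x => (f n x : ℂ) * Complex.I) (μ n) :=
      (hfi.ofReal (𝕜 := ℂ)).mul_const _
    have h1 : Integrable (fun x => (1 : ℂ) + (f n x : ℂ) * Complex.I) (μ n) :=
      (integrable_const (1 : ℂ)).add hfc
    have h2 : Integrable (fun x => ((f n x : ℂ)) ^ 2 / 2) (μ n) := by
      have := hf2i.ofReal (𝕜 := ℂ)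
      refine (this.div_const 2).congr (Eventually.of_forall fun x => ?_)
      simp
    have hq : Integrable (fun x => (1 + (f n x : ℂ) * Complex.I - (f n x : ℂ) ^ 2 / 2)) (μ n) :=
      h1.sub h2
    have hf0 : ∫ x, f n x ∂μ n = 0 := by
      simp only [hf]
      rw [integral_const_mul, integral_sub hφi (integrable_const _)]
      simp
    have hqv : ∫ x, (1 + (f n x : ℂ) * Complex.I - (f n x : ℂ) ^ 2 / 2) ∂μ n =
        1 - ((∫ x, f n x ^ 2 ∂μ n : ℝ) : ℂ) / 2 := by
      have e1 : ∫ x, (f n x : ℂ) ∂μ n = ((∫ x, f n x ∂μ n : ℝ) : ℂ) := integral_ofReal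
      have e2 : ∫ x, (f n x : ℂ) ^ 2 ∂μ n = ((∫ x, f n x ^ 2 ∂μ n : ℝ) : ℂ) := by
        rw [← integral_complex_ofReal]
        simp
      rw [integral_sub h1 h2, integral_add (integrable_const _) hfc, integral_mul_const,
        integral_div, e1, e2, hf0]
      simp
    have hf2v : n * ∫ x, f n x ^ 2 ∂μ n = t ^ 2 * ∫ x, (φ x - ∫ y, φ y ∂μ n) ^ 2 ∂μ n := by
      simp only [hf, mul_pow]
      rw [integral_const_mul, inv_pow, Real.sq_sqrt (by linarith)]
      field_simp
    have hkey : (n : ℂ) * g n - ((-(t ^ 2 * (∫ x, (φ x - ∫ y, φ y ∂μ n) ^ 2 ∂μ n) / 2) : ℝ) : ℂ) =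
        n * ∫ x, (Complex.exp ((f n x : ℂ) * Complex.I) -
          (1 + (f n x : ℂ) * Complex.I - (f n x : ℂ) ^ 2 / 2)) ∂μ n := by
      rw [integral_sub hei hq, hqv, ← hf2v, hg]
      push_cast
      ring
    rw [dist_comm, dist_eq_norm, hkey, norm_mul, Complex.norm_natCast]
    calc (n : ℝ) * ‖∫ x, (Complex.exp ((f n x : ℂ) * Complex.I) -
          (1 + (f n x : ℂ) * Complex.I - (f n x : ℂ) ^ 2 / 2)) ∂μ n‖
        ≤ n * ((M / √n) ^ 3 * Real.exp M) := by
          refine mul_le_mul_of_nonneg_left ?_ (by linarith)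
          have := norm_integral_le_of_norm_le_const (μ := μ n) (C := (M / √n) ^ 3 * Real.exp M)
            (f := fun x => Complex.exp ((f n x : ℂ) * Complex.I) -
              (1 + (f n x : ℂ) * Complex.I - (f n x : ℂ) ^ 2 / 2))
            (Eventually.of_forall fun x => (norm_cexp_mul_I_sub_quadratic_le (f n x)).trans
              (mul_le_mul (pow_le_pow_left₀ (abs_nonneg _) (hfb x) 3)
                (Real.exp_le_exp.2 (hfb' x)) (Real.exp_nonneg _) (by positivity)))
          simpa using this
      _ = M ^ 3 * Real.exp M / √n := by
          have h3 : √(n : ℝ) ^ 3 = n * √n := by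
            rw [pow_succ, Real.sq_sqrt (by linarith)]
          rw [div_pow, h3]
          field_simp
  have := Complex.tendsto_one_add_pow_exp_of_tendsto hlim
  refine this.congr' ?_
  filter_upwards [hμ] with n hn
  rw [integral_cexp_empirical, hg]
  simp only [hf, add_sub_cancel]

end TriangularCLT

/-! ### From pathwise differentiability to regularity. -/

section Regularity

variable {𝒳 : Type*} [MeasurableSpace 𝒳]

lemma norm_cexp_mul_I_sub_le (x y : ℝ) :
    ‖Complex.exp (x * Complex.I) - Complex.exp (y * Complex.I)‖ ≤ |x - y| := by
  have h : Complex.exp (x * Complex.I) - Complex.exp (y * Complex.I) =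
      Complex.exp (y * Complex.I) * (Complex.exp (Complex.I * ((x - y : ℝ) : ℂ)) - 1) := by
    rw [mul_sub, mul_one, ← Complex.exp_add]
    congr 2
    push_cast
    ring
  rw [h, norm_mul, Complex.norm_exp_ofReal_mul_I, one_mul]
  exact Real.norm_exp_I_mul_ofReal_sub_one_le

/-- The exponentials are `|t|`-Lipschitz in the variable where the two variables are close, and at
most `2` apart elsewhere. -/
lemma norm_integral_cexp_sub_le {S : Type*} [MeasurableSpace S] {μ : Measure S}
    [IsProbabilityMeasure μ] {X Y : S → ℝ} (hX : Measurable X) (hY : Measurable Y) (t : ℝ) {ε : ℝ}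
    (hε : 0 < ε) :
    ‖∫ s, Complex.exp (((t * X s : ℝ) : ℂ) * Complex.I) ∂μ -
      ∫ s, Complex.exp (((t * Y s : ℝ) : ℂ) * Complex.I) ∂μ‖ ≤
      |t| * ε + 2 * μ.real {s | ε ≤ |X s - Y s|} := by
  have hi : ∀ {X : S → ℝ}, Measurable X →
      Integrable (fun s => Complex.exp (((t * X s : ℝ) : ℂ) * Complex.I)) μ := fun hX =>
    Integrable.of_bound (by fun_prop) 1
      (Eventually.of_forall fun x => (Complex.norm_exp_ofReal_mul_I _).le)
  set A := {s | ε ≤ |X s - Y s|} with hA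
  have hAm : MeasurableSet A :=
    measurableSet_le measurable_const (continuous_abs.measurable.comp (hX.sub hY))
  have hAi : Integrable (fun s => 2 * A.indicator (1 : S → ℝ) s) μ :=
    ((integrable_const (1 : ℝ)).indicator hAm).const_mul 2
  rw [← integral_sub (hi hX) (hi hY)]
  calc _ ≤ ∫ s, (|t| * ε + 2 * A.indicator 1 s) ∂μ := by
        refine norm_integral_le_of_norm_le ((integrable_const _).add hAi)
          (Eventually.of_forall fun s => ?_)
        by_cases hs : s ∈ A
        · rw [Set.indicator_of_mem hs, Pi.one_apply, mul_one]
          refine (norm_sub_le _ _).trans ?_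
          rw [Complex.norm_exp_ofReal_mul_I, Complex.norm_exp_ofReal_mul_I]
          have : 0 ≤ |t| * ε := by positivity
          linarith
        · rw [Set.indicator_of_notMem hs, mul_zero, add_zero]
          refine (norm_cexp_mul_I_sub_le _ _).trans ?_
          rw [← mul_sub, abs_mul]
          have hs' : |X s - Y s| < ε := not_le.1 hs
          exact mul_le_mul_of_nonneg_left hs'.le (abs_nonneg _)
    _ = |t| * ε + 2 * μ.real A := by
        rw [integral_add (integrable_const _) hAi, integral_const_mul (2 : ℝ),
          integral_indicator_one hAm]
        simp

lemma tendsto_zero_of_sqrt_mul_norm_le {E : Type*} [NormedAddCommGroup E] {α : ℕ → E} {B : ℝ}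
    (hα : ∀ n : ℕ, √n * ‖α n‖ ≤ B) : Tendsto α atTop (𝓝 0) := by
  rw [tendsto_zero_iff_norm_tendsto_zero]
  have hlim : Tendsto (fun n : ℕ => B / √(n : ℝ)) atTop (𝓝 0) :=
    tendsto_const_nhds.div_atTop (Real.tendsto_sqrt_atTop.comp tendsto_natCast_atTop_atTop)
  refine squeeze_zero' (Eventually.of_forall fun n => norm_nonneg _) ?_ hlim
  filter_upwards [eventually_gt_atTop 0] with n hn
  rw [le_div_iff₀ (Real.sqrt_pos.2 (Nat.cast_pos.2 hn)), mul_comm]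
  exact hα n

/-- Along a differentiable submodel, expectations of a bounded function converge. -/
lemma QMD.tendsto_integral {P : Measure 𝒳} {d : ℕ} {Pα : EuclideanSpace ℝ (Fin d) → Measure 𝒳}
    {ν : Measure 𝒳} {ℓ : 𝒳 → EuclideanSpace ℝ (Fin d)} (h : QMD P Pα ν ℓ) {f : 𝒳 → ℝ}
    (hf : Measurable f) {K : ℝ} (hK : ∀ x, |f x| ≤ K) :
    Tendsto (fun α => ∫ x, f x ∂(Pα α)) (𝓝 0) (𝓝 (∫ x, f x ∂P)) := by
  have := h.isProbabilityMeasure_zero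
  have hK0 : 0 ≤ K := by
    obtain ⟨x⟩ : Nonempty 𝒳 := nonempty_of_isProbabilityMeasure P
    exact (abs_nonneg _).trans (hK x)
  have hmem : ∀ μ : Measure 𝒳, IsProbabilityMeasure μ → MemLp f 2 μ ∧ ∫ x, f x ^ 2 ∂μ ≤ K ^ 2 := by
    intro μ _
    have hm : MemLp f 2 μ := MemLp.of_bound hf.aestronglyMeasurable K (Eventually.of_forall hK)
    refine ⟨hm, ?_⟩
    calc ∫ x, f x ^ 2 ∂μ ≤ ∫ _, K ^ 2 ∂μ :=
          integral_mono hm.integrable_sq (integrable_const _) fun x =>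
            sq_le_sq.2 ((hK x).trans (le_abs_self K))
      _ = K ^ 2 := by simp
  set T := ∫ x, ‖ℓ x‖ ^ 2 ∂P
  have hT : 0 ≤ T := integral_nonneg fun x => sq_nonneg _
  rw [tendsto_iff_norm_sub_tendsto_zero]
  have hlim : Tendsto (fun α : EuclideanSpace ℝ (Fin d) => (K + K * √T) * ‖α‖) (𝓝 0) (𝓝 0) := by
    have := (continuous_norm (E := EuclideanSpace ℝ (Fin d))).const_mul (K + K * √T)
    simpa using this.tendsto 0
  refine squeeze_zero' (Eventually.of_forall fun _ => norm_nonneg _) ?_ hlim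
  filter_upwards [h.expectation_expansion one_pos, h.isProbabilityMeasure] with α hα hprob
  have h1 := hα f K hK0 hf (hmem _ hprob).1 (hmem P ‹_›).1 (hmem _ hprob).2 (hmem P ‹_›).2
  have h2 : |∫ x, f x * inner ℝ α (ℓ x) ∂P| ≤ K * (‖α‖ * √T) := by
    refine abs_integral_mul_le_of_sq_le (hmem P ‹_›).1 (h.memLp_inner_score α) hK0 (by positivity)
      (hmem P ‹_›).2 ?_
    rw [mul_pow, Real.sq_sqrt hT, ← integral_const_mul]
    refine integral_mono (h.memLp_inner_score α).integrable_sq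
      (h.memLp_norm_score.integrable_sq.const_mul _) fun x => ?_
    beta_reduce
    rw [← mul_pow, sq_le_sq, abs_of_nonneg (by positivity : 0 ≤ ‖α‖ * ‖ℓ x‖)]
    exact abs_real_inner_le_norm _ _
  rw [Real.norm_eq_abs]
  rw [abs_le] at h1 h2 ⊢
  constructor <;> linarith [h1.1, h1.2, h2.1, h2.2]

/-- The characteristic function of an asymptotically linear estimator under local data generating
processes along which the parameter is differentiable with derivative given by the influence
function. -/
lemma tendsto_integral_cexp_of_pathwise {P : Measure 𝒳} {θ : ℝ} {k : ℕ → ℕ}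
    (hk : (fun n => (k n : ℝ)) =O[atTop] fun n => (n : ℝ))
    {est : ∀ n, Sample 𝒳 n (k n) → ℝ} (hest : ∀ n, 0 < n → Measurable (est n))
    {φ : 𝒳 → ℝ} (hφ : Measurable φ) (hAL : IsAsymptoticallyLinear P θ k est φ)
    {d : ℕ} {Pα : EuclideanSpace ℝ (Fin d) → Measure 𝒳} {θα : EuclideanSpace ℝ (Fin d) → ℝ}
    {ν : Measure 𝒳} {ℓ : 𝒳 → EuclideanSpace ℝ (Fin d)} (h : QMD P Pα ν ℓ)
    (hpath : (fun α => θα α - θ - ∫ x, φ x * inner ℝ α (ℓ x) ∂P) =o[𝓝 0] fun α => ‖α‖)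
    {α : ℕ → EuclideanSpace ℝ (Fin d)} {B : ℝ} (hα : ∀ n : ℕ, √n * ‖α n‖ ≤ B) (t : ℝ) :
    Tendsto (fun n : ℕ => ∫ s, Complex.exp (((t * (√n * (est n s - θα (α n))) : ℝ) : ℂ) * Complex.I)
      ∂(sampleLaw (Pα (α n)) n (k n))) atTop
      (𝓝 (Complex.exp ((-(t ^ 2 * (∫ x, φ x ^ 2 ∂P) / 2) : ℝ)))) := by
  have := h.isProbabilityMeasure_zero
  have hB : 0 ≤ B := le_trans (by positivity) (hα 0)
  have hα0 : Tendsto α atTop (𝓝 0) := tendsto_zero_of_sqrt_mul_norm_le hα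
  obtain ⟨C, hC, hcont⟩ := h.contiguity hα hk
  set σ2 := ∫ x, φ x ^ 2 ∂P with hσ2
  set T := ∫ x, ‖ℓ x‖ ^ 2 ∂P with hT
  have hT0 : 0 ≤ T := integral_nonneg fun x => sq_nonneg _
  rw [Metric.tendsto_nhds]
  intro ε₀ hε₀
  -- The error is at most `3 |t| ε` where the variables are close, `4 ε` from an event of
  -- probability at most `2 ε`, and `ε` each from the central limit theorem and from replacing `v`
  -- by `σ2`: in total `(3 |t| + 6) ε`.
  set ε : ℝ := ε₀ / (3 * |t| + 7) with hε
  have hεpos : 0 < ε := by positivity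
  -- With this choice contiguity turns a `P`-probability of at most `p` into a local probability of
  -- at most `ε + C √p = 2 ε`.
  set p : ℝ := (ε / C) ^ 2 with hp
  have hppos : 0 < p := by positivity
  have hcp : C * √p = ε := by
    rw [hp, Real.sqrt_sq (by positivity)]; field_simp
  have hexp : Continuous fun v : ℝ => Complex.exp ((-(t ^ 2 * v / 2) : ℝ)) := by fun_prop
  obtain ⟨δ₁, hδ₁, hδ₁v⟩ := Metric.continuous_iff.1 hexp σ2 ε hεpos
  obtain ⟨δ, hδ, hδ2, hδp, hδB⟩ : ∃ δ > 0, 2 * δ ^ 2 < δ₁ ∧ δ ^ 2 ≤ ε ^ 2 * (p / 2) ∧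
      B * √T * δ ≤ ε / 3 := by
    have h1 : ∀ᶠ δ : ℝ in 𝓝[>] 0, 2 * δ ^ 2 < δ₁ := by
      have : Continuous fun δ : ℝ => 2 * δ ^ 2 := by fun_prop
      exact nhdsWithin_le_nhds ((this.tendsto 0).eventually (gt_mem_nhds (by simpa using hδ₁)))
    have h2 : ∀ᶠ δ : ℝ in 𝓝[>] 0, δ ^ 2 < ε ^ 2 * (p / 2) := by
      have : Continuous fun δ : ℝ => δ ^ 2 := by fun_prop
      exact nhdsWithin_le_nhds ((this.tendsto 0).eventually
        (gt_mem_nhds (by simpa using by positivity)))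
    have h3 : ∀ᶠ δ : ℝ in 𝓝[>] 0, B * √T * δ < ε / 3 := by
      have : Continuous fun δ : ℝ => B * √T * δ := by fun_prop
      exact nhdsWithin_le_nhds ((this.tendsto 0).eventually
        (gt_mem_nhds (by simpa using by positivity)))
    obtain ⟨δ, ⟨⟨h1, h2⟩, h3⟩, h0⟩ := (((h1.and h2).and h3).and self_mem_nhdsWithin).exists
    exact ⟨δ, h0, h1, h2.le, h3.le⟩
  -- `φ` is square integrable under `P`, with nothing known under the local laws. Its tail `ψ`,
  -- centred at its `P`-mean, has a small empirical process under `P`; contiguity carries this,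
  -- together with the remainder of the linear expansion, to the local laws. Only the bounded part
  -- `φK` meets the central limit theorem.
  obtain ⟨K, hK, hKt⟩ := exists_tail_sq_le hφ hAL.memLp hδ
  set A : Set 𝒳 := {y | K < |φ y|} with hA
  have hAm : MeasurableSet A := measurableSet_lt measurable_const (continuous_abs.measurable.comp hφ)
  set ψ := A.indicator φ with hψ
  set φK := Aᶜ.indicator φ with hφK
  have hsum : ∀ x, φ x = φK x + ψ x := fun x => by
    rw [hψ, hφK, ← Pi.add_apply, Set.indicator_compl_add_self]
  have hψm : Measurable ψ := hφ.indicator hAm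
  have hφKm : Measurable φK := hφ.indicator hAm.compl
  have hψ2 : MemLp ψ 2 P := hAL.memLp.indicator hAm
  have hφKb : ∀ x, |φK x| ≤ K := by
    intro x
    by_cases hx : x ∈ A
    · simp [hφK, hx, hK.le]
    · rw [hφK, Set.indicator_of_mem (by exact hx : x ∈ Aᶜ)]
      exact not_lt.1 hx
  have hφKmem : ∀ μ : Measure 𝒳, IsProbabilityMeasure μ → MemLp φK 2 μ ∧
      ∫ x, φK x ^ 2 ∂μ ≤ K ^ 2 := by
    intro μ _
    have hm : MemLp φK 2 μ := MemLp.of_bound hφKm.aestronglyMeasurable K (Eventually.of_forall hφKb)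
    refine ⟨hm, ?_⟩
    calc ∫ x, φK x ^ 2 ∂μ ≤ ∫ _, K ^ 2 ∂μ :=
          integral_mono hm.integrable_sq (integrable_const _) fun x =>
            sq_le_sq.2 ((hφKb x).trans (le_abs_self K))
      _ = K ^ 2 := by simp
  have hφK2 : MemLp φK 2 P := (hφKmem P inferInstance).1
  have hmean : ∫ x, φK x ∂P = - ∫ x, ψ x ∂P := by
    have := hAL.mean_zero
    simp_rw [hsum] at this
    rw [integral_add (hφK2.integrable one_le_two) (hψ2.integrable one_le_two)] at this
    linarith
  have hmeanψ : (∫ x, ψ x ∂P) ^ 2 ≤ δ ^ 2 := by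
    have := abs_integral_mul_le_of_sq_le (ν := P) hψ2 (memLp_const (1 : ℝ)) hδ.le zero_le_one hKt
      (by simp)
    simp only [mul_one] at this
    rw [sq_le_sq, abs_of_pos hδ]
    exact this
  set v := ∫ x, φK x ^ 2 ∂P - (∫ x, φK x ∂P) ^ 2 with hv
  have hvσ : dist v σ2 < δ₁ := by
    have hsplit : σ2 = ∫ x, φK x ^ 2 ∂P + ∫ x, ψ x ^ 2 ∂P := by
      rw [hσ2, ← integral_add hφK2.integrable_sq hψ2.integrable_sq]
      refine integral_congr_ae (Eventually.of_forall fun x => ?_)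
      by_cases hx : x ∈ A <;> simp [hφK, hψ, hx]
    have h0 : 0 ≤ ∫ x, ψ x ^ 2 ∂P := integral_nonneg fun x => sq_nonneg _
    rw [Real.dist_eq, hv, hsplit, hmean, neg_sq, abs_lt]
    constructor <;> linarith [sq_nonneg (∫ x, ψ x ∂P)]
  have hvar : Tendsto (fun n => ∫ x, (φK x - ∫ y, φK y ∂(Pα (α n))) ^ 2 ∂(Pα (α n))) atTop
      (𝓝 v) := by
    have h1 := (h.tendsto_integral hφKm hφKb).comp hα0
    have h2 := (h.tendsto_integral (hφKm.pow_const 2) (K := K ^ 2) fun x => by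
      rw [abs_pow]; exact pow_le_pow_left₀ (abs_nonneg _) (hφKb x) 2).comp hα0
    refine (h2.sub (h1.pow 2)).congr' ?_
    filter_upwards [hα0.eventually h.isProbabilityMeasure] with n hn
    have hm := (hφKmem _ hn).1
    have := variance_eq_sub hm
    rw [variance_eq_integral hφKm.aemeasurable] at this
    simpa using this.symm
  have hclt := tendsto_integral_cexp_empirical (hα0.eventually h.isProbabilityMeasure) hφKm hφKb
    hvar t
  set ε₁ : ℝ := ε / (3 * (B + 1) * (K + 1)) with hε₁
  have hε₁pos : 0 < ε₁ := by positivity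
  have hε₁B : ε₁ * B ≤ ε / 3 := by
    rw [hε₁, div_mul_eq_mul_div, div_le_div_iff₀ (by positivity) (by norm_num)]
    have : B ≤ (B + 1) * (K + 1) := by nlinarith
    nlinarith
  have hε₁KB : ε₁ * K * B ≤ ε / 3 := by
    rw [hε₁, div_mul_eq_mul_div, div_mul_eq_mul_div,
      div_le_div_iff₀ (by positivity) (by norm_num)]
    have : K * B ≤ (B + 1) * (K + 1) := by nlinarith
    nlinarith
  have hAL' := hAL.expansion.eventually_le hεpos (half_pos hppos)
  filter_upwards [eventually_gt_atTop 0, hα0.eventually h.isProbabilityMeasure,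
    hα0.eventually (h.expectation_expansion hε₁pos), hα0.eventually (hpath.def hε₁pos),
    Metric.tendsto_nhds.1 hclt ε hεpos, hcont ε hεpos, hAL'] with n hn hprob hexpn hpathn hcltn
    hcontn hALn
  have hn0 : (0 : ℝ) ≤ n := Nat.cast_nonneg n
  have hsq : 0 < √(n : ℝ) := Real.sqrt_pos.2 (Nat.cast_pos.2 hn)
  set c := ∫ y, φK y ∂(Pα (α n)) with hc
  -- The deterministic drift. The parameter moves by about `∫ φ ⟨α, ℓ⟩ dP` and the mean of `φK` by
  -- about `∫ φK ⟨α, ℓ⟩ dP`; the two cancel up to the contribution of `ψ`, at most `δ √T ‖α n‖`.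
  -- This is where the gradient has to be the influence function, and it dispenses with the limit of
  -- the log-likelihood ratio.
  set D := √n * (θ - θα (α n)) + √n * (c - ∫ x, φK x ∂P) with hD
  have hDb : |D| ≤ ε := by
    have h1 := hexpn φK K hK.le hφKm (hφKmem _ hprob).1 hφK2 (hφKmem _ hprob).2
      (hφKmem P inferInstance).2
    have h2 : |∫ x, ψ x * inner ℝ (α n) (ℓ x) ∂P| ≤ δ * (‖α n‖ * √T) := by
      refine abs_integral_mul_le_of_sq_le hψ2 (h.memLp_inner_score _) hδ.le (by positivity) hKt ?_
      rw [mul_pow, Real.sq_sqrt hT0, ← integral_const_mul]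
      refine integral_mono (h.memLp_inner_score _).integrable_sq
        (h.memLp_norm_score.integrable_sq.const_mul _) fun x => ?_
      beta_reduce
      rw [← mul_pow, sq_le_sq, abs_of_nonneg (by positivity : 0 ≤ ‖α n‖ * ‖ℓ x‖)]
      exact abs_real_inner_le_norm _ _
    have h3 : ∫ x, φ x * inner ℝ (α n) (ℓ x) ∂P =
        ∫ x, φK x * inner ℝ (α n) (ℓ x) ∂P + ∫ x, ψ x * inner ℝ (α n) (ℓ x) ∂P := by
      rw [← integral_add]
      · refine integral_congr_ae (Eventually.of_forall fun x => ?_)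
        beta_reduce
        rw [hsum x]; ring
      · exact hφK2.integrable_mul (h.memLp_inner_score _)
      · exact hψ2.integrable_mul (h.memLp_inner_score _)
    rw [h3, Real.norm_eq_abs, norm_norm] at hpathn
    have hb := hα n
    have hDeq : D = √n * -(θα (α n) - θ - (∫ x, φK x * inner ℝ (α n) (ℓ x) ∂P
        + ∫ x, ψ x * inner ℝ (α n) (ℓ x) ∂P)) +
        √n * (c - ∫ x, φK x ∂P - ∫ x, φK x * inner ℝ (α n) (ℓ x) ∂P) -
        √n * ∫ x, ψ x * inner ℝ (α n) (ℓ x) ∂P := by rw [hD]; ring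
    rw [hDeq]
    refine (abs_sub _ _).trans ?_
    refine (add_le_add (abs_add_le _ _) le_rfl).trans ?_
    rw [abs_mul, abs_mul, abs_mul, abs_of_pos hsq, abs_neg]
    have g1 := mul_le_mul_of_nonneg_left hpathn hsq.le
    have g2 := mul_le_mul_of_nonneg_left h1 hsq.le
    have g3 := mul_le_mul_of_nonneg_left h2 hsq.le
    have k1 := mul_le_mul_of_nonneg_left hb hε₁pos.le
    have k2 := mul_le_mul_of_nonneg_left hb (by positivity : 0 ≤ ε₁ * K)
    have k3 := mul_le_mul_of_nonneg_left hb (by positivity : 0 ≤ √T * δ)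
    linarith
  set E : Set (Sample 𝒳 n (k n)) :=
    {s | ENNReal.ofReal ε ≤ ‖√n * (est n s - θ) - (√n)⁻¹ * ∑ i, φ (s.1 i)‖ₑ} ∪
    {s | s.1 ∈ {x | ε ≤ |empirical P n ψ x|}} with hE
  have hPE : sampleLaw P n (k n) E ≤ ENNReal.ofReal p := by
    calc sampleLaw P n (k n) E ≤ ENNReal.ofReal (p / 2) + ENNReal.ofReal (p / 2) := by
          refine (measure_union_le _ _).trans (add_le_add hALn ?_)
          refine (sampleLaw_preimage_fst_le _).trans
            ((measure_empirical_ge_le hψ2 n hεpos).trans (ENNReal.ofReal_le_ofReal ?_))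
          rw [div_le_iff₀ (by positivity), mul_comm]
          exact hKt.trans hδp
      _ = ENNReal.ofReal p := by
          rw [← ENNReal.ofReal_add (by positivity) (by positivity), add_halves]
  have hαE := hcontn E p hppos.le hPE
  rw [hcp] at hαE
  have hμprob : IsProbabilityMeasure (sampleLaw (Pα (α n)) n (k n)) := by
    unfold sampleLaw; infer_instance
  have hX : Measurable fun s : Sample 𝒳 n (k n) => √n * (est n s - θα (α n)) :=
    ((hest n hn).sub_const _).const_mul _
  have hY : Measurable fun s : Sample 𝒳 n (k n) => empirical (Pα (α n)) n φK s.1 :=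
    (measurable_empirical hφKm n).comp measurable_fst
  have hdiff := norm_integral_cexp_sub_le (μ := sampleLaw (Pα (α n)) n (k n)) hX hY t
    (ε := 3 * ε) (by positivity)
  have hsub : {s : Sample 𝒳 n (k n) | 3 * ε ≤ |√n * (est n s - θα (α n)) -
      empirical (Pα (α n)) n φK s.1|} ⊆ E := by
    intro s hs
    by_contra hcon
    simp only [hE, Set.mem_union, Set.mem_ofPred_eq, not_or, not_le] at hcon hs
    obtain ⟨c1, c2⟩ := hcon
    rw [Real.enorm_eq_ofReal_abs, ENNReal.ofReal_lt_ofReal_iff hεpos] at c1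
    have hdec : √n * (est n s - θα (α n)) - empirical (Pα (α n)) n φK s.1 =
        (√n * (est n s - θ) - (√n)⁻¹ * ∑ i, φ (s.1 i)) + empirical P n ψ s.1 + D := by
      simp only [empirical, hD, hmean, hsum, ← hc, Finset.sum_sub_distrib, Finset.sum_add_distrib,
        Finset.sum_const, Finset.card_univ, Fintype.card_fin, nsmul_eq_mul]
      field_simp
      rw [Real.sq_sqrt hn0]
      ring
    rw [hdec] at hs
    have := (abs_add_le ((√n * (est n s - θ) - (√n)⁻¹ * ∑ i, φ (s.1 i)) + empirical P n ψ s.1) D)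
    have := abs_add_le (√n * (est n s - θ) - (√n)⁻¹ * ∑ i, φ (s.1 i)) (empirical P n ψ s.1)
    linarith
  have hreal : (sampleLaw (Pα (α n)) n (k n)).real {s : Sample 𝒳 n (k n) | 3 * ε ≤
      |√n * (est n s - θα (α n)) - empirical (Pα (α n)) n φK s.1|} ≤ ε + ε :=
    ENNReal.toReal_le_of_le_ofReal (by positivity) ((measure_mono hsub).trans hαE)
  have hfst : ∫ s, Complex.exp (((t * empirical (Pα (α n)) n φK s.1 : ℝ) : ℂ) * Complex.I)
      ∂(sampleLaw (Pα (α n)) n (k n)) =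
      ∫ x, Complex.exp (((t * empirical (Pα (α n)) n φK x : ℝ) : ℂ) * Complex.I)
        ∂(Measure.pi fun _ : Fin n => Pα (α n)) := by
    unfold sampleLaw
    rw [integral_fun_fst fun x : Fin n → 𝒳 =>
      Complex.exp (((t * empirical (Pα (α n)) n φK x : ℝ) : ℂ) * Complex.I)]
    simp
  rw [hfst] at hdiff
  rw [dist_eq_norm] at hcltn ⊢
  have hfin := hδ₁v v hvσ
  rw [dist_eq_norm] at hfin
  refine (norm_sub_le_norm_sub_add_norm_sub _ (∫ x, Complex.exp (((t * empirical (Pα (α n)) n φK x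
    : ℝ) : ℂ) * Complex.I) ∂(Measure.pi fun _ : Fin n => Pα (α n))) _).trans_lt ?_
  have htri := norm_sub_le_norm_sub_add_norm_sub (∫ x, Complex.exp (((t *
    empirical (Pα (α n)) n φK x : ℝ) : ℂ) * Complex.I) ∂(Measure.pi fun _ : Fin n => Pα (α n)))
    (Complex.exp ((-(t ^ 2 * v / 2) : ℝ))) (Complex.exp ((-(t ^ 2 * σ2 / 2) : ℝ)))
  have hε₀eq : ε₀ = ε * (3 * |t| + 7) := by rw [hε]; field_simp
  rw [hε₀eq]
  linarith

/-- An asymptotically linear estimator is regular if its influence function is the pathwise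
derivative of the parameter along every submodel. -/
theorem isRegularEstimator_of_pathwise {𝓜 : Set (Measure 𝒳 × ℝ)}
    (h𝓜 : ∀ q ∈ 𝓜, IsProbabilityMeasure q.1) {P : Measure 𝒳} {θ : ℝ}
    {k : ℕ → ℕ} (hk : (fun n => (k n : ℝ)) =O[atTop] fun n => (n : ℝ))
    {est : ∀ n, Sample 𝒳 n (k n) → ℝ} (hest : ∀ n, 0 < n → Measurable (est n))
    {φ : 𝒳 → ℝ} (hφ : Measurable φ) (hAL : IsAsymptoticallyLinear P θ k est φ)
    (hpath : ∀ (d : ℕ) (Pα : EuclideanSpace ℝ (Fin d) → Measure 𝒳)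
      (θα : EuclideanSpace ℝ (Fin d) → ℝ) (ν : Measure 𝒳) (ℓ : 𝒳 → EuclideanSpace ℝ (Fin d)),
      IsRegularSubmodel 𝓜 P θ d Pα θα → QMD P Pα ν ℓ →
      (fun α => θα α - θ - ∫ x, φ x * inner ℝ α (ℓ x) ∂P) =o[𝓝 0] fun α => ‖α‖) :
    IsRegularEstimator 𝓜 P θ k est := by
  -- The limit depends on `φ` and `P` only, hence is common to all submodels and local sequences.
  refine ⟨gaussianReal 0 (∫ x, φ x ^ 2 ∂P).toNNReal, inferInstance, ?_⟩
  intro d Pα θα hsub α ⟨B, hα⟩ H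
  obtain ⟨ν, ℓ, h⟩ := hsub.exists_qmd h𝓜
  have hcf := tendsto_integral_cexp_of_pathwise hk hest hφ hAL h
    (hpath d Pα θα ν ℓ hsub h) hα
  have hα0 : Tendsto α atTop (𝓝 0) := tendsto_zero_of_sqrt_mul_norm_le hα
  let X : ∀ n, Sample 𝒳 n (k n) → ℝ := fun n s => √n * (est n s - θα (α n))
  have hgood : ∀ᶠ n in atTop, 0 < n ∧ IsProbabilityMeasure (sampleLaw (Pα (α n)) n (k n)) := by
    filter_upwards [eventually_gt_atTop 0, hα0.eventually h.isProbabilityMeasure] with n hn hp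
    exact ⟨hn, by unfold sampleLaw; infer_instance⟩
  have hX : ∀ n, 0 < n → Measurable (X n) := fun n hn => ((hest n hn).sub_const _).const_mul _
  classical
  -- At `n = 0` the estimator may fail to be measurable, and for small `n` the local law may lie
  -- outside the model; a Dirac mass fills in for these finitely many terms.
  let μ : ℕ → ProbabilityMeasure ℝ := fun n =>
    if hn : 0 < n ∧ IsProbabilityMeasure (sampleLaw (Pα (α n)) n (k n)) then
      ⟨(sampleLaw (Pα (α n)) n (k n)).map (X n),
        have := hn.2
        Measure.isProbabilityMeasure_map (hX n hn.1).aemeasurable⟩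
    else ⟨Measure.dirac 0, inferInstance⟩
  have hμ : ∀ᶠ n in atTop, ((μ n : ProbabilityMeasure ℝ) : Measure ℝ) =
      (sampleLaw (Pα (α n)) n (k n)).map (X n) ∧ 0 < n := by
    filter_upwards [hgood] with n hn
    refine ⟨?_, hn.1⟩
    have : μ n = _ := dif_pos hn
    rw [this]
    rfl
  let μ₀ : ProbabilityMeasure ℝ :=
    ⟨gaussianReal 0 (∫ x, φ x ^ 2 ∂P).toNNReal, inferInstance⟩
  have hlevy : Tendsto μ atTop (𝓝 μ₀) := by
    rw [ProbabilityMeasure.tendsto_iff_tendsto_charFun]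
    intro t
    have hlim : charFun (μ₀ : Measure ℝ) t =
        Complex.exp ((-(t ^ 2 * (∫ x, φ x ^ 2 ∂P) / 2) : ℝ)) := by
      change charFun (gaussianReal 0 (∫ x, φ x ^ 2 ∂P).toNNReal) t = _
      rw [charFun_gaussianReal]
      congr 1
      rw [Real.coe_toNNReal _ (integral_nonneg fun x => sq_nonneg _)]
      push_cast
      ring
    rw [hlim]
    refine (hcf t).congr' ?_
    filter_upwards [hμ] with n hn
    rw [hn.1, charFun_apply_real, integral_map (hX n hn.2).aemeasurable (by fun_prop)]
    refine integral_congr_ae (Eventually.of_forall fun s => ?_)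
    simp only [X]
    push_cast
    rfl
  have := (ProbabilityMeasure.tendsto_iff_forall_integral_tendsto.1 hlevy) H
  refine this.congr' ?_
  filter_upwards [hμ] with n hn
  rw [hn.1, integral_map (hX n hn.2).aemeasurable H.continuous.measurable.aestronglyMeasurable]

end Regularity

/-! ### Elementary conditioning on a countable-valued variable. -/

section Disintegration

variable {𝒳 𝒯 : Type*} [MeasurableSpace 𝒳] [MeasurableSpace 𝒯] [DiscreteMeasurableSpace 𝒯]
  [Countable 𝒯] {P : Measure 𝒳} [IsFiniteMeasure P] {T : 𝒳 → 𝒯}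

/-- Here `κ` is the conditional probability of `D` given `T`. On a countable space it suffices to
compare masses of points, so no conditional kernels are involved. -/
lemma map_restrict_eq_map_withDensity (hT : Measurable T) {D : Set 𝒳}
    {κ : 𝒯 → ℝ} (hκ0 : ∀ c, 0 ≤ κ c)
    (hκ : ∀ c, P.real (D ∩ {x | T x = c}) = κ c * P.real {x | T x = c}) :
    (P.restrict D).map T = (P.withDensity fun x => ENNReal.ofReal (κ (T x))).map T := by
  refine Measure.ext_of_singleton fun c => ?_
  have hc : MeasurableSet {x | T x = c} := hT (measurableSet_singleton c)
  rw [Measure.map_apply hT (measurableSet_singleton c),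
    Measure.map_apply hT (measurableSet_singleton c)]
  change (P.restrict D) {x | T x = c} = (P.withDensity _) {x | T x = c}
  rw [Measure.restrict_apply hc, withDensity_apply _ hc, Set.inter_comm]
  have : ∫⁻ x in {x | T x = c}, ENNReal.ofReal (κ (T x)) ∂P =
      ∫⁻ _ in {x | T x = c}, ENNReal.ofReal (κ c) ∂P :=
    setLIntegral_congr_fun hc fun x hx => by
      have hx' : T x = c := hx
      simp only [hx']
  rw [this, setLIntegral_const, ← ofReal_measureReal, hκ c, ENNReal.ofReal_mul (hκ0 c),
    ofReal_measureReal]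

lemma setLIntegral_comp_eq (hT : Measurable T) {D : Set 𝒳}
    {κ : 𝒯 → ℝ} (hκ0 : ∀ c, 0 ≤ κ c)
    (hκ : ∀ c, P.real (D ∩ {x | T x = c}) = κ c * P.real {x | T x = c}) (G : 𝒯 → ℝ≥0∞) :
    ∫⁻ x in D, G (T x) ∂P = ∫⁻ x, ENNReal.ofReal (κ (T x)) * G (T x) ∂P := by
  have hG : Measurable G := .of_discrete
  have hGT : Measurable fun x => G (T x) := hG.comp hT
  have hκm : Measurable fun x => ENNReal.ofReal (κ (T x)) :=
    (Measurable.of_discrete (f := fun c => ENNReal.ofReal (κ c))).comp hT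
  rw [← lintegral_map hG hT, map_restrict_eq_map_withDensity hT hκ0 hκ, lintegral_map hG hT,
    lintegral_withDensity_eq_lintegral_mul _ hκm hGT]
  rfl

lemma setIntegral_comp_eq (hT : Measurable T) {D : Set 𝒳}
    {κ : 𝒯 → ℝ} (hκ0 : ∀ c, 0 ≤ κ c)
    (hκ : ∀ c, P.real (D ∩ {x | T x = c}) = κ c * P.real {x | T x = c}) (G : 𝒯 → ℝ) :
    ∫ x in D, G (T x) ∂P = ∫ x, κ (T x) * G (T x) ∂P := by
  have hG : Measurable G := .of_discrete
  have hκm : Measurable fun x => ENNReal.ofReal (κ (T x)) :=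
    (Measurable.of_discrete (f := fun c => ENNReal.ofReal (κ c))).comp hT
  rw [← integral_map hT.aemeasurable hG.aestronglyMeasurable,
    map_restrict_eq_map_withDensity hT hκ0 hκ,
    integral_map hT.aemeasurable hG.aestronglyMeasurable,
    integral_withDensity_eq_integral_toReal_smul hκm (Eventually.of_forall fun x => by simp)]
  refine integral_congr_ae (Eventually.of_forall fun x => ?_)
  simp only [ENNReal.toReal_ofReal (hκ0 _), smul_eq_mul]

omit [IsFiniteMeasure P] in
lemma integral_eq_zero_of_fibers (hT : Measurable T) {f : 𝒳 → ℝ} (hf : Integrable f P)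
    (h : ∀ c, ∫ x in {x | T x = c}, f x ∂P = 0) : ∫ x, f x ∂P = 0 := by
  have hc : ∀ c, MeasurableSet {x | T x = c} := fun c => hT (measurableSet_singleton c)
  have hU : (⋃ c, {x | T x = c}) = Set.univ := by
    ext x; simp
  rw [← setIntegral_univ, ← hU, integral_iUnion hc _
    (hf.integrableOn)]
  · simp [h]
  · intro c c' hcc'
    exact Set.disjoint_left.2 fun x hx hx' => hcc' (by
      rw [← (show T x = c from hx), ← (show T x = c' from hx')])

/-- The two measures may differ: this allows an integral of conditional quantities under a law to be
compared with a Hellinger integral under the dominating measure. -/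
lemma lintegral_le_of_fibers {μ ν : Measure 𝒳} (hT : Measurable T) {f g : 𝒳 → ℝ≥0∞}
    (h : ∀ c, ∫⁻ x in {x | T x = c}, f x ∂μ ≤ ∫⁻ x in {x | T x = c}, g x ∂ν) :
    ∫⁻ x, f x ∂μ ≤ ∫⁻ x, g x ∂ν := by
  have hc : ∀ c, MeasurableSet {x | T x = c} := fun c => hT (measurableSet_singleton c)
  have hU : (⋃ c, {x | T x = c}) = Set.univ := by
    ext x; simp
  have hd : Pairwise (Function.onFun Disjoint fun c => {x | T x = c}) := fun c c' hcc' =>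
    Set.disjoint_left.2 fun x hx hx' => hcc' (by
      rw [← (show T x = c from hx), ← (show T x = c' from hx')])
  rw [← setLIntegral_univ, ← setLIntegral_univ (μ := ν) g, ← hU,
    lintegral_iUnion hc hd, lintegral_iUnion hc hd]
  exact ENNReal.tsum_le_tsum h

end Disintegration

/-! ### The law of `(C, A, Z, Y)` and its conditional probabilities. -/

section ObservedLaw

set_option linter.unusedSectionVars false

variable {𝒜 𝒵 𝒞 : Type u} [MeasurableSpace 𝒜] [MeasurableSpace 𝒵] [MeasurableSpace 𝒞]

namespace ObsTD

lemma measurable_A : Measurable (ObsTD.A : ObsTD 𝒜 𝒵 𝒞 → 𝒜) := measurable_fst.comp measurable_snd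

lemma measurable_Z : Measurable (ObsTD.Z : ObsTD 𝒜 𝒵 𝒞 → 𝒵) :=
  measurable_fst.comp (measurable_snd.comp measurable_snd)

lemma measurable_C : Measurable (ObsTD.C : ObsTD 𝒜 𝒵 𝒞 → 𝒞) := measurable_fst

lemma measurable_Y : Measurable (ObsTD.Y : ObsTD 𝒜 𝒵 𝒞 → ℝ) :=
  measurable_snd.comp (measurable_snd.comp measurable_snd)

/-- The discrete part `(A, Z, C)` of an observation. -/
def AZC (x : ObsTD 𝒜 𝒵 𝒞) : 𝒜 × 𝒵 × 𝒞 := (x.A, x.Z, x.C)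

lemma measurable_AZC : Measurable (AZC : ObsTD 𝒜 𝒵 𝒞 → 𝒜 × 𝒵 × 𝒞) :=
  measurable_A.prodMk (measurable_Z.prodMk measurable_C)

end ObsTD

variable [DiscreteMeasurableSpace 𝒜] [Countable 𝒜] [DiscreteMeasurableSpace 𝒵] [Countable 𝒵]
  [DiscreteMeasurableSpace 𝒞] [Countable 𝒞]

lemma measurable_comp_AZC {E : Type*} [MeasurableSpace E] (g : 𝒜 → 𝒵 → 𝒞 → E) :
    Measurable fun x : ObsTD 𝒜 𝒵 𝒞 => g x.A x.Z x.C :=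
  (Measurable.of_discrete (f := fun w : 𝒜 × 𝒵 × 𝒞 => g w.1 w.2.1 w.2.2)).comp ObsTD.measurable_AZC

lemma measurableSet_AZC (s : 𝒜 → 𝒵 → 𝒞 → Prop) :
    MeasurableSet {x : ObsTD 𝒜 𝒵 𝒞 | s x.A x.Z x.C} :=
  measurableSet_setOfPred.2 (measurable_comp_AZC s)

variable {P : Measure (ObsTD 𝒜 𝒵 𝒞)}

lemma trueNuisanceTD_mediator [IsFiniteMeasure P] (z : 𝒵) (a : 𝒜) (c : 𝒞) :
    (trueNuisanceTD P).mediator z a c =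
      P.real {x | x.A = a ∧ x.Z = z ∧ x.C = c} / P.real {x | x.A = a ∧ x.C = c} := by
  have hs : MeasurableSet {x : ObsTD 𝒜 𝒵 𝒞 | x.A = a ∧ x.C = c} :=
    measurableSet_AZC fun a' _ c' => a' = a ∧ c' = c
  have hi : {x : ObsTD 𝒜 𝒵 𝒞 | x.A = a ∧ x.C = c} ∩ {x | x.Z = z} =
      {x | x.A = a ∧ x.Z = z ∧ x.C = c} := by
    ext x; simp only [Set.mem_inter_iff, Set.mem_ofPred_eq]; tauto
  simp only [trueNuisanceTD]
  rw [measureReal_def, cond_apply hs, hi, ENNReal.toReal_mul, ENNReal.toReal_inv, div_eq_inv_mul]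
  rfl

lemma trueNuisanceTD_propensity [IsFiniteMeasure P] (a : 𝒜) (c : 𝒞) :
    (trueNuisanceTD P).propensity a c =
      P.real {x | x.A = a ∧ x.C = c} / P.real {x | x.C = c} := by
  have hs : MeasurableSet {x : ObsTD 𝒜 𝒵 𝒞 | x.C = c} := measurableSet_AZC fun _ _ c' => c' = c
  have hi : {x : ObsTD 𝒜 𝒵 𝒞 | x.C = c} ∩ {x | x.A = a} = {x | x.A = a ∧ x.C = c} := by
    ext x; simp only [Set.mem_inter_iff, Set.mem_ofPred_eq]; tauto
  simp only [trueNuisanceTD]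
  rw [measureReal_def, cond_apply hs, hi, ENNReal.toReal_mul, ENNReal.toReal_inv, div_eq_inv_mul]
  rfl

/-- Positivity of a law of `(C, A, Z, Y)`, with lower bound `ε` on the conditional probabilities. -/
structure PositiveLaw (P : Measure (ObsTD 𝒜 𝒵 𝒞)) (ε : ℝ) : Prop where
  eps_pos : 0 < ε
  cell_pos : ∀ a z c, 0 < P {x | x.A = a ∧ x.Z = z ∧ x.C = c}
  mediator : ∀ z a c, ε < (trueNuisanceTD P).mediator z a c
  propensity : ∀ a c, ε < (trueNuisanceTD P).propensity a c

/-- Every cell is charged, so a null set contains no cell. This upgrades almost sure bounds on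
functions of `(A, Z, C)` to bounds everywhere. -/
lemma forall_of_ae_AZC (hpos : ∀ a z c, 0 < P {x | x.A = a ∧ x.Z = z ∧ x.C = c})
    {p : 𝒜 → 𝒵 → 𝒞 → Prop} (h : ∀ᵐ x ∂P, p x.A x.Z x.C) (a : 𝒜) (z : 𝒵) (c : 𝒞) : p a z c := by
  by_contra hcon
  refine (hpos a z c).ne' (measure_mono_null ?_ (ae_iff.1 h))
  rintro x ⟨rfl, rfl, rfl⟩
  exact hcon

namespace PositiveLaw

variable [IsProbabilityMeasure P] {ε : ℝ} (h : PositiveLaw P ε)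

include h

lemma cell_real_pos (a : 𝒜) (z : 𝒵) (c : 𝒞) : 0 < P.real {x | x.A = a ∧ x.Z = z ∧ x.C = c} :=
  ENNReal.toReal_pos (h.cell_pos a z c).ne' (measure_ne_top _ _)

lemma nonempty_Z : Nonempty 𝒵 := by
  obtain ⟨x⟩ : Nonempty (ObsTD 𝒜 𝒵 𝒞) := nonempty_of_isProbabilityMeasure P
  exact ⟨x.Z⟩

lemma nonempty_A : Nonempty 𝒜 := by
  obtain ⟨x⟩ : Nonempty (ObsTD 𝒜 𝒵 𝒞) := nonempty_of_isProbabilityMeasure P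
  exact ⟨x.A⟩

lemma nonempty_C : Nonempty 𝒞 := by
  obtain ⟨x⟩ : Nonempty (ObsTD 𝒜 𝒵 𝒞) := nonempty_of_isProbabilityMeasure P
  exact ⟨x.C⟩

lemma AC_real_pos (a : 𝒜) (c : 𝒞) : 0 < P.real {x | x.A = a ∧ x.C = c} := by
  obtain ⟨z⟩ := h.nonempty_Z
  exact (h.cell_real_pos a z c).trans_le (measureReal_mono fun x hx => ⟨hx.1, hx.2.2⟩)

lemma C_real_pos (c : 𝒞) : 0 < P.real {x | x.C = c} := by
  obtain ⟨a⟩ := h.nonempty_A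
  exact (h.AC_real_pos a c).trans_le (measureReal_mono fun x hx => hx.2)

lemma mediator_pos (z : 𝒵) (a : 𝒜) (c : 𝒞) : 0 < (trueNuisanceTD P).mediator z a c :=
  h.eps_pos.trans (h.mediator z a c)

lemma propensity_pos (a : 𝒜) (c : 𝒞) : 0 < (trueNuisanceTD P).propensity a c :=
  h.eps_pos.trans (h.propensity a c)

lemma mediator_le_one (z : 𝒵) (a : 𝒜) (c : 𝒞) : (trueNuisanceTD P).mediator z a c ≤ 1 := by
  rw [trueNuisanceTD_mediator, div_le_one (h.AC_real_pos a c)]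
  exact measureReal_mono fun x hx => ⟨hx.1, hx.2.2⟩

lemma propensity_le_one (a : 𝒜) (c : 𝒞) : (trueNuisanceTD P).propensity a c ≤ 1 := by
  rw [trueNuisanceTD_propensity, div_le_one (h.C_real_pos c)]
  exact measureReal_mono fun x hx => hx.2

lemma cell_real_eq (a : 𝒜) (z : 𝒵) (c : 𝒞) : P.real {x | x.A = a ∧ x.Z = z ∧ x.C = c} =
    (trueNuisanceTD P).propensity a c * (trueNuisanceTD P).mediator z a c *
      P.real {x | x.C = c} := by
  rw [trueNuisanceTD_mediator, trueNuisanceTD_propensity]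
  have h1 := (h.AC_real_pos a c).ne'
  have h2 := (h.C_real_pos c).ne'
  field_simp

/-- Within a stratum of `C` the events `A = a` are disjoint and each has conditional probability
above `ε`. Together with the same fact for the mediator, this makes all inner sums of the influence
function finite. -/
lemma finite_A : Finite 𝒜 := by
  obtain ⟨c⟩ := h.nonempty_C
  have hs : MeasurableSet {x : ObsTD 𝒜 𝒵 𝒞 | x.C = c} := measurableSet_AZC fun _ _ c' => c' = c
  have := Measure.finite_const_le_meas_of_disjoint_iUnion
    (cond P {x : ObsTD 𝒜 𝒵 𝒞 | x.C = c}) (ENNReal.ofReal_pos.2 h.eps_pos)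
    (As := fun a => {x : ObsTD 𝒜 𝒵 𝒞 | x.A = a})
    (fun a => measurableSet_AZC fun a' _ _ => a' = a)
    (fun a a' haa' => Set.disjoint_left.2 fun x hx hx' => haa' (by
      rw [← (show x.A = a from hx), ← (show x.A = a' from hx')])) (measure_ne_top _ _)
  refine Set.finite_univ_iff.1 (this.subset fun a _ => ?_)
  change ENNReal.ofReal ε ≤ _
  rw [← ofReal_measureReal]
  exact ENNReal.ofReal_le_ofReal (h.propensity a c).le

lemma finite_Z : Finite 𝒵 := by
  obtain ⟨c⟩ := h.nonempty_C
  obtain ⟨a⟩ := h.nonempty_A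
  have := Measure.finite_const_le_meas_of_disjoint_iUnion
    (cond P {x : ObsTD 𝒜 𝒵 𝒞 | x.A = a ∧ x.C = c}) (ENNReal.ofReal_pos.2 h.eps_pos)
    (As := fun z => {x : ObsTD 𝒜 𝒵 𝒞 | x.Z = z})
    (fun a => measurableSet_AZC fun _ z' _ => z' = a)
    (fun a a' haa' => Set.disjoint_left.2 fun x hx hx' => haa' (by
      rw [← (show x.Z = a from hx), ← (show x.Z = a' from hx')])) (measure_ne_top _ _)
  refine Set.finite_univ_iff.1 (this.subset fun z _ => ?_)
  change ENNReal.ofReal ε ≤ _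
  rw [← ofReal_measureReal]
  exact ENNReal.ofReal_le_ofReal (h.mediator z a c).le

lemma sum_mediator [Fintype 𝒵] (a : 𝒜) (c : 𝒞) :
    ∑ z, (trueNuisanceTD P).mediator z a c = 1 := by
  simp_rw [trueNuisanceTD_mediator, ← Finset.sum_div]
  rw [div_eq_one_iff_eq (h.AC_real_pos a c).ne']
  have hU : {x : ObsTD 𝒜 𝒵 𝒞 | x.A = a ∧ x.C = c} =
      ⋃ z, {x | x.A = a ∧ x.Z = z ∧ x.C = c} := by
    ext x; simp
  rw [hU, measureReal_iUnion_fintype]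
  · intro z z' hzz'
    exact Set.disjoint_left.2 fun x hx hx' => hzz' (by rw [← hx.2.1, ← hx'.2.1])
  · exact fun z => measurableSet_AZC fun a' z' c' => a' = a ∧ z' = z ∧ c' = c

/-- Integration of a nonnegative function of `(A, Z, C)`. -/
lemma lintegral_AZC [Fintype 𝒜] [Fintype 𝒵] (g : 𝒜 → 𝒵 → 𝒞 → ℝ≥0∞) :
    ∫⁻ x, g x.A x.Z x.C ∂P = ∑ a, ∑ z, ∫⁻ x, ENNReal.ofReal ((trueNuisanceTD P).propensity a x.C *
      (trueNuisanceTD P).mediator z a x.C) * g a z x.C ∂P := by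
  classical
  have hD : ∀ a z, MeasurableSet {x : ObsTD 𝒜 𝒵 𝒞 | x.A = a ∧ x.Z = z} := fun a z =>
    measurableSet_AZC fun a' z' _ => a' = a ∧ z' = z
  have hcell : ∀ a z, ∫⁻ x in {x : ObsTD 𝒜 𝒵 𝒞 | x.A = a ∧ x.Z = z}, g a z x.C ∂P =
      ∫⁻ x, ENNReal.ofReal ((trueNuisanceTD P).propensity a x.C *
        (trueNuisanceTD P).mediator z a x.C) * g a z x.C ∂P := by
    intro a z
    refine setLIntegral_comp_eq (T := ObsTD.C) ObsTD.measurable_C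
      (κ := fun c => (trueNuisanceTD P).propensity a c * (trueNuisanceTD P).mediator z a c)
      (fun c => mul_nonneg (h.propensity_pos a c).le (h.mediator_pos z a c).le) (fun c => ?_)
      fun c => g a z c
    rw [← h.cell_real_eq a z c]
    congr 1
    ext x; simp only [Set.mem_inter_iff, Set.mem_ofPred_eq]; tauto
  simp_rw [← hcell, ← lintegral_indicator (hD _ _)]
  rw [← Fintype.sum_prod_type' fun a z => ∫⁻ x, {x : ObsTD 𝒜 𝒵 𝒞 | x.A = a ∧ x.Z = z}.indicator
    (fun x => g a z x.C) x ∂P, ← lintegral_finsetSum]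
  · refine lintegral_congr fun x => ?_
    rw [Finset.sum_eq_single (x.A, x.Z)]
    · simp
    · rintro ⟨a, z⟩ - hne
      exact Set.indicator_of_notMem (fun hx => hne (Prod.ext hx.1.symm hx.2.symm)) _
    · simp
  · exact fun w _ => (measurable_comp_AZC fun _ _ c => g w.1 w.2 c).indicator (hD _ _)

/-- Integration of a bounded function of `(A, Z, C)`. -/
lemma integral_AZC [Fintype 𝒜] [Fintype 𝒵] {g : 𝒜 → 𝒵 → 𝒞 → ℝ} {K : ℝ}
    (hg : ∀ a z c, |g a z c| ≤ K) :
    ∫ x, g x.A x.Z x.C ∂P = ∫ x, ∑ a, ∑ z, (trueNuisanceTD P).propensity a x.C *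
      (trueNuisanceTD P).mediator z a x.C * g a z x.C ∂P := by
  classical
  have hD : ∀ a z, MeasurableSet {x : ObsTD 𝒜 𝒵 𝒞 | x.A = a ∧ x.Z = z} := fun a z =>
    measurableSet_AZC fun a' z' _ => a' = a ∧ z' = z
  have hcell : ∀ a z, ∫ x in {x : ObsTD 𝒜 𝒵 𝒞 | x.A = a ∧ x.Z = z}, g a z x.C ∂P =
      ∫ x, (trueNuisanceTD P).propensity a x.C *
        (trueNuisanceTD P).mediator z a x.C * g a z x.C ∂P := by
    intro a z
    refine setIntegral_comp_eq (T := ObsTD.C) ObsTD.measurable_C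
      (κ := fun c => (trueNuisanceTD P).propensity a c * (trueNuisanceTD P).mediator z a c)
      (fun c => mul_nonneg (h.propensity_pos a c).le (h.mediator_pos z a c).le) (fun c => ?_)
      fun c => g a z c
    rw [← h.cell_real_eq a z c]
    congr 1
    ext x; simp only [Set.mem_inter_iff, Set.mem_ofPred_eq]; tauto
  have hgi : ∀ a z, Integrable (fun x : ObsTD 𝒜 𝒵 𝒞 => g a z x.C) P := fun a z =>
    Integrable.of_bound (measurable_comp_AZC fun _ _ c => g a z c).aestronglyMeasurable K
      (Eventually.of_forall fun x => hg _ _ _)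
  have hK : 0 ≤ K := by
    obtain ⟨a⟩ := h.nonempty_A
    obtain ⟨z⟩ := h.nonempty_Z
    obtain ⟨c⟩ := h.nonempty_C
    exact (abs_nonneg _).trans (hg a z c)
  have hgi' : ∀ a z, Integrable (fun x : ObsTD 𝒜 𝒵 𝒞 => (trueNuisanceTD P).propensity a x.C *
      (trueNuisanceTD P).mediator z a x.C * g a z x.C) P := fun a z =>
    Integrable.of_bound (measurable_comp_AZC fun _ _ c => (trueNuisanceTD P).propensity a c *
      (trueNuisanceTD P).mediator z a c * g a z c).aestronglyMeasurable K
      (Eventually.of_forall fun x => by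
        rw [norm_mul, Real.norm_of_nonneg (mul_nonneg (h.propensity_pos a _).le
          (h.mediator_pos z a _).le)]
        have := mul_le_one₀ (h.propensity_le_one a x.C) (h.mediator_pos z a x.C).le
          (h.mediator_le_one z a x.C)
        calc _ ≤ 1 * K := mul_le_mul this (hg _ _ _) (abs_nonneg _) zero_le_one
          _ = K := one_mul K)
  rw [integral_finsetSum _ fun a _ => integrable_finsetSum _ fun z _ => hgi' a z]
  simp_rw [integral_finsetSum _ fun z (_ : z ∈ Finset.univ) => hgi' _ z, ← hcell,
    ← integral_indicator (hD _ _)]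
  rw [← Fintype.sum_prod_type' fun a z => ∫ x, {x : ObsTD 𝒜 𝒵 𝒞 | x.A = a ∧ x.Z = z}.indicator
    (fun x => g a z x.C) x ∂P, ← integral_finsetSum]
  · refine integral_congr_ae (Eventually.of_forall fun x => ?_)
    beta_reduce
    rw [Finset.sum_eq_single (x.A, x.Z)]
    · simp
    · rintro ⟨a, z⟩ - hne
      exact Set.indicator_of_notMem (fun hx => hne (Prod.ext hx.1.symm hx.2.symm)) _
    · simp
  · exact fun w _ => (hgi _ _).indicator (hD _ _)

/-- The sum over `(a, z)` of a nonnegative function of `(a, z, C)` is dominated by its value at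
`(A, Z, C)`. -/
lemma sum_lintegral_le [Fintype 𝒜] [Fintype 𝒵] (g : 𝒜 → 𝒵 → 𝒞 → ℝ≥0∞) :
    ∑ a, ∑ z, ∫⁻ x, g a z x.C ∂P ≤ ENNReal.ofReal (ε ^ 2)⁻¹ * ∫⁻ x, g x.A x.Z x.C ∂P := by
  -- Each pair `(a, z)` carries the weight `p(a|C) p(z|a,C)`, which exceeds `ε ^ 2`.
  rw [h.lintegral_AZC, Finset.mul_sum]
  refine Finset.sum_le_sum fun a _ => ?_
  rw [Finset.mul_sum]
  refine Finset.sum_le_sum fun z _ => ?_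
  rw [← lintegral_const_mul' _ _ ENNReal.ofReal_ne_top]
  refine lintegral_mono fun x => ?_
  rw [← mul_assoc, ← ENNReal.ofReal_mul (by have := h.eps_pos; positivity)]
  refine le_mul_of_one_le_left zero_le ?_
  rw [ENNReal.one_le_ofReal]
  have hε := h.eps_pos
  rw [← div_eq_inv_mul, one_le_div (by positivity), sq]
  exact mul_le_mul (h.propensity a _).le (h.mediator z a _).le hε.le (h.propensity_pos a _).le

end PositiveLaw

/-- Jensen's inequality on each cell, as monotonicity of `L^p` norms under the conditional law; null
cells contribute nothing. -/
lemma lintegral_outcome_sq_le [IsProbabilityMeasure P] :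
    ∫⁻ x, ‖(trueNuisanceTD P).outcome x.A x.Z x.C‖ₑ ^ 2 ∂P ≤ ∫⁻ x, ‖x.Y‖ₑ ^ 2 ∂P := by
  refine lintegral_le_of_fibers ObsTD.measurable_AZC fun w => ?_
  obtain ⟨a, z, c⟩ := w
  have hset : {x : ObsTD 𝒜 𝒵 𝒞 | x.AZC = (a, z, c)} = {x | x.A = a ∧ x.Z = z ∧ x.C = c} := by
    ext x; simp [ObsTD.AZC]
  rw [hset]
  set D := {x : ObsTD 𝒜 𝒵 𝒞 | x.A = a ∧ x.Z = z ∧ x.C = c} with hD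
  have hDm : MeasurableSet D := measurableSet_AZC fun a' z' c' => a' = a ∧ z' = z ∧ c' = c
  have h1 : ∫⁻ x in D, ‖(trueNuisanceTD P).outcome x.A x.Z x.C‖ₑ ^ 2 ∂P =
      ∫⁻ _ in D, ‖(trueNuisanceTD P).outcome a z c‖ₑ ^ 2 ∂P :=
    setLIntegral_congr_fun hDm fun x hx => by simp only [hx.1, hx.2.1, hx.2.2]
  rw [h1, setLIntegral_const]
  rcases eq_or_ne (P D) 0 with h0 | h0
  · rw [h0, mul_zero]; exact zero_le
  have : IsProbabilityMeasure (cond P D) := cond_isProbabilityMeasure h0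
  have h2 : ‖(trueNuisanceTD P).outcome a z c‖ₑ ^ 2 ≤ ∫⁻ x, ‖x.Y‖ₑ ^ 2 ∂(cond P D) := by
    have hle : ‖(trueNuisanceTD P).outcome a z c‖ₑ ≤ eLpNorm ObsTD.Y 2 (cond P D) := by
      calc ‖(trueNuisanceTD P).outcome a z c‖ₑ ≤ ∫⁻ x, ‖x.Y‖ₑ ∂(cond P D) :=
            enorm_integral_le_lintegral_enorm _
        _ = eLpNorm ObsTD.Y 1 (cond P D) := eLpNorm_one_eq_lintegral_enorm.symm
        _ ≤ eLpNorm ObsTD.Y 2 (cond P D) :=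
            eLpNorm_le_eLpNorm_of_exponent_le one_le_two
              ObsTD.measurable_Y.aestronglyMeasurable
    rw [← eLpNorm_two_sq]
    gcongr
  calc _ ≤ (∫⁻ x, ‖x.Y‖ₑ ^ 2 ∂(cond P D)) * P D := mul_le_mul' h2 le_rfl
    _ = ∫⁻ x in D, ‖x.Y‖ₑ ^ 2 ∂P := by
        rw [ProbabilityTheory.cond, lintegral_smul_measure, smul_eq_mul, mul_comm, ← mul_assoc,
          ENNReal.mul_inv_cancel h0 (measure_ne_top _ _), one_mul]

lemma memLp_outcome [IsProbabilityMeasure P] (hY : MemLp ObsTD.Y 2 P) :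
    MemLp (fun x : ObsTD 𝒜 𝒵 𝒞 => (trueNuisanceTD P).outcome x.A x.Z x.C) 2 P := by
  refine ⟨(measurable_comp_AZC _).aestronglyMeasurable, ?_⟩
  have h1 := lintegral_outcome_sq_le (P := P)
  rw [← eLpNorm_two_sq, ← eLpNorm_two_sq] at h1
  have h2 : eLpNorm ObsTD.Y 2 P ^ 2 < ∞ := ENNReal.pow_lt_top hY.2
  have := h1.trans_lt h2
  by_contra hcon
  rw [not_lt, top_le_iff] at hcon
  rw [hcon] at this
  simp at this

/-- `E(Y|A,Z,C)` is the conditional expectation of `Y`. -/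
lemma integral_Y_mul_eq [IsProbabilityMeasure P] (hY : MemLp ObsTD.Y 2 P)
    (hpos : ∀ a z c, 0 < P {x | x.A = a ∧ x.Z = z ∧ x.C = c}) {g : 𝒜 → 𝒵 → 𝒞 → ℝ} {K : ℝ}
    (hg : ∀ a z c, |g a z c| ≤ K) :
    ∫ x, x.Y * g x.A x.Z x.C ∂P =
      ∫ x, (trueNuisanceTD P).outcome x.A x.Z x.C * g x.A x.Z x.C ∂P := by
  have hgm := (measurable_comp_AZC g).aestronglyMeasurable (μ := P)
  have hgb : ∀ᵐ x : ObsTD 𝒜 𝒵 𝒞 ∂P, ‖g x.A x.Z x.C‖ ≤ K := Eventually.of_forall fun x => hg _ _ _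
  have hYi := hY.integrable one_le_two
  have hQi := (memLp_outcome hY).integrable one_le_two
  have h1 : Integrable (fun x : ObsTD 𝒜 𝒵 𝒞 => x.Y * g x.A x.Z x.C) P := hYi.mul_bdd hgm hgb
  have h2 : Integrable (fun x : ObsTD 𝒜 𝒵 𝒞 =>
    (trueNuisanceTD P).outcome x.A x.Z x.C * g x.A x.Z x.C) P := hQi.mul_bdd hgm hgb
  rw [← sub_eq_zero, ← integral_sub h1 h2]
  refine integral_eq_zero_of_fibers ObsTD.measurable_AZC (h1.sub h2) fun w => ?_
  obtain ⟨a, z, c⟩ := w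
  have hset : {x : ObsTD 𝒜 𝒵 𝒞 | x.AZC = (a, z, c)} = {x | x.A = a ∧ x.Z = z ∧ x.C = c} := by
    ext x; simp [ObsTD.AZC]
  rw [hset]
  set D := {x : ObsTD 𝒜 𝒵 𝒞 | x.A = a ∧ x.Z = z ∧ x.C = c} with hD
  have hDm : MeasurableSet D := measurableSet_AZC fun a' z' c' => a' = a ∧ z' = z ∧ c' = c
  have hcongr : ∫ x in D, (x.Y * g x.A x.Z x.C -
      (trueNuisanceTD P).outcome x.A x.Z x.C * g x.A x.Z x.C) ∂P =
      ∫ x in D, (x.Y - (trueNuisanceTD P).outcome a z c) * g a z c ∂P :=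
    setIntegral_congr_fun hDm fun x hx => by
      simp only [hx.1, hx.2.1, hx.2.2, sub_mul]
  rw [hcongr, integral_mul_const, integral_sub hYi.integrableOn (integrable_const _)]
  have hQ : (trueNuisanceTD P).outcome a z c = (P.real D)⁻¹ * ∫ x in D, x.Y ∂P := by
    change ∫ x, x.Y ∂(cond P D) = _
    rw [ProbabilityTheory.cond, integral_smul_measure, ENNReal.toReal_inv, smul_eq_mul]
    rfl
  have hDpos : P.real D ≠ 0 := (ENNReal.toReal_pos (hpos a z c).ne' (measure_ne_top _ _)).ne'
  rw [hQ]
  simp only [integral_const, smul_eq_mul, measureReal_restrict_apply_univ]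
  rw [← mul_assoc, mul_inv_cancel₀ hDpos, one_mul, sub_self, zero_mul]

end ObservedLaw

/-! ### Algebra of the two-door estimating function. -/

section TwoDoorAlgebra

variable {𝒜 𝒵 𝒞 : Type u}

namespace NuisanceTD

/-- The contrast `p(z|a*,c) - p(z|a,c)`. -/
def contrast (η : NuisanceTD 𝒜 𝒵 𝒞) (aStar a : 𝒜) (z : 𝒵) (c : 𝒞) : ℝ :=
  η.mediator z aStar c - η.mediator z a c

/-- The weight `(p(z|a*,c) - p(z|a,c)) / p(z|b,c)`. -/
noncomputable def weight (η : NuisanceTD 𝒜 𝒵 𝒞) (aStar a b : 𝒜) (z : 𝒵) (c : 𝒞) : ℝ :=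
  η.contrast aStar a z c / η.mediator z b c

/-- The part of `m_td` that does not involve the outcome `Y`. -/
noncomputable def rest (η : NuisanceTD 𝒜 𝒵 𝒞) (aStar a b : 𝒜) (z : 𝒵) (c : 𝒞) : ℝ :=
  ((∑' b', η.outcome b' z c * η.propensity b' c)
      - ∑' b', ∑' z', η.outcome b' z' c * η.mediator z' b c * η.propensity b' c) *
      ((Set.indicator {aStar} (fun _ => (1 : ℝ)) b - Set.indicator {a} (fun _ => (1 : ℝ)) b)
        / η.propensity b c)
  + ∑' z', η.outcome b z' c * η.contrast aStar a z' c

/-- The second order remainder due to the estimation of the mediator and treatment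
probabilities. -/
noncomputable def secondOrder (η η₀ : NuisanceTD 𝒜 𝒵 𝒞) (a' : 𝒜) (c : 𝒞) : ℝ :=
  ∑' b, ∑' z, η.outcome b z c * (η₀.mediator z a' c - η.mediator z a' c) *
    (η₀.propensity a' c / η.propensity a' c * η.propensity b c - η₀.propensity b c)

end NuisanceTD

open NuisanceTD

lemma mTD_eq (aStar a : 𝒜) (x : ObsTD 𝒜 𝒵 𝒞) (η : NuisanceTD 𝒜 𝒵 𝒞) :
    mTD aStar a x η = (x.Y - η.outcome x.A x.Z x.C) * η.weight aStar a x.A x.Z x.C +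
      η.rest aStar a x.A x.Z x.C := by
  simp only [mTD, NuisanceTD.weight, NuisanceTD.rest, contrast]
  ring

/-- The average over the treatment and the mediator of the part of `m_td` not involving `Y`. -/
lemma sum_rest [Fintype 𝒜] [Fintype 𝒵] (η η₀ : NuisanceTD 𝒜 𝒵 𝒞) (aStar a : 𝒜) (c : 𝒞)
    (hp : ∀ b z, η₀.mediator z b c ≠ 0) (hsum : ∀ b, ∑ z, η₀.mediator z b c = 1) :
    ∑ b, ∑ z, η₀.propensity b c * η₀.mediator z b c *
        (η.rest aStar a b z c - η.outcome b z c * η₀.weight aStar a b z c) =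
      secondOrder η η₀ aStar c - secondOrder η η₀ a c := by
  classical
  set S : 𝒵 → ℝ := fun z => ∑ b', η.outcome b' z c * η.propensity b' c with hS
  set R : 𝒜 → ℝ := fun b => ∑ b', ∑ z', η.outcome b' z' c * η.mediator z' b c * η.propensity b' c
    with hR
  set T : 𝒜 → ℝ := fun b => ∑ z', η.outcome b z' c * η.contrast aStar a z' c with hT
  -- The treatment term of `rest` survives only at `aStar` and `a`, where averaging over the true
  -- mediator law produces `U`. The last term of `rest` and the regression term combine into
  -- mediator errors weighted by the true propensity. Subtracting these from `U` leaves the factor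
  -- `π₀(a') / π(a') · π(b) - π₀(b)`, which vanishes at the truth; hence `secondOrder` is a product
  -- of two errors.
  set U : 𝒜 → ℝ := fun b => η₀.propensity b c / η.propensity b c *
    ((∑ z, η₀.mediator z b c * S z) - R b) with hU
  have hterm : ∀ b, ∑ z, η₀.propensity b c * η₀.mediator z b c *
      (η.rest aStar a b z c - η.outcome b z c * η₀.weight aStar a b z c) =
      ((if b = aStar then U b else 0) - (if b = a then U b else 0)) + η₀.propensity b c * T b -
        η₀.propensity b c * ∑ z, η.outcome b z c * η₀.contrast aStar a z c := by
    intro b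
    have h1 : ∀ z, η₀.propensity b c * η₀.mediator z b c *
        (η.rest aStar a b z c - η.outcome b z c * η₀.weight aStar a b z c) =
        (η₀.mediator z b c * S z) * (((if b = aStar then 1 else 0) - (if b = a then 1 else 0)) *
          (η₀.propensity b c / η.propensity b c))
        + η₀.mediator z b c * (η₀.propensity b c * T b - R b *
          (((if b = aStar then 1 else 0) - (if b = a then 1 else 0)) *
            (η₀.propensity b c / η.propensity b c)))
        - η₀.propensity b c * (η.outcome b z c * η₀.contrast aStar a z c) := by
      intro z
      have hz := hp b z
      simp only [NuisanceTD.rest, NuisanceTD.weight, tsum_fintype, Set.indicator_apply,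
        Set.mem_singleton_iff, hS, hR, hT]
      have e : η₀.propensity b c * η₀.mediator z b c *
          (η.outcome b z c * (η₀.contrast aStar a z c / η₀.mediator z b c)) =
          η₀.propensity b c * (η.outcome b z c * η₀.contrast aStar a z c) := by
        field_simp
      rw [mul_sub, e]
      ring
    simp_rw [h1]
    rw [Finset.sum_sub_distrib, Finset.sum_add_distrib, ← Finset.sum_mul, ← Finset.sum_mul, hsum,
      ← Finset.mul_sum]
    simp only [hU]
    split_ifs <;> ring
  simp_rw [hterm]
  rw [Finset.sum_sub_distrib, Finset.sum_add_distrib, Finset.sum_sub_distrib]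
  simp only [Finset.sum_ite_eq', Finset.mem_univ, if_true]
  have hUe : ∀ a', U a' = η₀.propensity a' c / η.propensity a' c *
      ∑ b, ∑ z, η.outcome b z c * (η₀.mediator z a' c - η.mediator z a' c) *
        η.propensity b c := by
    intro a'
    simp only [hU, hS, hR]
    congr 1
    simp_rw [Finset.mul_sum]
    rw [Finset.sum_comm, ← Finset.sum_sub_distrib]
    refine Finset.sum_congr rfl fun b _ => ?_
    rw [← Finset.sum_sub_distrib]
    exact Finset.sum_congr rfl fun z _ => by ring
  have hso : ∀ a', secondOrder η η₀ a' c = U a' -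
      ∑ b, η₀.propensity b c * ∑ z, η.outcome b z c *
        (η₀.mediator z a' c - η.mediator z a' c) := by
    intro a'
    simp only [secondOrder, tsum_fintype]
    rw [hUe, Finset.mul_sum, ← Finset.sum_sub_distrib]
    refine Finset.sum_congr rfl fun b _ => ?_
    rw [Finset.mul_sum, Finset.mul_sum, ← Finset.sum_sub_distrib]
    exact Finset.sum_congr rfl fun z _ => by ring
  rw [hso, hso]
  have hlast : ∑ b, η₀.propensity b c * T b -
      ∑ b, η₀.propensity b c * ∑ z, η.outcome b z c * η₀.contrast aStar a z c =
      ∑ b, η₀.propensity b c * ∑ z, η.outcome b z c * (η₀.mediator z a c - η.mediator z a c) -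
      ∑ b, η₀.propensity b c * ∑ z, η.outcome b z c *
        (η₀.mediator z aStar c - η.mediator z aStar c) := by
    rw [← Finset.sum_sub_distrib, ← Finset.sum_sub_distrib]
    refine Finset.sum_congr rfl fun b _ => ?_
    rw [← mul_sub, ← mul_sub]
    congr 1
    simp only [hT, contrast]
    rw [← Finset.sum_sub_distrib, ← Finset.sum_sub_distrib]
    exact Finset.sum_congr rfl fun z _ => by ring
  linarith

/-- Bounds on nuisance functions under which `m_td` is bounded up to a multiple of `Y`. -/
structure NuisanceTD.Bounds (η : NuisanceTD 𝒜 𝒵 𝒞) (aStar a : 𝒜) (l L : ℝ) : Prop where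
  pos : 0 < l
  outcome : ∀ b z c, |η.outcome b z c| ≤ L
  mediator_below : ∀ z b c, l ≤ η.mediator z b c
  mediator_above : ∀ b ∈ ({aStar, a} : Set 𝒜), ∀ z c, |η.mediator z b c| ≤ L
  propensity_below : ∀ b ∈ ({aStar, a} : Set 𝒜), ∀ c, l ≤ η.propensity b c
  propensity_above : ∀ b c, |η.propensity b c| ≤ L

namespace NuisanceTD.Bounds

variable {η η₀ : NuisanceTD 𝒜 𝒵 𝒞} {aStar a : 𝒜} {l L l₀ L₀ : ℝ}

lemma abs_contrast_le (h : η.Bounds aStar a l L) (z : 𝒵) (c : 𝒞) :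
    |η.contrast aStar a z c| ≤ 2 * L := by
  have h1 := h.mediator_above aStar (by simp) z c
  have h2 := h.mediator_above a (by simp) z c
  exact (abs_sub _ _).trans (by linarith)

lemma abs_weight_le (h : η.Bounds aStar a l L) (b : 𝒜) (z : 𝒵) (c : 𝒞) :
    |η.weight aStar a b z c| ≤ 2 * L / l := by
  have h1 := h.abs_contrast_le z c
  have h2 := h.mediator_below z b c
  rw [NuisanceTD.weight, abs_div, abs_of_pos (h.pos.trans_le h2)]
  exact div_le_div₀ ((abs_nonneg _).trans h1) h1 h.pos h2

lemma exists_abs_rest_le [Fintype 𝒜] [Fintype 𝒵] (h : η.Bounds aStar a l L) :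
    ∃ K, ∀ b z c, |η.rest aStar a b z c| ≤ K := by
  classical
  obtain ⟨N, hN⟩ : ∃ N : ℝ, N = Fintype.card 𝒜 := ⟨_, rfl⟩
  obtain ⟨N', hN'⟩ : ∃ N' : ℝ, N' = Fintype.card 𝒵 := ⟨_, rfl⟩
  have hN0 : 0 ≤ N := hN ▸ Nat.cast_nonneg _
  have hN0' : 0 ≤ N' := hN' ▸ Nat.cast_nonneg _
  refine ⟨(N * (L * L) + N * (N' * (L * L * L))) * (1 / l) + N' * (L * (2 * L)),
    fun b z c => ?_⟩
  have hl := h.pos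
  have hL : 0 ≤ L := (abs_nonneg _).trans (h.outcome b z c)
  simp only [NuisanceTD.rest, tsum_fintype]
  refine (abs_add_le _ _).trans (add_le_add ?_ ?_)
  -- Upper bounds on the mediator and lower bounds on the propensity are available only at `aStar`
  -- and `a`; at any other treatment the difference of indicators kills the term that would need
  -- them.
  · by_cases hb : b ∈ ({aStar, a} : Set 𝒜)
    · rw [abs_mul]
      refine mul_le_mul ((abs_sub _ _).trans (add_le_add ?_ ?_)) ?_ (abs_nonneg _) (by positivity)
      · refine (Finset.abs_sum_le_sum_abs _ _).trans ((Finset.sum_le_card_nsmul _ _ (L * L)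
          fun b' _ => ?_).trans (by simp [hN]))
        rw [abs_mul]
        exact mul_le_mul (h.outcome _ _ _) (h.propensity_above _ _) (abs_nonneg _) hL
      · refine (Finset.abs_sum_le_sum_abs _ _).trans ((Finset.sum_le_card_nsmul _ _
          (N' * (L * L * L)) fun b' _ => ?_).trans (by simp [hN]))
        refine (Finset.abs_sum_le_sum_abs _ _).trans ((Finset.sum_le_card_nsmul _ _ (L * L * L)
          fun z' _ => ?_).trans (by simp [hN']))
        rw [abs_mul, abs_mul]
        exact mul_le_mul (mul_le_mul (h.outcome _ _ _) (h.mediator_above b hb _ _) (abs_nonneg _)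
          hL) (h.propensity_above _ _) (abs_nonneg _) (by positivity)
      · have h2 := h.propensity_below b hb c
        rw [abs_div, abs_of_pos (hl.trans_le h2)]
        refine div_le_div₀ zero_le_one ?_ hl h2
        simp only [Set.indicator_apply, Set.mem_singleton_iff]
        split_ifs <;> simp
    · simp only [Set.mem_insert_iff, Set.mem_singleton_iff, not_or] at hb
      simp only [Set.indicator_apply, Set.mem_singleton_iff, hb.1, hb.2, if_false, sub_zero,
        zero_div, mul_zero, abs_zero]
      positivity
  · refine (Finset.abs_sum_le_sum_abs _ _).trans ((Finset.sum_le_card_nsmul _ _ (L * (2 * L))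
      fun z' _ => ?_).trans (by simp [hN']))
    rw [abs_mul]
    exact mul_le_mul (h.outcome _ _ _) (h.abs_contrast_le _ _) (abs_nonneg _) hL

end NuisanceTD.Bounds

/-- The change of the weights is controlled by the change of the mediator probabilities. -/
lemma NuisanceTD.abs_weight_sub_weight_le {η η₀ : NuisanceTD 𝒜 𝒵 𝒞} {aStar a b : 𝒜} {z : 𝒵}
    {c : 𝒞} {l ε : ℝ} (hl : 0 < l) (hε : 0 < ε) (h1 : l ≤ η.mediator z b c)
    (h2 : ε ≤ η₀.mediator z b c) (h3 : |η₀.contrast aStar a z c| ≤ 1) :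
    |η.weight aStar a b z c - η₀.weight aStar a b z c| ≤ (1 / l + 1 / (l * ε)) *
      (|η.mediator z b c - η₀.mediator z b c| +
        (|η.mediator z aStar c - η₀.mediator z aStar c| +
          |η.mediator z a c - η₀.mediator z a c|)) := by
  have hp := hl.trans_le h1
  have hp₀ := hε.trans_le h2
  set D := |η.mediator z b c - η₀.mediator z b c|
  set E := |η.mediator z aStar c - η₀.mediator z aStar c| +
          |η.mediator z a c - η₀.mediator z a c|
  have hD : 0 ≤ D := abs_nonneg _
  have hE : 0 ≤ E := by positivity
  have e : η.weight aStar a b z c - η₀.weight aStar a b z c =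
      (η.contrast aStar a z c - η₀.contrast aStar a z c) / η.mediator z b c
      - η₀.contrast aStar a z c * (η.mediator z b c - η₀.mediator z b c) /
        (η.mediator z b c * η₀.mediator z b c) := by
    simp only [NuisanceTD.weight]
    field_simp
    ring
  have hc : |η.contrast aStar a z c - η₀.contrast aStar a z c| ≤ E := by
    simp only [contrast]
    rw [show η.mediator z aStar c - η.mediator z a c - (η₀.mediator z aStar c -
      η₀.mediator z a c) = (η.mediator z aStar c - η₀.mediator z aStar c) -
      (η.mediator z a c - η₀.mediator z a c) by ring]
    exact abs_sub _ _
  rw [e]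
  refine (abs_sub _ _).trans ?_
  rw [abs_div, abs_div, abs_mul, abs_of_pos hp, abs_of_pos (mul_pos hp hp₀)]
  have i1 : |η.contrast aStar a z c - η₀.contrast aStar a z c| / η.mediator z b c ≤ E / l :=
    div_le_div₀ hE hc hl h1
  have i2 : |η₀.contrast aStar a z c| * |η.mediator z b c - η₀.mediator z b c| /
      (η.mediator z b c * η₀.mediator z b c) ≤ D / (l * ε) :=
    div_le_div₀ hD (by nlinarith) (by positivity) (mul_le_mul h1 h2 hε.le hp.le)
  have i3 : 0 ≤ D / l := by positivity
  have i4 : 0 ≤ E / (l * ε) := by positivity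
  calc _ ≤ E / l + D / (l * ε) := add_le_add i1 i2
    _ ≤ E / l + D / (l * ε) + (D / l + E / (l * ε)) := by linarith
    _ = _ := by ring

end TwoDoorAlgebra

/-! ### The bias as a sum of products of errors. -/

section TwoDoorBias

set_option linter.unusedSectionVars false

open NuisanceTD

variable {𝒜 𝒵 𝒞 : Type u} [MeasurableSpace 𝒜] [MeasurableSpace 𝒵] [MeasurableSpace 𝒞]
  [DiscreteMeasurableSpace 𝒜] [Countable 𝒜] [DiscreteMeasurableSpace 𝒵] [Countable 𝒵]
  [DiscreteMeasurableSpace 𝒞] [Countable 𝒞]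
  {P : Measure (ObsTD 𝒜 𝒵 𝒞)} [IsProbabilityMeasure P] {ε : ℝ}
  {aStar a : 𝒜} {η : NuisanceTD 𝒜 𝒵 𝒞} {l L : ℝ}

lemma PositiveLaw.abs_contrast_le_one (h : PositiveLaw P ε) (aStar a : 𝒜) (z : 𝒵) (c : 𝒞) :
    |(trueNuisanceTD P).contrast aStar a z c| ≤ 1 := by
  have h1 := h.mediator_pos z aStar c
  have h2 := h.mediator_pos z a c
  have h3 := h.mediator_le_one z aStar c
  have h4 := h.mediator_le_one z a c
  rw [contrast, abs_le]
  constructor <;> linarith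

lemma PositiveLaw.abs_weight_le (h : PositiveLaw P ε) (aStar a b : 𝒜) (z : 𝒵) (c : 𝒞) :
    |(trueNuisanceTD P).weight aStar a b z c| ≤ 1 / ε := by
  rw [weight, abs_div, abs_of_pos (h.mediator_pos z b c)]
  exact div_le_div₀ zero_le_one (h.abs_contrast_le_one _ _ _ _) h.eps_pos (h.mediator z b c).le

lemma integrable_comp_AZC {g : 𝒜 → 𝒵 → 𝒞 → ℝ} {K : ℝ} (hg : ∀ a z c, |g a z c| ≤ K) :
    Integrable (fun x : ObsTD 𝒜 𝒵 𝒞 => g x.A x.Z x.C) P :=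
  Integrable.of_bound (measurable_comp_AZC g).aestronglyMeasurable K
    (Eventually.of_forall fun _ => hg _ _ _)

lemma integrable_Y_sub_mul (hY : MemLp ObsTD.Y 2 P) {q g : 𝒜 → 𝒵 → 𝒞 → ℝ} {K K' : ℝ}
    (hq : ∀ a z c, |q a z c| ≤ K) (hg : ∀ a z c, |g a z c| ≤ K') :
    Integrable (fun x : ObsTD 𝒜 𝒵 𝒞 => (x.Y - q x.A x.Z x.C) * g x.A x.Z x.C) P :=
  ((hY.integrable one_le_two).sub (integrable_comp_AZC hq)).mul_bdd
    (measurable_comp_AZC g).aestronglyMeasurable (Eventually.of_forall fun _ => hg _ _ _)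

/-- The bias of the estimating function. -/
theorem integral_mTD_sub [Fintype 𝒜] [Fintype 𝒵] (h : PositiveLaw P ε) (hY : MemLp ObsTD.Y 2 P)
    (hη : η.Bounds aStar a l L) :
    Integrable (fun x => mTD aStar a x η) P ∧
    ∫ x, mTD aStar a x η ∂P - ∫ x, x.Y * (trueNuisanceTD P).weight aStar a x.A x.Z x.C ∂P =
      ∫ x, (x.Y - η.outcome x.A x.Z x.C) * (η.weight aStar a x.A x.Z x.C -
        (trueNuisanceTD P).weight aStar a x.A x.Z x.C) ∂P +
      ∫ x, (secondOrder η (trueNuisanceTD P) aStar x.C -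
        secondOrder η (trueNuisanceTD P) a x.C) ∂P := by
  obtain ⟨K, hK⟩ := hη.exists_abs_rest_le
  set η₀ := trueNuisanceTD P with hη₀
  have hw := hη.abs_weight_le
  have hw₀ : ∀ b z c, |η₀.weight aStar a b z c| ≤ 1 / ε := h.abs_weight_le aStar a
  have hint : Integrable (fun x => mTD aStar a x η) P := by
    simp_rw [mTD_eq]
    exact (integrable_Y_sub_mul hY hη.outcome hw).add (integrable_comp_AZC hK)
  have hYw : Integrable (fun x : ObsTD 𝒜 𝒵 𝒞 => x.Y * η₀.weight aStar a x.A x.Z x.C) P := by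
    simpa using integrable_Y_sub_mul hY (q := fun _ _ _ => 0) (K := 0) (by simp) hw₀
  have hv : ∀ b z c, |η.weight aStar a b z c - η₀.weight aStar a b z c| ≤ 2 * L / l + 1 / ε :=
    fun b z c => (abs_sub _ _).trans (add_le_add (hw b z c) (hw₀ b z c))
  have hiv := integrable_Y_sub_mul hY hη.outcome hv
  have hr : ∀ b z c, |η.rest aStar a b z c - η.outcome b z c * η₀.weight aStar a b z c| ≤
      K + L * (1 / ε) := fun b z c => by
    refine (abs_sub _ _).trans (add_le_add (hK b z c) ?_)
    rw [abs_mul]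
    exact mul_le_mul (hη.outcome b z c) (hw₀ b z c) (abs_nonneg _)
      ((abs_nonneg _).trans (hη.outcome b z c))
  refine ⟨hint, ?_⟩
  rw [← integral_sub hint hYw]
  -- Subtracting `Y w₀`, rather than its mean, is what factorizes: the residual meets only the error
  -- of the weight, and what remains is a function of `(A, Z, C)` whose average is given by
  -- `sum_rest`.
  have e : ∀ x : ObsTD 𝒜 𝒵 𝒞, mTD aStar a x η - x.Y * η₀.weight aStar a x.A x.Z x.C =
      (x.Y - η.outcome x.A x.Z x.C) *
        (η.weight aStar a x.A x.Z x.C - η₀.weight aStar a x.A x.Z x.C) +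
      (η.rest aStar a x.A x.Z x.C -
        η.outcome x.A x.Z x.C * η₀.weight aStar a x.A x.Z x.C) := fun x => by
    rw [mTD_eq]; ring
  simp_rw [e]
  rw [integral_add hiv (integrable_comp_AZC hr), h.integral_AZC hr]
  simp_rw [← hη₀]
  congr 1
  exact integral_congr_ae (Eventually.of_forall fun x =>
    sum_rest η η₀ aStar a x.C (fun b z => (h.mediator_pos z b x.C).ne')
      fun b => h.sum_mediator b x.C)

/-- Hölder's inequality in `ℝ≥0∞`, so that no error norm has to be known finite. -/
lemma lintegral_enorm_mul_le {𝒳 : Type*} [MeasurableSpace 𝒳] {ν : Measure 𝒳} {f g : 𝒳 → ℝ}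
    (hf : AEStronglyMeasurable f ν) (hg : AEStronglyMeasurable g ν) :
    ∫⁻ x, ‖f x‖ₑ * ‖g x‖ₑ ∂ν ≤ eLpNorm f 2 ν * eLpNorm g 2 ν := by
  have := eLpNorm_smul_le_mul_eLpNorm (p := 2) (q := 2) (r := 1) hg hf
  rw [eLpNorm_one_eq_lintegral_enorm] at this
  refine le_trans (le_of_eq ?_) this
  exact lintegral_congr fun x => by simp [enorm_mul]

/-- The remainder in the second part of the bias is of second order. -/
lemma lintegral_secondOrder_le [Fintype 𝒜] [Fintype 𝒵] (h : PositiveLaw P ε)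
    (hη : η.Bounds aStar a l L) {a' : 𝒜} (ha' : a' ∈ ({aStar, a} : Set 𝒜)) :
    ∫⁻ x, ‖secondOrder η (trueNuisanceTD P) a' x.C‖ₑ ∂P ≤
      ENNReal.ofReal ((ε ^ 2)⁻¹ * (L * (L / l + 1))) *
      (eLpNorm (fun x => η.mediator x.Z a' x.C - (trueNuisanceTD P).mediator x.Z a' x.C) 2 P *
          eLpNorm (fun x => η.propensity a' x.C - (trueNuisanceTD P).propensity a' x.C) 2 P +
        eLpNorm (fun x => η.mediator x.Z a' x.C - (trueNuisanceTD P).mediator x.Z a' x.C) 2 P *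
          eLpNorm (fun x => η.propensity x.A x.C - (trueNuisanceTD P).propensity x.A x.C) 2 P) := by
  set η₀ := trueNuisanceTD P with hη₀
  have hl := hη.pos
  have hL : 0 ≤ L := by
    obtain ⟨b⟩ := h.nonempty_A
    obtain ⟨c⟩ := h.nonempty_C
    exact (abs_nonneg _).trans (hη.propensity_above b c)
  have hε := h.eps_pos
  set g : 𝒜 → 𝒵 → 𝒞 → ℝ≥0∞ := fun b z c => ‖η.mediator z a' c - η₀.mediator z a' c‖ₑ *
    (‖η.propensity a' c - η₀.propensity a' c‖ₑ + ‖η.propensity b c - η₀.propensity b c‖ₑ) with hg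
  have hpt : ∀ c, ‖secondOrder η η₀ a' c‖ₑ ≤
      ENNReal.ofReal (L * (L / l + 1)) * ∑ b, ∑ z, g b z c := by
    intro c
    simp only [secondOrder, tsum_fintype]
    rw [Finset.mul_sum]
    refine (enorm_sum_le _ _).trans (Finset.sum_le_sum fun b _ => ?_)
    rw [Finset.mul_sum]
    refine (enorm_sum_le _ _).trans (Finset.sum_le_sum fun z _ => ?_)
    simp only [hg, Real.enorm_eq_ofReal_abs]
    rw [← ENNReal.ofReal_add (abs_nonneg _) (abs_nonneg _), ← ENNReal.ofReal_mul (abs_nonneg _),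
      ← ENNReal.ofReal_mul (by positivity)]
    refine ENNReal.ofReal_le_ofReal ?_
    have hpa := hη.propensity_below a' ha' c
    have hpa' := hl.trans_le hpa
    -- The factor is split into the propensity error at `b` and the one at `a'`; they lead to the
    -- rate conditions at the observed `A` and at the fixed treatment respectively.
    have e : η₀.propensity a' c / η.propensity a' c * η.propensity b c - η₀.propensity b c =
        (η.propensity b c - η₀.propensity b c) - η.propensity b c / η.propensity a' c *
          (η.propensity a' c - η₀.propensity a' c) := by
      field_simp; ring
    rw [abs_mul, abs_mul, e, abs_sub_comm (η₀.mediator z a' c)]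
    have i1 : |η.propensity b c / η.propensity a' c| ≤ L / l := by
      rw [abs_div, abs_of_pos hpa']
      exact div_le_div₀ hL (hη.propensity_above b c) hl hpa
    set D := |η.propensity a' c - η₀.propensity a' c| with hD
    set E := |η.propensity b c - η₀.propensity b c| with hE
    have hD0 : 0 ≤ D := abs_nonneg _
    have hE0 : 0 ≤ E := abs_nonneg _
    have i2 : |(η.propensity b c - η₀.propensity b c) - η.propensity b c / η.propensity a' c *
          (η.propensity a' c - η₀.propensity a' c)| ≤ (L / l + 1) * (D + E) := by
      refine (abs_sub _ _).trans ?_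
      rw [abs_mul, ← hD, ← hE]
      have : 0 ≤ L / l := by positivity
      have := mul_le_mul_of_nonneg_right i1 hD0
      nlinarith
    calc _ ≤ L * |η.mediator z a' c - η₀.mediator z a' c| * ((L / l + 1) * (D + E)) :=
          mul_le_mul (mul_le_mul_of_nonneg_right (hη.outcome b z c) (abs_nonneg _)) i2
            (abs_nonneg _) (by positivity)
      _ = _ := by ring
  have hgm : ∀ b z, Measurable fun x : ObsTD 𝒜 𝒵 𝒞 => g b z x.C := fun b z =>
    measurable_comp_AZC fun _ _ c => g b z c
  have m1 : AEStronglyMeasurable (fun x : ObsTD 𝒜 𝒵 𝒞 =>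
      η.mediator x.Z a' x.C - η₀.mediator x.Z a' x.C) P :=
    (measurable_comp_AZC fun _ z c => η.mediator z a' c - η₀.mediator z a' c).aestronglyMeasurable
  have m2 : AEStronglyMeasurable (fun x : ObsTD 𝒜 𝒵 𝒞 =>
      η.propensity a' x.C - η₀.propensity a' x.C) P :=
    (measurable_comp_AZC fun _ _ c =>
      η.propensity a' c - η₀.propensity a' c).aestronglyMeasurable
  have m3 : AEStronglyMeasurable (fun x : ObsTD 𝒜 𝒵 𝒞 =>
      η.propensity x.A x.C - η₀.propensity x.A x.C) P :=
    (measurable_comp_AZC fun b _ c => η.propensity b c - η₀.propensity b c).aestronglyMeasurable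
  calc ∫⁻ x, ‖secondOrder η η₀ a' x.C‖ₑ ∂P
      ≤ ∫⁻ x, ENNReal.ofReal (L * (L / l + 1)) * ∑ b, ∑ z, g b z x.C ∂P :=
        lintegral_mono fun x => hpt x.C
    _ = ENNReal.ofReal (L * (L / l + 1)) * ∑ b, ∑ z, ∫⁻ x, g b z x.C ∂P := by
        rw [lintegral_const_mul' _ _ ENNReal.ofReal_ne_top, lintegral_finsetSum _ fun b _ =>
          Finset.measurable_fun_sum _ fun z _ => hgm b z]
        simp_rw [lintegral_finsetSum _ fun z (_ : z ∈ Finset.univ) => hgm _ z]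
    _ ≤ ENNReal.ofReal (L * (L / l + 1)) *
        (ENNReal.ofReal (ε ^ 2)⁻¹ * ∫⁻ x, g x.A x.Z x.C ∂P) :=
        -- Positivity trades the sum over all `(b, z)` for the observed `(A, Z)`, where the norms of
        -- the rate conditions are taken.
        mul_le_mul' le_rfl (h.sum_lintegral_le g)
    _ = ENNReal.ofReal ((ε ^ 2)⁻¹ * (L * (L / l + 1))) * ∫⁻ x, g x.A x.Z x.C ∂P := by
        rw [← mul_assoc, ← ENNReal.ofReal_mul (by positivity), mul_comm (ε ^ 2)⁻¹]
    _ ≤ _ := by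
        refine mul_le_mul' le_rfl ?_
        simp only [hg, mul_add]
        rw [lintegral_add_left ((measurable_comp_AZC fun b z c =>
          ‖η.mediator z a' c - η₀.mediator z a' c‖ₑ * ‖η.propensity a' c - η₀.propensity a' c‖ₑ))]
        exact add_le_add (lintegral_enorm_mul_le m1 m2) (lintegral_enorm_mul_le m1 m3)

/-- The bias of the estimating function is bounded by products of estimation errors. -/
theorem enorm_integral_mTD_sub_le [Fintype 𝒜] [Fintype 𝒵] (h : PositiveLaw P ε)
    (hY : MemLp ObsTD.Y 2 P) (hη : η.Bounds aStar a l L) {η₀ : NuisanceTD 𝒜 𝒵 𝒞}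
    (hη₀ : η₀ = trueNuisanceTD P) {N₁ N₂ M₁ M₂ M₃ : ℝ≥0∞} {N : 𝒜 → ℝ≥0∞}
    (hN₁ : N₁ = eLpNorm (fun x => η.outcome x.A x.Z x.C - η₀.outcome x.A x.Z x.C) 2 P)
    (hN₂ : N₂ = eLpNorm (fun x => η.mediator x.Z x.A x.C - η₀.mediator x.Z x.A x.C) 2 P)
    (hN : ∀ b, N b = eLpNorm (fun x => η.mediator x.Z b x.C - η₀.mediator x.Z b x.C) 2 P)
    (hM₁ : M₁ = eLpNorm (fun x => η.propensity aStar x.C - η₀.propensity aStar x.C) 2 P)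
    (hM₂ : M₂ = eLpNorm (fun x => η.propensity a x.C - η₀.propensity a x.C) 2 P)
    (hM₃ : M₃ = eLpNorm (fun x => η.propensity x.A x.C - η₀.propensity x.A x.C) 2 P) :
    ‖∫ x, mTD aStar a x η ∂P - ∫ x, x.Y * η₀.weight aStar a x.A x.Z x.C ∂P‖ₑ ≤
      ENNReal.ofReal (1 / l + 1 / (l * ε)) * (N₁ * N₂ + (N₁ * N aStar + N₁ * N a)) +
      ENNReal.ofReal ((ε ^ 2)⁻¹ * (L * (L / l + 1))) *
        ((N aStar * M₁ + N aStar * M₃) + (N a * M₂ + N a * M₃)) := by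
  have hso : ∀ {a'}, a' ∈ ({aStar, a} : Set 𝒜) → _ := fun ha' => lintegral_secondOrder_le h hη ha'
  rw [hη₀, (integral_mTD_sub h hY hη).2]
  rw [← hη₀] at hso ⊢
  have hl := hη.pos
  have hε := h.eps_pos
  have hw₀ : ∀ b z c, |η₀.weight aStar a b z c| ≤ 1 / ε := hη₀ ▸ h.abs_weight_le aStar a
  have hv : ∀ b z c, |η.weight aStar a b z c - η₀.weight aStar a b z c| ≤ 2 * L / l + 1 / ε :=
    fun b z c => (abs_sub _ _).trans (add_le_add (hη.abs_weight_le b z c) (hw₀ b z c))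
  refine (enorm_add_le _ _).trans (add_le_add ?_ ?_)
  · have hYv := integrable_Y_sub_mul hY (q := fun _ _ _ => 0) (K := 0) (by simp) hv
    have hQv : Integrable (fun x : ObsTD 𝒜 𝒵 𝒞 => η.outcome x.A x.Z x.C *
        (η.weight aStar a x.A x.Z x.C - η₀.weight aStar a x.A x.Z x.C)) P :=
      (integrable_comp_AZC hη.outcome).mul_bdd (measurable_comp_AZC fun b z c =>
        η.weight aStar a b z c - η₀.weight aStar a b z c).aestronglyMeasurable
        (Eventually.of_forall fun _ => hv _ _ _)
    have hQ₀v : Integrable (fun x : ObsTD 𝒜 𝒵 𝒞 => η₀.outcome x.A x.Z x.C *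
        (η.weight aStar a x.A x.Z x.C - η₀.weight aStar a x.A x.Z x.C)) P :=
      (hη₀ ▸ (memLp_outcome hY).integrable one_le_two).mul_bdd (measurable_comp_AZC fun b z c =>
        η.weight aStar a b z c - η₀.weight aStar a b z c).aestronglyMeasurable
        (Eventually.of_forall fun _ => hv _ _ _)
    -- The change of the weight is a function of `(A, Z, C)`, so `Y` may be replaced by its true
    -- regression; the residual thereby becomes an estimation error.
    have e : ∫ x, (x.Y - η.outcome x.A x.Z x.C) *
        (η.weight aStar a x.A x.Z x.C - η₀.weight aStar a x.A x.Z x.C) ∂P =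
        ∫ x, (η₀.outcome x.A x.Z x.C - η.outcome x.A x.Z x.C) *
          (η.weight aStar a x.A x.Z x.C - η₀.weight aStar a x.A x.Z x.C) ∂P := by
      have := integral_Y_mul_eq hY h.cell_pos hv
      simp only [sub_zero] at hYv
      simp_rw [sub_mul (_ : ℝ) (η.outcome _ _ _)]
      rw [integral_sub hYv hQv, integral_sub hQ₀v hQv, this, hη₀]
    rw [e]
    refine (enorm_integral_le_lintegral_enorm _).trans ?_
    have m0 : AEStronglyMeasurable (fun x : ObsTD 𝒜 𝒵 𝒞 =>
        η.outcome x.A x.Z x.C - η₀.outcome x.A x.Z x.C) P :=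
      (measurable_comp_AZC fun b z c => η.outcome b z c - η₀.outcome b z c).aestronglyMeasurable
    have m1 : AEStronglyMeasurable (fun x : ObsTD 𝒜 𝒵 𝒞 =>
        η.mediator x.Z x.A x.C - η₀.mediator x.Z x.A x.C) P :=
      (measurable_comp_AZC fun b z c => η.mediator z b c - η₀.mediator z b c).aestronglyMeasurable
    have m2 : ∀ a', AEStronglyMeasurable (fun x : ObsTD 𝒜 𝒵 𝒞 =>
        η.mediator x.Z a' x.C - η₀.mediator x.Z a' x.C) P := fun a' =>
      (measurable_comp_AZC fun _ z c =>
        η.mediator z a' c - η₀.mediator z a' c).aestronglyMeasurable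
    have hpt : ∀ x : ObsTD 𝒜 𝒵 𝒞, ‖(η₀.outcome x.A x.Z x.C - η.outcome x.A x.Z x.C) *
        (η.weight aStar a x.A x.Z x.C - η₀.weight aStar a x.A x.Z x.C)‖ₑ ≤
        ENNReal.ofReal (1 / l + 1 / (l * ε)) *
        (‖η.outcome x.A x.Z x.C - η₀.outcome x.A x.Z x.C‖ₑ *
            ‖η.mediator x.Z x.A x.C - η₀.mediator x.Z x.A x.C‖ₑ +
          (‖η.outcome x.A x.Z x.C - η₀.outcome x.A x.Z x.C‖ₑ *
            ‖η.mediator x.Z aStar x.C - η₀.mediator x.Z aStar x.C‖ₑ +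
          ‖η.outcome x.A x.Z x.C - η₀.outcome x.A x.Z x.C‖ₑ *
            ‖η.mediator x.Z a x.C - η₀.mediator x.Z a x.C‖ₑ)) := by
      intro x
      have hb := abs_weight_sub_weight_le (η := η) (η₀ := η₀) (aStar := aStar) (a := a) (b := x.A)
        (z := x.Z) (c := x.C) hl hε (hη.mediator_below _ _ _)
        (hη₀ ▸ (h.mediator _ _ _).le) (hη₀ ▸ h.abs_contrast_le_one aStar a x.Z x.C)
      have hb' := ENNReal.ofReal_le_ofReal hb
      rw [ENNReal.ofReal_mul (by positivity), ENNReal.ofReal_add (abs_nonneg _) (by positivity),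
        ENNReal.ofReal_add (abs_nonneg _) (abs_nonneg _)] at hb'
      simp only [← Real.enorm_eq_ofReal_abs] at hb'
      rw [enorm_mul, ← neg_sub, enorm_neg]
      refine (mul_le_mul' le_rfl hb').trans (le_of_eq ?_)
      ring
    refine (lintegral_mono hpt).trans ?_
    rw [lintegral_const_mul' _ _ ENNReal.ofReal_ne_top, lintegral_add_left (measurable_comp_AZC
      fun b z c => ‖η.outcome b z c - η₀.outcome b z c‖ₑ * ‖η.mediator z b c - η₀.mediator z b c‖ₑ),
      lintegral_add_left (measurable_comp_AZC fun b z c =>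
        ‖η.outcome b z c - η₀.outcome b z c‖ₑ * ‖η.mediator z aStar c - η₀.mediator z aStar c‖ₑ)]
    rw [hN₁, hN₂, hN, hN]
    exact mul_le_mul' le_rfl (add_le_add (lintegral_enorm_mul_le m0 m1)
      (add_le_add (lintegral_enorm_mul_le m0 (m2 aStar)) (lintegral_enorm_mul_le m0 (m2 a))))
  · refine (enorm_integral_le_lintegral_enorm _).trans ?_
    refine (lintegral_mono fun x => enorm_sub_le).trans ?_
    rw [lintegral_add_left (measurable_comp_AZC fun _ _ c => ‖secondOrder η η₀ aStar c‖ₑ),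
      mul_add, hN, hN, hM₁, hM₂, hM₃]
    exact add_le_add (hso (by simp)) (hso (by simp))

end TwoDoorBias

/-! ### Truncation of the outcome regression. -/

section Truncation

set_option linter.unusedSectionVars false

open NuisanceTD

variable {𝒜 𝒵 𝒞 : Type u}

/-- The nuisance functions with the outcome regression set to zero where it exceeds `K`. -/
noncomputable def NuisanceTD.truncate (η : NuisanceTD 𝒜 𝒵 𝒞) (K : ℝ) : NuisanceTD 𝒜 𝒵 𝒞 where
  outcome b z c := if |η.outcome b z c| ≤ K then η.outcome b z c else 0
  mediator := η.mediator
  propensity := η.propensity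

/-- By `mTD_eq` the estimating function is affine in `Y` with bounded coefficients. Linear growth
gives square integrability and second-moment bounds that are uniform over the local laws. -/
lemma NuisanceTD.Bounds.exists_abs_mTD_le [Fintype 𝒜] [Fintype 𝒵] {η : NuisanceTD 𝒜 𝒵 𝒞}
    {aStar a : 𝒜} {l L : ℝ} (hη : η.Bounds aStar a l L) :
    ∃ K, 0 ≤ K ∧ ∀ x, |mTD aStar a x η| ≤ K * (|x.Y| + 1) := by
  obtain ⟨R, hR⟩ := hη.exists_abs_rest_le
  refine ⟨|2 * L / l| + |L| * |2 * L / l| + |R|, by positivity, fun x => ?_⟩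
  rw [mTD_eq]
  have h1 := (hη.outcome x.A x.Z x.C).trans (le_abs_self L)
  have h2 := (hη.abs_weight_le x.A x.Z x.C).trans (le_abs_self _)
  have h3 := (hR x.A x.Z x.C).trans (le_abs_self R)
  have h4 : |(x.Y - η.outcome x.A x.Z x.C) * η.weight aStar a x.A x.Z x.C| ≤
      (|x.Y| + |L|) * |2 * L / l| := by
    rw [abs_mul]
    exact mul_le_mul ((abs_sub _ _).trans (by linarith)) h2 (abs_nonneg _) (by positivity)
  refine (abs_add_le _ _).trans ((add_le_add h4 h3).trans ?_)
  have h5 : 0 ≤ |R| * |x.Y| := by positivity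
  have h6 : 0 ≤ |2 * L / l| := abs_nonneg _
  have h7 : 0 ≤ |L| * |2 * L / l| * |x.Y| := by positivity
  nlinarith

variable [MeasurableSpace 𝒜] [MeasurableSpace 𝒵] [MeasurableSpace 𝒞]
  [DiscreteMeasurableSpace 𝒜] [Countable 𝒜] [DiscreteMeasurableSpace 𝒵] [Countable 𝒵]
  [DiscreteMeasurableSpace 𝒞] [Countable 𝒞]
  {P : Measure (ObsTD 𝒜 𝒵 𝒞)} [IsProbabilityMeasure P] {ε : ℝ}
  {aStar a : 𝒜} {η : NuisanceTD 𝒜 𝒵 𝒞} {l L : ℝ}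

lemma measurable_mTD (aStar a : 𝒜) (η : NuisanceTD 𝒜 𝒵 𝒞) :
    Measurable fun x : ObsTD 𝒜 𝒵 𝒞 => mTD aStar a x η := by
  simp_rw [mTD_eq]
  exact ((ObsTD.measurable_Y.sub (measurable_comp_AZC η.outcome)).mul
    (measurable_comp_AZC (η.weight aStar a))).add (measurable_comp_AZC (η.rest aStar a))

/-- The estimating function is jointly measurable in the observation and the data. -/
lemma measurable_mTD_uncurry [Finite 𝒜] [Finite 𝒵] {S : Type*} [MeasurableSpace S] (aStar a : 𝒜)
    {ηhat : S → NuisanceTD 𝒜 𝒵 𝒞} (h1 : ∀ a z c, Measurable fun s => (ηhat s).outcome a z c)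
    (h2 : ∀ z a c, Measurable fun s => (ηhat s).mediator z a c)
    (h3 : ∀ a c, Measurable fun s => (ηhat s).propensity a c) :
    Measurable fun p : ObsTD 𝒜 𝒵 𝒞 × S => mTD aStar a p.1 (ηhat p.2) := by
  have := Fintype.ofFinite 𝒜
  have := Fintype.ofFinite 𝒵
  have key : Measurable fun p : (𝒜 × 𝒵 × 𝒞) × (ℝ × S) =>
      mTD aStar a ((p.1.2.2, p.1.1, p.1.2.1, p.2.1) : ObsTD 𝒜 𝒵 𝒞) (ηhat p.2.2) := by
    -- For a fixed value of the countable triple only finite sums, products and quotients of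
    -- measurable functions remain.
    refine measurable_from_prod_countable_right fun w => ?_
    simp only [mTD, tsum_fintype, ObsTD.A, ObsTD.Z, ObsTD.C, ObsTD.Y]
    have h1' : ∀ a z c, Measurable fun p : ℝ × S => (ηhat p.2).outcome a z c :=
      fun a z c => (h1 a z c).comp measurable_snd
    have h2' : ∀ z a c, Measurable fun p : ℝ × S => (ηhat p.2).mediator z a c :=
      fun a z c => (h2 a z c).comp measurable_snd
    have h3' : ∀ a c, Measurable fun p : ℝ × S => (ηhat p.2).propensity a c :=
      fun a c => (h3 a c).comp measurable_snd
    fun_prop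
  exact key.comp ((ObsTD.measurable_AZC.comp measurable_fst).prodMk
    ((ObsTD.measurable_Y.comp measurable_fst).prodMk measurable_snd))

/-- A finite second moment of `Y` does not bound the regression over infinitely many covariate
values, so the true nuisance itself may fail `Bounds`. Truncating the regression alone repairs this.
-/
lemma PositiveLaw.bounds_truncate (h : PositiveLaw P ε) (aStar a : 𝒜) (K : ℝ) :
    ((trueNuisanceTD P).truncate K).Bounds aStar a ε (max K 1) where
  pos := h.eps_pos
  outcome b z c := by
    simp only [truncate]
    split_ifs with hK
    · exact hK.trans (le_max_left _ _)
    · simp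
  mediator_below z b c := (h.mediator z b c).le
  mediator_above b _ z c := by
    refine le_trans ?_ (le_max_right _ _)
    exact (abs_of_pos (h.mediator_pos z b c)).trans_le (h.mediator_le_one z b c)
  propensity_below b _ c := (h.propensity b c).le
  propensity_above b c := by
    refine le_trans ?_ (le_max_right _ _)
    exact (abs_of_pos (h.propensity_pos b c)).trans_le (h.propensity_le_one b c)

lemma exists_truncate_le (hY : MemLp ObsTD.Y 2 P) {δ : ℝ} (hδ : 0 < δ) :
    ∃ K, eLpNorm (fun x => ((trueNuisanceTD P).truncate K).outcome x.A x.Z x.C -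
      (trueNuisanceTD P).outcome x.A x.Z x.C) 2 P ≤ ENNReal.ofReal δ := by
  obtain ⟨K, -, hK⟩ := exists_tail_sq_le (measurable_comp_AZC (trueNuisanceTD P).outcome)
    (memLp_outcome hY) hδ
  refine ⟨K, ?_⟩
  set f : ObsTD 𝒜 𝒵 𝒞 → ℝ := fun x => (trueNuisanceTD P).outcome x.A x.Z x.C with hf
  have hfm : Measurable f := measurable_comp_AZC (trueNuisanceTD P).outcome
  have hset : MeasurableSet {y | K < |f y|} := measurableSet_lt measurable_const hfm.abs
  have e : eLpNorm (fun x => ((trueNuisanceTD P).truncate K).outcome x.A x.Z x.C -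
      (trueNuisanceTD P).outcome x.A x.Z x.C) 2 P = eLpNorm ({y | K < |f y|}.indicator f) 2 P := by
    refine eLpNorm_congr_norm_ae (Eventually.of_forall fun x => ?_)
    simp only [truncate, Set.indicator_apply, Set.mem_ofPred_eq, hf]
    split_ifs with h1 h2 h2
    · exact absurd h2 (not_lt.2 h1)
    · simp
    · simp
    · exact absurd (not_le.1 h1) h2
  rw [e]
  have h1 := ofReal_integral_sq ((memLp_outcome hY).indicator hset)
  have h2 : eLpNorm ({y | K < |f y|}.indicator f) 2 P ^ 2 ≤ ENNReal.ofReal δ ^ 2 := by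
    rw [← h1, ← ENNReal.ofReal_pow hδ.le]
    exact ENNReal.ofReal_le_ofReal hK
  exact (ENNReal.pow_le_pow_left_iff two_ne_zero).1 h2

/-- With the mediator and treatment probabilities held at the truth, `mTD` is affine in the
regression. The residual term contributes `1 / ε`, the two sums divided by the propensity `2 / ε`,
and the sum against the contrast `1`. -/
lemma PositiveLaw.abs_mTD_sub_le [Fintype 𝒜] [Fintype 𝒵] (h : PositiveLaw P ε)
    (hm : η.mediator = (trueNuisanceTD P).mediator)
    (hp : η.propensity = (trueNuisanceTD P).propensity) (x : ObsTD 𝒜 𝒵 𝒞) :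
    |mTD aStar a x η - mTD aStar a x (trueNuisanceTD P)| ≤ (3 / ε + 1) *
      ∑ w : 𝒜 × 𝒵, |η.outcome w.1 w.2 x.C - (trueNuisanceTD P).outcome w.1 w.2 x.C| := by
  set η₀ := trueNuisanceTD P with hη₀
  set D : 𝒜 → 𝒵 → ℝ := fun b z => η.outcome b z x.C - η₀.outcome b z x.C with hD
  have hε := h.eps_pos
  have e : mTD aStar a x η - mTD aStar a x η₀ =
      -(D x.A x.Z * η₀.weight aStar a x.A x.Z x.C) +
      ((∑ b, D b x.Z * η₀.propensity b x.C) -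
        ∑ b, ∑ z, D b z * η₀.mediator z x.A x.C * η₀.propensity b x.C) *
      ((Set.indicator {aStar} (fun _ => (1 : ℝ)) x.A - Set.indicator {a} (fun _ => (1 : ℝ)) x.A)
        / η₀.propensity x.A x.C) + ∑ z, D x.A z * η₀.contrast aStar a z x.C := by
    simp only [mTD, tsum_fintype, hm, hp, hD, sub_mul, Finset.sum_sub_distrib, weight, contrast]
    ring
  set T := ∑ w : 𝒜 × 𝒵, |η.outcome w.1 w.2 x.C - η₀.outcome w.1 w.2 x.C| with hT
  have hT' : T = ∑ b, ∑ z, |D b z| := Fintype.sum_prod_type _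
  have hT0 : 0 ≤ T := Finset.sum_nonneg fun _ _ => abs_nonneg _
  have hrow : ∀ b, ∑ z, |D b z| ≤ T := fun b => by
    rw [hT']
    exact Finset.single_le_sum (f := fun b => ∑ z, |D b z|)
      (fun _ _ => Finset.sum_nonneg fun _ _ => abs_nonneg _) (Finset.mem_univ b)
  have hentry : ∀ b z, |D b z| ≤ ∑ z, |D b z| := fun b z =>
    Finset.single_le_sum (f := fun z => |D b z|) (fun _ _ => abs_nonneg _) (Finset.mem_univ z)
  have hπ : ∀ b, |η₀.propensity b x.C| ≤ 1 := fun b =>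
    (abs_of_pos (h.propensity_pos b x.C)).trans_le (h.propensity_le_one b x.C)
  have hpm : ∀ b z, |η₀.mediator z b x.C| ≤ 1 := fun b z =>
    (abs_of_pos (h.mediator_pos z b x.C)).trans_le (h.mediator_le_one z b x.C)
  have i1 : |D x.A x.Z * η₀.weight aStar a x.A x.Z x.C| ≤ T * (1 / ε) := by
    rw [abs_mul]
    exact mul_le_mul ((hentry _ _).trans (hrow _)) (h.abs_weight_le _ _ _ _ _) (abs_nonneg _) hT0
  have i2 : |∑ b, D b x.Z * η₀.propensity b x.C| ≤ T := by
    rw [hT']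
    refine (Finset.abs_sum_le_sum_abs _ _).trans (Finset.sum_le_sum fun b _ => ?_)
    rw [abs_mul]
    exact (mul_le_of_le_one_right (abs_nonneg _) (hπ b)).trans (hentry _ _)
  have i3 : |∑ b, ∑ z, D b z * η₀.mediator z x.A x.C * η₀.propensity b x.C| ≤ T := by
    rw [hT']
    refine (Finset.abs_sum_le_sum_abs _ _).trans (Finset.sum_le_sum fun b _ => ?_)
    refine (Finset.abs_sum_le_sum_abs _ _).trans (Finset.sum_le_sum fun z _ => ?_)
    rw [abs_mul, abs_mul]
    exact (mul_le_of_le_one_right (by positivity) (hπ b)).trans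
      (mul_le_of_le_one_right (abs_nonneg _) (hpm _ _))
  have i4 : |(Set.indicator {aStar} (fun _ => (1 : ℝ)) x.A -
      Set.indicator {a} (fun _ => (1 : ℝ)) x.A) / η₀.propensity x.A x.C| ≤ 1 / ε := by
    rw [abs_div, abs_of_pos (h.propensity_pos _ _)]
    refine div_le_div₀ zero_le_one ?_ hε (h.propensity _ _).le
    classical
    simp only [Set.indicator_apply, Set.mem_singleton_iff]
    split_ifs <;> simp
  have i5 : |∑ z, D x.A z * η₀.contrast aStar a z x.C| ≤ T := by
    refine le_trans ?_ (hrow x.A)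
    refine (Finset.abs_sum_le_sum_abs _ _).trans (Finset.sum_le_sum fun z _ => ?_)
    rw [abs_mul]
    exact mul_le_of_le_one_right (abs_nonneg _) (h.abs_contrast_le_one _ _ _ _)
  rw [e]
  refine (abs_add_le _ _).trans ((add_le_add ((abs_add_le _ _).trans (add_le_add
    ((abs_neg _).trans_le i1) ((abs_mul _ _).trans_le (mul_le_mul ((abs_sub _ _).trans
      (add_le_add i2 i3)) i4 (abs_nonneg _) (by positivity))))) i5).trans (le_of_eq ?_))
  ring

/-- The pointwise bound involves the regression error at all `(b, z)`; Cauchy–Schwarz for finite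
sums followed by positivity brings it back to the observed cell. -/
lemma PositiveLaw.exists_eLpNorm_mTD_sub_le [Fintype 𝒜] [Fintype 𝒵] (h : PositiveLaw P ε)
    (aStar a : 𝒜) :
    ∃ C : ℝ, 0 ≤ C ∧ ∀ η : NuisanceTD 𝒜 𝒵 𝒞, η.mediator = (trueNuisanceTD P).mediator →
      η.propensity = (trueNuisanceTD P).propensity →
      eLpNorm (fun x => mTD aStar a x η - mTD aStar a x (trueNuisanceTD P)) 2 P ≤
        ENNReal.ofReal C *
          eLpNorm (fun x => η.outcome x.A x.Z x.C - (trueNuisanceTD P).outcome x.A x.Z x.C) 2 P := by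
  have hε := h.eps_pos
  set N : ℝ := ((Finset.univ : Finset (𝒜 × 𝒵)).card : ℝ) with hN
  have hN0 : 0 ≤ N := Nat.cast_nonneg _
  refine ⟨(3 / ε + 1) * √N * ε⁻¹, by positivity, fun η hm hp => ?_⟩
  set η₀ := trueNuisanceTD P with hη₀
  refine (ENNReal.pow_le_pow_left_iff two_ne_zero).1 ?_
  rw [mul_pow, eLpNorm_two_sq, eLpNorm_two_sq, ← ENNReal.ofReal_pow (by positivity)]
  have hpt : ∀ x : ObsTD 𝒜 𝒵 𝒞, ‖mTD aStar a x η - mTD aStar a x η₀‖ₑ ^ 2 ≤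
      ENNReal.ofReal ((3 / ε + 1) ^ 2 * N) *
        ∑ b, ∑ z, ‖η.outcome b z x.C - η₀.outcome b z x.C‖ₑ ^ 2 := by
    intro x
    rw [← Fintype.sum_prod_type' fun b z => ‖η.outcome b z x.C - η₀.outcome b z x.C‖ₑ ^ 2]
    simp only [Real.enorm_eq_ofReal_abs, ← ENNReal.ofReal_pow (abs_nonneg _)]
    rw [← ENNReal.ofReal_sum_of_nonneg fun _ _ => sq_nonneg _,
      ← ENNReal.ofReal_mul (by positivity)]
    refine ENNReal.ofReal_le_ofReal ?_
    have h1 := h.abs_mTD_sub_le (aStar := aStar) (a := a) hm hp x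
    have h2 := sq_sum_le_card_mul_sum_sq (s := Finset.univ)
      (f := fun w : 𝒜 × 𝒵 => |η.outcome w.1 w.2 x.C - η₀.outcome w.1 w.2 x.C|)
    calc _ ≤ ((3 / ε + 1) *
          ∑ w : 𝒜 × 𝒵, |η.outcome w.1 w.2 x.C - η₀.outcome w.1 w.2 x.C|) ^ 2 :=
          pow_le_pow_left₀ (abs_nonneg _) h1 2
      _ = (3 / ε + 1) ^ 2 *
          (∑ w : 𝒜 × 𝒵, |η.outcome w.1 w.2 x.C - η₀.outcome w.1 w.2 x.C|) ^ 2 := mul_pow _ _ _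
      _ ≤ (3 / ε + 1) ^ 2 * (N *
          ∑ w : 𝒜 × 𝒵, |η.outcome w.1 w.2 x.C - η₀.outcome w.1 w.2 x.C| ^ 2) :=
          mul_le_mul_of_nonneg_left h2 (by positivity)
      _ = _ := by ring
  have hgm : ∀ b z, Measurable fun x : ObsTD 𝒜 𝒵 𝒞 =>
      ‖η.outcome b z x.C - η₀.outcome b z x.C‖ₑ ^ 2 := fun b z =>
    measurable_comp_AZC fun _ _ c => ‖η.outcome b z c - η₀.outcome b z c‖ₑ ^ 2
  calc _ ≤ ∫⁻ x, ENNReal.ofReal ((3 / ε + 1) ^ 2 * N) *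
        ∑ b, ∑ z, ‖η.outcome b z x.C - η₀.outcome b z x.C‖ₑ ^ 2 ∂P := lintegral_mono hpt
    _ = ENNReal.ofReal ((3 / ε + 1) ^ 2 * N) *
        ∑ b, ∑ z, ∫⁻ x, ‖η.outcome b z x.C - η₀.outcome b z x.C‖ₑ ^ 2 ∂P := by
        rw [lintegral_const_mul' _ _ ENNReal.ofReal_ne_top, lintegral_finsetSum _ fun b _ =>
          Finset.measurable_fun_sum _ fun z _ => hgm b z]
        simp_rw [lintegral_finsetSum _ fun z (_ : z ∈ Finset.univ) => hgm _ z]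
    _ ≤ ENNReal.ofReal ((3 / ε + 1) ^ 2 * N) * (ENNReal.ofReal (ε ^ 2)⁻¹ *
        ∫⁻ x, ‖η.outcome x.A x.Z x.C - η₀.outcome x.A x.Z x.C‖ₑ ^ 2 ∂P) :=
        mul_le_mul' le_rfl
          (h.sum_lintegral_le fun b z c => ‖η.outcome b z c - η₀.outcome b z c‖ₑ ^ 2)
    _ = _ := by
        rw [← mul_assoc, ← ENNReal.ofReal_mul (by positivity)]
        congr 2
        rw [mul_pow, mul_pow, Real.sq_sqrt hN0, inv_pow]

lemma NuisanceTD.Bounds.memLp_mTD [Fintype 𝒜] [Fintype 𝒵] (hη : η.Bounds aStar a l L)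
    (hY : MemLp ObsTD.Y 2 P) : MemLp (fun x => mTD aStar a x η) 2 P := by
  obtain ⟨K, -, hK⟩ := hη.exists_abs_mTD_le
  have h1 : MemLp (fun x : ObsTD 𝒜 𝒵 𝒞 => K * (|x.Y| + 1)) 2 P :=
    (hY.abs.add (memLp_const 1)).const_mul K
  exact h1.mono' (measurable_mTD aStar a η).aestronglyMeasurable (Eventually.of_forall hK)

/-- Robustness at work: every product in the bias bound contains a mediator error, and these vanish,
so truncating the regression at any level causes no bias. -/
lemma PositiveLaw.integral_mTD_truncate [Fintype 𝒜] [Fintype 𝒵] (h : PositiveLaw P ε)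
    (hY : MemLp ObsTD.Y 2 P) (aStar a : 𝒜) (K : ℝ) :
    ∫ x, mTD aStar a x ((trueNuisanceTD P).truncate K) ∂P =
      ∫ x, x.Y * (trueNuisanceTD P).weight aStar a x.A x.Z x.C ∂P := by
  have := enorm_integral_mTD_sub_le h hY (h.bounds_truncate aStar a K) rfl rfl rfl (fun _ => rfl)
    rfl rfl rfl
  simp only [truncate, sub_self, eLpNorm_zero', mul_zero, add_zero, nonpos_iff_eq_zero,
    enorm_eq_zero] at this
  exact sub_eq_zero.1 this

/-- The truncated version is in `L²` by linear growth in `Y`, and the truth is at finite `L²`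
distance from it. -/
lemma PositiveLaw.memLp_mTD [Fintype 𝒜] [Fintype 𝒵] (h : PositiveLaw P ε)
    (hY : MemLp ObsTD.Y 2 P) (aStar a : 𝒜) :
    MemLp (fun x => mTD aStar a x (trueNuisanceTD P)) 2 P := by
  obtain ⟨C, hC, hCle⟩ := h.exists_eLpNorm_mTD_sub_le aStar a
  obtain ⟨K, hK⟩ := exists_truncate_le hY one_pos
  have h1 := (h.bounds_truncate aStar a K).memLp_mTD hY
  have h2 := hCle ((trueNuisanceTD P).truncate K) rfl rfl
  have h3 : MemLp (fun x => mTD aStar a x ((trueNuisanceTD P).truncate K) -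
      mTD aStar a x (trueNuisanceTD P)) 2 P :=
    ⟨((measurable_mTD _ _ _).sub (measurable_mTD _ _ _)).aestronglyMeasurable,
      h2.trans_lt (ENNReal.mul_lt_top ENNReal.ofReal_lt_top
        (hK.trans_lt ENNReal.ofReal_lt_top))⟩
  refine (h1.sub h3).congr_norm (measurable_mTD _ _ _).aestronglyMeasurable
    (Eventually.of_forall fun x => ?_)
  simp

/-- The estimating function can be approximated in `L²` by one with bounded outcome regression. -/
lemma PositiveLaw.exists_truncate_mTD_le [Fintype 𝒜] [Fintype 𝒵] (h : PositiveLaw P ε)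
    (hY : MemLp ObsTD.Y 2 P) (aStar a : 𝒜) {δ : ℝ} (hδ : 0 < δ) :
    ∃ K, eLpNorm (fun x => ((trueNuisanceTD P).truncate K).outcome x.A x.Z x.C -
        (trueNuisanceTD P).outcome x.A x.Z x.C) 2 P ≤ ENNReal.ofReal δ ∧
      eLpNorm (fun x => mTD aStar a x ((trueNuisanceTD P).truncate K) -
        mTD aStar a x (trueNuisanceTD P)) 2 P ≤ ENNReal.ofReal δ := by
  obtain ⟨C, hC, hCle⟩ := h.exists_eLpNorm_mTD_sub_le aStar a
  obtain ⟨K, hK⟩ := exists_truncate_le hY (δ := δ / (C + 1)) (by positivity)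
  refine ⟨K, hK.trans (ENNReal.ofReal_le_ofReal (div_le_self hδ.le (by linarith))),
    (hCle ((trueNuisanceTD P).truncate K) rfl rfl).trans ((mul_le_mul' le_rfl hK).trans ?_)⟩
  rw [← ENNReal.ofReal_mul hC]
  refine ENNReal.ofReal_le_ofReal ?_
  rw [mul_div_assoc', div_le_iff₀ (by positivity)]
  nlinarith

/-- The mean of the estimating function at the true nuisance functions. -/
lemma PositiveLaw.integral_mTD [Fintype 𝒜] [Fintype 𝒵] (h : PositiveLaw P ε)
    (hY : MemLp ObsTD.Y 2 P) (aStar a : 𝒜) :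
    ∫ x, mTD aStar a x (trueNuisanceTD P) ∂P =
      ∫ x, x.Y * (trueNuisanceTD P).weight aStar a x.A x.Z x.C ∂P := by
  refine eq_of_forall_dist_le fun δ hδ => ?_
  obtain ⟨K, -, hK⟩ := h.exists_truncate_mTD_le hY aStar a hδ
  rw [← h.integral_mTD_truncate hY aStar a K, dist_comm, Real.dist_eq,
    ← integral_sub (((h.bounds_truncate aStar a K).memLp_mTD hY).integrable one_le_two)
      ((h.memLp_mTD hY aStar a).integrable one_le_two)]
  have h1 : ‖∫ x, (mTD aStar a x ((trueNuisanceTD P).truncate K) -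
      mTD aStar a x (trueNuisanceTD P)) ∂P‖ₑ ≤ ENNReal.ofReal δ :=
    (enorm_integral_le_lintegral_enorm _).trans (by
      rw [← eLpNorm_one_eq_lintegral_enorm]
      exact (eLpNorm_le_eLpNorm_of_exponent_le one_le_two
        ((measurable_mTD _ _ _).sub (measurable_mTD _ _ _)).aestronglyMeasurable).trans hK)
  rw [Real.enorm_eq_ofReal_abs] at h1
  exact (ENNReal.ofReal_le_ofReal_iff hδ.le).1 h1

end Truncation

/-! ### Asymptotic linearity of the two-door estimator. -/

section TwoDoorEstimator

set_option linter.unusedSectionVars false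

open NuisanceTD

variable {𝒜 𝒵 𝒞 : Type u}

/-- Bounds holding separately with probability tending to one hold jointly. -/
lemma NuisanceTD.exists_bounds_wpto {S : ℕ → Type*} [∀ n, MeasurableSpace (S n)]
    {μ : ∀ n, Measure (S n)} {ηhat : ∀ n, S n → NuisanceTD 𝒜 𝒵 𝒞} {aStar a : 𝒜}
    (h1 : ∃ ε : ℝ, WithProbTendingToOne μ fun n s => ∀ b z c, |(ηhat n s).outcome b z c| < ε)
    (h2 : ∃ ε : ℝ, 0 < ε ∧
      WithProbTendingToOne μ fun n s => ∀ b z c, ε < (ηhat n s).mediator z b c)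
    (h3 : ∀ b ∈ ({aStar, a} : Set 𝒜), ∃ ε : ℝ,
      WithProbTendingToOne μ fun n s => ∀ z c, |(ηhat n s).mediator z b c| < ε)
    (h4 : ∀ b ∈ ({aStar, a} : Set 𝒜), ∃ ε : ℝ, 0 < ε ∧
      WithProbTendingToOne μ fun n s => ∀ c, ε < (ηhat n s).propensity b c)
    (h5 : ∃ ε : ℝ, WithProbTendingToOne μ fun n s => ∀ b c, |(ηhat n s).propensity b c| < ε) :
    ∃ l L : ℝ, WithProbTendingToOne μ fun n s => (ηhat n s).Bounds aStar a l L := by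
  obtain ⟨e1, h1⟩ := h1
  obtain ⟨e2, he2, h2⟩ := h2
  obtain ⟨e3, h3s⟩ := h3 aStar (by simp)
  obtain ⟨e3', h3a⟩ := h3 a (by simp)
  obtain ⟨e4, he4, h4s⟩ := h4 aStar (by simp)
  obtain ⟨e4', he4', h4a⟩ := h4 a (by simp)
  obtain ⟨e5, h5⟩ := h5
  refine ⟨min e2 (min e4 e4'), max e1 (max e3 (max e3' e5)),
    ((h1.and h2).and ((h3s.and h3a).and ((h4s.and h4a).and h5))).mono ?_⟩
  rintro n s ⟨⟨g1, g2⟩, ⟨g3s, g3a⟩, ⟨g4s, g4a⟩, g5⟩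
  refine ⟨by positivity, fun b z c => (g1 b z c).le.trans (by simp),
    fun z b c => (min_le_left _ _).trans (g2 b z c).le, ?_, ?_,
    fun b c => (g5 b c).le.trans (by simp)⟩
  · rintro b (rfl | rfl) z c
    · exact (g3s z c).le.trans (by simp)
    · exact (g3a z c).le.trans (by simp)
  · rintro b (rfl | rfl) c
    · exact ((min_le_right _ _).trans (min_le_left _ _)).trans (g4s c).le
    · exact ((min_le_right _ _).trans (min_le_right _ _)).trans (g4a c).le

variable [MeasurableSpace 𝒜] [MeasurableSpace 𝒵] [MeasurableSpace 𝒞]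
  [DiscreteMeasurableSpace 𝒜] [Countable 𝒜] [DiscreteMeasurableSpace 𝒵] [Countable 𝒵]
  [DiscreteMeasurableSpace 𝒞] [Countable 𝒞]
  {𝒳 : Type*} [MeasurableSpace 𝒳] {P : Measure 𝒳} {X : 𝒳 → ObsTD 𝒜 𝒵 𝒞} {ε : ℝ} {aStar a : 𝒜}

/-- Asymptotic linearity of the two-door estimator, for observations from which `(C, A, Z, Y)` is
obtained by a map `X`. -/
theorem isAsymptoticallyLinear_twoDoor [IsProbabilityMeasure P] (hX : Measurable X)
    (h : PositiveLaw (P.map X) ε) (hY : MemLp ObsTD.Y 2 (P.map X)) {η₀ : NuisanceTD 𝒜 𝒵 𝒞}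
    (hη₀ : η₀ = trueNuisanceTD (P.map X)) {θ : ℝ}
    (hθ : ∫ x, x.Y * η₀.weight aStar a x.A x.Z x.C ∂(P.map X) = θ) {k : ℕ → ℕ}
    {ηhat : ∀ n, Sample 𝒳 n (k n) → NuisanceTD 𝒜 𝒵 𝒞} {est : ∀ n, Sample 𝒳 n (k n) → ℝ}
    (hm1 : ∀ n a z c, Measurable fun s => (ηhat n s).outcome a z c)
    (hm2 : ∀ n z a c, Measurable fun s => (ηhat n s).mediator z a c)
    (hm3 : ∀ n a c, Measurable fun s => (ηhat n s).propensity a c)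
    (hest : ∀ n s, 0 < n →
      est n s = (1 / (n : ℝ)) * ∑ i, mTD aStar a (X (s.1 i)) (ηhat n s))
    (hreg : PlugInRegularity P k (fun x η => mTD aStar a (X x) η) η₀ ηhat)
    (hB : ∃ l L : ℝ, WithProbTendingToOne (fun n => sampleLaw P n (k n))
      fun n s => (ηhat n s).Bounds aStar a l L)
    (r1 : ProductRate P k
      (fun n s x => (ηhat n s).outcome (X x).A (X x).Z (X x).C - η₀.outcome (X x).A (X x).Z (X x).C)
      (fun n s x => (ηhat n s).mediator (X x).Z (X x).A (X x).C -
        η₀.mediator (X x).Z (X x).A (X x).C))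
    (r2 : ∀ b ∈ ({aStar, a} : Set 𝒜), ProductRate P k
      (fun n s x => (ηhat n s).outcome (X x).A (X x).Z (X x).C - η₀.outcome (X x).A (X x).Z (X x).C)
      (fun n s x => (ηhat n s).mediator (X x).Z b (X x).C - η₀.mediator (X x).Z b (X x).C))
    (r3 : ∀ b ∈ ({aStar, a} : Set 𝒜), ProductRate P k
      (fun n s x => (ηhat n s).mediator (X x).Z b (X x).C - η₀.mediator (X x).Z b (X x).C)
      (fun n s x => (ηhat n s).propensity b (X x).C - η₀.propensity b (X x).C))
    (r4 : ∀ b ∈ ({aStar, a} : Set 𝒜), ProductRate P k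
      (fun n s x => (ηhat n s).mediator (X x).Z b (X x).C - η₀.mediator (X x).Z b (X x).C)
      (fun n s x => (ηhat n s).propensity (X x).A (X x).C - η₀.propensity (X x).A (X x).C)) :
    IsAsymptoticallyLinear P θ k est fun x => mTD aStar a (X x) η₀ - θ := by
  have : IsProbabilityMeasure (P.map X) := Measure.isProbabilityMeasure_map hX.aemeasurable
  have := h.finite_A
  have := h.finite_Z
  have := Fintype.ofFinite 𝒜
  have := Fintype.ofFinite 𝒵
  have hmm := fun η : NuisanceTD 𝒜 𝒵 𝒞 => measurable_mTD aStar a η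
  have hmem : MemLp (fun x => mTD aStar a (X x) η₀) 2 P := by
    rw [hη₀]
    exact (h.memLp_mTD hY aStar a).comp_of_map hX.aemeasurable
  refine isAsymptoticallyLinear_of_plugIn hreg (fun n => ?_) ((hmm η₀).comp hX) hmem ?_ ?_ hest
  · exact (measurable_mTD_uncurry aStar a (hm1 n) (hm2 n) (hm3 n)).comp
      ((hX.comp measurable_fst).prodMk measurable_snd)
  · rw [← hθ, hη₀, ← h.integral_mTD hY aStar a, integral_map hX.aemeasurable
      (hmm _).aestronglyMeasurable]
  · obtain ⟨l, L, hB⟩ := hB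
    set c₁ := ENNReal.ofReal (1 / l + 1 / (l * ε))
    set c₂ := ENNReal.ofReal ((ε ^ 2)⁻¹ * (L * (L / l + 1)))
    have hs : aStar ∈ ({aStar, a} : Set 𝒜) := by simp
    have ha : a ∈ ({aStar, a} : Set 𝒜) := by simp
    have hrate := (TendstoZeroInProb.const_mul (TendstoZeroInProb.add r1
      ((r2 _ hs).add (r2 _ ha))) (c := c₁) ENNReal.ofReal_ne_top).add
      (TendstoZeroInProb.const_mul (TendstoZeroInProb.add
        (TendstoZeroInProb.add (r3 _ hs) (r4 _ hs)) ((r3 _ ha).add (r4 _ ha)))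
        (c := c₂) ENNReal.ofReal_ne_top)
    -- The bias bound is available on an event whose probability tends to one, and `hrate` concerns
    -- `√n` times its right-hand side.
    refine TendstoZeroInProb.of_wpto hB hrate (Eventually.of_forall fun n s hs => ?_)
    have hb := enorm_integral_mTD_sub_le h hY hs hη₀ rfl rfl (fun _ => rfl) rfl rfl rfl
    rw [integral_map hX.aemeasurable (hmm _).aestronglyMeasurable, hθ] at hb
    have hmap : ∀ g : 𝒜 → 𝒵 → 𝒞 → ℝ, eLpNorm (fun x : ObsTD 𝒜 𝒵 𝒞 => g x.A x.Z x.C) 2 (P.map X) =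
        eLpNorm (fun x => g (X x).A (X x).Z (X x).C) 2 P := fun g =>
      eLpNorm_map_measure (measurable_comp_AZC g).aestronglyMeasurable hX.aemeasurable
    rw [hmap fun b z c => (ηhat n s).outcome b z c - η₀.outcome b z c,
      hmap fun b z c => (ηhat n s).mediator z b c - η₀.mediator z b c,
      hmap fun b z c => (ηhat n s).mediator z aStar c - η₀.mediator z aStar c,
      hmap fun b z c => (ηhat n s).mediator z a c - η₀.mediator z a c,
      hmap fun b z c => (ηhat n s).propensity aStar c - η₀.propensity aStar c,
      hmap fun b z c => (ηhat n s).propensity a c - η₀.propensity a c,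
      hmap fun b z c => (ηhat n s).propensity b c - η₀.propensity b c] at hb
    refine (mul_le_mul' le_rfl hb).trans (le_of_eq ?_)
    ring

end TwoDoorEstimator

/-! ### Hellinger continuity of the conditional probabilities. -/

section Discrepancy

set_option linter.unusedSectionVars false

open NuisanceTD

lemma integral_sq_le_of_eLpNorm_le {𝒳 : Type*} [MeasurableSpace 𝒳] {P : Measure 𝒳} {f : 𝒳 → ℝ}
    (hf : AEStronglyMeasurable f P) {N : ℝ} (hN : 0 ≤ N)
    (h : eLpNorm f 2 P ≤ ENNReal.ofReal N) : MemLp f 2 P ∧ ∫ x, f x ^ 2 ∂P ≤ N ^ 2 := by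
  have hm : MemLp f 2 P := ⟨hf, h.trans_lt ENNReal.ofReal_lt_top⟩
  refine ⟨hm, ?_⟩
  rw [← ENNReal.ofReal_le_ofReal_iff (sq_nonneg N), ofReal_integral_sq hm, ENNReal.ofReal_pow hN]
  gcongr

/-- Perturbation of a ratio of probabilities in terms of their square roots. -/
lemma mul_div_sub_div_sq_le {s t s' t' : ℝ} (hs : 0 ≤ s) (hst : s ≤ t) (ht : 0 < t) (hs' : 0 ≤ s')
    (hst' : s' ≤ t') (ht' : 0 < t') :
    t * (s / t - s' / t') ^ 2 ≤ 8 * ((√s - √s') ^ 2 + (√t - √t') ^ 2) := by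
  -- With the roots `x`, `y` of the two ratios, both in `[0, 1]`, one has `|x² - y²| ≤ 2 |x - y|`
  -- and `√t (x - y) = (√s - √s') - (√t - √t') y`.
  set x := √(s / t) with hx
  set y := √(s' / t') with hy
  have hx0 : 0 ≤ x := Real.sqrt_nonneg _
  have hy0 : 0 ≤ y := Real.sqrt_nonneg _
  have hx1 : x ≤ 1 := Real.sqrt_le_one.2 ((div_le_one ht).2 hst)
  have hy1 : y ≤ 1 := Real.sqrt_le_one.2 ((div_le_one ht').2 hst')
  have ex : s / t = x ^ 2 := (Real.sq_sqrt (by positivity)).symm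
  have ey : s' / t' = y ^ 2 := (Real.sq_sqrt (by positivity)).symm
  have es : √s = √t * x := by
    rw [hx, Real.sqrt_div' _ ht.le, mul_div_cancel₀]
    exact (Real.sqrt_pos.2 ht).ne'
  have es' : √s' = √t' * y := by
    rw [hy, Real.sqrt_div' _ ht'.le, mul_div_cancel₀]
    exact (Real.sqrt_pos.2 ht').ne'
  have et : t = √t ^ 2 := (Real.sq_sqrt ht.le).symm
  rw [ex, ey, es, es']
  set T := √t
  set T' := √t'
  have h1 : (x ^ 2 - y ^ 2) ^ 2 ≤ 4 * (x - y) ^ 2 := by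
    have : (x + y) ^ 2 ≤ 4 := by nlinarith
    calc (x ^ 2 - y ^ 2) ^ 2 = (x + y) ^ 2 * (x - y) ^ 2 := by ring
      _ ≤ 4 * (x - y) ^ 2 := mul_le_mul_of_nonneg_right this (sq_nonneg _)
  have h2 : (T * (x - y)) ^ 2 ≤ 2 * ((T * x - T' * y) ^ 2 + (T - T') ^ 2) := by
    have e : T * (x - y) = (T * x - T' * y) - (T - T') * y := by ring
    have h3 : ((T - T') * y) ^ 2 ≤ (T - T') ^ 2 := by
      rw [mul_pow]
      exact mul_le_of_le_one_right (sq_nonneg _) (pow_le_one₀ hy0 hy1)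
    rw [e]
    nlinarith [sq_nonneg ((T * x - T' * y) + (T - T') * y)]
  calc t * (x ^ 2 - y ^ 2) ^ 2 ≤ t * (4 * (x - y) ^ 2) := mul_le_mul_of_nonneg_left h1 ht.le
    _ = 4 * (T * (x - y)) ^ 2 := by rw [et]; ring
    _ ≤ _ := by linarith

/-- The difference of root probabilities is bounded by the Hellinger integral. -/
lemma sq_sqrt_sub_sqrt_le {𝒳 : Type*} [MeasurableSpace 𝒳] {μ ρ ν : Measure 𝒳}
    [IsProbabilityMeasure μ] [IsProbabilityMeasure ρ] [SigmaFinite ν] (hμ : μ ≪ ν) (hρ : ρ ≪ ν)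
    {S : Set 𝒳} (hS : MeasurableSet S) :
    (√(μ.real S) - √(ρ.real S)) ^ 2 ≤
      ∫ x in S, (rootDensity μ ν x - rootDensity ρ ν x) ^ 2 ∂ν := by
  -- The reverse triangle inequality in `L²` of `ν` restricted to `S`, where the root densities have
  -- norms `√(μ.real S)` and `√(ρ.real S)`.
  have hu := (memLp_rootDensity hμ).restrict S
  have hv := (memLp_rootDensity hρ).restrict S
  have hmass : ∀ {κ : Measure 𝒳} [IsProbabilityMeasure κ], κ ≪ ν →
      ∫ x in S, rootDensity κ ν x ^ 2 ∂ν = √(κ.real S) ^ 2 := by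
    intro κ _ hκ
    have := integral_mul_rootDensity_sq hκ (S.indicator 1)
    rw [integral_indicator_one hS] at this
    rw [Real.sq_sqrt measureReal_nonneg, ← this, ← integral_indicator hS]
    refine integral_congr_ae (Eventually.of_forall fun x => ?_)
    by_cases hx : x ∈ S <;> simp [hx]
  have h1 := abs_integral_mul_le_of_sq_le hu hv (Real.sqrt_nonneg (μ.real S))
    (Real.sqrt_nonneg (ρ.real S)) (hmass hμ).le (hmass hρ).le
  have e : ∀ x, (rootDensity μ ν x - rootDensity ρ ν x) ^ 2 =
      rootDensity μ ν x ^ 2 + rootDensity ρ ν x ^ 2 -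
        2 * (rootDensity μ ν x * rootDensity ρ ν x) := fun x => by ring
  simp_rw [e]
  have i1 : Integrable (fun x => rootDensity μ ν x ^ 2 + rootDensity ρ ν x ^ 2)
    (ν.restrict S) := hu.integrable_sq.add hv.integrable_sq
  have i2 : Integrable (fun x => rootDensity μ ν x * rootDensity ρ ν x) (ν.restrict S) :=
    hu.integrable_mul hv
  rw [integral_sub i1 (i2.const_mul 2), integral_add hu.integrable_sq hv.integrable_sq, integral_const_mul,
    hmass hμ, hmass hρ]
  have h2 := (abs_le.1 h1).2
  nlinarith

variable {𝒜 𝒵 𝒞 : Type u}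

/-- Total squared difference between the conditional probabilities of two nuisance values. -/
def NuisanceTD.discrepancy [Fintype 𝒜] [Fintype 𝒵] (η η' : NuisanceTD 𝒜 𝒵 𝒞) (c : 𝒞) : ℝ :=
  ∑ b, ∑ z, (η.mediator z b c - η'.mediator z b c) ^ 2 +
    ∑ b, (η.propensity b c - η'.propensity b c) ^ 2

namespace NuisanceTD

variable [Fintype 𝒜] [Fintype 𝒵] (η η' : NuisanceTD 𝒜 𝒵 𝒞)

lemma discrepancy_comm (c : 𝒞) : discrepancy η η' c = discrepancy η' η c := by
  simp only [discrepancy, ← neg_sub (η'.mediator _ _ _), ← neg_sub (η'.propensity _ _), neg_sq]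

lemma abs_mediator_sub_le (z : 𝒵) (b : 𝒜) (c : 𝒞) :
    |η.mediator z b c - η'.mediator z b c| ≤ √(discrepancy η η' c) := by
  refine Real.abs_le_sqrt ?_
  have h1 := Finset.single_le_sum (f := fun z => (η.mediator z b c - η'.mediator z b c) ^ 2)
    (fun _ _ => sq_nonneg _) (Finset.mem_univ z)
  have h2 := Finset.single_le_sum
    (f := fun b => ∑ z, (η.mediator z b c - η'.mediator z b c) ^ 2)
    (fun _ _ => Finset.sum_nonneg fun _ _ => sq_nonneg _) (Finset.mem_univ b)
  exact (h1.trans h2).trans (le_add_of_nonneg_right (Finset.sum_nonneg fun _ _ => sq_nonneg _))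

lemma abs_propensity_sub_le (b : 𝒜) (c : 𝒞) :
    |η.propensity b c - η'.propensity b c| ≤ √(discrepancy η η' c) := by
  refine Real.abs_le_sqrt ?_
  have h1 := Finset.single_le_sum (f := fun b => (η.propensity b c - η'.propensity b c) ^ 2)
    (fun _ _ => sq_nonneg _) (Finset.mem_univ b)
  exact h1.trans (le_add_of_nonneg_left
    (Finset.sum_nonneg fun _ _ => Finset.sum_nonneg fun _ _ => sq_nonneg _))

end NuisanceTD

variable [MeasurableSpace 𝒜] [MeasurableSpace 𝒵] [MeasurableSpace 𝒞]
  [DiscreteMeasurableSpace 𝒜] [Countable 𝒜] [DiscreteMeasurableSpace 𝒵] [Countable 𝒵]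
  [DiscreteMeasurableSpace 𝒞] [Countable 𝒞] [Fintype 𝒜] [Fintype 𝒵]
  {𝒳 : Type*} [MeasurableSpace 𝒳] {μ ρ ν : Measure 𝒳} {X : 𝒳 → ObsTD 𝒜 𝒵 𝒞} {ε : ℝ}

/-- The conditional probabilities depend on the law in a Lipschitz way with respect to the
Hellinger distance. -/
lemma PositiveLaw.eLpNorm_sqrt_discrepancy_le [IsProbabilityMeasure μ] [IsProbabilityMeasure ρ]
    [SigmaFinite ν] (hμ : μ ≪ ν) (hρ : ρ ≪ ν) (hX : Measurable X)
    (h : PositiveLaw (μ.map X) ε) (h' : PositiveLaw (ρ.map X) ε) {H : ℝ} (hH0 : 0 ≤ H)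
    (hH : ∫ x, (rootDensity μ ν x - rootDensity ρ ν x) ^ 2 ∂ν ≤ H ^ 2) :
    eLpNorm (fun x => √(discrepancy (trueNuisanceTD (μ.map X)) (trueNuisanceTD (ρ.map X)) x.C)) 2
      (μ.map X) ≤
      ENNReal.ofReal (√(16 / ε * (Fintype.card 𝒜 * Fintype.card 𝒵 + Fintype.card 𝒜)) * H) := by
  have : IsProbabilityMeasure (μ.map X) := Measure.isProbabilityMeasure_map hX.aemeasurable
  have : IsProbabilityMeasure (ρ.map X) := Measure.isProbabilityMeasure_map hX.aemeasurable
  set η := trueNuisanceTD (μ.map X) with hη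
  set η' := trueNuisanceTD (ρ.map X) with hη'
  set M : ℝ := 16 / ε * (Fintype.card 𝒜 * Fintype.card 𝒵 + Fintype.card 𝒜) with hM
  have hε := h.eps_pos
  have hM0 : 0 ≤ M := by positivity
  set D : 𝒳 → ℝ := fun x => rootDensity μ ν x - rootDensity ρ ν x with hD
  have hDi : Integrable (fun x => D x ^ 2) ν :=
    ((memLp_rootDensity hμ).sub (memLp_rootDensity hρ)).integrable_sq
  have hdisc : ∀ c, 0 ≤ discrepancy η η' c := fun c =>
    add_nonneg (Finset.sum_nonneg fun _ _ => Finset.sum_nonneg fun _ _ => sq_nonneg _)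
      (Finset.sum_nonneg fun _ _ => sq_nonneg _)
  have hreal : ∀ {κ : Measure 𝒳} {s : Set (ObsTD 𝒜 𝒵 𝒞)}, MeasurableSet s →
      (κ.map X).real s = κ.real (X ⁻¹' s) := fun hs => map_measureReal_apply hX hs
  -- Stratum by stratum: the mass of `A = b, C = c` exceeds `ε` times that of `C = c`, so the ratio
  -- inequality can be weighted by the stratum. The constant `16` is `8` times two squared root
  -- differences, each at most the Hellinger integral `I` over the stratum. These local integrals
  -- add up to the global one.
  have hcell : ∀ c, discrepancy η η' c * (μ.map X).real {x | x.C = c} ≤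
      M * ∫ x in X ⁻¹' {x | x.C = c}, D x ^ 2 ∂ν := by
    intro c
    have mC : MeasurableSet {x : ObsTD 𝒜 𝒵 𝒞 | x.C = c} := measurableSet_AZC fun _ _ c' => c' = c
    have mAC : ∀ b, MeasurableSet {x : ObsTD 𝒜 𝒵 𝒞 | x.A = b ∧ x.C = c} := fun b =>
      measurableSet_AZC fun b' _ c' => b' = b ∧ c' = c
    have mAZC : ∀ b z, MeasurableSet {x : ObsTD 𝒜 𝒵 𝒞 | x.A = b ∧ x.Z = z ∧ x.C = c} :=
      fun b z => measurableSet_AZC fun b' z' c' => b' = b ∧ z' = z ∧ c' = c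
    set I : ℝ := ∫ x in X ⁻¹' {x | x.C = c}, D x ^ 2 ∂ν with hI
    have hI0 : 0 ≤ I := integral_nonneg fun x => sq_nonneg _
    have hsub : ∀ s : Set (ObsTD 𝒜 𝒵 𝒞), MeasurableSet s → s ⊆ {x | x.C = c} →
        (√((μ.map X).real s) - √((ρ.map X).real s)) ^ 2 ≤ I := by
      intro s hs hsc
      rw [hreal hs, hreal hs]
      refine (sq_sqrt_sub_sqrt_le hμ hρ (hX hs)).trans ?_
      exact setIntegral_mono_set hDi.integrableOn (Eventually.of_forall fun x => sq_nonneg _)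
        (Eventually.of_forall fun x hx => hsc hx)
    have hC := hsub _ mC le_rfl
    have hAC := fun b => hsub _ (mAC b) fun x hx => hx.2
    have hAZC := fun b z => hsub _ (mAZC b z) fun x hx => hx.2.2
    have hp : ∀ b z, (η.mediator z b c - η'.mediator z b c) ^ 2 * (μ.map X).real {x | x.C = c} ≤
        16 / ε * I := by
      intro b z
      have h1 := mul_div_sub_div_sq_le (s := (μ.map X).real {x | x.A = b ∧ x.Z = z ∧ x.C = c})
        (t := (μ.map X).real {x | x.A = b ∧ x.C = c})
        (s' := (ρ.map X).real {x | x.A = b ∧ x.Z = z ∧ x.C = c})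
        (t' := (ρ.map X).real {x | x.A = b ∧ x.C = c}) measureReal_nonneg
        (measureReal_mono fun x hx => ⟨hx.1, hx.2.2⟩) (h.AC_real_pos b c) measureReal_nonneg
        (measureReal_mono fun x hx => ⟨hx.1, hx.2.2⟩) (h'.AC_real_pos b c)
      rw [← trueNuisanceTD_mediator, ← trueNuisanceTD_mediator, ← hη, ← hη'] at h1
      have h2 := h.propensity b c
      rw [trueNuisanceTD_propensity, lt_div_iff₀ (h.C_real_pos c)] at h2
      rw [div_mul_eq_mul_div, le_div_iff₀ hε]
      have h3 := mul_le_mul_of_nonneg_right h2.le (sq_nonneg (η.mediator z b c - η'.mediator z b c))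
      nlinarith [hAC b, hAZC b z]
    have hε1 : ε ≤ 1 := by
      obtain ⟨b⟩ := h.nonempty_A
      exact (h.propensity b c).le.trans (h.propensity_le_one b c)
    have hπ : ∀ b, (η.propensity b c - η'.propensity b c) ^ 2 * (μ.map X).real {x | x.C = c} ≤
        16 / ε * I := by
      intro b
      have h1 := mul_div_sub_div_sq_le (s := (μ.map X).real {x | x.A = b ∧ x.C = c})
        (t := (μ.map X).real {x | x.C = c})
        (s' := (ρ.map X).real {x | x.A = b ∧ x.C = c})
        (t' := (ρ.map X).real {x | x.C = c}) measureReal_nonneg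
        (measureReal_mono fun x hx => hx.2) (h.C_real_pos c) measureReal_nonneg
        (measureReal_mono fun x hx => hx.2) (h'.C_real_pos c)
      rw [← trueNuisanceTD_propensity, ← trueNuisanceTD_propensity, ← hη, ← hη'] at h1
      have h2 : 16 * I ≤ 16 / ε * I := by
        rw [div_mul_eq_mul_div, le_div_iff₀ hε]
        exact mul_le_of_le_one_right (by positivity) hε1
      linarith [hAC b]
    calc discrepancy η η' c * (μ.map X).real {x | x.C = c}
        = ∑ b, ∑ z, (η.mediator z b c - η'.mediator z b c) ^ 2 * (μ.map X).real {x | x.C = c} +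
          ∑ b, (η.propensity b c - η'.propensity b c) ^ 2 * (μ.map X).real {x | x.C = c} := by
          simp only [discrepancy, add_mul, Finset.sum_mul]
      _ ≤ ∑ _b : 𝒜, ∑ _z : 𝒵, 16 / ε * I + ∑ _b : 𝒜, 16 / ε * I :=
          add_le_add (Finset.sum_le_sum fun b _ => Finset.sum_le_sum fun z _ => hp b z)
            (Finset.sum_le_sum fun b _ => hπ b)
      _ = M * I := by
          simp only [Finset.sum_const, Finset.card_univ, nsmul_eq_mul, hM]
          ring
  have hCX : Measurable fun x => (X x).C := ObsTD.measurable_C.comp hX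
  refine (ENNReal.pow_le_pow_left_iff two_ne_zero).1 ?_
  rw [eLpNorm_two_sq, ← ENNReal.ofReal_pow (by positivity), mul_pow, Real.sq_sqrt hM0,
    lintegral_map ((measurable_comp_AZC fun _ _ c => ‖√(discrepancy η η' c)‖ₑ ^ 2)) hX]
  calc ∫⁻ x, ‖√(discrepancy η η' (X x).C)‖ₑ ^ 2 ∂μ
      ≤ ∫⁻ x, ENNReal.ofReal (M * D x ^ 2) ∂ν := by
        refine lintegral_le_of_fibers hCX fun c => ?_
        have hset : {x | (X x).C = c} = X ⁻¹' {x | x.C = c} := rfl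
        have hms : MeasurableSet {x | (X x).C = c} := hCX (measurableSet_singleton c)
        have e1 : ∫⁻ x in {x | (X x).C = c}, ‖√(discrepancy η η' (X x).C)‖ₑ ^ 2 ∂μ =
            ∫⁻ _ in {x | (X x).C = c}, ENNReal.ofReal (discrepancy η η' c) ∂μ :=
          setLIntegral_congr_fun hms fun x hx => by
            have hx' : (X x).C = c := hx
            simp only [hx']
            rw [Real.enorm_eq_ofReal (Real.sqrt_nonneg _),
              ← ENNReal.ofReal_pow (Real.sqrt_nonneg _), Real.sq_sqrt (hdisc c)]
        rw [e1, setLIntegral_const, ← ofReal_measureReal, ← ENNReal.ofReal_mul (hdisc c),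
          ← ofReal_integral_eq_lintegral_ofReal (hDi.integrableOn.const_mul M)
            (Eventually.of_forall fun x => by positivity), integral_const_mul]
        refine ENNReal.ofReal_le_ofReal ?_
        rw [hset, ← hreal (measurableSet_AZC fun _ _ c' => c' = c)]
        exact hcell c
    _ = ENNReal.ofReal (M * ∫ x, D x ^ 2 ∂ν) := by
        rw [← integral_const_mul, ofReal_integral_eq_lintegral_ofReal (hDi.const_mul M)
          (Eventually.of_forall fun x => by positivity)]
    _ ≤ ENNReal.ofReal (M * H ^ 2) :=
        ENNReal.ofReal_le_ofReal (mul_le_mul_of_nonneg_left hH hM0)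

end Discrepancy

/-! ### Pathwise differentiability of the parameter. -/

section Pathwise

set_option linter.unusedSectionVars false

open NuisanceTD

variable {𝒜 𝒵 𝒞 : Type u} [MeasurableSpace 𝒜] [MeasurableSpace 𝒵] [MeasurableSpace 𝒞]
  [DiscreteMeasurableSpace 𝒜] [Countable 𝒜] [DiscreteMeasurableSpace 𝒵] [Countable 𝒵]
  [DiscreteMeasurableSpace 𝒞] [Countable 𝒞] [Fintype 𝒜] [Fintype 𝒵]

section SingleLaw

variable {P : Measure (ObsTD 𝒜 𝒵 𝒞)} [IsProbabilityMeasure P] {ε : ℝ}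
  {aStar a : 𝒜} {η : NuisanceTD 𝒜 𝒵 𝒞} {l L : ℝ}

/-- A stratum of positive mass lets an `L²` bound control the value on it. The resulting convergence
is pointwise in `c`, not uniform, which is all that dominated convergence requires. -/
lemma abs_mul_sqrt_le_of_eLpNorm_le {g : 𝒞 → ℝ} {N : ℝ} (hN : 0 ≤ N)
    (hg : eLpNorm (fun x : ObsTD 𝒜 𝒵 𝒞 => g x.C) 2 P ≤ ENNReal.ofReal N) (c : 𝒞) :
    |g c| * √(P.real {x | x.C = c}) ≤ N := by
  obtain ⟨hm, hsq⟩ := integral_sq_le_of_eLpNorm_le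
    (measurable_comp_AZC fun _ _ c => g c).aestronglyMeasurable hN hg
  have hms : MeasurableSet {x : ObsTD 𝒜 𝒵 𝒞 | x.C = c} := measurableSet_AZC fun _ _ c' => c' = c
  have h1 : g c ^ 2 * P.real {x | x.C = c} ≤ N ^ 2 := by
    refine le_trans ?_ hsq
    rw [mul_comm, ← smul_eq_mul, ← setIntegral_const]
    refine le_trans (le_of_eq ?_) (setIntegral_le_integral hm.integrable_sq
      (Eventually.of_forall fun x => sq_nonneg _) (s := {x | x.C = c}))
    exact setIntegral_congr_fun hms fun x hx => by
      have hx' : x.C = c := hx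
      simp only [hx']
  refine abs_le_of_sq_le_sq' ?_ hN |>.2
  rwa [mul_pow, sq_abs, Real.sq_sqrt measureReal_nonneg]

/-- Both error factors are at most the root discrepancy, so the bound is quadratic in `N`; with `N =
O(‖α‖)` the second-order terms are `O(‖α‖²)`. -/
lemma PositiveLaw.abs_integral_secondOrder_le (h : PositiveLaw P ε) (hη : η.Bounds aStar a l L)
    {N : ℝ} (hN0 : 0 ≤ N)
    (hN : eLpNorm (fun x => √(discrepancy η (trueNuisanceTD P) x.C)) 2 P ≤ ENNReal.ofReal N) :
    |∫ x, (secondOrder η (trueNuisanceTD P) aStar x.C -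
      secondOrder η (trueNuisanceTD P) a x.C) ∂P| ≤
      4 * ((ε ^ 2)⁻¹ * (L * (L / l + 1))) * N ^ 2 := by
  set η₀ := trueNuisanceTD P with hη₀
  have hl := hη.pos
  have hε := h.eps_pos
  have hL : 0 ≤ L := by
    obtain ⟨b⟩ := h.nonempty_A
    obtain ⟨c⟩ := h.nonempty_C
    exact (abs_nonneg _).trans (hη.propensity_above b c)
  set K := (ε ^ 2)⁻¹ * (L * (L / l + 1)) with hK
  have hK0 : 0 ≤ K := by positivity
  have hmono : ∀ g : 𝒜 → 𝒵 → 𝒞 → ℝ, (∀ b z c, |g b z c| ≤ √(discrepancy η η₀ c)) →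
      eLpNorm (fun x : ObsTD 𝒜 𝒵 𝒞 => g x.A x.Z x.C) 2 P ≤ ENNReal.ofReal N := fun g hg =>
    (eLpNorm_mono_real fun x => hg _ _ _).trans hN
  have hone : ∀ a' ∈ ({aStar, a} : Set 𝒜),
      ∫⁻ x, ‖secondOrder η η₀ a' x.C‖ₑ ∂P ≤ ENNReal.ofReal (2 * K * N ^ 2) := by
    intro a' ha'
    have b1 := hmono (fun b z c => η.mediator z a' c - η₀.mediator z a' c)
      fun b z c => abs_mediator_sub_le _ _ _ _ _
    have b2 := hmono (fun b z c => η.propensity a' c - η₀.propensity a' c)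
      fun b z c => abs_propensity_sub_le _ _ _ _
    have b3 := hmono (fun b z c => η.propensity b c - η₀.propensity b c)
      fun b z c => abs_propensity_sub_le _ _ _ _
    refine (lintegral_secondOrder_le h hη ha').trans
      ((mul_le_mul' le_rfl (add_le_add (mul_le_mul' b1 b2) (mul_le_mul' b1 b3))).trans
        (le_of_eq ?_))
    rw [← ENNReal.ofReal_mul hN0, ← ENNReal.ofReal_add (by positivity) (by positivity),
      ← ENNReal.ofReal_mul hK0]
    congr 1
    ring
  have hfin : ‖∫ x, (secondOrder η η₀ aStar x.C - secondOrder η η₀ a x.C) ∂P‖ₑ ≤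
      ENNReal.ofReal (4 * K * N ^ 2) := by
    refine (enorm_integral_le_lintegral_enorm _).trans ?_
    refine (lintegral_mono fun x => enorm_sub_le).trans ?_
    rw [lintegral_add_left (measurable_comp_AZC fun _ _ c => ‖secondOrder η η₀ aStar c‖ₑ)]
    refine (add_le_add (hone aStar (by simp)) (hone a (by simp))).trans (le_of_eq ?_)
    rw [← ENNReal.ofReal_add (by positivity) (by positivity)]
    congr 1
    ring
  rw [Real.enorm_eq_ofReal_abs] at hfin
  exact (ENNReal.ofReal_le_ofReal_iff (by positivity)).1 hfin

/-- The difference of the weights of two laws is controlled by the discrepancy of the nuisance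
functions. -/
lemma PositiveLaw.abs_weight_sub_le {P' : Measure (ObsTD 𝒜 𝒵 𝒞)} [IsProbabilityMeasure P']
    (h : PositiveLaw P ε) (h' : PositiveLaw P' ε) (aStar a b : 𝒜) (z : 𝒵) (c : 𝒞) :
    |(trueNuisanceTD P).weight aStar a b z c - (trueNuisanceTD P').weight aStar a b z c| ≤
      3 * (1 / ε + 1 / (ε * ε)) *
        √(discrepancy (trueNuisanceTD P) (trueNuisanceTD P') c) := by
  have hε := h.eps_pos
  refine (abs_weight_sub_weight_le hε hε (h.mediator z b c).le (h'.mediator z b c).le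
    (h'.abs_contrast_le_one aStar a z c)).trans ?_
  have h1 := abs_mediator_sub_le (trueNuisanceTD P) (trueNuisanceTD P') z b c
  have h2 := abs_mediator_sub_le (trueNuisanceTD P) (trueNuisanceTD P') z aStar c
  have h3 := abs_mediator_sub_le (trueNuisanceTD P) (trueNuisanceTD P') z a c
  rw [mul_comm 3, mul_assoc]
  exact mul_le_mul_of_nonneg_left (by linarith) (by positivity)

/-- The residual of a bounded approximation to the outcome regression, weighted. -/
lemma abs_integral_Y_sub_mul_le (hY : MemLp ObsTD.Y 2 P)
    (hpos : ∀ a z c, 0 < P {x | x.A = a ∧ x.Z = z ∧ x.C = c}) {q v : 𝒜 → 𝒵 → 𝒞 → ℝ}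
    {K K' δ N : ℝ} (hq : ∀ b z c, |q b z c| ≤ K) (hv : ∀ b z c, |v b z c| ≤ K') (hδ : 0 ≤ δ)
    (hN : 0 ≤ N) (hqδ : eLpNorm (fun x => q x.A x.Z x.C - (trueNuisanceTD P).outcome x.A x.Z x.C)
      2 P ≤ ENNReal.ofReal δ)
    (hvN : eLpNorm (fun x : ObsTD 𝒜 𝒵 𝒞 => v x.A x.Z x.C) 2 P ≤ ENNReal.ofReal N) :
    |∫ x, (x.Y - q x.A x.Z x.C) * v x.A x.Z x.C ∂P| ≤ δ * N := by
  have i2 := integrable_Y_sub_mul hY (q := fun _ _ _ => 0) (K := 0) (by simp) hv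
  have hvm : AEStronglyMeasurable (fun x : ObsTD 𝒜 𝒵 𝒞 => v x.A x.Z x.C) P :=
    (measurable_comp_AZC v).aestronglyMeasurable
  have hvb : ∀ᵐ x : ObsTD 𝒜 𝒵 𝒞 ∂P, ‖v x.A x.Z x.C‖ ≤ K' := Eventually.of_forall fun _ => hv _ _ _
  have i3 : Integrable (fun x : ObsTD 𝒜 𝒵 𝒞 => q x.A x.Z x.C * v x.A x.Z x.C) P :=
    (integrable_comp_AZC hq).mul_bdd hvm hvb
  have i4 : Integrable (fun x : ObsTD 𝒜 𝒵 𝒞 =>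
      (trueNuisanceTD P).outcome x.A x.Z x.C * v x.A x.Z x.C) P :=
    ((memLp_outcome hY).integrable one_le_two).mul_bdd hvm hvb
  simp only [sub_zero] at i2
  have e : ∫ x, (x.Y - q x.A x.Z x.C) * v x.A x.Z x.C ∂P =
      -∫ x, (q x.A x.Z x.C - (trueNuisanceTD P).outcome x.A x.Z x.C) * v x.A x.Z x.C ∂P := by
    simp_rw [sub_mul]
    rw [integral_sub i2 i3, integral_sub i3 i4, integral_Y_mul_eq hY hpos hv]
    ring
  have hq1 := integral_sq_le_of_eLpNorm_le (measurable_comp_AZC fun b z c =>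
    q b z c - (trueNuisanceTD P).outcome b z c).aestronglyMeasurable hδ hqδ
  have hq2 := integral_sq_le_of_eLpNorm_le hvm hN hvN
  rw [e, abs_neg]
  exact abs_integral_mul_le_of_sq_le hq1.1 hq2.1 hδ hN hq1.2 hq2.2

end SingleLaw

variable {𝒳 : Type*} [MeasurableSpace 𝒳]

/-- Second moments of functions of linear growth in `Y`. -/
lemma memLp_two_of_abs_le_affine {P : Measure 𝒳} [IsProbabilityMeasure P] {y f : 𝒳 → ℝ} {S B : ℝ}
    (hy : MemLp y 2 P) (hB : ∫ x, y x ^ 2 ∂P ≤ B) (hf : Measurable f)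
    (hle : ∀ x, |f x| ≤ S * (|y x| + 1)) :
    MemLp f 2 P ∧ ∫ x, f x ^ 2 ∂P ≤ (S * √(2 * (B + 1))) ^ 2 := by
  have hB0 : 0 ≤ B := (integral_nonneg fun x => sq_nonneg _).trans hB
  have h1 : MemLp (fun x => S * (|y x| + 1)) 2 P := (hy.abs.add (memLp_const 1)).const_mul S
  have hm : MemLp f 2 P := h1.mono' hf.aestronglyMeasurable (Eventually.of_forall hle)
  refine ⟨hm, ?_⟩
  have hpt : ∀ x, f x ^ 2 ≤ S ^ 2 * (2 * y x ^ 2 + 2) := fun x => by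
    have h2 := pow_le_pow_left₀ (abs_nonneg _) (hle x) 2
    rw [sq_abs, mul_pow] at h2
    refine h2.trans (mul_le_mul_of_nonneg_left ?_ (sq_nonneg S))
    nlinarith [sq_nonneg (|y x| - 1), sq_abs (y x)]
  have hi : Integrable (fun x => S ^ 2 * (2 * y x ^ 2 + 2)) P :=
    ((hy.integrable_sq.const_mul 2).add (integrable_const 2)).const_mul _
  refine (integral_mono hm.integrable_sq hi hpt).trans ?_
  rw [integral_const_mul, integral_add (hy.integrable_sq.const_mul 2) (integrable_const 2),
    integral_const_mul, mul_pow, Real.sq_sqrt (by positivity)]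
  simp only [integral_const, probReal_univ, one_smul]
  exact mul_le_mul_of_nonneg_left (by linarith) (sq_nonneg S)

variable {P : Measure 𝒳} {d : ℕ} {Pα : EuclideanSpace ℝ (Fin d) → Measure 𝒳} {ν : Measure 𝒳}
  {ℓ : 𝒳 → EuclideanSpace ℝ (Fin d)} {X : 𝒳 → ObsTD 𝒜 𝒵 𝒞} {ε B : ℝ} {aStar a : 𝒜}
  {θα : EuclideanSpace ℝ (Fin d) → ℝ}

/-- The nuisance probabilities are Lipschitz along a differentiable submodel. -/
lemma QMD.exists_discrepancy_le (hq : QMD P Pα ν ℓ) (hX : Measurable X)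
    (hpos : ∀ᶠ α in 𝓝 0, PositiveLaw ((Pα α).map X) ε) :
    ∃ C : ℝ, 0 ≤ C ∧ ∀ᶠ α in 𝓝 0,
      eLpNorm (fun x => √(discrepancy (trueNuisanceTD (P.map X)) (trueNuisanceTD ((Pα α).map X))
        x.C)) 2 (P.map X) ≤ ENNReal.ofReal (C * ‖α‖) ∧
      eLpNorm (fun x => √(discrepancy (trueNuisanceTD (P.map X)) (trueNuisanceTD ((Pα α).map X))
        x.C)) 2 ((Pα α).map X) ≤ ENNReal.ofReal (C * ‖α‖) := by
  have := hq.sigmaFinite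
  have := hq.isProbabilityMeasure_zero
  have h0 : PositiveLaw (P.map X) ε := by
    have := hpos.self_of_nhds
    rwa [hq.law_zero] at this
  obtain ⟨C, hC, hH⟩ := hq.exists_hellinger_le
  set κ := √(16 / ε * (Fintype.card 𝒜 * Fintype.card 𝒵 + Fintype.card 𝒜)) with hκ
  refine ⟨κ * C, by positivity, ?_⟩
  filter_upwards [hH, hpos, hq.isProbabilityMeasure, hq.ac] with α hHα hα hprob hac
  rw [mul_assoc]
  refine ⟨PositiveLaw.eLpNorm_sqrt_discrepancy_le hq.ac_zero hac hX h0 hα (by positivity) ?_, ?_⟩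
  · simpa only [← neg_sub (rootDensity (Pα α) ν _), neg_sq] using hHα
  · simp_rw [discrepancy_comm (trueNuisanceTD (P.map X))]
    exact PositiveLaw.eLpNorm_sqrt_discrepancy_le hac hq.ac_zero hX hα h0 (by positivity) hHα

lemma QMD.abs_integral_mul_inner_le (hq : QMD P Pα ν ℓ) {f : 𝒳 → ℝ} (hf : MemLp f 2 P)
    (α : EuclideanSpace ℝ (Fin d)) :
    |∫ x, f x * inner ℝ α (ℓ x) ∂P| ≤ (∫ x, |f x| * ‖ℓ x‖ ∂P) * ‖α‖ := by
  have hint : Integrable (fun x => |f x| * ‖ℓ x‖) P := hf.abs.integrable_mul hq.memLp_norm_score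
  have hint' : Integrable (fun x => f x * inner ℝ α (ℓ x)) P :=
    hf.integrable_mul (hq.memLp_inner_score α)
  refine abs_integral_le_integral_abs.trans ?_
  rw [← integral_mul_const]
  refine integral_mono hint'.abs (hint.mul_const _) fun x => ?_
  beta_reduce
  rw [abs_mul, mul_assoc, mul_comm ‖ℓ x‖]
  exact mul_le_mul_of_nonneg_left (abs_real_inner_le_norm _ _) (abs_nonneg _)

lemma QMD.abs_integral_mul_inner_le_sqrt (hq : QMD P Pα ν ℓ) {f : 𝒳 → ℝ} (hf : MemLp f 2 P)
    {δ : ℝ} (hδ : 0 ≤ δ) (hfδ : ∫ x, f x ^ 2 ∂P ≤ δ ^ 2) (α : EuclideanSpace ℝ (Fin d)) :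
    |∫ x, f x * inner ℝ α (ℓ x) ∂P| ≤ δ * √(∫ x, ‖ℓ x‖ ^ 2 ∂P) * ‖α‖ := by
  refine (hq.abs_integral_mul_inner_le hf α).trans (mul_le_mul_of_nonneg_right ?_ (norm_nonneg _))
  have h1 : ∫ x, ‖ℓ x‖ ^ 2 ∂P ≤ √(∫ x, ‖ℓ x‖ ^ 2 ∂P) ^ 2 :=
    (Real.sq_sqrt (integral_nonneg fun x => sq_nonneg _)).ge
  have h2 := abs_integral_mul_le_of_sq_le hf.abs hq.memLp_norm_score hδ (Real.sqrt_nonneg _)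
    (by simpa only [Pi.abs_apply, sq_abs] using hfδ) h1
  exact (le_abs_self _).trans h2

/-- Dominated convergence with majorant `(|Y| + L) M ‖ℓ‖`, integrable as a product of two `L²`
functions. The weights tend to zero at each covariate value because its stratum has positive mass,
so that the root of `D α` there is `O(‖α‖)`. -/
lemma QMD.tendsto_integral_resid (hq : QMD P Pα ν ℓ) (hX : Measurable X)
    (h0 : PositiveLaw (P.map X) ε) (hY0 : MemLp ObsTD.Y 2 (P.map X))
    {v : EuclideanSpace ℝ (Fin d) → 𝒜 → 𝒵 → 𝒞 → ℝ} {D : EuclideanSpace ℝ (Fin d) → 𝒞 → ℝ}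
    {q : 𝒜 → 𝒵 → 𝒞 → ℝ} {L M W C : ℝ} (hW0 : 0 ≤ W) (hC : 0 ≤ C) (hq' : ∀ b z c, |q b z c| ≤ L)
    (hL : 0 ≤ L)
    (hv : ∀ᶠ α in 𝓝 0, ∀ b z c, |v α b z c| ≤ M ∧ |v α b z c| ≤ W * √(D α c))
    (hD : ∀ᶠ α in 𝓝 0, eLpNorm (fun x : ObsTD 𝒜 𝒵 𝒞 => √(D α x.C)) 2 (P.map X) ≤
      ENNReal.ofReal (C * ‖α‖)) :
    Tendsto (fun α => ∫ x, |((X x).Y - q (X x).A (X x).Z (X x).C) *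
      v α (X x).A (X x).Z (X x).C| * ‖ℓ x‖ ∂P) (𝓝 0) (𝓝 0) := by
  have := hq.isProbabilityMeasure_zero
  have : IsProbabilityMeasure (P.map X) := Measure.isProbabilityMeasure_map hX.aemeasurable
  have hYX : MemLp (fun x => (X x).Y) 2 P := hY0.comp_of_map hX.aemeasurable
  have hfm : ∀ α, Measurable fun x => ((X x).Y - q (X x).A (X x).Z (X x).C) *
      v α (X x).A (X x).Z (X x).C := fun α =>
    ((ObsTD.measurable_Y.sub (measurable_comp_AZC q)).mul (measurable_comp_AZC (v α))).comp hX
  have hresid : ∀ x, |(X x).Y - q (X x).A (X x).Z (X x).C| ≤ |(X x).Y| + L := fun x =>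
    (abs_sub _ _).trans (add_le_add le_rfl (hq' _ _ _))
  rw [show (0 : ℝ) = ∫ _, (0 : ℝ) ∂P by simp]
  refine tendsto_integral_filter_of_dominated_convergence
    (fun x => (|(X x).Y| + L) * M * ‖ℓ x‖) (Eventually.of_forall fun α =>
      ((hfm α).abs.mul hq.measurable_score.norm).aestronglyMeasurable) ?_ ?_
    (Eventually.of_forall fun x => ?_)
  · filter_upwards [hv] with α hvα
    refine Eventually.of_forall fun x => ?_
    rw [Real.norm_of_nonneg (by positivity)]
    refine mul_le_mul_of_nonneg_right ?_ (norm_nonneg _)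
    rw [abs_mul]
    exact mul_le_mul (hresid x) (hvα _ _ _).1 (abs_nonneg _) (by positivity)
  · have h1 : MemLp (fun x => M * (|(X x).Y| + L)) 2 P :=
      (hYX.abs.add (memLp_const L)).const_mul M
    refine (h1.integrable_mul hq.memLp_norm_score).congr (Eventually.of_forall fun x => ?_)
    simp only [Pi.mul_apply]
    ring
  · have hp := h0.C_real_pos (X x).C
    set p := (P.map X).real {y | y.C = (X x).C} with hp'
    set E := |(X x).Y - q (X x).A (X x).Z (X x).C| with hE
    have hE0 : 0 ≤ E := abs_nonneg _
    have hlim : Tendsto (fun α : EuclideanSpace ℝ (Fin d) =>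
        E * (W * (C * ‖α‖ / √p)) * ‖ℓ x‖) (𝓝 0) (𝓝 0) := by
      have : Continuous fun α : EuclideanSpace ℝ (Fin d) =>
        E * (W * (C * ‖α‖ / √p)) * ‖ℓ x‖ := by fun_prop
      simpa using this.tendsto 0
    refine squeeze_zero' (Eventually.of_forall fun α => by positivity) ?_ hlim
    filter_upwards [hv, hD] with α hvα hdα
    have hs := abs_mul_sqrt_le_of_eLpNorm_le (g := fun c' => √(D α c')) (by positivity) hdα (X x).C
    rw [abs_of_nonneg (Real.sqrt_nonneg _), ← le_div_iff₀ (Real.sqrt_pos.2 hp)] at hs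
    refine mul_le_mul_of_nonneg_right ?_ (norm_nonneg _)
    rw [abs_mul]
    exact mul_le_mul_of_nonneg_left ((hvα _ _ _).2.trans (mul_le_mul_of_nonneg_left hs hW0)) hE0

set_option maxHeartbeats 800000 in
/-- The weighted mean of `Y` is pathwise differentiable, with the influence function as its
gradient. -/
theorem QMD.isLittleO_twoDoor (hq : QMD P Pα ν ℓ) (hX : Measurable X)
    (hα : ∀ᶠ α in 𝓝 0, PositiveLaw ((Pα α).map X) ε ∧ MemLp ObsTD.Y 2 ((Pα α).map X) ∧
      ∫ x, ObsTD.Y x ^ 2 ∂((Pα α).map X) ≤ B ∧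
      θα α = ∫ x, x.Y * (trueNuisanceTD ((Pα α).map X)).weight aStar a x.A x.Z x.C
        ∂((Pα α).map X)) :
    (fun α => θα α - θα 0 - ∫ x, (mTD aStar a (X x) (trueNuisanceTD (P.map X)) - θα 0) *
      inner ℝ α (ℓ x) ∂P) =o[𝓝 0] fun α => ‖α‖ := by
  -- The working nuisance is the truth at `α = 0` with truncated regression. Under the law at `α`,
  -- `integral_mTD_sub` reads `θα α - θ = (E_α mK - θ) - E_α (f α) - SO`, with `f α` the residual
  -- times the change of the weights. The first bracket expands with gradient `mK - θ`. The mean of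
  -- `f α` is expanded about its `P`-mean, which is `O(δ ‖α‖)` since the truncated regression is
  -- `δ`-close to the true one; its derivative term is `o(‖α‖)`, and `SO` is `O(‖α‖²)`.
  have := hq.isProbabilityMeasure_zero
  have : IsProbabilityMeasure (P.map X) := Measure.isProbabilityMeasure_map hX.aemeasurable
  obtain ⟨h0, hY0, hB0, hθ0⟩ : PositiveLaw (P.map X) ε ∧ MemLp ObsTD.Y 2 (P.map X) ∧
      ∫ x, ObsTD.Y x ^ 2 ∂(P.map X) ≤ B ∧
      θα 0 = ∫ x, x.Y * (trueNuisanceTD (P.map X)).weight aStar a x.A x.Z x.C ∂(P.map X) := by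
    have := hα.self_of_nhds
    rwa [hq.law_zero] at this
  set θ := θα 0 with hθ
  set η₀ := trueNuisanceTD (P.map X) with hη₀
  have hε := h0.eps_pos
  have hBnn : 0 ≤ B := (integral_nonneg fun x => sq_nonneg _).trans hB0
  obtain ⟨C, hC, hdisc⟩ := hq.exists_discrepancy_le hX (hα.mono fun α h => h.1)
  set W : ℝ := 3 * (1 / ε + 1 / (ε * ε)) with hW
  have hW0 : 0 ≤ W := by positivity
  set Λ := √(∫ x, ‖ℓ x‖ ^ 2 ∂P) with hΛ
  have hΛ0 : 0 ≤ Λ := Real.sqrt_nonneg _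
  have hmm := fun η : NuisanceTD 𝒜 𝒵 𝒞 => measurable_mTD aStar a η
  have hYX : MemLp (fun x => (X x).Y) 2 P := hY0.comp_of_map hX.aemeasurable
  have hBX : ∫ x, (X x).Y ^ 2 ∂P ≤ B := by
    rw [integral_map hX.aemeasurable (ObsTD.measurable_Y.pow_const 2).aestronglyMeasurable] at hB0
    exact hB0
  rw [Asymptotics.isLittleO_iff]
  intro c hc
  -- The allowance `c ‖α‖` is spent in fifths: two expansions of expectations, the second-order
  -- term, the derivative of the residual term, and the two effects of truncation, `δ Λ` and `δ W
  -- C`, together.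
  obtain ⟨K, hK1, hK2⟩ := h0.exists_truncate_mTD_le hY0 aStar a (δ := c / 5 / (Λ + W * C + 1))
    (by positivity)
  set δ := c / 5 / (Λ + W * C + 1) with hδ
  have hδ0 : 0 ≤ δ := by positivity
  have hδΛ : δ * (Λ + W * C) ≤ c / 5 := by
    rw [hδ, div_mul_eq_mul_div, div_le_iff₀ (by positivity)]
    have : 0 ≤ c / 5 := by positivity
    nlinarith
  set ηK := η₀.truncate K with hηK
  have hbd : ηK.Bounds aStar a ε (max K 1) := h0.bounds_truncate aStar a K
  obtain ⟨R, hR0, hR⟩ := hbd.exists_abs_mTD_le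
  set L := max K 1 with hL
  have hL0 : 0 ≤ L := zero_le_one.trans (le_max_right _ _)
  -- One constant of linear growth in `Y` for `mK - θ` and for `f α` at all small `α`. With the
  -- second moment of `Y` at most `B` under every local law it yields the common bound `Bd`; the
  -- expansion must be uniform because `f α` moves with `α`.
  set S : ℝ := R + |θ| + (1 + L) * (2 / ε) with hS
  have hS0 : 0 ≤ S := by positivity
  set Bd := S * √(2 * (B + 1)) with hBd
  have hBd0 : 0 ≤ Bd := by positivity
  set m₀ : 𝒳 → ℝ := fun x => mTD aStar a (X x) η₀ with hm₀
  set mK : 𝒳 → ℝ := fun x => mTD aStar a (X x) ηK with hmK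
  have hm₀m : Measurable m₀ := (hmm η₀).comp hX
  have hmKm : Measurable mK := (hmm ηK).comp hX
  have hm₀L : MemLp m₀ 2 P := (h0.memLp_mTD hY0 aStar a).comp_of_map hX.aemeasurable
  have hmKL : MemLp mK 2 P := (hbd.memLp_mTD hY0).comp_of_map hX.aemeasurable
  have hmKmean : ∫ x, mK x ∂P = θ := by
    rw [hθ0, ← h0.integral_mTD_truncate hY0 aStar a K,
      integral_map hX.aemeasurable (hmm _).aestronglyMeasurable]
  have hdiff : MemLp (fun x => mK x - m₀ x) 2 P ∧ ∫ x, (mK x - m₀ x) ^ 2 ∂P ≤ δ ^ 2 := by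
    refine integral_sq_le_of_eLpNorm_le (hmKm.sub hm₀m).aestronglyMeasurable hδ0 ?_
    have hsub : AEStronglyMeasurable (fun x => mTD aStar a x ηK - mTD aStar a x η₀) (P.map X) :=
      ((hmm _).sub (hmm _)).aestronglyMeasurable
    rw [eLpNorm_map_measure hsub hX.aemeasurable] at hK2
    exact hK2
  set v : EuclideanSpace ℝ (Fin d) → 𝒜 → 𝒵 → 𝒞 → ℝ := fun α b z c' =>
    η₀.weight aStar a b z c' - (trueNuisanceTD ((Pα α).map X)).weight aStar a b z c' with hv
  set f : EuclideanSpace ℝ (Fin d) → 𝒳 → ℝ := fun α x =>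
    ((X x).Y - ηK.outcome (X x).A (X x).Z (X x).C) * v α (X x).A (X x).Z (X x).C with hf
  have hfm : ∀ α, Measurable (f α) := fun α =>
    ((ObsTD.measurable_Y.sub (measurable_comp_AZC ηK.outcome)).mul
      (measurable_comp_AZC (v α))).comp hX
  have hvle : ∀ᶠ α in 𝓝 0, ∀ b z c', |v α b z c'| ≤ 2 / ε ∧
      |v α b z c'| ≤ W * √(discrepancy η₀ (trueNuisanceTD ((Pα α).map X)) c') := by
    filter_upwards [hα, hq.isProbabilityMeasure] with α h hprob b z c'
    have : IsProbabilityMeasure ((Pα α).map X) := Measure.isProbabilityMeasure_map hX.aemeasurable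
    refine ⟨(abs_sub _ _).trans ((add_le_add (h0.abs_weight_le aStar a b z c')
      (h.1.abs_weight_le aStar a b z c')).trans (le_of_eq (by ring))),
      h0.abs_weight_sub_le h.1 aStar a b z c'⟩
  have hresid : ∀ x, |(X x).Y - ηK.outcome (X x).A (X x).Z (X x).C| ≤ (1 + L) * (|(X x).Y| + 1) :=
    fun x => by
      refine (abs_sub _ _).trans ((add_le_add le_rfl (hbd.outcome _ _ _)).trans ?_)
      have : 0 ≤ L * |(X x).Y| := by positivity
      linarith
  have hflim : Tendsto (fun α => ∫ x, |f α x| * ‖ℓ x‖ ∂P) (𝓝 0) (𝓝 0) :=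
    hq.tendsto_integral_resid hX h0 hY0 (v := v)
      (D := fun α => discrepancy η₀ (trueNuisanceTD ((Pα α).map X))) hW0 hC hbd.outcome hL0 hvle
      (hdisc.mono fun α h => h.1)
  have hsmall : ∀ᶠ α : EuclideanSpace ℝ (Fin d) in 𝓝 0,
      4 * ((ε ^ 2)⁻¹ * (L * (L / ε + 1))) * C ^ 2 * ‖α‖ ≤ c / 5 := by
    have : Continuous fun α : EuclideanSpace ℝ (Fin d) =>
      4 * ((ε ^ 2)⁻¹ * (L * (L / ε + 1))) * C ^ 2 * ‖α‖ := by fun_prop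
    have := this.tendsto 0
    rw [norm_zero, mul_zero] at this
    exact (this.eventually (gt_mem_nhds (by positivity))).mono fun α hα => hα.le
  have hexp := hq.expectation_expansion (ε := c / 5 / (Bd + 1)) (by positivity)
  have hBd1 : c / 5 / (Bd + 1) * Bd ≤ c / 5 := by
    rw [div_mul_eq_mul_div, div_le_iff₀ (by positivity)]
    have : 0 ≤ c / 5 := by positivity
    nlinarith
  filter_upwards [hα, hq.isProbabilityMeasure, hdisc, hvle, hsmall, hexp,
    hflim.eventually (gt_mem_nhds (show (0 : ℝ) < c / 5 by positivity))]
    with α hαα hprob hdα hvα hsα hexpα hfα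
  obtain ⟨hposα, hYα, hBα, hθα⟩ := hαα
  have : IsProbabilityMeasure ((Pα α).map X) := Measure.isProbabilityMeasure_map hX.aemeasurable
  have hYXα : MemLp (fun x => (X x).Y) 2 (Pα α) := hYα.comp_of_map hX.aemeasurable
  have hBXα : ∫ x, (X x).Y ^ 2 ∂(Pα α) ≤ B := by
    rw [integral_map hX.aemeasurable (ObsTD.measurable_Y.pow_const 2).aestronglyMeasurable] at hBα
    exact hBα
  set ηα := trueNuisanceTD ((Pα α).map X) with hηα
  have hα0 : 0 ≤ ‖α‖ := norm_nonneg _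
  -- expansion of the mean of the bounded part
  have hgK : ∀ x, |mK x - θ| ≤ S * (|(X x).Y| + 1) := fun x => by
    refine (abs_sub _ _).trans ((add_le_add (hR (X x)) le_rfl).trans ?_)
    have h1 : 0 ≤ |(X x).Y| := abs_nonneg _
    have h2 : 0 ≤ |θ| := abs_nonneg _
    have h3 : 0 ≤ (1 + L) * (2 / ε) := by positivity
    simp only [hS]
    nlinarith [mul_nonneg h2 h1, mul_nonneg h3 h1]
  have hfα' : ∀ x, |f α x| ≤ S * (|(X x).Y| + 1) := fun x => by
    simp only [hf, abs_mul]
    refine (mul_le_mul (hresid x) (hvα _ _ _).1 (abs_nonneg _) (by positivity)).trans ?_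
    have h1 : 0 ≤ |(X x).Y| + 1 := by positivity
    have h2 : 0 ≤ R + |θ| := by positivity
    simp only [hS]
    nlinarith [mul_nonneg h2 h1]
  have hgKm : Measurable fun x => mK x - θ := hmKm.sub_const θ
  have A1 := memLp_two_of_abs_le_affine hYXα hBXα hgKm hgK
  have A2 := memLp_two_of_abs_le_affine hYX hBX hgKm hgK
  have A3 := memLp_two_of_abs_le_affine hYXα hBXα (hfm α) hfα'
  have A4 := memLp_two_of_abs_le_affine hYX hBX (hfm α) hfα'
  have T1 := hexpα (fun x => mK x - θ) Bd hBd0 hgKm A1.1 A2.1 A1.2 A2.2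
  have T2 := hexpα (f α) Bd hBd0 (hfm α) A3.1 A4.1 A3.2 A4.2
  have hBα' : c / 5 / (Bd + 1) * Bd * ‖α‖ ≤ c / 5 * ‖α‖ :=
    mul_le_mul_of_nonneg_right hBd1 hα0
  have hmKα : Integrable mK (Pα α) := by
    have := A1.1.integrable one_le_two
    exact (this.add (integrable_const θ)).congr (Eventually.of_forall fun x => by simp)
  have e1 : ∫ x, (mK x - θ) ∂(Pα α) = ∫ x, mK x ∂(Pα α) - θ := by
    rw [integral_sub hmKα (integrable_const θ)]
    simp
  have e2 : ∫ x, (mK x - θ) ∂P = 0 := by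
    rw [integral_sub (hmKL.integrable one_le_two) (integrable_const θ), hmKmean]
    simp
  rw [e1, e2, sub_zero] at T1
  -- the bias of the estimating function under the perturbed law
  have hbias := (integral_mTD_sub hposα hYα hbd).2
  rw [← hθα, integral_map hX.aemeasurable (hmm _).aestronglyMeasurable,
    integral_map (f := fun x : ObsTD 𝒜 𝒵 𝒞 => (x.Y - ηK.outcome x.A x.Z x.C) *
      (ηK.weight aStar a x.A x.Z x.C - ηα.weight aStar a x.A x.Z x.C)) hX.aemeasurable
      ((ObsTD.measurable_Y.sub (measurable_comp_AZC ηK.outcome)).mul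
        (measurable_comp_AZC (v α))).aestronglyMeasurable] at hbias
  change ∫ x, mK x ∂(Pα α) - θα α = ∫ x, f α x ∂(Pα α) + _ at hbias
  have T3 := hposα.abs_integral_secondOrder_le hbd (N := C * ‖α‖) (by positivity) hdα.2
  set SO := ∫ x, (secondOrder ηK ηα aStar x.C - secondOrder ηK ηα a x.C) ∂((Pα α).map X) with hSO
  have T3' : |SO| ≤ c / 5 * ‖α‖ := by
    refine T3.trans ?_
    calc _ = 4 * ((ε ^ 2)⁻¹ * (L * (L / ε + 1))) * C ^ 2 * ‖α‖ * ‖α‖ := by ring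
      _ ≤ _ := mul_le_mul_of_nonneg_right hsα hα0
  -- the mean of the residual part under the true law
  have T4 : |∫ x, f α x ∂P| ≤ δ * (W * C) * ‖α‖ := by
    have hvN : eLpNorm (fun x : ObsTD 𝒜 𝒵 𝒞 => v α x.A x.Z x.C) 2 (P.map X) ≤
        ENNReal.ofReal (W * (C * ‖α‖)) := by
      refine (eLpNorm_mono_real (g := fun x : ObsTD 𝒜 𝒵 𝒞 =>
        W * √(discrepancy η₀ ηα x.C)) fun x => (hvα _ _ _).2).trans ?_
      refine (eLpNorm_const_smul_le (c := W)).trans ?_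
      rw [Real.enorm_eq_ofReal hW0, ENNReal.ofReal_mul hW0]
      exact mul_le_mul' le_rfl hdα.1
    have := abs_integral_Y_sub_mul_le hY0 h0.cell_pos hbd.outcome (fun b z c' => (hvα b z c').1)
      hδ0 (by positivity) hK1 hvN
    have hres : AEStronglyMeasurable (fun x : ObsTD 𝒜 𝒵 𝒞 =>
        (x.Y - ηK.outcome x.A x.Z x.C) * v α x.A x.Z x.C) (P.map X) :=
      ((ObsTD.measurable_Y.sub (measurable_comp_AZC ηK.outcome)).mul
        (measurable_comp_AZC (v α))).aestronglyMeasurable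
    rw [integral_map hX.aemeasurable hres] at this
    exact this.trans (le_of_eq (by ring))
  have T5 : |∫ x, f α x * inner ℝ α (ℓ x) ∂P| ≤ c / 5 * ‖α‖ :=
    (hq.abs_integral_mul_inner_le A4.1 α).trans (mul_le_mul_of_nonneg_right hfα.le hα0)
  -- the change of the gradient due to the truncation
  have T6 : |∫ x, (mK x - m₀ x) * inner ℝ α (ℓ x) ∂P| ≤ δ * Λ * ‖α‖ :=
    hq.abs_integral_mul_inner_le_sqrt hdiff.1 hδ0 hdiff.2 α
  have e3 : ∫ x, (m₀ x - θ) * inner ℝ α (ℓ x) ∂P = ∫ x, (mK x - θ) * inner ℝ α (ℓ x) ∂P -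
      ∫ x, (mK x - m₀ x) * inner ℝ α (ℓ x) ∂P := by
    have i1 : Integrable (fun x => (mK x - θ) * inner ℝ α (ℓ x)) P := A2.1.integrable_mul (hq.memLp_inner_score α)
    have i2 : Integrable (fun x => (mK x - m₀ x) * inner ℝ α (ℓ x)) P :=
      hdiff.1.integrable_mul (hq.memLp_inner_score α)
    rw [← integral_sub i1 i2]
    exact integral_congr_ae (Eventually.of_forall fun x => by ring)
  change ‖θα α - θ - ∫ x, (m₀ x - θ) * inner ℝ α (ℓ x) ∂P‖ ≤ c * ‖‖α‖‖
  rw [e3, norm_norm, Real.norm_eq_abs]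
  have hfin : δ * Λ * ‖α‖ + δ * (W * C) * ‖α‖ ≤ c / 5 * ‖α‖ := by
    have := mul_le_mul_of_nonneg_right hδΛ hα0
    linarith
  rw [abs_le] at T1 T2 T3' T4 T5 T6 ⊢
  constructor <;> linarith

end Pathwise

/-! ### Identification of the causal effect. -/

section Identification

set_option linter.unusedSectionVars false

/-- Clearing denominators makes the identity hold, as `0 = 0`, for a null conditioning event too. -/
lemma measureReal_inter_mul_of_indepFun_cond {Ω E F : Type*} [MeasurableSpace Ω]
    [MeasurableSpace E] [MeasurableSpace F] {μ : Measure Ω} [IsFiniteMeasure μ] {S : Set Ω}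
    (hS : MeasurableSet S) {f : Ω → E} {g : Ω → F} (h : IndepFun f g (cond μ S)) {s : Set E}
    {t : Set F} (hs : MeasurableSet s) (ht : MeasurableSet t) :
    μ.real (S ∩ (f ⁻¹' s ∩ g ⁻¹' t)) * μ.real S =
      μ.real (S ∩ f ⁻¹' s) * μ.real (S ∩ g ⁻¹' t) := by
  have h1 := h.measure_inter_preimage_eq_mul _ _ hs ht
  rw [cond_apply hS, cond_apply hS, cond_apply hS] at h1
  have h2 := congrArg ENNReal.toReal h1
  simp only [ENNReal.toReal_mul, ENNReal.toReal_inv, ← measureReal_def] at h2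
  rcases eq_or_ne (μ.real S) 0 with h0 | h0
  · have : μ.real (S ∩ f ⁻¹' s) = 0 :=
      le_antisymm ((measureReal_mono Set.inter_subset_left).trans h0.le) measureReal_nonneg
    rw [h0, this, mul_zero, zero_mul]
  · field_simp at h2
    linarith

lemma lintegral_eq_tsum_fibers {Ω 𝒯 : Type*} [MeasurableSpace Ω] [MeasurableSpace 𝒯]
    [DiscreteMeasurableSpace 𝒯] [Countable 𝒯] {μ : Measure Ω} {T : Ω → 𝒯} (hT : Measurable T)
    (f : Ω → ℝ≥0∞) : ∫⁻ x, f x ∂μ = ∑' c, ∫⁻ x in {x | T x = c}, f x ∂μ := by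
  have hc : ∀ c, MeasurableSet {x | T x = c} := fun c => hT (measurableSet_singleton c)
  have hU : (⋃ c, {x | T x = c}) = Set.univ := by
    ext x; simp
  have hd : Pairwise (Function.onFun Disjoint fun c => {x | T x = c}) := fun c c' hcc' =>
    Set.disjoint_left.2 fun x hx hx' => hcc' (by
      rw [← (show T x = c from hx), ← (show T x = c' from hx')])
  rw [← setLIntegral_univ, ← hU, lintegral_iUnion hc hd]

variable {𝒜 𝒵 𝒞 : Type u} [MeasurableSpace 𝒜] [MeasurableSpace 𝒵] [MeasurableSpace 𝒞]
  [DiscreteMeasurableSpace 𝒜] [Countable 𝒜] [DiscreteMeasurableSpace 𝒵] [Countable 𝒵]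
  [DiscreteMeasurableSpace 𝒞] [Countable 𝒞] {ε : ℝ}

namespace CausalModel

variable (M : CausalModel 𝒜 𝒵 𝒞)

lemma measurable_obsTD : Measurable fun ω => ((M.C ω, M.A ω, M.Z ω, M.Y ω) : ObsTD 𝒜 𝒵 𝒞) :=
  M.measurable_C.prodMk (M.measurable_A.prodMk (M.measurable_Z.prodMk M.measurable_Y))

instance isProbabilityMeasure_obsLawTD : IsProbabilityMeasure M.obsLawTD :=
  Measure.isProbabilityMeasure_map M.measurable_obsTD.aemeasurable

lemma obsLawTD_apply (s : 𝒜 → 𝒵 → 𝒞 → Prop) :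
    M.obsLawTD {x | s x.A x.Z x.C} = M.Q {ω | s (M.A ω) (M.Z ω) (M.C ω)} := by
  rw [obsLawTD, Measure.map_apply M.measurable_obsTD (measurableSet_AZC s)]
  rfl

lemma memLp_Y_obsLawTD (hY : MemLp M.Y 2 M.Q) : MemLp ObsTD.Y 2 M.obsLawTD :=
  (memLp_map_measure_iff ObsTD.measurable_Y.aestronglyMeasurable
    M.measurable_obsTD.aemeasurable).2 hY

lemma integral_Y_sq_obsLawTD :
    ∫ x, ObsTD.Y x ^ 2 ∂M.obsLawTD = ∫ ω, M.Y ω ^ 2 ∂M.Q := by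
  rw [obsLawTD, integral_map M.measurable_obsTD.aemeasurable
    (ObsTD.measurable_Y.pow_const 2).aestronglyMeasurable]
  rfl

variable {M}

lemma PositiveTD.cell_pos (hpos : M.PositiveTD) (a : 𝒜) (z : 𝒵) (c : 𝒞) :
    0 < M.obsLawTD {x | x.A = a ∧ x.Z = z ∧ x.C = c} := by
  rw [M.obsLawTD_apply fun a' z' c' => a' = a ∧ z' = z ∧ c' = c]
  exact hpos a z c

/-- The law of the observations satisfies the positivity conditions. -/
lemma PositiveTD.positiveLaw (hpos : M.PositiveTD) {ε₁ ε₂ : ℝ} (h1 : 0 < ε₁) (h2 : 0 < ε₂)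
    (hm : ∀ᵐ x ∂M.obsLawTD, ε₁ < (trueNuisanceTD M.obsLawTD).mediator x.Z x.A x.C)
    (hp : ∀ᵐ x ∂M.obsLawTD, ε₂ < (trueNuisanceTD M.obsLawTD).propensity x.A x.C) :
    PositiveLaw M.obsLawTD (min ε₁ ε₂) where
  eps_pos := lt_min h1 h2
  cell_pos := hpos.cell_pos
  mediator z a c := (min_le_left _ _).trans_lt (forall_of_ae_AZC (p := fun a z c =>
    ε₁ < (trueNuisanceTD M.obsLawTD).mediator z a c) hpos.cell_pos hm a z c)
  propensity a c := by
    obtain ⟨x⟩ : Nonempty (ObsTD 𝒜 𝒵 𝒞) := nonempty_of_isProbabilityMeasure M.obsLawTD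
    exact (min_le_right _ _).trans_lt (forall_of_ae_AZC (p := fun a _ c =>
      ε₂ < (trueNuisanceTD M.obsLawTD).propensity a c) hpos.cell_pos hp a x.Z c)

/-- The joint law of the potential variables in terms of the observed ones. -/
lemma TwoDoor.measureReal_potential (hTD : M.TwoDoor) (h : PositiveLaw M.obsLawTD ε)
    (a' b : 𝒜) (z : 𝒵) (c : 𝒞) {S : Set ℝ} (hS : MeasurableSet S) :
    M.Q.real {ω | (M.A ω, M.Zpot a' ω, M.C ω) = (b, z, c) ∧ M.Ypot a' ω ∈ S} =
      (trueNuisanceTD M.obsLawTD).mediator z a' c / (trueNuisanceTD M.obsLawTD).mediator z b c *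
        M.Q.real {ω | (M.A ω, M.Z ω, M.C ω) = (b, z, c) ∧ M.Y ω ∈ S} := by
  have mC : MeasurableSet {ω | M.C ω = c} := M.measurable_C (measurableSet_singleton c)
  have mA : ∀ b, MeasurableSet {ω | M.A ω = b} := fun b => M.measurable_A (measurableSet_singleton b)
  have mAC : ∀ b, MeasurableSet {ω | M.A ω = b ∧ M.C ω = c} := fun b => (mA b).inter mC
  have hAC : ∀ b, 0 < M.Q.real {ω | M.A ω = b ∧ M.C ω = c} := fun b => by
    have := h.AC_real_pos b c
    rwa [measureReal_def, M.obsLawTD_apply fun a' _ c' => a' = b ∧ c' = c] at this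
  have hC : 0 < M.Q.real {ω | M.C ω = c} := by
    have := h.C_real_pos c
    rwa [measureReal_def, M.obsLawTD_apply fun _ _ c' => c' = c] at this
  have hmed : ∀ b, (trueNuisanceTD M.obsLawTD).mediator z b c =
      M.Q.real {ω | M.A ω = b ∧ M.Z ω = z ∧ M.C ω = c} /
        M.Q.real {ω | M.A ω = b ∧ M.C ω = c} := fun b => by
    rw [trueNuisanceTD_mediator, measureReal_def, measureReal_def,
      M.obsLawTD_apply fun a' z' c' => a' = b ∧ z' = z ∧ c' = c,
      M.obsLawTD_apply fun a' _ c' => a' = b ∧ c' = c]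
    rfl
  -- the potential mediators are independent of the treatment given the covariate
  have hZ1 : ∀ a₁ b, M.Q.real {ω | M.A ω = b ∧ M.C ω = c ∧ M.Zpot a₁ ω = z} *
      M.Q.real {ω | M.C ω = c} = M.Q.real {ω | M.C ω = c ∧ M.Zpot a₁ ω = z} *
        M.Q.real {ω | M.A ω = b ∧ M.C ω = c} := fun a₁ b => by
    have := measureReal_inter_mul_of_indepFun_cond mC (hTD.td2 a₁ c)
      (measurableSet_singleton z) (measurableSet_singleton b)
    have e1 : {ω | M.C ω = c} ∩ (M.Zpot a₁ ⁻¹' {z} ∩ M.A ⁻¹' {b}) =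
        {ω | M.A ω = b ∧ M.C ω = c ∧ M.Zpot a₁ ω = z} := by
      ext ω; simp; tauto
    have e2 : {ω | M.C ω = c} ∩ M.Zpot a₁ ⁻¹' {z} = {ω | M.C ω = c ∧ M.Zpot a₁ ω = z} := rfl
    have e3 : {ω | M.C ω = c} ∩ M.A ⁻¹' {b} = {ω | M.A ω = b ∧ M.C ω = c} := by
      ext ω; simp; tauto
    rwa [e1, e2, e3] at this
  -- Given the covariate, `Z(a₁)` has the same law in every treatment arm, and in arm `a₁`
  -- consistency makes it the observed mediator.
  have hZ : ∀ a₁ b, M.Q.real {ω | M.A ω = b ∧ M.C ω = c ∧ M.Zpot a₁ ω = z} =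
      (trueNuisanceTD M.obsLawTD).mediator z a₁ c * M.Q.real {ω | M.A ω = b ∧ M.C ω = c} := by
    intro a₁ b
    have e : M.Q.real {ω | M.A ω = a₁ ∧ M.C ω = c ∧ M.Zpot a₁ ω = z} =
        M.Q.real {ω | M.A ω = a₁ ∧ M.Z ω = z ∧ M.C ω = c} := by
      refine measureReal_congr (Filter.eventuallyEq_set.2 ?_)
      filter_upwards [M.consistency_Z a₁] with ω h1
      constructor
      · rintro ⟨g1, g2, g3⟩
        exact ⟨g1, (h1 g1).trans g3, g2⟩
      · rintro ⟨g1, g2, g3⟩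
        exact ⟨g1, g3, (h1 g1).symm.trans g2⟩
    have h1 := hZ1 a₁ a₁
    have h2 := hZ1 a₁ b
    rw [e] at h1
    rw [hmed]
    have := (hAC a₁).ne'
    have := hC.ne'
    field_simp
    refine mul_right_cancel₀ hC.ne' ?_
    calc _ = (M.Q.real {ω | M.A ω = b ∧ M.C ω = c ∧ M.Zpot a₁ ω = z} *
          M.Q.real {ω | M.C ω = c}) * M.Q.real {ω | M.A ω = a₁ ∧ M.C ω = c} := by ring
      _ = (M.Q.real {ω | M.C ω = c ∧ M.Zpot a₁ ω = z} *
          M.Q.real {ω | M.A ω = a₁ ∧ M.C ω = c}) * M.Q.real {ω | M.A ω = b ∧ M.C ω = c} := by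
          rw [h2]; ring
      _ = _ := by rw [← h1]; ring
  -- the potential outcomes are independent of the potential mediators
  have hY : ∀ a₁, M.Q.real {ω | M.A ω = b ∧ M.C ω = c ∧ M.Zpot a₁ ω = z ∧ M.Ypot₂ a₁ z ω ∈ S} =
      (trueNuisanceTD M.obsLawTD).mediator z a₁ c *
        M.Q.real {ω | M.A ω = b ∧ M.C ω = c ∧ M.Ypot₂ a₁ z ω ∈ S} := by
    intro a₁
    have h1 := measureReal_inter_mul_of_indepFun_cond (mAC b) (hTD.td3 a₁ a₁ z b c) hS
      (measurableSet_singleton z)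
    have e1 : {ω | M.A ω = b ∧ M.C ω = c} ∩ (M.Ypot₂ a₁ z ⁻¹' S ∩ M.Zpot a₁ ⁻¹' {z}) =
        {ω | M.A ω = b ∧ M.C ω = c ∧ M.Zpot a₁ ω = z ∧ M.Ypot₂ a₁ z ω ∈ S} := by
      ext ω; simp; tauto
    have e2 : {ω | M.A ω = b ∧ M.C ω = c} ∩ M.Ypot₂ a₁ z ⁻¹' S =
        {ω | M.A ω = b ∧ M.C ω = c ∧ M.Ypot₂ a₁ z ω ∈ S} := by
      ext ω; simp; tauto
    have e3 : {ω | M.A ω = b ∧ M.C ω = c} ∩ M.Zpot a₁ ⁻¹' {z} =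
        {ω | M.A ω = b ∧ M.C ω = c ∧ M.Zpot a₁ ω = z} := by
      ext ω; simp; tauto
    rw [e1, e2, e3, hZ] at h1
    refine mul_right_cancel₀ (hAC b).ne' (h1.trans ?_)
    ring
  have eL : M.Q.real {ω | (M.A ω, M.Zpot a' ω, M.C ω) = (b, z, c) ∧ M.Ypot a' ω ∈ S} =
      M.Q.real {ω | M.A ω = b ∧ M.C ω = c ∧ M.Zpot a' ω = z ∧ M.Ypot₂ a' z ω ∈ S} := by
    refine measureReal_congr (Filter.eventuallyEq_set.2 ?_)
    filter_upwards [M.composition a' z] with ω h1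
    simp only [Prod.mk.injEq]
    constructor
    · rintro ⟨⟨g1, g2, g3⟩, g4⟩
      exact ⟨g1, g3, g2, h1 g2 ▸ g4⟩
    · rintro ⟨g1, g3, g2, g4⟩
      exact ⟨⟨g1, g2, g3⟩, (h1 g2).symm ▸ g4⟩
  have eR : M.Q.real {ω | (M.A ω, M.Z ω, M.C ω) = (b, z, c) ∧ M.Y ω ∈ S} =
      M.Q.real {ω | M.A ω = b ∧ M.C ω = c ∧ M.Zpot b ω = z ∧ M.Ypot₂ b z ω ∈ S} := by
    refine measureReal_congr (Filter.eventuallyEq_set.2 ?_)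
    filter_upwards [M.consistency_Z b, M.consistency_Y₂ b z] with ω h1 h2
    simp only [Prod.mk.injEq]
    constructor
    · rintro ⟨⟨g1, g2, g3⟩, g4⟩
      exact ⟨g1, g3, (h1 g1).symm.trans g2, h2 g1 g2 ▸ g4⟩
    · rintro ⟨g1, g3, g2, g4⟩
      have g2' := (h1 g1).trans g2
      exact ⟨⟨g1, g2', g3⟩, (h2 g1 g2').symm ▸ g4⟩
  -- There is no direct effect of the treatment, so the outcome factors for `a'` and for `b` agree
  -- and only the ratio of the mediator factors remains.
  have eM : M.Q.real {ω | M.A ω = b ∧ M.C ω = c ∧ M.Ypot₂ a' z ω ∈ S} =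
      M.Q.real {ω | M.A ω = b ∧ M.C ω = c ∧ M.Ypot₂ b z ω ∈ S} := by
    refine measureReal_congr (Filter.eventuallyEq_set.2 ?_)
    filter_upwards [hTD.td1 a' b z] with ω h1
    simp only [h1]
  rw [eL, eR, hY, hY, eM]
  have := (h.mediator_pos z b c).ne'
  field_simp

/-- The law of the potential outcome is a reweighting of the law of the outcome. -/
lemma TwoDoor.map_Ypot_eq (hTD : M.TwoDoor) (h : PositiveLaw M.obsLawTD ε) (a' : 𝒜)
    {r : 𝒜 → 𝒵 → 𝒞 → ℝ}
    (hr0 : ∀ b z c, 0 ≤ r b z c)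
    (hr : ∀ b z c, r b z c = (trueNuisanceTD M.obsLawTD).mediator z a' c /
      (trueNuisanceTD M.obsLawTD).mediator z b c) :
    M.Q.map (M.Ypot a') =
      (M.Q.withDensity fun ω => ENNReal.ofReal (r (M.A ω) (M.Z ω) (M.C ω))).map M.Y := by
  have hT : Measurable fun ω => (M.A ω, M.Z ω, M.C ω) :=
    M.measurable_A.prodMk (M.measurable_Z.prodMk M.measurable_C)
  have hT' : Measurable fun ω => (M.A ω, M.Zpot a' ω, M.C ω) :=
    M.measurable_A.prodMk ((M.measurable_Zpot a').prodMk M.measurable_C)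
  refine Measure.ext fun S hS => ?_
  have mS : MeasurableSet (M.Ypot a' ⁻¹' S) := M.measurable_Ypot a' hS
  have mS' : MeasurableSet (M.Y ⁻¹' S) := M.measurable_Y hS
  -- The two sides are cut along different partitions, by the value of `Z(a')` and by that of `Z`;
  -- cells with equal labels are matched.
  rw [Measure.map_apply (M.measurable_Ypot a') hS, Measure.map_apply M.measurable_Y hS,
    withDensity_apply _ mS', ← lintegral_indicator_one mS, ← lintegral_indicator mS',
    lintegral_eq_tsum_fibers hT', lintegral_eq_tsum_fibers hT]
  refine tsum_congr fun w => ?_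
  obtain ⟨b, z, c⟩ := w
  have mT : MeasurableSet {ω | (M.A ω, M.Z ω, M.C ω) = (b, z, c)} :=
    hT (measurableSet_singleton _)
  have e1 : ∫⁻ ω in {ω | (M.A ω, M.Z ω, M.C ω) = (b, z, c)},
      (M.Y ⁻¹' S).indicator (fun ω => ENNReal.ofReal (r (M.A ω) (M.Z ω) (M.C ω))) ω ∂M.Q =
      ∫⁻ ω in {ω | (M.A ω, M.Z ω, M.C ω) = (b, z, c)},
        (M.Y ⁻¹' S).indicator (fun _ => ENNReal.ofReal (r b z c)) ω ∂M.Q :=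
    setLIntegral_congr_fun mT fun ω hω => by
      have hω' : (M.A ω, M.Z ω, M.C ω) = (b, z, c) := hω
      simp only [Prod.mk.injEq] at hω'
      classical
      simp only [Set.indicator_apply, hω'.1, hω'.2.1, hω'.2.2]
  rw [e1, lintegral_indicator_one mS, lintegral_indicator_const mS',
    Measure.restrict_apply mS, Measure.restrict_apply mS', ← ofReal_measureReal,
    ← ofReal_measureReal, ← ENNReal.ofReal_mul (hr0 b z c)]
  congr 1
  have := hTD.measureReal_potential h a' b z c hS
  rw [← hr] at this
  rw [Set.inter_comm, Set.inter_comm (M.Y ⁻¹' S)]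
  exact this

/-- Identification of the mean of the potential outcome. -/
theorem TwoDoor.meanY_eq (hTD : M.TwoDoor) (h : PositiveLaw M.obsLawTD ε) (a' : 𝒜) :
    M.meanY a' = ∫ x, x.Y * ((trueNuisanceTD M.obsLawTD).mediator x.Z a' x.C /
      (trueNuisanceTD M.obsLawTD).mediator x.Z x.A x.C) ∂M.obsLawTD := by
  obtain ⟨r, hr⟩ : ∃ r : 𝒜 → 𝒵 → 𝒞 → ℝ, ∀ b z c, r b z c =
    (trueNuisanceTD M.obsLawTD).mediator z a' c / (trueNuisanceTD M.obsLawTD).mediator z b c :=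
    ⟨_, fun _ _ _ => rfl⟩
  have hr0 : ∀ b z c, 0 ≤ r b z c := fun b z c => by
    rw [hr]
    exact div_nonneg (h.mediator_pos z a' c).le (h.mediator_pos z b c).le
  have hT : Measurable fun ω => (M.A ω, M.Z ω, M.C ω) :=
    M.measurable_A.prodMk (M.measurable_Z.prodMk M.measurable_C)
  have hrm : Measurable fun ω => ENNReal.ofReal (r (M.A ω) (M.Z ω) (M.C ω)) :=
    (Measurable.of_discrete (f := fun w : 𝒜 × 𝒵 × 𝒞 => ENNReal.ofReal (r w.1 w.2.1 w.2.2))).comp hT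
  have hgm : AEStronglyMeasurable (fun x : ObsTD 𝒜 𝒵 𝒞 => x.Y * r x.A x.Z x.C) M.obsLawTD :=
    (ObsTD.measurable_Y.mul (measurable_comp_AZC r)).aestronglyMeasurable
  simp_rw [← hr]
  have hY := M.measurable_Y
  -- Equality of laws transfers Bochner integrals as they stand, so integrability of `Y(a')` need
  -- not be established.
  calc M.meanY a' = ∫ y, y ∂(M.Q.map (M.Ypot a')) :=
        (integral_map (M.measurable_Ypot a').aemeasurable aestronglyMeasurable_id).symm
    _ = ∫ ω, M.Y ω ∂(M.Q.withDensity fun ω => ENNReal.ofReal (r (M.A ω) (M.Z ω) (M.C ω))) := by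
        rw [hTD.map_Ypot_eq h a' hr0 hr]
        exact integral_map hY.aemeasurable aestronglyMeasurable_id
    _ = ∫ ω, M.Y ω * r (M.A ω) (M.Z ω) (M.C ω) ∂M.Q := by
        rw [integral_withDensity_eq_integral_toReal_smul hrm (Eventually.of_forall fun x => by simp)]
        refine integral_congr_ae (Eventually.of_forall fun x => ?_)
        simp only [ENNReal.toReal_ofReal (hr0 _ _ _), smul_eq_mul]
        ring
    _ = _ := by
        exact (integral_map M.measurable_obsTD.aemeasurable hgm).symm

/-- Identification of the average causal effect. -/
theorem TwoDoor.ace_eq (hTD : M.TwoDoor) (h : PositiveLaw M.obsLawTD ε) (hY : MemLp M.Y 2 M.Q)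
    (aStar a : 𝒜) :
    M.ace aStar a =
      ∫ x, x.Y * (trueNuisanceTD M.obsLawTD).weight aStar a x.A x.Z x.C ∂M.obsLawTD := by
  have hb : ∀ a' b z c, |(trueNuisanceTD M.obsLawTD).mediator z a' c /
      (trueNuisanceTD M.obsLawTD).mediator z b c| ≤ 1 / ε := fun a' b z c => by
    rw [abs_div, abs_of_pos (h.mediator_pos z b c), abs_of_pos (h.mediator_pos z a' c)]
    exact div_le_div₀ zero_le_one (h.mediator_le_one z a' c) h.eps_pos (h.mediator z b c).le
  have hi := fun a' => integrable_Y_sub_mul (M.memLp_Y_obsLawTD hY) (q := fun _ _ _ => 0) (K := 0)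
    (by simp) (hb a')
  simp only [sub_zero] at hi
  rw [ace, hTD.meanY_eq h, hTD.meanY_eq h, ← integral_sub (hi aStar) (hi a)]
  refine integral_congr_ae (Eventually.of_forall fun x => ?_)
  simp only [NuisanceTD.weight, NuisanceTD.contrast]
  ring

end CausalModel

end Identification

/-! ### From the assumptions on the estimators to the general theorems. -/

section Transfer

set_option linter.unusedSectionVars false

open NuisanceTD

variable {𝒜 𝒵 𝒞 : Type u} [MeasurableSpace 𝒜] [MeasurableSpace 𝒵] [MeasurableSpace 𝒞]
  [DiscreteMeasurableSpace 𝒜] [Countable 𝒜] [DiscreteMeasurableSpace 𝒵] [Countable 𝒵]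
  [DiscreteMeasurableSpace 𝒞] [Countable 𝒞]
  {𝒳 : Type*} [MeasurableSpace 𝒳] {P : Measure 𝒳} {X : 𝒳 → ObsTD 𝒜 𝒵 𝒞} {ε B : ℝ} {aStar a : 𝒜}
  {k : ℕ → ℕ} {ηhat : ∀ n, Sample 𝒳 n (k n) → NuisanceTD 𝒜 𝒵 𝒞}

/-- Almost sure bounds on the nuisance estimators hold everywhere, by positivity. -/
lemma PositiveLaw.exists_bounds_wpto [IsProbabilityMeasure P] (hX : Measurable X)
    (h : PositiveLaw (P.map X) ε)
    (h1 : BoundedAboveWPTO P k fun n s x => (ηhat n s).outcome (X x).A (X x).Z (X x).C)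
    (h2 : BoundedBelowWPTO P k fun n s x => (ηhat n s).mediator (X x).Z (X x).A (X x).C)
    (h3 : ∀ b ∈ ({aStar, a} : Set 𝒜),
      BoundedAboveWPTO P k fun n s x => (ηhat n s).mediator (X x).Z b (X x).C)
    (h4 : ∀ b ∈ ({aStar, a} : Set 𝒜),
      BoundedBelowWPTO P k fun n s x => (ηhat n s).propensity b (X x).C)
    (h5 : BoundedAboveWPTO P k fun n s x => (ηhat n s).propensity (X x).A (X x).C) :
    ∃ l L : ℝ, WithProbTendingToOne (fun n => sampleLaw P n (k n))
      fun n s => (ηhat n s).Bounds aStar a l L := by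
  have : IsProbabilityMeasure (P.map X) := Measure.isProbabilityMeasure_map hX.aemeasurable
  obtain ⟨b₀⟩ := h.nonempty_A
  obtain ⟨z₀⟩ := h.nonempty_Z
  have key : ∀ {p : 𝒜 → 𝒵 → 𝒞 → Prop}, (∀ᵐ x ∂P, p (X x).A (X x).Z (X x).C) →
      ∀ b z c, p b z c := fun {p} hp =>
    forall_of_ae_AZC h.cell_pos ((ae_map_iff hX.aemeasurable (measurableSet_AZC p)).2 hp)
  refine NuisanceTD.exists_bounds_wpto ?_ ?_ (fun b hb => ?_) (fun b hb => ?_) ?_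
  · obtain ⟨e, he⟩ := h1
    exact ⟨e, he.mono fun n s hs => key (p := fun b z c => |(ηhat n s).outcome b z c| < e) hs⟩
  · obtain ⟨e, he0, he⟩ := h2
    exact ⟨e, he0, he.mono fun n s hs =>
      key (p := fun b z c => e < (ηhat n s).mediator z b c) hs⟩
  · obtain ⟨e, he⟩ := h3 b hb
    exact ⟨e, he.mono fun n s hs =>
      key (p := fun _ z c => |(ηhat n s).mediator z b c| < e) hs b₀⟩
  · obtain ⟨e, he0, he⟩ := h4 b hb
    exact ⟨e, he0, he.mono fun n s hs =>
      key (p := fun _ _ c => e < (ηhat n s).propensity b c) hs b₀ z₀⟩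
  · obtain ⟨e, he⟩ := h5
    exact ⟨e, he.mono fun n s hs b =>
      key (p := fun b _ c => |(ηhat n s).propensity b c| < e) hs b z₀⟩

lemma measurable_twoDoorEstimator [Finite 𝒜] [Finite 𝒵] (hX : Measurable X)
    {est : ∀ n, Sample 𝒳 n (k n) → ℝ}
    (hm1 : ∀ n a z c, Measurable fun s => (ηhat n s).outcome a z c)
    (hm2 : ∀ n z a c, Measurable fun s => (ηhat n s).mediator z a c)
    (hm3 : ∀ n a c, Measurable fun s => (ηhat n s).propensity a c)
    (hest : ∀ n s, 0 < n →
      est n s = (1 / (n : ℝ)) * ∑ i, mTD aStar a (X (s.1 i)) (ηhat n s)) (n : ℕ) (hn : 0 < n) :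
    Measurable (est n) := by
  rw [show est n = fun s => (1 / (n : ℝ)) * ∑ i, mTD aStar a (X (s.1 i)) (ηhat n s) from
    funext fun s => hest n s hn]
  refine measurable_const.mul (Finset.measurable_fun_sum _ fun i _ => ?_)
  exact (measurable_mTD_uncurry aStar a (hm1 n) (hm2 n) (hm3 n)).comp
    ((hX.comp ((measurable_pi_apply i).comp measurable_fst)).prodMk measurable_id)

/-- Regularity of an asymptotically linear estimator with the two-door influence function. -/
theorem isRegularEstimator_twoDoor [Finite 𝒜] [Finite 𝒵] (hX : Measurable X)
    {𝓜 : Set (Measure 𝒳 × ℝ)} (h𝓜 : ∀ q ∈ 𝓜, IsProbabilityMeasure q.1 ∧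
      PositiveLaw (q.1.map X) ε ∧ MemLp ObsTD.Y 2 (q.1.map X) ∧
      ∫ x, ObsTD.Y x ^ 2 ∂(q.1.map X) ≤ B ∧
      q.2 = ∫ x, x.Y * (trueNuisanceTD (q.1.map X)).weight aStar a x.A x.Z x.C ∂(q.1.map X))
    (hk : (fun n => (k n : ℝ)) =O[atTop] fun n => (n : ℝ)) {θ : ℝ}
    {est : ∀ n, Sample 𝒳 n (k n) → ℝ} (hest : ∀ n, 0 < n → Measurable (est n))
    (hAL : IsAsymptoticallyLinear P θ k est
      fun x => mTD aStar a (X x) (trueNuisanceTD (P.map X)) - θ) :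
    IsRegularEstimator 𝓜 P θ k est := by
  have := Fintype.ofFinite 𝒜
  have := Fintype.ofFinite 𝒵
  refine isRegularEstimator_of_pathwise (fun q hq => (h𝓜 q hq).1) hk hest
    (((measurable_mTD aStar a _).comp hX).sub_const θ) hAL fun d Pα θα ν ℓ hsub hq => ?_
  have := hq.isLittleO_twoDoor (θα := θα) (ε := ε) (B := B) (aStar := aStar) (a := a) hX
    (hsub.mem_model.mono fun α hα => (h𝓜 _ hα).2)
  rwa [hsub.param_zero] at this

end Transfer

/-! ### The front-door problem as a two-door problem with one-point covariate. -/

section FrontDoorTransfer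

set_option linter.unusedSectionVars false

variable {𝒜 𝒵 𝒞 : Type u}

/-- An observation without covariates, as one with a trivial covariate. -/
def ObsFD.toTD (x : ObsFD 𝒜 𝒵) : ObsTD 𝒜 𝒵 PUnit.{u + 1} := (PUnit.unit, x)

/-- Nuisance functions without covariates, as ones with a trivial covariate. -/
def NuisanceFD.toTD (η : NuisanceFD 𝒜 𝒵) : NuisanceTD 𝒜 𝒵 PUnit.{u + 1} where
  outcome b z _ := η.outcome b z
  mediator z b _ := η.mediator z b
  propensity b _ := η.treatment b

/-- With the front-door expressions for the means, the front-door influence function is the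
two-door influence function with a trivial covariate. -/
lemma phiFDPlugIn_eq (aStar a : 𝒜) (x : ObsFD 𝒜 𝒵) (η : NuisanceFD 𝒜 𝒵) (θ : ℝ) :
    phiFDPlugIn aStar a x η θ = mTD aStar a x.toTD η.toTD - θ := by
  classical
  -- The indicator forces `A = a'`, so the subtracted mean may be taken at the observed treatment,
  -- where it is the double sum in `mTD`.
  have e : ∀ a', Set.indicator {a'} (fun _ => (1 : ℝ)) x.A * frontDoorMean η a' =
      Set.indicator {a'} (fun _ => (1 : ℝ)) x.A * frontDoorMean η x.A := by
    intro a'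
    by_cases h : x.A = a'
    · rw [h]
    · simp [h]
  have h1 := e aStar
  have h2 := e a
  simp only [phiFDPlugIn, phiFD, mTD, NuisanceFD.toTD]
  change _ = (x.Y - η.outcome x.A x.Z) *
      ((η.mediator x.Z aStar - η.mediator x.Z a) / η.mediator x.Z x.A)
    + ((∑' b, η.outcome b x.Z * η.treatment b) - frontDoorMean η x.A) *
      ((Set.indicator {aStar} (fun _ => (1 : ℝ)) x.A - Set.indicator {a} (fun _ => (1 : ℝ)) x.A)
        / η.treatment x.A)
    + ∑' z, η.outcome x.A z * (η.mediator z aStar - η.mediator z a) - θ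
  linear_combination (-(η.treatment x.A)⁻¹) * h1 + (η.treatment x.A)⁻¹ * h2

lemma mFD_eq (aStar a : 𝒜) (x : ObsFD 𝒜 𝒵) (η : NuisanceFD 𝒜 𝒵) :
    mFD aStar a x η = mTD aStar a x.toTD η.toTD := by
  rw [mFD, phiFDPlugIn_eq, sub_zero]

variable [MeasurableSpace 𝒜] [MeasurableSpace 𝒵] [MeasurableSpace 𝒞]

lemma ObsFD.measurable_toTD :
    Measurable (ObsFD.toTD : ObsFD 𝒜 𝒵 → ObsTD 𝒜 𝒵 PUnit.{u + 1}) :=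
  measurable_const.prodMk measurable_id

lemma cond_map_eq {α β : Type*} [MeasurableSpace α] [MeasurableSpace β] {μ : Measure α}
    {f : α → β} (hf : Measurable f) {s : Set β} (hs : MeasurableSet s) :
    cond (μ.map f) s = (cond μ (f ⁻¹' s)).map f := by
  rw [ProbabilityTheory.cond, ProbabilityTheory.cond, Measure.map_smul, Measure.map_apply hf hs,
    Measure.restrict_map hf hs]

variable [DiscreteMeasurableSpace 𝒜] [Countable 𝒜] [DiscreteMeasurableSpace 𝒵] [Countable 𝒵]

/-- Conditioning on a one-point covariate is conditioning on the whole space. -/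
lemma trueNuisanceTD_map_toTD (P : Measure (ObsFD 𝒜 𝒵)) [IsProbabilityMeasure P] :
    trueNuisanceTD (P.map ObsFD.toTD) = (trueNuisanceFD P).toTD := by
  have hX := ObsFD.measurable_toTD (𝒜 := 𝒜) (𝒵 := 𝒵)
  have hm := fun s => measurableSet_AZC (𝒜 := 𝒜) (𝒵 := 𝒵) (𝒞 := PUnit.{u + 1}) s
  unfold trueNuisanceTD NuisanceFD.toTD
  congr 1
  · funext b z c
    rw [cond_map_eq hX (hm fun b' z' c' => b' = b ∧ z' = z ∧ c' = c),
      integral_map hX.aemeasurable ObsTD.measurable_Y.aestronglyMeasurable]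
    have : (ObsFD.toTD ⁻¹' {x | x.A = b ∧ x.Z = z ∧ x.C = c} : Set (ObsFD 𝒜 𝒵)) =
        {x | x.A = b ∧ x.Z = z} := by
      ext x
      exact ⟨fun h => ⟨h.1, h.2.1⟩, fun h => ⟨h.1, h.2, rfl⟩⟩
    rw [this]
    rfl
  · funext z b c
    rw [cond_map_eq hX (hm fun b' _ c' => b' = b ∧ c' = c),
      map_measureReal_apply hX (hm fun _ z' _ => z' = z)]
    have : (ObsFD.toTD ⁻¹' {x | x.A = b ∧ x.C = c} : Set (ObsFD 𝒜 𝒵)) = {x | x.A = b} := by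
      ext x
      exact ⟨fun h => h.1, fun h => ⟨h, rfl⟩⟩
    rw [this]
    rfl
  · funext b c
    rw [cond_map_eq hX (hm fun _ _ c' => c' = c), map_measureReal_apply hX (hm fun b' _ _ => b' = b)]
    have : (ObsFD.toTD ⁻¹' {x | x.C = c} : Set (ObsFD 𝒜 𝒵)) = Set.univ := by
      ext x
      exact ⟨fun _ => trivial, fun _ => rfl⟩
    rw [this, cond_univ]
    rfl

namespace CausalModel

/-- The potential outcome model with the covariates dropped. -/
def dropCovariates (M : CausalModel 𝒜 𝒵 𝒞) : CausalModel 𝒜 𝒵 PUnit.{u + 1} :=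
  { M with
    C := fun _ => PUnit.unit
    measurable_C := measurable_const }

variable (M : CausalModel 𝒜 𝒵 𝒞)

lemma measurable_obsFD : Measurable fun ω => ((M.A ω, M.Z ω, M.Y ω) : ObsFD 𝒜 𝒵) :=
  M.measurable_A.prodMk (M.measurable_Z.prodMk M.measurable_Y)

instance isProbabilityMeasure_obsLawFD : IsProbabilityMeasure M.obsLawFD :=
  Measure.isProbabilityMeasure_map M.measurable_obsFD.aemeasurable

lemma map_toTD_obsLawFD : M.obsLawFD.map ObsFD.toTD = M.dropCovariates.obsLawTD := by
  rw [obsLawFD, Measure.map_map ObsFD.measurable_toTD M.measurable_obsFD]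
  rfl

variable {M}

lemma FrontDoor.twoDoor (h : M.FrontDoor) : M.dropCovariates.TwoDoor where
  td1 := h.fd1
  td2 a c := by
    have : {ω | M.dropCovariates.C ω = c} = Set.univ := by
      ext ω
      exact ⟨fun _ => trivial, fun _ => rfl⟩
    rw [this, cond_univ]
    exact h.fd2 a
  td3 a a' z b c := by
    have : {ω | M.dropCovariates.A ω = b ∧ M.dropCovariates.C ω = c} = {ω | M.A ω = b} := by
      ext ω
      exact ⟨fun h => h.1, fun h => ⟨h, rfl⟩⟩
    rw [this]
    exact h.fd3 a a' z b

lemma PositiveFD.positiveTD (h : M.PositiveFD) : M.dropCovariates.PositiveTD := fun a z _ =>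
  (h a z).trans_le (measure_mono fun _ hω => ⟨hω.1, hω.2, rfl⟩)

/-- Positivity of the law of `(A, Z, Y)`, seen as a law with a trivial covariate. -/
lemma PositiveFD.positiveLaw (hpos : M.PositiveFD) {ε₁ ε₂ : ℝ} (h1 : 0 < ε₁) (h2 : 0 < ε₂)
    (hm : ∀ᵐ x ∂M.obsLawFD, ε₁ < (trueNuisanceFD M.obsLawFD).mediator x.Z x.A)
    (hp : ∀ᵐ x ∂M.obsLawFD, ε₂ < (trueNuisanceFD M.obsLawFD).treatment x.A) :
    PositiveLaw (M.obsLawFD.map ObsFD.toTD) (min ε₁ ε₂) := by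
  have hX := ObsFD.measurable_toTD (𝒜 := 𝒜) (𝒵 := 𝒵)
  rw [M.map_toTD_obsLawFD]
  refine hpos.positiveTD.positiveLaw h1 h2 ?_ ?_ <;>
    rw [← M.map_toTD_obsLawFD, trueNuisanceTD_map_toTD]
  · exact (ae_map_iff hX.aemeasurable (measurableSet_AZC fun b z c =>
      ε₁ < (trueNuisanceFD M.obsLawFD).toTD.mediator z b c)).2 hm
  · exact (ae_map_iff hX.aemeasurable (measurableSet_AZC fun b _ c =>
      ε₂ < (trueNuisanceFD M.obsLawFD).toTD.propensity b c)).2 hp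

/-- The front-door formula for the mean of a potential outcome. -/
lemma FrontDoor.meanY_eq (hFD : M.FrontDoor) {ε : ℝ}
    (h : PositiveLaw (M.obsLawFD.map ObsFD.toTD) ε) (hY : MemLp M.Y 2 M.Q) (a' : 𝒜) :
    M.meanY a' = frontDoorMean (trueNuisanceFD M.obsLawFD) a' := by
  have hη := trueNuisanceTD_map_toTD M.obsLawFD
  rw [M.map_toTD_obsLawFD] at h hη
  have := h.finite_A
  have := h.finite_Z
  have := Fintype.ofFinite 𝒜
  have := Fintype.ofFinite 𝒵
  have hb : ∀ b z c, |(trueNuisanceTD M.dropCovariates.obsLawTD).mediator z a' c /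
      (trueNuisanceTD M.dropCovariates.obsLawTD).mediator z b c| ≤ 1 / ε := fun b z c => by
    rw [abs_div, abs_of_pos (h.mediator_pos z b c), abs_of_pos (h.mediator_pos z a' c)]
    exact div_le_div₀ zero_le_one (h.mediator_le_one z a' c) h.eps_pos (h.mediator z b c).le
  -- Without covariates there are finitely many cells, so the regression is bounded, as
  -- `integral_AZC` requires.
  obtain ⟨K, hK⟩ : ∃ K : ℝ, ∀ b z c, |(trueNuisanceTD M.dropCovariates.obsLawTD).outcome b z c *
      ((trueNuisanceTD M.dropCovariates.obsLawTD).mediator z a' c /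
      (trueNuisanceTD M.dropCovariates.obsLawTD).mediator z b c)| ≤ K := by
    obtain ⟨K, hK⟩ := (Set.finite_range fun w : 𝒜 × 𝒵 × PUnit.{u + 1} =>
      |(trueNuisanceTD M.dropCovariates.obsLawTD).outcome w.1 w.2.1 w.2.2 *
      ((trueNuisanceTD M.dropCovariates.obsLawTD).mediator w.2.1 a' w.2.2 /
      (trueNuisanceTD M.dropCovariates.obsLawTD).mediator w.2.1 w.1 w.2.2)|).bddAbove
    exact ⟨K, fun b z c => hK ⟨(b, z, c), rfl⟩⟩
  have hmean : M.meanY a' = M.dropCovariates.meanY a' := rfl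
  rw [hmean, hFD.twoDoor.meanY_eq h, integral_Y_mul_eq
    (M.dropCovariates.memLp_Y_obsLawTD hY) h.cell_pos hb, h.integral_AZC hK]
  have hconst : ∀ x : ObsTD 𝒜 𝒵 PUnit.{u + 1}, ∑ b, ∑ z,
      (trueNuisanceTD M.dropCovariates.obsLawTD).propensity b x.C *
      (trueNuisanceTD M.dropCovariates.obsLawTD).mediator z b x.C *
      ((trueNuisanceTD M.dropCovariates.obsLawTD).outcome b z x.C *
      ((trueNuisanceTD M.dropCovariates.obsLawTD).mediator z a' x.C /
      (trueNuisanceTD M.dropCovariates.obsLawTD).mediator z b x.C)) =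
      frontDoorMean (trueNuisanceFD M.obsLawFD) a' := fun x => by
    simp only [frontDoorMean, tsum_fintype]
    refine Finset.sum_congr rfl fun b _ => Finset.sum_congr rfl fun z _ => ?_
    have := (h.mediator_pos z b x.C).ne'
    rw [hη] at this ⊢
    simp only [NuisanceFD.toTD] at this ⊢
    field_simp
  simp_rw [hconst]
  simp

end CausalModel

end FrontDoorTransfer

/-! ### The two estimators. -/

section Main

set_option linter.unusedSectionVars false

variable {𝒜 𝒵 𝒞 : Type u} [MeasurableSpace 𝒜] [MeasurableSpace 𝒵] [MeasurableSpace 𝒞]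
  [DiscreteMeasurableSpace 𝒜] [Countable 𝒜] [DiscreteMeasurableSpace 𝒵] [Countable 𝒵]
  [DiscreteMeasurableSpace 𝒞] [Countable 𝒞]

lemma eq_average_of_average_sub_eq_zero {n : ℕ} (hn : 0 < n) {f : Fin n → ℝ} {θ : ℝ}
    (h : (1 / (n : ℝ)) * ∑ i, (f i - θ) = 0) : θ = (1 / (n : ℝ)) * ∑ i, f i := by
  have hn' : (n : ℝ) ≠ 0 := by positivity
  rw [Finset.sum_sub_distrib, mul_sub] at h
  simp only [Finset.sum_const, Finset.card_univ, Fintype.card_fin, nsmul_eq_mul] at h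
  rw [← mul_assoc, one_div_mul_cancel hn', one_mul] at h
  linarith

/-- Asymptotic linearity and regularity of the two-door estimator. -/
theorem twoDoorEstimator_asymptotics (M : CausalModel 𝒜 𝒵 𝒞) (hY : MemLp M.Y 2 M.Q) (aStar a : 𝒜)
    (k : ℕ → ℕ) (hk : (fun n => (k n : ℝ)) =O[atTop] fun n => (n : ℝ))
    (ηhat : ∀ n, Sample (ObsTD 𝒜 𝒵 𝒞) n (k n) → NuisanceTD 𝒜 𝒵 𝒞)
    (θhat : ∀ n, Sample (ObsTD 𝒜 𝒵 𝒞) n (k n) → ℝ) (hTD : M.TwoDoor) (hpos : M.PositiveTD)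
    (hmeas : MeasurableNuisanceTD ηhat)
    (hest : ∀ (n : ℕ) (s : Sample (ObsTD 𝒜 𝒵 𝒞) n (k n)), 0 < n →
      (1 / (n : ℝ)) * ∑ i, phiTD aStar a (s.1 i) (ηhat n s) (θhat n s) = 0)
    (hreg : PlugInRegularity M.obsLawTD k (mTD aStar a) (trueNuisanceTD M.obsLawTD) ηhat)
    (hB : BoundednessTD aStar a M.obsLawTD k ηhat) (hR : RatesTD aStar a M.obsLawTD k ηhat) :
    IsAsymptoticallyLinear M.obsLawTD (M.ace aStar a) k θhat
        (fun x => phiTD aStar a x (trueNuisanceTD M.obsLawTD) (M.ace aStar a)) ∧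
      ∀ ε B : ℝ, 0 < ε →
        IsRegularEstimator (modelTD aStar a ε B) M.obsLawTD (M.ace aStar a) k θhat := by
  obtain ⟨ε₁, hε₁, hm⟩ := hB.mediator
  obtain ⟨ε₂, hε₂, hp⟩ := hB.propensity
  have h := hpos.positiveLaw hε₁ hε₂ hm hp
  -- The two-door case is the general one with `X` the identity.
  have hid : ∀ P : Measure (ObsTD 𝒜 𝒵 𝒞), P.map (fun x => x) = P := fun P => Measure.map_id
  have hX : Measurable fun x : ObsTD 𝒜 𝒵 𝒞 => x := measurable_id
  have h' : PositiveLaw (M.obsLawTD.map fun x => x) (min ε₁ ε₂) := (hid _).symm ▸ h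
  have hest' : ∀ n s, 0 < n →
      θhat n s = (1 / (n : ℝ)) * ∑ i, mTD aStar a (s.1 i) (ηhat n s) := fun n s hn =>
    eq_average_of_average_sub_eq_zero hn (hest n s hn)
  have := h.finite_A
  have := h.finite_Z
  have hAL : IsAsymptoticallyLinear M.obsLawTD (M.ace aStar a) k θhat
      (fun x => phiTD aStar a x (trueNuisanceTD M.obsLawTD) (M.ace aStar a)) :=
    isAsymptoticallyLinear_twoDoor hX h' (by rw [hid]; exact M.memLp_Y_obsLawTD hY)
      (by rw [hid]) (by rw [hid]; exact (hTD.ace_eq h hY aStar a).symm) hmeas.1 hmeas.2.1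
      hmeas.2.2 hest' hreg (h'.exists_bounds_wpto hX hB.outcome_hat hB.mediator_hat_below
        hB.mediator_hat_above hB.propensity_hat_below hB.propensity_hat_above)
      hR.outcome_mediator hR.outcome_mediator' hR.mediator_propensity hR.mediator_propensity'
  refine ⟨hAL, fun ε B hε => ?_⟩
  refine isRegularEstimator_twoDoor (ε := ε) (B := B) (aStar := aStar) (a := a) hX ?_ hk
    (measurable_twoDoorEstimator hX hmeas.1 hmeas.2.1 hmeas.2.2 hest') (by rw [hid]; exact hAL)
  rintro q ⟨M', hTD', hpos', hm', hp', hY', hB', rfl⟩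
  have h'' := hpos'.positiveLaw hε hε hm' hp'
  rw [min_self] at h''
  simp only [hid]
  exact ⟨inferInstance, h'', M'.memLp_Y_obsLawTD hY', M'.integral_Y_sq_obsLawTD.trans_le hB',
    hTD'.ace_eq h'' hY' aStar a⟩

/-- Asymptotic linearity and regularity of the front-door estimator. -/
theorem frontDoorEstimator_asymptotics (M : CausalModel 𝒜 𝒵 𝒞) (hY : MemLp M.Y 2 M.Q) (aStar a : 𝒜)
    (k : ℕ → ℕ) (hk : (fun n => (k n : ℝ)) =O[atTop] fun n => (n : ℝ))
    (ηhat : ∀ n, Sample (ObsFD 𝒜 𝒵) n (k n) → NuisanceFD 𝒜 𝒵)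
    (θhat : ∀ n, Sample (ObsFD 𝒜 𝒵) n (k n) → ℝ) (hFD : M.FrontDoor) (hpos : M.PositiveFD)
    (hmeas : MeasurableNuisanceFD ηhat)
    (hest : ∀ (n : ℕ) (s : Sample (ObsFD 𝒜 𝒵) n (k n)), 0 < n →
      (1 / (n : ℝ)) * ∑ i, phiFDPlugIn aStar a (s.1 i) (ηhat n s) (θhat n s) = 0)
    (hreg : PlugInRegularity M.obsLawFD k (mFD aStar a) (trueNuisanceFD M.obsLawFD) ηhat)
    (hB : BoundednessFD aStar a M.obsLawFD k ηhat) (hR : RatesFD aStar a M.obsLawFD k ηhat) :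
    IsAsymptoticallyLinear M.obsLawFD (M.ace aStar a) k θhat
        (fun x => phiFD aStar a x (trueNuisanceFD M.obsLawFD) (M.meanY aStar) (M.meanY a)
          (M.ace aStar a)) ∧
      ∀ ε B : ℝ, 0 < ε →
        IsRegularEstimator (modelFD 𝒞 aStar a ε B) M.obsLawFD (M.ace aStar a) k θhat := by
  obtain ⟨ε₁, hε₁, hm⟩ := hB.mediator
  obtain ⟨ε₂, hε₂, hp⟩ := hB.treatment
  have h := hpos.positiveLaw hε₁ hε₂ hm hp
  have hX := ObsFD.measurable_toTD (𝒜 := 𝒜) (𝒵 := 𝒵)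
  have : IsProbabilityMeasure (M.obsLawFD.map ObsFD.toTD) :=
    Measure.isProbabilityMeasure_map hX.aemeasurable
  have hη := trueNuisanceTD_map_toTD M.obsLawFD
  have hest' : ∀ n s, 0 < n → θhat n s =
      (1 / (n : ℝ)) * ∑ i, mTD aStar a (s.1 i).toTD (ηhat n s).toTD := fun n s hn => by
    have := hest n s hn
    simp only [phiFDPlugIn_eq] at this
    exact eq_average_of_average_sub_eq_zero hn this
  have := h.finite_A
  have := h.finite_Z
  have hm1 : ∀ n a z (c : PUnit.{u + 1}), Measurable fun s => (ηhat n s).toTD.outcome a z c :=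
    fun n a z _ => hmeas.1 n a z
  have hm2 : ∀ n z a (c : PUnit.{u + 1}), Measurable fun s => (ηhat n s).toTD.mediator z a c :=
    fun n z a _ => hmeas.2.1 n z a
  have hm3 : ∀ n a (c : PUnit.{u + 1}), Measurable fun s => (ηhat n s).toTD.propensity a c :=
    fun n a _ => hmeas.2.2 n a
  have hreg' : PlugInRegularity M.obsLawFD k (fun x η => mTD aStar a (ObsFD.toTD x) η)
      (trueNuisanceFD M.obsLawFD).toTD fun n s => (ηhat n s).toTD := by
    refine ⟨?_, ?_⟩
    · simpa only [mFD_eq] using hreg.1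
    · rcases hreg.2 with hs | ⟨F, hF, hFm⟩
      · exact Or.inl fun n s s' hss => congrArg NuisanceFD.toTD (hs n s s' hss)
      · refine Or.inr ⟨F, hF, ?_⟩
        simpa only [mFD_eq] using hFm
  have hidn : ∀ {M' : CausalModel 𝒜 𝒵 𝒞} {ε : ℝ}, M'.FrontDoor → MemLp M'.Y 2 M'.Q →
      PositiveLaw (M'.obsLawFD.map ObsFD.toTD) ε → M'.ace aStar a =
      ∫ x, x.Y * (trueNuisanceTD (M'.obsLawFD.map ObsFD.toTD)).weight aStar a x.A x.Z x.C
        ∂(M'.obsLawFD.map ObsFD.toTD) := fun {M'} ε hFD' hY' h' => by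
    rw [M'.map_toTD_obsLawFD] at h' ⊢
    exact hFD'.twoDoor.ace_eq h' hY' aStar a
  have hAL : IsAsymptoticallyLinear M.obsLawFD (M.ace aStar a) k θhat
      (fun x => mTD aStar a x.toTD (trueNuisanceFD M.obsLawFD).toTD - M.ace aStar a) :=
    isAsymptoticallyLinear_twoDoor hX h
      (by rw [M.map_toTD_obsLawFD]; exact M.dropCovariates.memLp_Y_obsLawTD hY) hη.symm
      (by rw [← hη]; exact (hidn hFD hY h).symm) hm1 hm2 hm3 hest' hreg'
      (h.exists_bounds_wpto hX hB.outcome_hat hB.mediator_hat_below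
        hB.mediator_hat_above hB.treatment_hat_below hB.treatment_hat_above)
      hR.outcome_mediator hR.outcome_mediator' hR.mediator_treatment hR.mediator_treatment'
  refine ⟨?_, fun ε B hε => ?_⟩
  -- At the true nuisance the plug-in means are the actual means of the potential outcomes, by the
  -- front-door formula.
  · have : (fun x => phiFD aStar a x (trueNuisanceFD M.obsLawFD) (M.meanY aStar) (M.meanY a)
        (M.ace aStar a)) =
        fun x => mTD aStar a x.toTD (trueNuisanceFD M.obsLawFD).toTD - M.ace aStar a := by
      funext x
      rw [← phiFDPlugIn_eq, phiFDPlugIn, hFD.meanY_eq h hY, hFD.meanY_eq h hY]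
    rw [this]
    exact hAL
  · refine isRegularEstimator_twoDoor (ε := ε) (B := B) (aStar := aStar) (a := a) hX ?_ hk
      (measurable_twoDoorEstimator hX hm1 hm2 hm3 hest') (by rw [hη]; exact hAL)
    rintro q ⟨M', hFD', hpos', hm', hp', hY', hB', rfl⟩
    have h'' := hpos'.positiveLaw hε hε hm' hp'
    rw [min_self] at h''
    refine ⟨M'.isProbabilityMeasure_obsLawFD, h'', ?_, ?_, hidn hFD' hY' h''⟩
    · rw [M'.map_toTD_obsLawFD]
      exact M'.dropCovariates.memLp_Y_obsLawTD hY'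
    · rw [M'.map_toTD_obsLawFD]
      exact M'.dropCovariates.integral_Y_sq_obsLawTD.trans_le hB'

end Main

theorem mainTheorem7 {𝒜 𝒵 𝒞 : Type u}
    [MeasurableSpace 𝒜] [DiscreteMeasurableSpace 𝒜] [Countable 𝒜]
    [MeasurableSpace 𝒵] [DiscreteMeasurableSpace 𝒵] [Countable 𝒵]
    [MeasurableSpace 𝒞] [DiscreteMeasurableSpace 𝒞] [Countable 𝒞]
    (M : CausalModel 𝒜 𝒵 𝒞) (hY : MemLp M.Y 2 M.Q) (aStar a : 𝒜)
    (k : ℕ → ℕ) (hk : (fun n => (k n : ℝ)) =O[atTop] fun n => (n : ℝ)) :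
    (∀ (ηhat : ∀ n, Sample (ObsTD 𝒜 𝒵 𝒞) n (k n) → NuisanceTD 𝒜 𝒵 𝒞)
        (θhat : ∀ n, Sample (ObsTD 𝒜 𝒵 𝒞) n (k n) → ℝ),
      M.TwoDoor → M.PositiveTD → MeasurableNuisanceTD ηhat →
      (∀ (n : ℕ) (s : Sample (ObsTD 𝒜 𝒵 𝒞) n (k n)), 0 < n →
        (1 / (n : ℝ)) * ∑ i, phiTD aStar a (s.1 i) (ηhat n s) (θhat n s) = 0) →
      PlugInRegularity M.obsLawTD k (mTD aStar a) (trueNuisanceTD M.obsLawTD) ηhat →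
      BoundednessTD aStar a M.obsLawTD k ηhat →
      RatesTD aStar a M.obsLawTD k ηhat →
      IsAsymptoticallyLinear M.obsLawTD (M.ace aStar a) k θhat
          (fun x => phiTD aStar a x (trueNuisanceTD M.obsLawTD) (M.ace aStar a)) ∧
        ∀ ε B : ℝ, 0 < ε →
          IsRegularEstimator (modelTD aStar a ε B) M.obsLawTD (M.ace aStar a) k θhat) ∧
    (∀ (ηhat : ∀ n, Sample (ObsFD 𝒜 𝒵) n (k n) → NuisanceFD 𝒜 𝒵)
        (θhat : ∀ n, Sample (ObsFD 𝒜 𝒵) n (k n) → ℝ),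
      M.FrontDoor → M.PositiveFD → MeasurableNuisanceFD ηhat →
      (∀ (n : ℕ) (s : Sample (ObsFD 𝒜 𝒵) n (k n)), 0 < n →
        (1 / (n : ℝ)) * ∑ i, phiFDPlugIn aStar a (s.1 i) (ηhat n s) (θhat n s) = 0) →
      PlugInRegularity M.obsLawFD k (mFD aStar a) (trueNuisanceFD M.obsLawFD) ηhat →
      BoundednessFD aStar a M.obsLawFD k ηhat →
      RatesFD aStar a M.obsLawFD k ηhat →
      IsAsymptoticallyLinear M.obsLawFD (M.ace aStar a) k θhat
          (fun x => phiFD aStar a x (trueNuisanceFD M.obsLawFD) (M.meanY aStar) (M.meanY a)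
            (M.ace aStar a)) ∧
        ∀ ε B : ℝ, 0 < ε →
          IsRegularEstimator (modelFD 𝒞 aStar a ε B) M.obsLawFD (M.ace aStar a) k θhat) := by
  exact ⟨fun ηhat θhat hTD hpos hmeas hest hreg hB hR =>
      twoDoorEstimator_asymptotics M hY aStar a k hk ηhat θhat hTD hpos hmeas hest hreg hB hR,
    fun ηhat θhat hFD hpos hmeas hest hreg hB hR =>
      frontDoorEstimator_asymptotics M hY aStar a k hk ηhat θhat hFD hpos hmeas hest hreg hB hR⟩
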